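/- **Proposition 1.4.** Let $X_0$ be a reduced projective curve over $\mathbb C$ with two smooth irreducible components $X_1,X_2$ meeting at exactly one point $x_0$, which is a node of $X_0$. Let $I=I_1\cup I_2$ be a finite set of closed points, $I_j\subset X_j\smallsetminus\{x_0\}$. Fix integers $r\ge 1$, $k\ge 1$, $\chi$, and for each $x\in I$ integers $n_1(x),\dots,n_{l_x+1}(x)\ge 0$, weights $0<a_1(x)<\dots<a_{l_x+1}(x)<k$ and $0\le\alpha_x<k-a_{l_x+1}(x)+a_1(x)$; put $d_i(x)=a_{i+1}(x)-a_i(x)$, $r_i(x)=n_1(x)+\dots+n_i(x)$. Let $c_1,c_2$ be positive integers (the degrees on $X_1,X_2$ of an ample line bundle on $X_0$) and $\ell_1,\ell_2$ integers with $\ell_j=\frac{c_j}{c_1+c_2}(\ell_1+\ell_2)$ and $$\sum_{x\in I}\sum_{i=1}^{l_x}d_i(x)r_i(x)+r\sum_{x\in I}\alpha_x+r(\ell_1+\ell_2)=k\chi .$$ A parabolic structure on a coherent sheaf $E$ consists of flags $E|_{\{x\}}=F_0(E)_x\supset\dots\supset F_{l_x+1}(E)_x=0$ with $\dim F_{i-1}(E)_x/F_i(E)_x=n_i(x)$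 at the given points $x$, and $par\chi(E)=\chi(E)+\frac1k\sum_x\sum_{i=1}^{l_x+1} n_i(x)a_i(x)$. A subsheaf $F\subset E$ with $E/F$ torsion free (every nonzero subsheaf of $E/F$ has one-dimensional support) carries the induced flags $F|_{\{x\}}\cap F_i(E)_x$, and $par\chi(F)$ is defined with the dimensions of their successive quotients. For a sheaf $F$ on $X_0$ of rank $r_j$ on $X_j$ let $$r(F)=\frac{c_1r_1+c_2r_2}{c_1+c_2},\qquad par\chi_m(F)=par\chi(F)+\sum_{j=1}^2\frac{r(F)-r_j}{k}\sum_{x\in I_j}\bigl(a_{l_x+1}(x)+\alpha_x\bigr).$$ A parabolic bundle $E$ on $X_0$ is *semistable* if $par\chi_m(F)\le\frac{par\chi_m(E)}{r(E)}r(F)$ for every coherent subsheaf $F\subset E$ with $E/F$ torsion free, and *stable* if the inequality is strict for all such $F\ne 0,E$. On $X_j$ (with the points $I_j$) semistability and stability are defined by the same inequalities with $par\chi$ and the usual rank. Put $n_j=\frac1k\bigl(\sum_{x\in I_j}\sum_{i=1}^{l_x} d_i(x)r_i(x)+r\sum_{x\in I_j}\alpha_x+r\ell_j\bigr)$, and let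 $\chi_1,\chi_2$ be integers with $\chi_1+\chi_2=\chi+r$ and $n_j\le\chi_j\le n_j+r$ for $j=1,2$. Let $\mathcal U_{X_j}$ be the moduli space of semistable parabolic bundles on $X_j$ of rank $r$ and Euler characteristic $\chi_j$, with parabolic structures of the given types and weights at the points of $I_j$. Suppose that $\mathcal U_{X_1}$ and $\mathcal U_{X_2}$ are nonempty, and let $E_1\in\mathcal U_{X_1}$, $E_2\in\mathcal U_{X_2}$ be any semistable parabolic bundles. Then there is a parabolic vector bundle $E$ of rank $r$ on $X_0$, with parabolic structures of the given types and weights at the points of $I$, such that $E|_{X_1}\cong E_1$ and $E|_{X_2}\cong E_2$ as parabolic bundles. Every such $E$ has Euler characteristic $\chi$ and is semistable. If moreover $n_j\le\chi_j<n_j+r$ for $j=1,2$, then every such $E$ is stable whenever $E_1$ or $E_2$ is stable. -/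

import Mathlib

open CategoryTheory Limits AlgebraicGeometry TensorProduct

noncomputable section

namespace ParabolicGluing

/-! ### Stalks, fibres and values of sections of `𝒪_X`-modules -/

section Sheaves

variable {X : Scheme.{0}}

/-- The stalk `F_x` as a module over the local ring `𝒪_{X,x}`. -/
instance stalkModule (F : X.Modules) (x : X) :
    Module (X.presheaf.stalk x) (F.presheaf.stalk x) :=
  PresheafOfModules.instModuleCarrierStalkCommRingCatCarrierAbPresheafOpensCarrier
    (R := X.presheaf) F.val x

lemma germ_smul (F : X.Modules) (x : X) (U : X.Opens) (hx : x ∈ U) (r : Γ(X, U)) (m : Γ(F, U)) :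
    F.presheaf.germ U x hx (r • m) = X.presheaf.germ U x hx r • F.presheaf.germ U x hx m :=
  PresheafOfModules.germ_smul (R := X.presheaf) (M := F.val) x U hx r m

/-- The `𝒪_{X,x}`-linear map induced on stalks by a morphism of `𝒪_X`-modules. -/
def stalkMap {F E : X.Modules} (f : F ⟶ E) (x : X) :
    F.presheaf.stalk x →ₗ[X.presheaf.stalk x] E.presheaf.stalk x where
  toFun := ((TopCat.Presheaf.stalkFunctor Ab x).map f.mapPresheaf).hom
  map_add' := map_add _
  map_smul' r m := by
    obtain ⟨U, hU, r, rfl⟩ := X.presheaf.exists_germ_eq r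
    obtain ⟨V, hV, m, rfl⟩ := F.presheaf.exists_germ_eq m
    have hW : x ∈ U ⊓ V := ⟨hU, hV⟩
    rw [← X.presheaf.germ_res_apply (homOfLE inf_le_left : U ⊓ V ⟶ U) x hW,
      ← F.presheaf.germ_res_apply (homOfLE inf_le_right : U ⊓ V ⟶ V) x hW, ← germ_smul]
    erw [TopCat.Presheaf.stalkFunctor_map_germ_apply, TopCat.Presheaf.stalkFunctor_map_germ_apply]
    rw [Scheme.Modules.mapPresheaf_app, RingHom.id_apply]
    erw [Scheme.Modules.Hom.app_smul, germ_smul]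

instance residueAlgebra (x : X) : Algebra (X.presheaf.stalk x) (X.residueField x) :=
  (X.residue x).hom.toAlgebra

/-- The fibre `F|_{x} = κ(x) ⊗ F_x`. -/
abbrev Fiber (F : X.Modules) (x : X) : Type :=
  (X.residueField x) ⊗[X.presheaf.stalk x] (F.presheaf.stalk x)

/-- The linear map `F|_{x} → E|_{x}` induced by a morphism. -/
def fiberMap {F E : X.Modules} (f : F ⟶ E) (x : X) :
    Fiber F x →ₗ[X.residueField x] Fiber E x :=
  (stalkMap f x).baseChange (X.residueField x)

/-- The value at `x` of a section `t` of `F` over a neighbourhood `U` of `x`. -/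
def value (F : X.Modules) (U : X.Opens) (x : X) (hx : x ∈ U) (t : Γ(F, U)) : Fiber F x :=
  1 ⊗ₜ[X.presheaf.stalk x] (F.presheaf.germ U x hx t)

/-- The dimension of the fibre at `x`. At the generic point of a component of a reduced curve this
is the rank of `F` on that component. -/
def fiberDim (F : X.Modules) (x : X) : ℕ :=
  Module.finrank (X.residueField x) (Fiber F x)

/-- Coherence (on a locally Noetherian scheme): quasi-coherent, with finitely generated modules of
sections over affine opens. -/
structure IsCoherent (F : X.Modules) : Prop where
  isQuasicoherent : F.IsQuasicoherent
  finite : ∀ W : X.Opens, IsAffineOpen W → Module.Finite Γ(X, W) Γ(F, W)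

/-- `Supp F`, the set of points with nonzero stalk. -/
def supp (F : X.Modules) : Set X := {x | Nontrivial (F.presheaf.stalk x)}

/-- A coherent sheaf is torsion free if it is pure of dimension one: all nonzero
`𝒪_X`-submodules have support of dimension one. -/
structure IsTorsionFree (E : X.Modules) : Prop where
  isCoherent : IsCoherent E
  pure : ∀ (G : X.Modules) (g : G ⟶ E), Mono g → ¬ IsZero G → topologicalKrullDim (supp G) = 1

/-! ### Euler characteristics -/

/-- The structure map `ℂ → Γ(X, W)` of a scheme over `ℂ`. -/
def scalars (s : X ⟶ Spec (.of ℂ)) (W : X.Opens) : ℂ →+* Γ(X, W) :=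
  (s.appLE ⊤ W le_top).hom.comp (Scheme.ΓSpecIso (.of ℂ)).inv.hom

lemma map_scalars (s : X ⟶ Spec (.of ℂ)) {V W : X.Opens} (h : V ≤ W) (z : ℂ) :
    X.presheaf.map (homOfLE h).op (scalars s W z) = scalars s V z := by
  have := s.appLE_map (U := ⊤) (V := W) le_top (homOfLE h).op
  simp only [scalars, RingHom.comp_apply]
  rw [← this]
  rfl

/-- `Γ(F, W)`, regarded as a complex vector space through `s : X ⟶ Spec ℂ`. -/
def Sections (_s : X ⟶ Spec (.of ℂ)) (F : X.Modules) (W : X.Opens) : Type := Γ(F, W)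

instance (s : X ⟶ Spec (.of ℂ)) (F : X.Modules) (W : X.Opens) : AddCommGroup (Sections s F W) :=
  inferInstanceAs (AddCommGroup Γ(F, W))

instance (s : X ⟶ Spec (.of ℂ)) (F : X.Modules) (W : X.Opens) : Module ℂ (Sections s F W) :=
  Module.compHom (Γ(F, W) : Type) (scalars s W)

/-- Restriction of sections. -/
def res (s : X ⟶ Spec (.of ℂ)) (F : X.Modules) {V W : X.Opens} (h : V ≤ W) :
    Sections s F W →ₗ[ℂ] Sections s F V where
  toFun t := F.presheaf.map (homOfLE h).op (show Γ(F, W) from t)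
  map_add' := map_add (F.presheaf.map (homOfLE h).op).hom
  map_smul' z t := by
    change F.presheaf.map (homOfLE h).op (scalars s W z • (show Γ(F, W) from t)) =
      scalars s V z • F.presheaf.map (homOfLE h).op (show Γ(F, W) from t)
    rw [Scheme.Modules.map_smul, map_scalars]

/-- The Čech differential `Γ(F, U) × Γ(F, V) → Γ(F, U ∩ V)` of the cover `{U, V}`. -/
def cechDiff (s : X ⟶ Spec (.of ℂ)) (U V : X.Opens) (F : X.Modules) :
    (Sections s F U × Sections s F V) →ₗ[ℂ] Sections s F (U ⊓ V) :=
  (res s F inf_le_left).comp (LinearMap.fst ℂ _ _) -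
    (res s F inf_le_right).comp (LinearMap.snd ℂ _ _)

/-- `χ(F) = dim H⁰(X, F) - dim H¹(X, F)`, where the cohomology of the quasi-coherent sheaf `F` is
the Čech cohomology of a cover `{U, V}` of the separated scheme `X` by two affine open sets. -/
def eulerChar (s : X ⟶ Spec (.of ℂ)) (U V : X.Opens) (F : X.Modules) : ℤ :=
  (Module.finrank ℂ (LinearMap.ker (cechDiff s U V F)) : ℤ) -
    Module.finrank ℂ (Sections s F (U ⊓ V) ⧸ LinearMap.range (cechDiff s U V F))

end Sheaves

/-! ### Parabolic data -/

/-- Numerical parabolic data at marked points indexed by `ι`: at the point `x`, the type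
`n_1(x), …, n_{l+1}(x)` and the weights `0 < a_1(x) < ⋯ < a_{l+1}(x) < k` (with `l = len x`, and
with indices shifted to start from `0`), and the integer `0 ≤ α_x < k - a_{l+1}(x) + a_1(x)`. -/
structure ParabolicData (ι : Type) where
  k : ℕ
  k_pos : 0 < k
  len : ι → ℕ
  n : ∀ x, Fin (len x + 1) → ℕ
  a : ∀ x, Fin (len x + 1) → ℤ
  a_strictMono : ∀ x, StrictMono (a x)
  a_pos : ∀ x i, 0 < a x i
  a_lt : ∀ x i, a x i < k
  α : ι → ℤ
  α_nonneg : ∀ x, 0 ≤ α x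
  α_lt : ∀ x, α x < k - a x (Fin.last (len x)) + a x 0

namespace ParabolicData

variable {ι ι' : Type} (D : ParabolicData ι)

/-- Parabolic data along a map of index sets. -/
def comap (f : ι' → ι) : ParabolicData ι' where
  k := D.k
  k_pos := D.k_pos
  len x := D.len (f x)
  n x := D.n (f x)
  a x := D.a (f x)
  a_strictMono x := D.a_strictMono (f x)
  a_pos x := D.a_pos (f x)
  a_lt x := D.a_lt (f x)
  α x := D.α (f x)
  α_nonneg x := D.α_nonneg (f x)
  α_lt x := D.α_lt (f x)

/-- `d_i(x) = a_{i+1}(x) - a_i(x)`. -/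
def d (x : ι) (i : Fin (D.len x)) : ℤ := D.a x i.succ - D.a x i.castSucc

/-- `r_i(x) = n_1(x) + ⋯ + n_i(x)`. -/
def r (x : ι) (i : Fin (D.len x)) : ℕ := ∑ j ∈ Finset.Iic i.castSucc, D.n x j

/-- `∑_x ∑_i d_i(x) r_i(x) + rk ∑_x α_x`. -/
def total [Fintype ι] (rk : ℕ) : ℤ :=
  ∑ x, ∑ i, D.d x i * D.r x i + rk * ∑ x, D.α x

/-- `∑_x (a_{l+1}(x) + α_x)`. -/
def topWeight [Fintype ι] : ℤ := ∑ x, (D.a x (Fin.last (D.len x)) + D.α x)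

end ParabolicData

/-! ### Parabolic bundles -/

section Parabolic

variable {X : Scheme.{0}} {ι : Type}

/-- A quasi-parabolic structure on `E` at the points `pt x`, of the type prescribed by `D`: flags
`E|_{pt x} = F_0 ⊇ F_1 ⊇ ⋯ ⊇ F_{l+1} = 0` with `dim F_{i-1} / F_i = n_i(x)`. -/
structure Flags (D : ParabolicData ι) (pt : ι → X) (E : X.Modules) where
  flag : ∀ x, Fin (D.len x + 2) → Submodule (X.residueField (pt x)) (Fiber E (pt x))
  antitone : ∀ x, Antitone (flag x)
  flag_zero : ∀ x, flag x 0 = ⊤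
  flag_last : ∀ x, flag x (Fin.last (D.len x + 1)) = ⊥
  finrank_flag : ∀ x (i : Fin (D.len x + 1)),
    Module.finrank (X.residueField (pt x)) (flag x i.castSucc) =
      Module.finrank (X.residueField (pt x)) (flag x i.succ) + D.n x i

namespace Flags

variable {D : ParabolicData ι} {pt : ι → X} {E : X.Modules}

/-- The flags at some of the marked points. -/
def comap {ι' : Type} (P : Flags D pt E) (f : ι' → ι) :
    Flags (D.comap f) (fun x => pt (f x)) E where
  flag x := P.flag (f x)
  antitone x := P.antitone (f x)
  flag_zero x := P.flag_zero (f x)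
  flag_last x := P.flag_last (f x)
  finrank_flag x := P.finrank_flag (f x)

/-- For a morphism `f : F ⟶ E`, the number `dim (F_{i-1}(F)_x / F_i(F)_x)`, where
`F_i(F)_x = F|_{x} ∩ F_i(E)_x` is the flag induced on the image of the fibre `F|_{x}` in `E|_{x}`. -/
def inducedDim (P : Flags D pt E) {F : X.Modules} (f : F ⟶ E) (x : ι) (i : Fin (D.len x + 1)) : ℤ :=
  (Module.finrank (X.residueField (pt x))
      ((LinearMap.range (fiberMap f (pt x)) ⊓ P.flag x i.castSucc : Submodule _ _)) : ℤ) -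
    Module.finrank (X.residueField (pt x))
      ((LinearMap.range (fiberMap f (pt x)) ⊓ P.flag x i.succ : Submodule _ _))

/-- The parabolic Euler characteristic `χ(F) + (1/k) ∑_x ∑_i n_i(x) a_i(x)` of a subsheaf
`f : F ⟶ E` with the induced parabolic structure. -/
def parChi [Fintype ι] (P : Flags D pt E) (s : X ⟶ Spec (.of ℂ)) (U V : X.Opens)
    {F : X.Modules} (f : F ⟶ E) : ℚ :=
  eulerChar s U V F + (1 / (D.k : ℚ)) * ∑ x, ∑ i, (P.inducedDim f x i : ℚ) * D.a x i

end Flags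

/-- A parabolic vector bundle of rank `rk`, with the parabolic data `D` at the points `pt x`. -/
structure ParabolicBundle (D : ParabolicData ι) (pt : ι → X) (rk : ℕ) where
  sheaf : X.Modules
  isCoherent : IsCoherent sheaf
  isLocallyFree : sheaf.IsLocallyFree
  rank_eq : ∀ x : X, fiberDim sheaf x = rk
  flags : Flags D pt sheaf

namespace ParabolicBundle

variable [Fintype ι] {D : ParabolicData ι} {pt : ι → X} {rk : ℕ}

/-- Semistability of a parabolic bundle on an irreducible curve: `parχ(F) ≤ parχ(E) / r(E) * r(F)`
for all subsheaves `F` of `E` with torsion free quotient. -/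
def IsSemistable [IrreducibleSpace X] (E : ParabolicBundle D pt rk) (s : X ⟶ Spec (.of ℂ))
    (U V : X.Opens) : Prop :=
  ∀ (F : X.Modules) (f : F ⟶ E.sheaf), Mono f → IsCoherent F → IsTorsionFree (cokernel f) →
    E.flags.parChi s U V f ≤
      E.flags.parChi s U V (𝟙 E.sheaf) / fiberDim E.sheaf (genericPoint X) *
        fiberDim F (genericPoint X)

/-- Stability of a parabolic bundle on an irreducible curve: the strict inequality for all
subsheaves other than `0` and `E`, with torsion free quotient. -/
def IsStable [IrreducibleSpace X] (E : ParabolicBundle D pt rk) (s : X ⟶ Spec (.of ℂ))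
    (U V : X.Opens) : Prop :=
  ∀ (F : X.Modules) (f : F ⟶ E.sheaf), Mono f → IsCoherent F → IsTorsionFree (cokernel f) →
    ¬ IsZero F → ¬ IsIso f →
    E.flags.parChi s U V f <
      E.flags.parChi s U V (𝟙 E.sheaf) / fiberDim E.sheaf (genericPoint X) *
        fiberDim F (genericPoint X)

end ParabolicBundle

/-- `E|_Y ≅ E'` as parabolic bundles, for `i : Y ⟶ X` and marked points `q x` of `Y`: an isomorphism
of the pullback `i^* E` with `E'` under which the flags of `E` at `i (q x)` correspond to those of
`E'` at `q x`. The correspondence of fibres is tested on values of local sections, where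
`E ⟶ i_* E'` is the adjoint of the given isomorphism. -/
def RestrictsTo {Y : Scheme.{0}} (i : Y ⟶ X) {D : ParabolicData ι} {q : ι → Y}
    {E : X.Modules} (P : Flags D (fun x => i (q x)) E) {E' : Y.Modules} (P' : Flags D q E') : Prop :=
  ∃ e : (Scheme.Modules.pullback i).obj E ≅ E',
    ∀ (x : ι) (j : Fin (D.len x + 2)) (W : X.Opens) (hx : i (q x) ∈ W) (t : Γ(E, W)),
      value E W (i (q x)) hx t ∈ P.flag x j ↔
        value E' (i ⁻¹ᵁ W) (q x) hx
          ((((Scheme.Modules.pullbackPushforwardAdjunction i).homEquiv E E' e.hom).app W) t) ∈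
            P'.flag x j

end Parabolic

/-! ### The reducible nodal curve -/

/-- A reduced projective curve `X₀` over `ℂ` with two smooth irreducible components `X 0`, `X 1`
meeting at exactly one point, which is a node. Properness is the same as projectivity here, and the
two smooth branches meet in an ordinary double point if and only if they meet transversally, that
is, the scheme-theoretic intersection is a reduced point. -/
structure NodalCurve where
  X₀ : Scheme.{0}
  str : X₀ ⟶ Spec (.of ℂ)
  X : Fin 2 → Scheme.{0}
  i : ∀ j, X j ⟶ X₀
  isReduced : IsReduced X₀
  isProper : IsProper str
  isClosedImmersion : ∀ j, IsClosedImmersion (i j)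
  irreducible : ∀ j, IrreducibleSpace (X j)
  smooth : ∀ j, SmoothOfRelativeDimension 1 (i j ≫ str)
  covers : ∀ y : X₀, ∃ j, y ∈ Set.range (i j)
  node : IsIso (pullback.fst (i 0) (i 1) ≫ i 0 ≫ str)

namespace NodalCurve

variable (C : NodalCurve)

instance (j : Fin 2) : IrreducibleSpace (C.X j) := C.irreducible j

/-- The structure morphism of the component `X j`. -/
def compStr (j : Fin 2) : C.X j ⟶ Spec (.of ℂ) := C.i j ≫ C.str

/-- The generic point of the component `X j`, as a point of `X₀`. -/
def gen (j : Fin 2) : C.X₀ := C.i j (genericPoint (C.X j))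

variable {ι : Fin 2 → Type}

/-- Marked points on the two components, as points of `X₀`. -/
def points (p : ∀ j, ι j → C.X j) (x : Σ j, ι j) : C.X₀ := C.i x.1 (p x.1 x.2)

/-- Admissible marked points: distinct closed points of the two components, none of them the
node. -/
structure IsMarking (p : ∀ j, ι j → C.X j) : Prop where
  isClosed : ∀ j x, IsClosed {p j x}
  injective : ∀ j, Function.Injective (p j)
  ne_node : ∀ j j' x, j' ≠ j → C.i j (p j x) ∉ Set.range (C.i j')

/-- The rank `r(F) = (c_1 r_1 + c_2 r_2) / (c_1 + c_2)` with respect to a polarization of degree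
`c_j` on the component `X j`, where `r_j` is the rank of `F` on `X j`. -/
def rank (c : Fin 2 → ℕ) (F : C.X₀.Modules) : ℚ :=
  (∑ j, (c j : ℚ) * fiberDim F (C.gen j)) / ∑ j, (c j : ℚ)

variable [∀ j, Fintype (ι j)] (D : ParabolicData (Σ j, ι j)) {p : ∀ j, ι j → C.X j} {rk : ℕ}

/-- `m(F) = ∑_j (r(F) - r_j) / k * ∑_{x ∈ I_j} (a_{l+1}(x) + α_x)`. -/
def correction (c : Fin 2 → ℕ) (F : C.X₀.Modules) : ℚ :=
  ∑ j, (C.rank c F - fiberDim F (C.gen j)) / D.k * (D.comap (Sigma.mk j)).topWeight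

/-- `parχ_m(F) = parχ(F) + m(F)` for a subsheaf `f : F ⟶ E` with its induced parabolic
structure. -/
def parChiM {D : ParabolicData (Σ j, ι j)} {E : C.X₀.Modules} (P : Flags D (C.points p) E)
    (c : Fin 2 → ℕ) (U V : C.X₀.Opens) {F : C.X₀.Modules} (f : F ⟶ E) : ℚ :=
  P.parChi C.str U V f + C.correction D c F

/-- Semistability on `X₀`: `parχ_m(F) ≤ parχ_m(E) / r(E) * r(F)` for all subsheaves `F` of `E` with
torsion free quotient. -/
def IsSemistable {D : ParabolicData (Σ j, ι j)} (E : ParabolicBundle D (C.points p) rk)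
    (c : Fin 2 → ℕ) (U V : C.X₀.Opens) : Prop :=
  ∀ (F : C.X₀.Modules) (f : F ⟶ E.sheaf), Mono f → IsCoherent F → IsTorsionFree (cokernel f) →
    C.parChiM E.flags c U V f ≤
      C.parChiM E.flags c U V (𝟙 E.sheaf) / C.rank c E.sheaf * C.rank c F

/-- Stability on `X₀`: the strict inequality for all subsheaves other than `0` and `E`, with torsion
free quotient. -/
def IsStable {D : ParabolicData (Σ j, ι j)} (E : ParabolicBundle D (C.points p) rk)
    (c : Fin 2 → ℕ) (U V : C.X₀.Opens) : Prop :=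
  ∀ (F : C.X₀.Modules) (f : F ⟶ E.sheaf), Mono f → IsCoherent F → IsTorsionFree (cokernel f) →
    ¬ IsZero F → ¬ IsIso f →
    C.parChiM E.flags c U V f <
      C.parChiM E.flags c U V (𝟙 E.sheaf) / C.rank c E.sheaf * C.rank c F

/-- `E|_{X j} ≅ E' j` for both `j`, compatibly with the parabolic structures: `E` is a gluing of
`E' 0` and `E' 1`. -/
def IsGluing {D : ParabolicData (Σ j, ι j)} (E : ParabolicBundle D (C.points p) rk)
    (E' : ∀ j, ParabolicBundle (D.comap (Sigma.mk j)) (p j) rk) : Prop :=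
  ∀ j, RestrictsTo (C.i j) (E.flags.comap (Sigma.mk j)) (E' j).flags

/-- `n_j = (1/k) (∑_{x ∈ I_j} ∑_i d_i(x) r_i(x) + r ∑_{x ∈ I_j} α_x + r ℓ_j)`. -/
def bound {ι : Fin 2 → Type} [∀ j, Fintype (ι j)] (D : ParabolicData (Σ j, ι j)) (rk : ℕ)
    (ℓ : Fin 2 → ℤ) (j : Fin 2) : ℚ :=
  (1 / (D.k : ℚ)) * ((D.comap (Sigma.mk j)).total rk + rk * ℓ j)

end NodalCurve

end ParabolicGluing

end

/-! A vector bundle on the nodal curve amounts to bundles on the two components with an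
identification of their fibres at the node. Indeed, functions on `X₀` are pairs of functions on the
components with equal values at the node, because `X₀` is reduced and the scheme-theoretic
intersection of the components is a reduced point (`exists_pf_eq`). Hence the pairs of sections of
E_0 and E_1 with equal values in ℂ^r, computed in chosen local bases at the node, form a locally
free sheaf restricting to E_0 and E_1 (`exists_isBasisOn_glueModule`). The flags carry over through
the comparison of fibres, and this gives existence (`exists_isGluing`).

Conversely, sections of any gluing E are such pairs (`GluedModule`). Let F ⊂ E have torsion free
quotient, and let F_j ⊂ E_j consist of the sections whose generic germ comes from F. The local rings
of the components are principal ideal domains, so F_j and E_j/F_j are locally free and F_j is a test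
subsheaf for E_j. A section of E whose restrictions lie in F_0 and F_1 has an image in E/F supported
at finitely many closed points, which vanishes by purity. So F consists exactly of the pairs with
components in F_0 and F_1 (`isGlued_satSub`). If V_j ⊂ ℂ^r denotes the space of values of F_j at the
node and T = dim(V_0 + V_1), the exact sequence 0 → F → F_0 ⊕ F_1 → V_0 + V_1 → 0, with a skyscraper
at the node on the right, gives χ(F) = χ(F_0) + χ(F_1) - T (`IsGlued.eulerChar_eq`). The same holds
for parχ, since the marked points avoid the node. For F = E one has T = r, whence χ(E) = χ. As F_j
is saturated, T is at least r_j = rk F_j.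

Put δ_j = χ_j - n_j, so that δ_0 + δ_1 = r. Since ℓ_j is proportional to c_j, the polarization
cancels and parχ_m(E)/r · r(F) - parχ_m(F) = ∑_j (parχ(E_j)/r · r_j - parχ(F_j)) + ∑_j (δ_j/r)(T -
r_j) (`slope_sub_parChiM`). The first sum is nonnegative by semistability of the E_j, the second
because δ_j ≥ 0 and T ≥ r_j. If δ_j < r for both j, then δ_j > 0 for both, and the second sum
vanishes only for r_0 = r_1 = T. In that case stability of one E_j makes the first sum positive
unless F_j is 0 or E_j. Then r_0 = r_1 is 0 or r, and F is 0 or E.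

Euler characteristics are differences of `finrank`, which is 0 on infinite-dimensional spaces. Their
additivity therefore needs finiteness of H⁰ and H¹ for bundles on the components
(`finite_sections_top`, `finite_quotient_cechDiff`), obtained inside the generic stalk from Noether
normalization and the analysis of poles. The snake lemma then compares Čech complexes
(`index_of_exact`). Throughout, bundles are handled through local bases of sections (`IsBasisOn`,
`HasBases`). -/

noncomputable section

namespace ParabolicGluing

/-! ### Sections of modules: restriction, locality and gluing -/

section Basics

variable {X : Scheme.{0}}

/-- Restriction of functions. -/
def rr (X : Scheme.{0}) {V W : X.Opens} (h : V ≤ W) : Γ(X, W) →+* Γ(X, V) :=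
  (X.presheaf.map (homOfLE h).op).hom

/-- Restriction of sections of a module. -/
def rs (M : X.Modules) {V W : X.Opens} (h : V ≤ W) : Γ(M, W) →+ Γ(M, V) :=
  (M.presheaf.map (homOfLE h).op).hom

lemma rs_smul (M : X.Modules) {V W : X.Opens} (h : V ≤ W) (r : Γ(X, W)) (s : Γ(M, W)) :
    rs M h (r • s) = rr X h r • rs M h s :=
  Scheme.Modules.map_smul M (homOfLE h) r s

lemma rs_rs (M : X.Modules) {U V W : X.Opens} (h : V ≤ W) (h' : U ≤ V) (s : Γ(M, W)) :
    rs M h' (rs M h s) = rs M (h'.trans h) s :=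
  (ConcreteCategory.congr_hom (M.presheaf.map_comp (homOfLE h).op (homOfLE h').op) s).symm

lemma rr_rr {U V W : X.Opens} (h : V ≤ W) (h' : U ≤ V) (s : Γ(X, W)) :
    rr X h' (rr X h s) = rr X (h'.trans h) s :=
  (ConcreteCategory.congr_hom (X.presheaf.map_comp (homOfLE h).op (homOfLE h').op) s).symm

lemma rs_self (M : X.Modules) {W : X.Opens} (h : W ≤ W) (s : Γ(M, W)) : rs M h s = s :=
  ConcreteCategory.congr_hom (M.presheaf.map_id (.op W)) s

lemma rr_self {W : X.Opens} (h : W ≤ W) (s : Γ(X, W)) : rr X h s = s :=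
  ConcreteCategory.congr_hom (X.presheaf.map_id (.op W)) s

/-- The action of a morphism of modules on sections. -/
def ap {M N : X.Modules} (f : M ⟶ N) (W : X.Opens) : Γ(M, W) →ₗ[Γ(X, W)] Γ(N, W) where
  toFun := f.app W
  map_add' := map_add (f.app W).hom
  map_smul' r s := Scheme.Modules.Hom.app_smul f r s

lemma ap_rs {M N : X.Modules} (f : M ⟶ N) {V W : X.Opens} (h : V ≤ W) (s : Γ(M, W)) :
    ap f V (rs M h s) = rs N h (ap f W s) :=
  ConcreteCategory.congr_hom (f.mapPresheaf.naturality (homOfLE h).op) s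

lemma ap_comp {M N K : X.Modules} (f : M ⟶ N) (g : N ⟶ K) (W : X.Opens) (s : Γ(M, W)) :
    ap (f ≫ g) W s = ap g W (ap f W s) := rfl

lemma ap_id {M : X.Modules} (W : X.Opens) (s : Γ(M, W)) : ap (𝟙 M) W s = s := rfl

lemma ap_zero {M N : X.Modules} (W : X.Opens) (s : Γ(M, W)) :
    ap (0 : M ⟶ N) W s = 0 := rfl

lemma hom_ext_ap {M N : X.Modules} {f g : M ⟶ N} (h : ∀ W s, ap f W s = ap g W s) : f = g :=
  Scheme.Modules.hom_ext f g fun W => by ext s; exact h W s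

/-- Construct a morphism of modules from its action on sections. -/
def homMk {M N : X.Modules} (φ : ∀ W : X.Opens, Γ(M, W) →ₗ[Γ(X, W)] Γ(N, W))
    (h : ∀ (V W : X.Opens) (hV : V ≤ W) (s : Γ(M, W)), φ V (rs M hV s) = rs N hV (φ W s)) :
    M ⟶ N :=
  ⟨PresheafOfModules.homMk (M₁ := M.val) (M₂ := N.val)
    { app := fun W => AddCommGrpCat.ofHom (φ W.unop).toAddMonoidHom
      naturality := fun V W f => by
        ext s
        exact h W.unop V.unop f.unop.le s }
    (fun W r m => (φ W.unop).map_smul r m)⟩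

lemma section_ext (M : X.Modules) {W : X.Opens} (s t : Γ(M, W))
    (h : ∀ x ∈ W, ∃ (V : X.Opens) (hV : V ≤ W), x ∈ V ∧ rs M hV s = rs M hV t) : s = t := by
  choose! V hV hx he using h
  refine TopCat.Sheaf.eq_of_locally_eq' ⟨M.presheaf, M.isSheaf⟩ (fun x : W => V x) W
    (fun x => homOfLE (hV x.1 x.2)) (fun x hx' => ?_) s t (fun x => he x.1 x.2)
  exact TopologicalSpace.Opens.mem_iSup.mpr ⟨⟨x, hx'⟩, hx x hx'⟩

lemma function_ext {W : X.Opens} (s t : Γ(X, W))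
    (h : ∀ x ∈ W, ∃ (V : X.Opens) (hV : V ≤ W), x ∈ V ∧ rr X hV s = rr X hV t) : s = t := by
  choose! V hV hx he using h
  refine TopCat.Sheaf.eq_of_locally_eq' X.sheaf (fun x : W => V x) W
    (fun x => homOfLE (hV x.1 x.2)) (fun x hx' => ?_) s t (fun x => he x.1 x.2)
  exact TopologicalSpace.Opens.mem_iSup.mpr ⟨⟨x, hx'⟩, hx x hx'⟩

lemma section_glue (M : X.Modules) {W : X.Opens} {I : Type} (V : I → X.Opens) (hV : ∀ i, V i ≤ W)
    (hc : ∀ x ∈ W, ∃ i, x ∈ V i) (s : ∀ i, Γ(M, V i))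
    (h : ∀ i j, rs M (inf_le_left : V i ⊓ V j ≤ V i) (s i) =
      rs M (inf_le_right : V i ⊓ V j ≤ V j) (s j)) :
    ∃ t : Γ(M, W), ∀ i, rs M (hV i) t = s i := by
  obtain ⟨t, ht, -⟩ := TopCat.Sheaf.existsUnique_gluing' ⟨M.presheaf, M.isSheaf⟩ V W
    (fun i => homOfLE (hV i))
    (fun x hx => by
      obtain ⟨i, hi⟩ := hc x hx
      exact TopologicalSpace.Opens.mem_iSup.mpr ⟨i, hi⟩) s (fun i j => h i j)
  exact ⟨t, ht⟩

lemma function_glue {W : X.Opens} {I : Type} (V : I → X.Opens) (hV : ∀ i, V i ≤ W)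
    (hc : ∀ x ∈ W, ∃ i, x ∈ V i) (s : ∀ i, Γ(X, V i))
    (h : ∀ i j, rr X (inf_le_left : V i ⊓ V j ≤ V i) (s i) =
      rr X (inf_le_right : V i ⊓ V j ≤ V j) (s j)) :
    ∃ t : Γ(X, W), ∀ i, rr X (hV i) t = s i := by
  obtain ⟨t, ht, -⟩ := TopCat.Sheaf.existsUnique_gluing' X.sheaf V W
    (fun i => homOfLE (hV i))
    (fun x hx => by
      obtain ⟨i, hi⟩ := hc x hx
      exact TopologicalSpace.Opens.mem_iSup.mpr ⟨i, hi⟩) s (fun i j => h i j)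
  exact ⟨t, ht⟩

/-! ### Subsheaves given by local conditions on sections -/

/-- A family of submodules of the modules of sections that is given by a local condition. -/
structure LocalSub (M : X.Modules) where
  carrier : ∀ W : X.Opens, Submodule Γ(X, W) Γ(M, W)
  res_mem : ∀ {V W : X.Opens} (h : V ≤ W) {s : Γ(M, W)}, s ∈ carrier W → rs M h s ∈ carrier V
  local_mem : ∀ {W : X.Opens} (s : Γ(M, W)),
    (∀ x ∈ W, ∃ (V : X.Opens) (hV : V ≤ W), x ∈ V ∧ rs M hV s ∈ carrier V) → s ∈ carrier W

namespace LocalSub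

variable {M : X.Modules} (N : LocalSub M)

/-- The underlying submodule presheaf. -/
def toSubmodule : PresheafOfModules.Submodule M.val where
  obj W := N.carrier W.unop
  map {V W} f := fun _ hs => N.res_mem (W := V.unop) (V := W.unop) f.unop.le hs

/-- The subsheaf of sections satisfying a local condition. -/
def toModules : X.Modules where
  val := N.toSubmodule.toPresheafOfModules
  isSheaf := by
    refine (TopCat.Presheaf.isSheaf_iff_isSheaf_comp (CategoryTheory.forget AddCommGrpCat) _).2 ?_
    refine TopCat.Presheaf.isSheaf_of_isSheafUniqueGluing_types _ ?_
    intro I V sf hsf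
    let s' : ∀ i, Γ(M, V i) := fun i => (sf i).1
    have hsf' : ∀ i j, rs M (inf_le_left : V i ⊓ V j ≤ V i) (s' i) =
        rs M (inf_le_right : V i ⊓ V j ≤ V j) (s' j) := fun i j => congrArg Subtype.val (hsf i j)
    obtain ⟨t, ht, hu⟩ := TopCat.Sheaf.existsUnique_gluing' ⟨M.presheaf, M.isSheaf⟩ V (iSup V)
      (fun i => homOfLE (le_iSup V i)) le_rfl s' (fun i j => hsf' i j)
    refine ⟨⟨t, N.local_mem t fun x hx => ?_⟩, fun i => Subtype.ext (ht i), fun y hy => ?_⟩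
    · obtain ⟨i, hi⟩ := TopologicalSpace.Opens.mem_iSup.mp hx
      refine ⟨V i, le_iSup V i, hi, ?_⟩
      have h1 : s' i ∈ N.carrier (V i) := (sf i).2
      rw [← ht i] at h1
      exact h1
    · exact Subtype.ext (hu _ fun i => congrArg Subtype.val (hy i))

/-- The inclusion of the subsheaf. -/
def ι : N.toModules ⟶ M := ⟨N.toSubmodule.ι⟩

lemma ap_ι_injective (W : X.Opens) : Function.Injective (ap N.ι W) := fun _ _ h => Subtype.ext h

lemma range_ap_ι (W : X.Opens) (s : Γ(M, W)) : (∃ t, ap N.ι W t = s) ↔ s ∈ N.carrier W :=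
  ⟨fun ⟨t, ht⟩ => ht ▸ t.2, fun h => ⟨⟨s, h⟩, rfl⟩⟩

instance : Mono N.ι := by
  refine ⟨fun f g h => hom_ext_ap fun W s => N.ap_ι_injective W ?_⟩
  rw [← ap_comp, ← ap_comp, h]

end LocalSub

/-! ### Monomorphisms and cokernels -/

lemma ap_injective {M N : X.Modules} (f : M ⟶ N) [Mono f] (W : X.Opens) :
    Function.Injective (ap f W) := by
  have : Mono ((Scheme.Modules.toPresheaf X).map f) := inferInstance
  have h2 : Mono (((Scheme.Modules.toPresheaf X).map f).app (.op W)) := inferInstance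
  exact (AddCommGrpCat.mono_iff_injective _).mp h2

lemma isIso_of_ap_bijective {M N : X.Modules} (f : M ⟶ N)
    (h : ∀ W, Function.Bijective (ap f W)) : IsIso f := by
  rw [Scheme.Modules.Hom.isIso_iff_isIso_app]
  intro W
  exact (ConcreteCategory.isIso_iff_bijective _).mpr (h W)

lemma ap_bijective {M N : X.Modules} (f : M ⟶ N) [IsIso f] (W : X.Opens) :
    Function.Bijective (ap f W) :=
  ConcreteCategory.bijective_of_isIso (f.app W)

lemma isZero_of_section_eq_zero {M : X.Modules} (h : ∀ (W : X.Opens) (s : Γ(M, W)), s = 0) :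
    IsZero M := by
  rw [IsZero.iff_id_eq_zero]
  exact hom_ext_ap fun W s => (h W s).trans (h W _).symm

/-- In an abelian category a monomorphism is the kernel of its cokernel. The subsheaf of sections
killed by the projection therefore factors through `f`, and this gives a lift over all of `W`, not
only locally. -/
lemma ap_cokernel_π_eq_zero_iff {M N : X.Modules} (f : M ⟶ N) [Mono f] (W : X.Opens)
    (s : Γ(N, W)) : ap (cokernel.π f) W s = 0 ↔ ∃ t, ap f W t = s := by
  constructor
  · intro hs
    let K : LocalSub N :=
      { carrier := fun W => LinearMap.ker (ap (cokernel.π f) W)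
        res_mem := fun h s hs => by
          rw [LinearMap.mem_ker] at hs ⊢
          rw [ap_rs, hs, map_zero]
        local_mem := fun s h => by
          rw [LinearMap.mem_ker]
          refine section_ext _ _ _ fun x hx => ?_
          obtain ⟨V, hV, hxV, hs⟩ := h x hx
          exact ⟨V, hV, hxV, by rw [← ap_rs, map_zero]; exact hs⟩ }
    have hK : K.ι ≫ cokernel.π f = 0 := hom_ext_ap fun W s => s.2
    have hl := Abelian.monoIsKernelOfCokernel (CokernelCofork.ofπ (cokernel.π f)
      (cokernel.condition f)) (cokernelIsCokernel f)
    obtain ⟨g, hg⟩ := KernelFork.IsLimit.lift' hl K.ι hK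
    refine ⟨ap g W ⟨s, hs⟩, ?_⟩
    change ap (g ≫ f) W _ = s
    rw [show g ≫ f = K.ι from hg]
    rfl
  · rintro ⟨t, rfl⟩
    rw [← ap_comp, cokernel.condition]
    rfl

/-- The locally liftable sections form a subsheaf through which `f` factors. Its inclusion is a
monomorphism and an epimorphism, hence an isomorphism. -/
lemma locally_surjective_of_epi {M N : X.Modules} (f : M ⟶ N) [Epi f] (W : X.Opens)
    (s : Γ(N, W)) (x : X) (hx : x ∈ W) :
    ∃ (V : X.Opens) (hV : V ≤ W) (t : Γ(M, V)), x ∈ V ∧ ap f V t = rs N hV s := by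
  let I : LocalSub N :=
    { carrier := fun W =>
        { carrier := {s | ∀ x ∈ W, ∃ (V : X.Opens) (hV : V ≤ W) (t : Γ(M, V)),
            x ∈ V ∧ ap f V t = rs N hV s}
          add_mem' := by
            intro a b ha hb x hx
            obtain ⟨V, hV, t, hxV, ht⟩ := ha x hx
            obtain ⟨V', hV', t', hxV', ht'⟩ := hb x hx
            refine ⟨V ⊓ V', inf_le_left.trans hV, rs M inf_le_left t + rs M inf_le_right t',
              ⟨hxV, hxV'⟩, ?_⟩
            rw [map_add, ap_rs, ap_rs, ht, ht', rs_rs, rs_rs, map_add]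
          zero_mem' := fun x hx => ⟨W, le_rfl, 0, hx, by simp⟩
          smul_mem' := by
            intro c a ha x hx
            obtain ⟨V, hV, t, hxV, ht⟩ := ha x hx
            exact ⟨V, hV, rr X hV c • t, hxV, by rw [map_smul, ht, rs_smul]⟩ }
      res_mem := by
        intro V W h s hs x hx
        obtain ⟨V', hV', t, hxV, ht⟩ := hs x (h hx)
        exact ⟨V' ⊓ V, inf_le_right, rs M inf_le_left t, ⟨hxV, hx⟩, by
          rw [ap_rs, ht, rs_rs, rs_rs]⟩
      local_mem := by
        intro W s h x hx
        obtain ⟨V, hV, hxV, hs⟩ := h x hx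
        obtain ⟨V', hV', t, hxV', ht⟩ := hs x hxV
        exact ⟨V', hV'.trans hV, t, hxV', by rw [ht, rs_rs]⟩ }
  let p : M ⟶ I.toModules := homMk
    (fun W => ((ap f W).codRestrict (I.carrier W)
      fun t x hx => ⟨W, le_rfl, t, hx, by rw [rs_self]⟩ : Γ(M, W) →ₗ[Γ(X, W)] I.carrier W))
    (fun V W hV s => Subtype.ext (ap_rs f hV s))
  have hp : p ≫ I.ι = f := hom_ext_ap fun W s => rfl
  have : Epi I.ι := by
    have : Epi (p ≫ I.ι) := hp ▸ ‹Epi f›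
    exact epi_of_epi p I.ι
  have : IsIso I.ι := isIso_of_mono_of_epi _
  obtain ⟨t, ht⟩ := (ap_bijective I.ι W).2 s
  have := (I.range_ap_ι W s).mp ⟨t, ht⟩
  exact this x hx

/-! ### Germs -/

/-- The germ of a section. -/
def gm (M : X.Modules) {W : X.Opens} {x : X} (hx : x ∈ W) : Γ(M, W) →+ M.presheaf.stalk x :=
  (M.presheaf.germ W x hx).hom

/-- The germ of a function. -/
def gr (X : Scheme.{0}) {W : X.Opens} {x : X} (hx : x ∈ W) : Γ(X, W) →+* X.presheaf.stalk x :=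
  (X.presheaf.germ W x hx).hom

lemma gm_rs (M : X.Modules) {V W : X.Opens} (h : V ≤ W) {x : X} (hx : x ∈ V) (s : Γ(M, W)) :
    gm M hx (rs M h s) = gm M (h hx) s :=
  TopCat.Presheaf.germ_res_apply M.presheaf (homOfLE h) x hx s

lemma gr_rr {V W : X.Opens} (h : V ≤ W) {x : X} (hx : x ∈ V) (s : Γ(X, W)) :
    gr X hx (rr X h s) = gr X (h hx) s :=
  TopCat.Presheaf.germ_res_apply X.presheaf (homOfLE h) x hx s

lemma gm_smul (M : X.Modules) {W : X.Opens} {x : X} (hx : x ∈ W) (r : Γ(X, W)) (s : Γ(M, W)) :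
    gm M hx (r • s) = gr X hx r • gm M hx s := germ_smul M x W hx r s

lemma exists_gm (M : X.Modules) {x : X} (m : M.presheaf.stalk x) :
    ∃ (W : X.Opens) (hx : x ∈ W) (s : Γ(M, W)), gm M hx s = m := by
  obtain ⟨W, hW, s, hs⟩ := M.presheaf.exists_germ_eq m
  exact ⟨W, hW, s, hs⟩

lemma exists_gr {x : X} (m : X.presheaf.stalk x) :
    ∃ (W : X.Opens) (hx : x ∈ W) (s : Γ(X, W)), gr X hx s = m := by
  obtain ⟨W, hW, s, hs⟩ := X.presheaf.exists_germ_eq m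
  exact ⟨W, hW, s, hs⟩

lemma gm_eq_iff (M : X.Modules) {U V : X.Opens} {x : X} (hU : x ∈ U) (hV : x ∈ V) (s : Γ(M, U))
    (t : Γ(M, V)) : gm M hU s = gm M hV t ↔
      ∃ (W : X.Opens) (h : W ≤ U) (h' : W ≤ V), x ∈ W ∧ rs M h s = rs M h' t := by
  constructor
  · intro h
    obtain ⟨W, hW, iU, iV, h⟩ := TopCat.Presheaf.germ_eq M.presheaf x hU hV s t h
    exact ⟨W, iU.le, iV.le, hW, h⟩
  · rintro ⟨W, h, h', hx, e⟩
    rw [← gm_rs M h hx, ← gm_rs M h' hx, e]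

lemma gm_eq_zero_iff (M : X.Modules) {U : X.Opens} {x : X} (hU : x ∈ U) (s : Γ(M, U)) :
    gm M hU s = 0 ↔ ∃ (W : X.Opens) (h : W ≤ U), x ∈ W ∧ rs M h s = 0 := by
  rw [← map_zero (gm M hU), gm_eq_iff]
  constructor
  · rintro ⟨W, h, h', hx, e⟩
    exact ⟨W, h, hx, by rw [e, map_zero]⟩
  · rintro ⟨W, h, hx, e⟩
    exact ⟨W, h, h, hx, by rw [e, map_zero]⟩

lemma section_eq_zero_of_gm (M : X.Modules) {U : X.Opens} (s : Γ(M, U))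
    (h : ∀ (x : X) (hx : x ∈ U), gm M hx s = 0) : s = 0 := by
  refine section_ext _ _ _ fun x hx => ?_
  obtain ⟨W, hW, hxW, e⟩ := (gm_eq_zero_iff M hx s).mp (h x hx)
  exact ⟨W, hW, hxW, by rw [e, map_zero]⟩

lemma stalkMap_gm {M N : X.Modules} (f : M ⟶ N) {W : X.Opens} {x : X} (hx : x ∈ W) (s : Γ(M, W)) :
    stalkMap f x (gm M hx s) = gm N hx (ap f W s) :=
  TopCat.Presheaf.stalkFunctor_map_germ_apply W x hx f.mapPresheaf s

lemma stalkMap_injective {M N : X.Modules} (f : M ⟶ N) [Mono f] (x : X) :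
    Function.Injective (stalkMap f x) := by
  rw [injective_iff_map_eq_zero]
  intro m hm
  obtain ⟨W, hx, s, rfl⟩ := exists_gm M m
  rw [stalkMap_gm, gm_eq_zero_iff] at hm
  obtain ⟨V, hV, hxV, e⟩ := hm
  rw [← ap_rs] at e
  rw [gm_eq_zero_iff]
  exact ⟨V, hV, hxV, ap_injective f V (by rw [e, map_zero])⟩

/-- The sections whose germs lie in given submodules of the stalks. -/
def stalkwise (M : X.Modules) (P : ∀ x : X, Submodule (X.presheaf.stalk x) (M.presheaf.stalk x)) :
    LocalSub M where
  carrier W :=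
    { carrier := {s | ∀ (x : X) (hx : x ∈ W), gm M hx s ∈ P x}
      add_mem' := fun ha hb x hx => by rw [map_add]; exact add_mem (ha x hx) (hb x hx)
      zero_mem' := fun x hx => by rw [map_zero]; exact zero_mem _
      smul_mem' := fun c s hs x hx => by rw [gm_smul]; exact Submodule.smul_mem _ _ (hs x hx) }
  res_mem h s hs x hx := by rw [gm_rs]; exact hs x (h hx)
  local_mem s hs x hx := by
    obtain ⟨V, hV, hxV, h⟩ := hs x hx
    have := h x hxV
    rwa [gm_rs] at this

end Basics


/-! ### Local bases and the morphisms they define -/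

section Bases

variable {X Y : Scheme.{0}}

/-- Sections of `M` over `W` that form a basis of `M` over all open subsets of `W`. -/
def IsBasisOn {n : ℕ} (M : X.Modules) (W : X.Opens) (e : Fin n → Γ(M, W)) : Prop :=
  ∀ (V : X.Opens) (h : V ≤ W),
    Function.Bijective (fun a : Fin n → Γ(X, V) => ∑ i, a i • rs M h (e i))

lemma IsBasisOn.res {n : ℕ} {M : X.Modules} {W : X.Opens} {e : Fin n → Γ(M, W)}
    (he : IsBasisOn M W e) {V : X.Opens} (h : V ≤ W) : IsBasisOn M V (fun i => rs M h (e i)) := by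
  intro V' h'
  simp only [rs_rs]
  exact he V' (h'.trans h)

lemma rs_sum_smul {n : ℕ} (M : X.Modules) {V W : X.Opens} (h : V ≤ W) (a : Fin n → Γ(X, W))
    (e : Fin n → Γ(M, W)) :
    rs M h (∑ i, a i • e i) = ∑ i, rr X h (a i) • rs M h (e i) := by
  rw [map_sum]
  simp only [rs_smul]

/-- Coordinates with respect to a basis. -/
def IsBasisOn.coord {n : ℕ} {M : X.Modules} {W : X.Opens} {e : Fin n → Γ(M, W)}
    (he : IsBasisOn M W e) {V : X.Opens} (h : V ≤ W) : Γ(M, V) ≃ₗ[Γ(X, V)] (Fin n → Γ(X, V)) :=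
  (LinearEquiv.ofBijective
    ({ toFun := fun a => ∑ i, a i • rs M h (e i)
       map_add' := fun a b => by simp [add_smul, Finset.sum_add_distrib]
       map_smul' := fun c a => by simp [Finset.smul_sum, mul_smul] } :
      (Fin n → Γ(X, V)) →ₗ[Γ(X, V)] Γ(M, V)) (he V h)).symm

lemma IsBasisOn.sum_coord {n : ℕ} {M : X.Modules} {W : X.Opens} {e : Fin n → Γ(M, W)}
    (he : IsBasisOn M W e) {V : X.Opens} (h : V ≤ W) (s : Γ(M, V)) :
    ∑ i, he.coord h s i • rs M h (e i) = s :=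
  (he.coord h).symm_apply_apply s

lemma IsBasisOn.coord_sum {n : ℕ} {M : X.Modules} {W : X.Opens} {e : Fin n → Γ(M, W)}
    (he : IsBasisOn M W e) {V : X.Opens} (h : V ≤ W) (a : Fin n → Γ(X, V)) :
    he.coord h (∑ i, a i • rs M h (e i)) = a :=
  (he.coord h).apply_symm_apply a

lemma IsBasisOn.coord_rs {n : ℕ} {M : X.Modules} {W : X.Opens} {e : Fin n → Γ(M, W)}
    (he : IsBasisOn M W e) {V V' : X.Opens} (h : V ≤ W) (h' : V' ≤ V) (s : Γ(M, V)) (i : Fin n) :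
    he.coord (h'.trans h) (rs M h' s) i = rr X h' (he.coord h s i) := by
  conv_lhs => rw [← he.sum_coord h s, rs_sum_smul]
  simp only [rs_rs]
  exact congrFun (he.coord_sum (h'.trans h) (fun i => rr X h' (he.coord h s i))) i

/-- The free module of rank `n`. -/
def freeModule (X : Scheme.{0}) (n : ℕ) : X.Modules where
  val :=
    { obj := fun W => ModuleCat.of Γ(X, W.unop) (Fin n → Γ(X, W.unop))
      map := fun {V W} f => ModuleCat.semilinearMapAddEquiv _ _ _
        ({ toFun := fun a i => rr X f.unop.le (a i)
           map_add' := fun a b => by ext i; simp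
           map_smul' := fun c a => by
            ext i
            exact map_mul (rr X f.unop.le) c (a i) } :
          (Fin n → Γ(X, V.unop)) →ₛₗ[rr X f.unop.le] (Fin n → Γ(X, W.unop)))
      map_id := fun W => by
        ext a
        funext i
        exact rr_self le_rfl _
      map_comp := fun f g => by
        ext a
        funext i
        exact (rr_rr _ _ _).symm }
  isSheaf := by
    refine (TopCat.Presheaf.isSheaf_iff_isSheaf_comp (CategoryTheory.forget AddCommGrpCat) _).2 ?_
    refine TopCat.Presheaf.isSheaf_of_isSheafUniqueGluing_types _ ?_
    intro I V sf hsf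
    let s' : ∀ (k : Fin n) i, Γ(X, V i) := fun k i => (show Fin n → Γ(X, V i) from sf i) k
    have hs' : ∀ k i j, rr X (inf_le_left : V i ⊓ V j ≤ V i) (s' k i) =
        rr X (inf_le_right : V i ⊓ V j ≤ V j) (s' k j) := fun k i j =>
      congrFun (show (_ : Fin n → Γ(X, V i ⊓ V j)) = _ from hsf i j) k
    have := fun k => TopCat.Sheaf.existsUnique_gluing' X.sheaf V (iSup V)
      (fun i => homOfLE (le_iSup V i)) le_rfl (s' k) (fun i j => hs' k i j)
    choose t ht hu using this
    refine ⟨t, fun i => funext fun k => ht k i, fun y hy => funext fun k => hu k _ fun i => ?_⟩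
    exact congrFun (show (_ : Fin n → Γ(X, V i)) = _ from hy i) k

/-- The standard basis of the free module. -/
def freeBasis (X : Scheme.{0}) (n : ℕ) (W : X.Opens) (i : Fin n) : Γ(freeModule X n, W) :=
  (Pi.single i 1 : Fin n → Γ(X, W))

lemma rs_freeBasis (n : ℕ) {V W : X.Opens} (h : V ≤ W) (i : Fin n) :
    rs (freeModule X n) h (freeBasis X n W i) = freeBasis X n V i := by
  funext k
  change rr X h ((Pi.single i 1 : Fin n → Γ(X, W)) k) = (Pi.single i 1 : Fin n → Γ(X, V)) k
  by_cases hk : k = i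
  · subst hk; simp
  · simp [hk]

lemma sum_freeBasis (n : ℕ) (V : X.Opens) (a : Fin n → Γ(X, V)) :
    ∑ i, a i • freeBasis X n V i = (show Γ(freeModule X n, V) from a) := by
  change ∑ i, a i • (Pi.single i 1 : Fin n → Γ(X, V)) = a
  simp only [← Pi.single_smul]
  simp only [smul_eq_mul, mul_one]
  exact Finset.univ_sum_single a

lemma isBasisOn_freeBasis (n : ℕ) (W : X.Opens) :
    IsBasisOn (freeModule X n) W (freeBasis X n W) := by
  intro V h
  simp only [rs_freeBasis, sum_freeBasis]
  exact Function.bijective_id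

/-- The morphism out of a module with a global basis. -/
def IsBasisOn.desc {n : ℕ} {M N : X.Modules} {e : Fin n → Γ(M, ⊤)} (he : IsBasisOn M ⊤ e)
    (t : Fin n → Γ(N, ⊤)) : M ⟶ N :=
  homMk (fun W =>
    { toFun := fun s => ∑ i, he.coord le_top s i • rs N (le_top : W ≤ ⊤) (t i)
      map_add' := fun s s' => by simp [add_smul, Finset.sum_add_distrib]
      map_smul' := fun c s => by simp [Finset.smul_sum, mul_smul] })
    (fun V W h s => by
      simp only [LinearMap.coe_mk, AddHom.coe_mk]
      rw [rs_sum_smul]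
      refine Finset.sum_congr rfl fun i _ => ?_
      rw [rs_rs, ← he.coord_rs le_top h])

lemma IsBasisOn.ap_desc {n : ℕ} {M N : X.Modules} {e : Fin n → Γ(M, ⊤)} (he : IsBasisOn M ⊤ e)
    (t : Fin n → Γ(N, ⊤)) (i : Fin n) : ap (he.desc t) ⊤ (e i) = t i := by
  change ∑ k, he.coord le_top (e i) k • rs N (le_top : (⊤ : X.Opens) ≤ ⊤) (t k) = t i
  have h1 : e i = ∑ k, (Pi.single i 1 : Fin n → Γ(X, ⊤)) k • rs M le_rfl (e k) := by
    simp [Pi.single_apply, rs_self]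
  rw [h1, he.coord_sum]
  simp [Pi.single_apply, rs_self]

/-- The action on sections of a morphism to a direct image. -/
def pa {f : Y ⟶ X} {M : X.Modules} {N : Y.Modules}
    (g : M ⟶ (Scheme.Modules.pushforward f).obj N) (W : X.Opens) : Γ(M, W) →+ Γ(N, f ⁻¹ᵁ W) :=
  (ap g W).toAddMonoidHom

/-- Pullback of functions. -/
def pf (f : Y ⟶ X) (W : X.Opens) : Γ(X, W) →+* Γ(Y, f ⁻¹ᵁ W) := (f.app W).hom

lemma pre_mono (f : Y ⟶ X) {V W : X.Opens} (h : V ≤ W) : f ⁻¹ᵁ V ≤ f ⁻¹ᵁ W := fun _ hx => h hx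

lemma pf_rr (f : Y ⟶ X) {V W : X.Opens} (h : V ≤ W) (r : Γ(X, W)) :
    pf f V (rr X h r) = rr Y (pre_mono f h) (pf f W r) :=
  ConcreteCategory.congr_hom (f.naturality (homOfLE h).op) r

lemma pa_smul {f : Y ⟶ X} {M : X.Modules} {N : Y.Modules}
    (g : M ⟶ (Scheme.Modules.pushforward f).obj N) (W : X.Opens) (r : Γ(X, W)) (s : Γ(M, W)) :
    pa g W (r • s) = pf f W r • pa g W s := (ap g W).map_smul r s

lemma pa_rs {f : Y ⟶ X} {M : X.Modules} {N : Y.Modules}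
    (g : M ⟶ (Scheme.Modules.pushforward f).obj N) {V W : X.Opens} (h : V ≤ W) (s : Γ(M, W)) :
    pa g V (rs M h s) = rs N (pre_mono f h) (pa g W s) := ap_rs g h s

lemma pushforward_hom_ext {f : Y ⟶ X} {M : X.Modules} {N : Y.Modules}
    {g g' : M ⟶ (Scheme.Modules.pushforward f).obj N} (h : ∀ W s, pa g W s = pa g' W s) : g = g' :=
  hom_ext_ap h

/-- Construct a morphism to a direct image from its action on sections. -/
def paMk {f : Y ⟶ X} {M : X.Modules} {N : Y.Modules} (φ : ∀ W : X.Opens, Γ(M, W) →+ Γ(N, f ⁻¹ᵁ W))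
    (h1 : ∀ (W : X.Opens) (r : Γ(X, W)) (s : Γ(M, W)), φ W (r • s) = pf f W r • φ W s)
    (h2 : ∀ (V W : X.Opens) (hV : V ≤ W) (s : Γ(M, W)),
      φ V (rs M hV s) = rs N (pre_mono f hV) (φ W s)) :
    M ⟶ (Scheme.Modules.pushforward f).obj N :=
  homMk (N := (Scheme.Modules.pushforward f).obj N)
    (fun W => { toFun := φ W, map_add' := (φ W).map_add, map_smul' := h1 W }) h2

lemma pa_paMk {f : Y ⟶ X} {M : X.Modules} {N : Y.Modules}
    (φ : ∀ W : X.Opens, Γ(M, W) →+ Γ(N, f ⁻¹ᵁ W)) (h1 h2) (W : X.Opens) (s : Γ(M, W)) :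
    pa (paMk φ h1 h2) W s = φ W s := rfl

/-- The pullback of sections. -/
def ps (f : Y ⟶ X) (M : X.Modules) :
    M ⟶ (Scheme.Modules.pushforward f).obj ((Scheme.Modules.pullback f).obj M) :=
  (Scheme.Modules.pullbackPushforwardAdjunction f).unit.app M

lemma pa_homEquiv (f : Y ⟶ X) (M : X.Modules) (N : Y.Modules)
    (φ : (Scheme.Modules.pullback f).obj M ⟶ N) (W : X.Opens) (s : Γ(M, W)) :
    pa ((Scheme.Modules.pullbackPushforwardAdjunction f).homEquiv M N φ) W s =
      ap φ (f ⁻¹ᵁ W) (pa (ps f M) W s) := by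
  rw [Adjunction.homEquiv_unit]
  rfl

lemma pa_restrict_homEquiv (f : Y ⟶ X) [IsOpenImmersion f] (M : X.Modules) (N : Y.Modules)
    (φ : M.restrict f ⟶ N) (W : X.Opens) (s : Γ(M, W)) :
    pa ((Scheme.Modules.restrictAdjunction f).homEquiv M N φ) W s =
      ap φ (f ⁻¹ᵁ W) (show Γ(M.restrict f, f ⁻¹ᵁ W) from rs M (f.image_preimage_le W) s) := by
  rw [Adjunction.homEquiv_unit]
  rfl

end Bases


/-! ### Pullbacks of local bases -/

section PullbackBasis

variable {X Y Z : Scheme.{0}}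

/-- The action on sections of the morphism `M ⟶ g_* N` defined on a basis of `M` over `W`, where
`g` takes values in `W`. -/
def basisHomApp (g : Z ⟶ X) {n : ℕ} {M : X.Modules} {W : X.Opens} {e : Fin n → Γ(M, W)}
    (he : IsBasisOn M W e) (hg : ∀ S : X.Opens, g ⁻¹ᵁ S ≤ g ⁻¹ᵁ (S ⊓ W)) {N : Z.Modules}
    (t : Fin n → Γ(N, ⊤)) (S : X.Opens) : Γ(M, S) →+ Γ(N, g ⁻¹ᵁ S) where
  toFun s := ∑ i, rr Z (hg S) (pf g _
    (he.coord (inf_le_right : S ⊓ W ≤ W) (rs M inf_le_left s) i)) • rs N le_top (t i)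
  map_zero' := by simp
  map_add' s s' := by simp [add_smul, Finset.sum_add_distrib]

lemma basisHomApp_apply (g : Z ⟶ X) {n : ℕ} {M : X.Modules} {W : X.Opens} {e : Fin n → Γ(M, W)}
    (he : IsBasisOn M W e) (hg : ∀ S : X.Opens, g ⁻¹ᵁ S ≤ g ⁻¹ᵁ (S ⊓ W)) {N : Z.Modules}
    (t : Fin n → Γ(N, ⊤)) (S : X.Opens) (s : Γ(M, S)) :
    basisHomApp g he hg t S s = ∑ i, rr Z (hg S) (pf g _
    (he.coord (inf_le_right : S ⊓ W ≤ W) (rs M inf_le_left s) i)) • rs N le_top (t i) := rfl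

/-- The morphism `M ⟶ g_* N` defined on a basis of `M` over `W`, where `g` takes values in `W`. -/
def basisHom (g : Z ⟶ X) {n : ℕ} {M : X.Modules} {W : X.Opens} {e : Fin n → Γ(M, W)}
    (he : IsBasisOn M W e) (hg : ∀ S : X.Opens, g ⁻¹ᵁ S ≤ g ⁻¹ᵁ (S ⊓ W)) {N : Z.Modules}
    (t : Fin n → Γ(N, ⊤)) : M ⟶ (Scheme.Modules.pushforward g).obj N :=
  paMk (basisHomApp g he hg t)
    (fun S r s => by
      simp only [basisHomApp_apply, rs_smul, map_smul, Pi.smul_apply, smul_eq_mul, map_mul,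
        mul_smul, ← Finset.smul_sum]
      rw [pf_rr, rr_rr, rr_self])
    (fun V S h s => by
      simp only [basisHomApp_apply]
      rw [rs_sum_smul]
      refine Finset.sum_congr rfl fun i _ => ?_
      rw [rs_rs, rs_rs, ← rs_rs M (inf_le_left : S ⊓ W ≤ S)
        (inf_le_inf_right W h : V ⊓ W ≤ S ⊓ W), he.coord_rs, pf_rr, rr_rr, rr_rr])

lemma pa_basisHom (g : Z ⟶ X) {n : ℕ} {M : X.Modules} {W : X.Opens} {e : Fin n → Γ(M, W)}
    (he : IsBasisOn M W e) (hg : ∀ S : X.Opens, g ⁻¹ᵁ S ≤ g ⁻¹ᵁ (S ⊓ W)) {N : Z.Modules}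
    (t : Fin n → Γ(N, ⊤)) (i : Fin n) :
    pa (basisHom g he hg t) W (e i) = rs N le_top (t i) := by
  rw [basisHom, pa_paMk, basisHomApp_apply]
  have h1 : rs M (inf_le_left : W ⊓ W ≤ W) (e i) =
      ∑ k, (Pi.single i 1 : Fin n → Γ(X, W ⊓ W)) k • rs M inf_le_right (e k) := by
    simp [Pi.single_apply]
  rw [h1]
  simp only [he.coord_sum]
  rw [Finset.sum_eq_single i]
  · simp
  · intro k _ hk
    simp [hk]
  · simp

lemma basis_hom_ext (g : Z ⟶ X) {n : ℕ} {M : X.Modules} {W : X.Opens} {e : Fin n → Γ(M, W)}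
    (he : IsBasisOn M W e) (hg : ∀ S : X.Opens, g ⁻¹ᵁ S ≤ g ⁻¹ᵁ (S ⊓ W)) {N : Z.Modules}
    {φ ψ : M ⟶ (Scheme.Modules.pushforward g).obj N}
    (h : ∀ i, pa φ W (e i) = pa ψ W (e i)) : φ = ψ := by
  refine pushforward_hom_ext fun S s => ?_
  have key : pa φ (S ⊓ W) (rs M inf_le_left s) = pa ψ (S ⊓ W) (rs M inf_le_left s) := by
    rw [← he.sum_coord inf_le_right (rs M inf_le_left s), map_sum, map_sum]
    refine Finset.sum_congr rfl fun i _ => ?_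
    rw [pa_smul, pa_smul, pa_rs, pa_rs, h]
  rw [pa_rs, pa_rs] at key
  have h2 := congrArg (rs N (hg S)) key
  rwa [rs_rs, rs_rs, rs_self, rs_self] at h2

/-- The identification of sections of a restriction. -/
def toR (j : Y ⟶ X) [IsOpenImmersion j] (M : X.Modules) (V : Y.Opens) :
    Γ(M, j ''ᵁ V) ≃+ Γ(M.restrict j, V) := AddEquiv.refl _

/-- The identification of functions on an open subscheme. -/
def toF (W : X.Opens) (V : W.toScheme.Opens) :
    Γ(X, W.ι ''ᵁ V) ≃+* Γ(W.toScheme, V) := RingEquiv.refl _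

lemma rs_toR (j : Y ⟶ X) [IsOpenImmersion j] (M : X.Modules) {V V' : Y.Opens} (h : V' ≤ V)
    (s : Γ(M, j ''ᵁ V)) :
    rs (M.restrict j) h (toR j M V s) = toR j M V' (rs M (j.image_mono h) s) := rfl

lemma toR_smul (W : X.Opens) (M : X.Modules) (V : W.toScheme.Opens) (r : Γ(X, W.ι ''ᵁ V))
    (s : Γ(M, W.ι ''ᵁ V)) : toF W V r • toR W.ι M V s = toR W.ι M V (r • s) := by
  have h : (W.ι.appIso V).inv (toF W V r) = r := by
    rw [Scheme.Opens.ι_appIso]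
    rfl
  have h2 : toF W V r • toR W.ι M V s = toR W.ι M V ((W.ι.appIso V).inv (toF W V r) • s) := rfl
  rw [h2, h]

/-- The restriction of the pullback to `f⁻¹ W`. -/
abbrev pullbackOn (f : Y ⟶ X) (M : X.Modules) (W : X.Opens) : (f ⁻¹ᵁ W).toScheme.Modules :=
  ((Scheme.Modules.pullback f).obj M).restrict (f ⁻¹ᵁ W).ι

/-- The section of the restricted pullback defined by a section of `M`. -/
def pullbackOnSection (f : Y ⟶ X) (M : X.Modules) (W : X.Opens) (s : Γ(M, W)) :
    Γ(pullbackOn f M W, ⊤) :=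
  toR _ _ _ (rs ((Scheme.Modules.pullback f).obj M) ((f ⁻¹ᵁ W).ι_image_top.le :
    (f ⁻¹ᵁ W).ι ''ᵁ ⊤ ≤ f ⁻¹ᵁ W) (pa (ps f M) W s))

/-- The combination of the adjunctions for `f` and for the inclusion of `f⁻¹ W`. -/
def pullbackOnEquiv (f : Y ⟶ X) (M : X.Modules) (W : X.Opens)
    (N : (f ⁻¹ᵁ W).toScheme.Modules) :
    (pullbackOn f M W ⟶ N) ≃ (M ⟶ (Scheme.Modules.pushforward ((f ⁻¹ᵁ W).ι ≫ f)).obj N) :=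
  ((Scheme.Modules.restrictAdjunction (f ⁻¹ᵁ W).ι).homEquiv _ N).trans
    (((Scheme.Modules.pullbackPushforwardAdjunction f).homEquiv M _).trans
      (Iso.homCongr (Iso.refl M) ((Scheme.Modules.pushforwardComp (f ⁻¹ᵁ W).ι f).app N)))

lemma pa_pushforwardComp {f : Y ⟶ X} {j : Z ⟶ Y} {M : X.Modules} {N : Z.Modules}
    (φ : M ⟶ (Scheme.Modules.pushforward f).obj ((Scheme.Modules.pushforward j).obj N))
    (S : X.Opens) (s : Γ(M, S)) :
    pa (Iso.homCongr (Iso.refl M) ((Scheme.Modules.pushforwardComp j f).app N) φ) S s =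
      (show Γ(N, j ⁻¹ᵁ (f ⁻¹ᵁ S)) from pa φ S s) := by
  simp only [Iso.homCongr_apply, Iso.refl_inv, Category.id_comp]
  rfl

lemma pa_pullbackOnEquiv (f : Y ⟶ X) (M : X.Modules) (W : X.Opens)
    (N : (f ⁻¹ᵁ W).toScheme.Modules) (φ : pullbackOn f M W ⟶ N) (S : X.Opens) (s : Γ(M, S)) :
    pa (pullbackOnEquiv f M W N φ) S s =
      ap φ ((f ⁻¹ᵁ W).ι ⁻¹ᵁ (f ⁻¹ᵁ S)) (toR _ _ _ (rs ((Scheme.Modules.pullback f).obj M)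
          ((f ⁻¹ᵁ W).ι.image_preimage_le (f ⁻¹ᵁ S)) (pa (ps f M) S s))) := by
  have h : pullbackOnEquiv f M W N φ = Iso.homCongr (Iso.refl M)
      ((Scheme.Modules.pushforwardComp (f ⁻¹ᵁ W).ι f).app N)
      ((Scheme.Modules.pullbackPushforwardAdjunction f).homEquiv M _
        ((Scheme.Modules.restrictAdjunction (f ⁻¹ᵁ W).ι).homEquiv _ N φ)) := by
    rw [pullbackOnEquiv, Equiv.trans_apply, Equiv.trans_apply]
  rw [h, pa_pushforwardComp, pa_homEquiv]
  exact pa_restrict_homEquiv (f ⁻¹ᵁ W).ι _ N φ (f ⁻¹ᵁ S) (pa (ps f M) S s)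

lemma ap_pullbackOnSection (f : Y ⟶ X) {M : X.Modules} (W : X.Opens)
    (N : (f ⁻¹ᵁ W).toScheme.Modules) (φ : pullbackOn f M W ⟶ N) (s : Γ(M, W)) :
    rs N (le_top : ((f ⁻¹ᵁ W).ι ≫ f) ⁻¹ᵁ W ≤ ⊤) (ap φ ⊤ (pullbackOnSection f M W s)) =
      pa (pullbackOnEquiv f M W N φ) W s := by
  rw [← ap_rs, pa_pullbackOnEquiv, pullbackOnSection, rs_toR, rs_rs]
  rfl

lemma preimage_le_inf (f : Y ⟶ X) (W S : X.Opens) :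
    ((f ⁻¹ᵁ W).ι ≫ f) ⁻¹ᵁ S ≤ ((f ⁻¹ᵁ W).ι ≫ f) ⁻¹ᵁ (S ⊓ W) := fun x hx => ⟨hx, x.2⟩

lemma pullbackOn_hom_ext (f : Y ⟶ X) {n : ℕ} {M : X.Modules} {W : X.Opens} {e : Fin n → Γ(M, W)}
    (he : IsBasisOn M W e) {N : (f ⁻¹ᵁ W).toScheme.Modules} {φ ψ : pullbackOn f M W ⟶ N}
    (h : ∀ i, ap φ ⊤ (pullbackOnSection f M W (e i)) = ap ψ ⊤ (pullbackOnSection f M W (e i))) :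
    φ = ψ := by
  apply (pullbackOnEquiv f M W N).injective
  refine basis_hom_ext _ he (preimage_le_inf f W) fun i => ?_
  rw [← ap_pullbackOnSection, ← ap_pullbackOnSection, h]

/-- The pullback of a local basis is a basis, on the restriction of the pullback. -/
lemma isBasisOn_pullbackOn (f : Y ⟶ X) {n : ℕ} {M : X.Modules} {W : X.Opens} {e : Fin n → Γ(M, W)}
    (he : IsBasisOn M W e) :
    IsBasisOn (pullbackOn f M W) ⊤ (fun i => pullbackOnSection f M W (e i)) := by
  let P := freeModule (f ⁻¹ᵁ W).toScheme n
  have hP : IsBasisOn P ⊤ (freeBasis _ n ⊤) := isBasisOn_freeBasis n ⊤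
  let ψ : P ⟶ pullbackOn f M W := hP.desc fun i => pullbackOnSection f M W (e i)
  -- The adjunctions turn a morphism out of the restricted pullback into a morphism out of `M`,
  -- which may be prescribed on the basis. This produces the inverse of `ψ` without any description
  -- of the sections of the pullback.
  let φ : pullbackOn f M W ⟶ P :=
    (pullbackOnEquiv f M W P).symm (basisHom _ he (preimage_le_inf f W) (freeBasis _ n ⊤))
  have hφ : ∀ i, ap φ ⊤ (pullbackOnSection f M W (e i)) = freeBasis _ n ⊤ i := by
    intro i
    have h1 := ap_pullbackOnSection f W P φ (e i)
    rw [Equiv.apply_symm_apply, pa_basisHom] at h1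
    have hle : (⊤ : (f ⁻¹ᵁ W).toScheme.Opens) ≤ ((f ⁻¹ᵁ W).ι ≫ f) ⁻¹ᵁ W := fun x _ => x.2
    have h2 := congrArg (rs P hle) h1
    rwa [rs_rs, rs_rs, rs_self, rs_self] at h2
  have hψ : ∀ i, ap ψ ⊤ (freeBasis _ n ⊤ i) = pullbackOnSection f M W (e i) := hP.ap_desc _
  have h1 : φ ≫ ψ = 𝟙 _ := pullbackOn_hom_ext f he fun i => by
    rw [ap_comp, hφ, hψ, ap_id]
  have : IsIso ψ := by
    refine ⟨φ, hom_ext_ap fun V s => ?_, h1⟩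
    rw [ap_comp, ap_id, ← hP.sum_coord le_top s, map_sum, map_sum]
    refine Finset.sum_congr rfl fun i _ => ?_
    rw [map_smul, map_smul, ap_rs, ap_rs, hψ, hφ]
  intro V hV
  have h2 := (ap_bijective ψ V).comp (hP V hV)
  convert h2 using 1
  funext a
  simp only [Function.comp]
  rw [map_sum]
  refine Finset.sum_congr rfl fun i _ => ?_
  rw [map_smul, ap_rs, hψ]

/-- A basis of the restriction of a module to an open subscheme. -/
lemma isBasisOn_of_restrict {n : ℕ} {M : X.Modules} {W : X.Opens} {e : Fin n → Γ(M, W)}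
    (he : IsBasisOn (M.restrict W.ι) ⊤
      (fun i => toR W.ι M ⊤ (rs M W.ι_image_top.le (e i)))) :
    IsBasisOn M W e := by
  intro V hV
  have h1 := he (W.ι ⁻¹ᵁ V) le_top
  have hV1 : W.ι ''ᵁ (W.ι ⁻¹ᵁ V) ≤ V := W.ι.image_preimage_le V
  have hV2 : V ≤ W.ι ''ᵁ (W.ι ⁻¹ᵁ V) := by
    rw [Scheme.Hom.image_preimage_eq_opensRange_inf]
    exact le_inf (by simpa using hV) le_rfl
  have hb : Function.Bijective (fun s => rs M hV2 ((toR W.ι M (W.ι ⁻¹ᵁ V)).symm s)) := by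
    refine Function.bijective_iff_has_inverse.mpr
      ⟨fun s => toR W.ι M (W.ι ⁻¹ᵁ V) (rs M hV1 s), fun s => ?_, fun s => ?_⟩ <;>
    simp [rs_rs, rs_self]
  have hb' : Function.Bijective fun a : Fin n → Γ(X, V) =>
      fun i => toF W (W.ι ⁻¹ᵁ V) (rr X hV1 (a i)) := by
    refine Function.bijective_iff_has_inverse.mpr
      ⟨fun a i => rr X hV2 ((toF W _).symm (a i)), fun s => ?_, fun s => ?_⟩ <;>
    · funext i
      simp [rr_rr, rr_self]
  have h2 := hb.comp (h1.comp hb')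
  convert h2 using 1
  funext a
  simp only [Function.comp, rs_toR, toR_smul, rs_rs]
  rw [← map_sum, AddEquiv.symm_apply_apply, rs_sum_smul]
  simp only [rr_rr, rr_self, rs_rs]

/-- The pullback of a local basis is a local basis. -/
lemma IsBasisOn.pullback (f : Y ⟶ X) {n : ℕ} {M : X.Modules} {W : X.Opens} {e : Fin n → Γ(M, W)}
    (he : IsBasisOn M W e) :
    IsBasisOn ((Scheme.Modules.pullback f).obj M) (f ⁻¹ᵁ W) (fun i => pa (ps f M) W (e i)) :=
  isBasisOn_of_restrict (isBasisOn_pullbackOn f he)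

end PullbackBasis


/-! ### Modules with local bases are locally free -/

section LocallyFree

variable {X : Scheme.{0}}

/-- The restriction of a module to the site of opens of `W`. -/
abbrev ov (M : X.Modules) (W : X.Opens) : SheafOfModules.{0} (X.ringCatSheaf.over W) :=
  SheafOfModules.over (R := X.ringCatSheaf) M W

/-- An open subset of `W`, as an object of the over category. -/
abbrev ob {V W : X.Opens} (h : V ≤ W) : (Over W)ᵒᵖ := .op (Over.mk (homOfLE h))

/-- The action of a morphism on sections over an open subset of `W`. -/
def apo {W : X.Opens} {M N : X.Modules} (φ : ov M W ⟶ ov N W) {V : X.Opens} (h : V ≤ W) :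
    Γ(M, V) →ₗ[Γ(X, V)] Γ(N, V) where
  toFun s := φ.val.app (ob h) s
  map_add' s t := map_add (φ.val.app (ob h)).hom s t
  map_smul' r s := (φ.val.app (ob h)).hom.map_smul (r : (X.ringCatSheaf.over W).obj.obj (ob h)) s

/-- The global section of the restriction to `W` defined by a section over `W`. -/
def secMk {W : X.Opens} {M : X.Modules} (s : Γ(M, W)) : (ov M W).sections :=
  PresheafOfModules.sectionsMk (fun Y => rs M Y.unop.hom.le s) (fun _ _ _ => rs_rs M _ _ s)

/-- The section over `W` defined by a global section of the restriction to `W`. -/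
def secVal {W : X.Opens} {M : X.Modules} (s : (ov M W).sections) : Γ(M, W) :=
  s.val (ob le_rfl)

/-- The action of functions on the sections of a sheaf on the site of opens of `W`. -/
def sm {W : X.Opens} (F : SheafOfModules.{0} (X.ringCatSheaf.over W)) (Y : (Over W)ᵒᵖ) :
    Γ(X, Y.unop.left) →+* AddMonoid.End (F.val.obj Y) :=
  Module.toAddMonoidEnd ((X.ringCatSheaf.over W).obj.obj Y) (F.val.obj Y)

lemma sm_map {W : X.Opens} (F : SheafOfModules.{0} (X.ringCatSheaf.over W)) {Y Z : (Over W)ᵒᵖ}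
    (f : Y ⟶ Z) (r : Γ(X, Y.unop.left)) (m : F.val.obj Y) :
    F.val.map f (sm F Y r m) = sm F Z (rr X f.unop.left.le r) (F.val.map f m) :=
  F.val.map_smul f r m

lemma sm_app {W : X.Opens} {F G : SheafOfModules.{0} (X.ringCatSheaf.over W)} (φ : F ⟶ G)
    (Y : (Over W)ᵒᵖ) (r : Γ(X, Y.unop.left)) (m : F.val.obj Y) :
    φ.val.app Y (sm F Y r m) = sm G Y r (φ.val.app Y m) :=
  (φ.val.app Y).hom.map_smul _ _

/-- The morphism defined on a basis, on sections. -/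
def IsBasisOn.descOverApp {n : ℕ} {M : X.Modules} {W : X.Opens} {e : Fin n → Γ(M, W)}
    (he : IsBasisOn M W e) {F : SheafOfModules.{0} (X.ringCatSheaf.over W)}
    (t : Fin n → F.sections) (Y : (Over W)ᵒᵖ) : Γ(M, Y.unop.left) →+ F.val.obj Y where
  toFun s := ∑ i, sm F Y (he.coord Y.unop.hom.le s i) ((t i).val Y)
  map_zero' := by simp
  map_add' a b := by
    rw [← Finset.sum_add_distrib]
    refine Finset.sum_congr rfl fun i _ => ?_
    rw [map_add, Pi.add_apply, map_add]
    rfl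

lemma IsBasisOn.descOverApp_apply {n : ℕ} {M : X.Modules} {W : X.Opens} {e : Fin n → Γ(M, W)}
    (he : IsBasisOn M W e) {F : SheafOfModules.{0} (X.ringCatSheaf.over W)}
    (t : Fin n → F.sections) (Y : (Over W)ᵒᵖ) (s : Γ(M, Y.unop.left)) :
    he.descOverApp t Y s = ∑ i, sm F Y (he.coord Y.unop.hom.le s i) ((t i).val Y) := rfl

lemma IsBasisOn.descOverApp_map {n : ℕ} {M : X.Modules} {W : X.Opens} {e : Fin n → Γ(M, W)}
    (he : IsBasisOn M W e) {F : SheafOfModules.{0} (X.ringCatSheaf.over W)}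
    (t : Fin n → F.sections) {Y Z : (Over W)ᵒᵖ} (f : Y ⟶ Z) (s : Γ(M, Y.unop.left)) :
    he.descOverApp t Z (rs M f.unop.left.le s) = F.val.map f (he.descOverApp t Y s) := by
  have h := map_sum (F.val.map f).hom
    (fun i => sm F Y (he.coord Y.unop.hom.le s i) ((t i).val Y)) Finset.univ
  refine Eq.trans (descOverApp_apply ..) (Eq.trans ?_ h.symm)
  refine Finset.sum_congr rfl fun i _ => ?_
  refine Eq.trans ?_ (sm_map F f _ _).symm
  rw [he.coord_rs Y.unop.hom.le f.unop.left.le]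
  exact congrArg _ ((t i).property f).symm

lemma IsBasisOn.descOverApp_smul {n : ℕ} {M : X.Modules} {W : X.Opens} {e : Fin n → Γ(M, W)}
    (he : IsBasisOn M W e) {F : SheafOfModules.{0} (X.ringCatSheaf.over W)}
    (t : Fin n → F.sections) (Y : (Over W)ᵒᵖ) (r : Γ(X, Y.unop.left)) (s : Γ(M, Y.unop.left)) :
    he.descOverApp t Y (r • s) = sm F Y r (he.descOverApp t Y s) := by
  have h := map_sum (sm F Y r)
    (fun i => sm F Y (he.coord Y.unop.hom.le s i) ((t i).val Y)) Finset.univ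
  refine Eq.trans (descOverApp_apply ..) (Eq.trans ?_ h.symm)
  refine Finset.sum_congr rfl fun i _ => ?_
  rw [map_smul]
  change sm F Y (_ * _) _ = _
  rw [map_mul]
  rfl

/-- The morphism defined on a basis. -/
def IsBasisOn.descOver {n : ℕ} {M : X.Modules} {W : X.Opens} {e : Fin n → Γ(M, W)}
    (he : IsBasisOn M W e) {F : SheafOfModules.{0} (X.ringCatSheaf.over W)}
    (t : Fin n → F.sections) : ov M W ⟶ F where
  val := PresheafOfModules.homMk
    { app := fun Y => AddCommGrpCat.ofHom (he.descOverApp t Y)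
      naturality := fun Y Z f => by
        ext s
        exact he.descOverApp_map t f s }
    (fun Y r m => he.descOverApp_smul t Y r m)

lemma IsBasisOn.coord_basis {n : ℕ} {M : X.Modules} {W : X.Opens} {e : Fin n → Γ(M, W)}
    (he : IsBasisOn M W e) {V : X.Opens} (h : V ≤ W) (i : Fin n) :
    he.coord h (rs M h (e i)) = Pi.single i 1 := by
  have h1 : rs M h (e i) = ∑ k, (Pi.single i 1 : Fin n → Γ(X, V)) k • rs M h (e k) := by
    simp [Pi.single_apply]
  rw [h1, he.coord_sum]

lemma IsBasisOn.descOver_basis {n : ℕ} {M : X.Modules} {W : X.Opens} {e : Fin n → Γ(M, W)}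
    (he : IsBasisOn M W e) {F : SheafOfModules.{0} (X.ringCatSheaf.over W)}
    (t : Fin n → F.sections) (i : Fin n) :
    SheafOfModules.sectionsMap (he.descOver t) (secMk (e i)) = t i := by
  apply Subtype.ext
  funext Y
  change ∑ k, sm F Y (he.coord Y.unop.hom.le (rs M Y.unop.hom.le (e i)) k) ((t k).val Y) =
    (t i).val Y
  rw [he.coord_basis, Finset.sum_eq_single i]
  · have : ((Pi.single i 1 : Fin n → Γ(X, Y.unop.left)) i) = 1 := by simp
    rw [this, map_one]
    rfl
  · intro k _ hk
    have : ((Pi.single i 1 : Fin n → Γ(X, Y.unop.left)) k) = 0 := by simp [hk]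
    rw [this, map_zero]
    rfl
  · simp

lemma IsBasisOn.hom_ext_over {n : ℕ} {M : X.Modules} {W : X.Opens} {e : Fin n → Γ(M, W)}
    (he : IsBasisOn M W e) {F : SheafOfModules.{0} (X.ringCatSheaf.over W)} {φ ψ : ov M W ⟶ F}
    (h : ∀ i, SheafOfModules.sectionsMap φ (secMk (e i)) =
      SheafOfModules.sectionsMap ψ (secMk (e i))) : φ = ψ := by
  apply SheafOfModules.hom_ext
  ext Y s
  have h1 : ∀ i, φ.val.app Y (rs M Y.unop.hom.le (e i)) = ψ.val.app Y (rs M Y.unop.hom.le (e i)) :=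
    fun i => congrFun (congrArg Subtype.val (h i)) Y
  have h2 : (s : Γ(M, Y.unop.left)) = _ := (he.sum_coord Y.unop.hom.le s).symm
  have key : ∀ χ : ov M W ⟶ F, χ.val.app Y s = ∑ i,
      sm F Y (he.coord Y.unop.hom.le s i) (χ.val.app Y (rs M Y.unop.hom.le (e i))) := by
    intro χ
    conv_lhs => rw [h2]
    erw [map_sum]
    refine Finset.sum_congr rfl fun i _ => ?_
    exact sm_app χ Y _ _
  rw [key φ, key ψ]
  simp only [h1]

/-- Sections forming a local basis identify the restriction with a free sheaf. -/
lemma IsBasisOn.isIso_free {n : ℕ} {M : X.Modules} {W : X.Opens} {e : Fin n → Γ(M, W)}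
    (he : IsBasisOn M W e) :
    IsIso ((ov M W).freeHomEquiv.symm (fun i => secMk (e i))) := by
  refine ⟨he.descOver (fun i => SheafOfModules.freeSection i), ?_, ?_⟩
  · apply (SheafOfModules.freeHomEquiv _).injective
    funext i
    rw [SheafOfModules.freeHomEquiv_apply, SheafOfModules.sectionsMap_comp,
      SheafOfModules.sectionsMap_freeHomEquiv_symm_freeSection, he.descOver_basis]
  · refine he.hom_ext_over fun i => ?_
    rw [SheafOfModules.sectionsMap_comp, he.descOver_basis,
      SheafOfModules.sectionsMap_freeHomEquiv_symm_freeSection, SheafOfModules.sectionsMap_id]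

lemma isLocallyFree_of_bases {M : X.Modules}
    (h : ∀ x : X, ∃ (W : X.Opens) (n : ℕ) (e : Fin n → Γ(M, W)), x ∈ W ∧ IsBasisOn M W e) :
    M.IsLocallyFree := by
  choose W n e hx he using h
  have hiso := fun x => (he x).isIso_free
  let q : SheafOfModules.LocalGeneratorsData.{0} M :=
    { I := X
      X := W
      coversTop := (Opens.coversTop_iff _ _).mpr
        (eq_top_iff.mpr fun x _ => TopologicalSpace.Opens.mem_iSup.mpr ⟨x, hx x⟩)
      generators := fun x =>
        { I := Fin (n x)
          s := fun i => secMk (e x i)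
          epi := by
            have := hiso x
            infer_instance } }
  have : q.IsLocallyFreeData := ⟨fun x => hiso x⟩
  exact q.isLocallyFree

end LocallyFree


/-! ### Bases of stalks and fibres -/

section StalkBasis

variable {X : Scheme.{0}}

lemma exists_gr_family {n : ℕ} {x : X} (c : Fin n → X.presheaf.stalk x) (W : X.Opens) (hx : x ∈ W) :
    ∃ (V : X.Opens) (_ : V ≤ W) (hxV : x ∈ V) (a : Fin n → Γ(X, V)), ∀ i, gr X hxV (a i) = c i := by
  choose U hU a ha using fun i => exists_gr (c i)
  have hxV : x ∈ W ⊓ Finset.univ.inf U := by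
    refine ⟨hx, ?_⟩
    have : ∀ s : Finset (Fin n), x ∈ s.inf U := by
      intro s
      induction s using Finset.cons_induction with
      | empty => exact trivial
      | cons i s _ ih => rw [Finset.inf_cons]; exact ⟨hU i, ih⟩
    exact this _
  refine ⟨_, inf_le_left, hxV, fun i => rr X (inf_le_right.trans (Finset.inf_le (Finset.mem_univ i)))
    (a i), fun i => ?_⟩
  rw [gr_rr, ha]

/-- The germs of a local basis form a basis of the stalk. -/
def IsBasisOn.stalkBasis {n : ℕ} {M : X.Modules} {W : X.Opens} {e : Fin n → Γ(M, W)}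
    (he : IsBasisOn M W e) {x : X} (hx : x ∈ W) :
    Module.Basis (Fin n) (X.presheaf.stalk x) (M.presheaf.stalk x) :=
  Module.Basis.mk (v := fun i => gm M hx (e i))
    (by
      rw [Fintype.linearIndependent_iff]
      intro c hc
      obtain ⟨V, hV, hxV, a, ha⟩ := exists_gr_family c W hx
      have h1 : gm M hxV (∑ i, a i • rs M hV (e i)) = 0 := by
        rw [map_sum, ← hc]
        refine Finset.sum_congr rfl fun i _ => ?_
        rw [gm_smul, ha, gm_rs]
      obtain ⟨V', h', hxV', h2⟩ := (gm_eq_zero_iff M hxV _).mp h1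
      rw [rs_sum_smul] at h2
      simp only [rs_rs] at h2
      have h3 := he.coord_sum (h'.trans hV) (fun i => rr X h' (a i))
      rw [h2, map_zero] at h3
      intro i
      rw [← ha i, ← gr_rr h' hxV', ← congrFun h3 i]
      simp)
    (by
      rintro m -
      obtain ⟨U, hU, s, rfl⟩ := exists_gm M m
      have hxV : x ∈ U ⊓ W := ⟨hU, hx⟩
      rw [← gm_rs M (inf_le_left : U ⊓ W ≤ U) hxV, ← he.sum_coord inf_le_right (rs M _ s), map_sum]
      refine Submodule.sum_mem _ fun i _ => ?_
      rw [gm_smul, gm_rs]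
      exact Submodule.smul_mem _ _ (Submodule.subset_span ⟨i, rfl⟩))

lemma IsBasisOn.stalkBasis_apply {n : ℕ} {M : X.Modules} {W : X.Opens} {e : Fin n → Γ(M, W)}
    (he : IsBasisOn M W e) {x : X} (hx : x ∈ W) (i : Fin n) :
    he.stalkBasis hx i = gm M hx (e i) := by
  rw [stalkBasis, Module.Basis.mk_apply]

/-- The values of a local basis form a basis of the fibre. -/
def IsBasisOn.fiberBasis {n : ℕ} {M : X.Modules} {W : X.Opens} {e : Fin n → Γ(M, W)}
    (he : IsBasisOn M W e) {x : X} (hx : x ∈ W) :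
    Module.Basis (Fin n) (X.residueField x) (Fiber M x) :=
  (he.stalkBasis hx).baseChange (X.residueField x)

lemma IsBasisOn.fiberBasis_apply {n : ℕ} {M : X.Modules} {W : X.Opens} {e : Fin n → Γ(M, W)}
    (he : IsBasisOn M W e) {x : X} (hx : x ∈ W) (i : Fin n) :
    he.fiberBasis hx i = value M W x hx (e i) := by
  rw [fiberBasis, Module.Basis.baseChange_apply, stalkBasis_apply]
  rfl

lemma IsBasisOn.fiberDim_eq {n : ℕ} {M : X.Modules} {W : X.Opens} {e : Fin n → Γ(M, W)}
    (he : IsBasisOn M W e) {x : X} (hx : x ∈ W) : fiberDim M x = n := by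
  rw [fiberDim, Module.finrank_eq_card_basis (he.fiberBasis hx), Fintype.card_fin]

end StalkBasis

/-! ### Coherent locally free modules have finite local bases -/

section Converse

variable {X : Scheme.{0}}

lemma apo_rs {W : X.Opens} {M N : X.Modules} (φ : ov M W ⟶ ov N W) {V V' : X.Opens} (h : V ≤ W)
    (h' : V' ≤ V) (s : Γ(M, V)) : apo φ (h'.trans h) (rs M h' s) = rs N h' (apo φ h s) :=
  PresheafOfModules.naturality_apply φ.val (X := ob h) (Y := ob (h'.trans h))
    (Over.homMk (U := Over.mk (homOfLE (h'.trans h))) (V := Over.mk (homOfLE h)) (homOfLE h')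
      (Subsingleton.elim _ _)).op s

lemma apo_secVal {W : X.Opens} {M N : X.Modules} (φ : ov M W ⟶ ov N W) (s : (ov M W).sections) :
    apo φ le_rfl (secVal s) = secVal (SheafOfModules.sectionsMap φ s) := rfl

lemma secVal_secMk {W : X.Opens} {M : X.Modules} (s : Γ(M, W)) : secVal (secMk s) = s :=
  rs_self M _ s

lemma apo_bijective {W : X.Opens} {M N : X.Modules} (φ : ov M W ⟶ ov N W) [IsIso φ] {V : X.Opens}
    (h : V ≤ W) : Function.Bijective (apo φ h) := by
  refine Function.bijective_iff_has_inverse.mpr ⟨apo (inv φ) h, fun s => ?_, fun s => ?_⟩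
  · change apo (φ ≫ inv φ) h s = s
    rw [IsIso.hom_inv_id]
    rfl
  · change apo (inv φ ≫ φ) h s = s
    rw [IsIso.inv_hom_id]
    rfl

lemma sectionsMap_inv_free {J : Type} {W : X.Opens} {F G : SheafOfModules.{0} (X.ringCatSheaf.over W)}
    (s : J → F.sections) [IsIso (F.freeHomEquiv.symm s)] (t : J → G.sections) (k : J) :
    SheafOfModules.sectionsMap (inv (F.freeHomEquiv.symm s) ≫ G.freeHomEquiv.symm t) (s k) = t k := by
  have h1 : s k = SheafOfModules.sectionsMap (F.freeHomEquiv.symm s)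
      (SheafOfModules.freeSection k) :=
    (SheafOfModules.sectionsMap_freeHomEquiv_symm_freeSection _ _).symm
  conv_lhs => rw [h1]
  rw [← SheafOfModules.sectionsMap_comp, IsIso.hom_inv_id_assoc,
        SheafOfModules.sectionsMap_freeHomEquiv_symm_freeSection]

lemma free_hom_ext {J : Type} {W : X.Opens} {F G : SheafOfModules.{0} (X.ringCatSheaf.over W)}
    (s : J → F.sections) [IsIso (F.freeHomEquiv.symm s)] {φ ψ : F ⟶ G}
    (h : ∀ k, SheafOfModules.sectionsMap φ (s k) = SheafOfModules.sectionsMap ψ (s k)) : φ = ψ := by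
  rw [← cancel_epi (F.freeHomEquiv.symm s), SheafOfModules.freeHomEquiv_symm_comp,
    SheafOfModules.freeHomEquiv_symm_comp]
  simp only [h]

/-- Sections that identify the restriction with a free sheaf form a local basis. -/
lemma isBasisOn_of_isIso {n : ℕ} {J : Type} (σ : J ≃ Fin n) {M : X.Modules} {W : X.Opens}
    (s : J → (ov M W).sections) [IsIso ((ov M W).freeHomEquiv.symm s)] :
    IsBasisOn M W (fun i => secVal (s (σ.symm i))) := by
  have hP : IsBasisOn (freeModule X n) W (freeBasis X n W) := isBasisOn_freeBasis n W
  have h3 : IsIso (hP.descOver fun i => s (σ.symm i)) := by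
    refine ⟨inv ((ov M W).freeHomEquiv.symm s) ≫ (ov (freeModule X n) W).freeHomEquiv.symm
      (fun k => secMk (freeBasis X n W (σ k))), hP.hom_ext_over fun i => ?_,
      free_hom_ext s fun k => ?_⟩
    · rw [SheafOfModules.sectionsMap_comp, hP.descOver_basis, sectionsMap_inv_free,
        Equiv.apply_symm_apply, SheafOfModules.sectionsMap_id]
    · rw [SheafOfModules.sectionsMap_comp, sectionsMap_inv_free, hP.descOver_basis,
        Equiv.symm_apply_apply, SheafOfModules.sectionsMap_id]
  intro V hV
  have h4 := (apo_bijective (hP.descOver fun i => s (σ.symm i)) hV).comp (hP V hV)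
  convert h4 using 1
  funext a
  simp only [Function.comp]
  rw [map_sum]
  refine Finset.sum_congr rfl fun i _ => ?_
  rw [map_smul, apo_rs _ le_rfl hV]
  congr 2
  rw [← secVal_secMk (M := freeModule X n) (freeBasis X n W i), apo_secVal, hP.descOver_basis]

/-- Local freeness alone allows infinite rank. Over a nonempty affine open the free generators stay
linearly independent in a finite module over a nontrivial ring, so there are finitely many. -/
lemma finite_of_isIso_free {M : X.Modules} (hc : IsCoherent M) {J : Type} {W : X.Opens} {x : X}
    (hx : x ∈ W) (s : J → (ov M W).sections) [IsIso ((ov M W).freeHomEquiv.symm s)] :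
    Finite J := by
  obtain ⟨V, hV, hxV, hVW⟩ :=
    TopologicalSpace.Opens.isBasis_iff_nbhd.mp X.isBasis_affineOpens hx
  classical
  -- The coordinate functionals of the free generators; applied to a linear relation, `c k` isolates
  -- the coefficient of index `k`.
  let c : J → (ov M W ⟶ ov (freeModule X 1) W) := fun k => inv ((ov M W).freeHomEquiv.symm s) ≫
    (ov (freeModule X 1) W).freeHomEquiv.symm
      (fun k' => secMk (if k' = k then freeBasis X 1 W 0 else 0))
  have hcs : ∀ k k', apo (c k) hVW (rs M hVW (secVal (s k'))) =
      if k' = k then freeBasis X 1 V 0 else 0 := by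
    intro k k'
    rw [apo_rs (c k) le_rfl hVW, apo_secVal, sectionsMap_inv_free, secVal_secMk]
    split_ifs
    · exact rs_freeBasis 1 hVW 0
    · exact map_zero _
  have hlin : LinearIndependent Γ(X, V) (fun k => rs M hVW (secVal (s k))) := by
    rw [linearIndependent_iff']
    intro t g hg k hk
    have h1 := congrArg (apo (c k) hVW) hg
    rw [map_sum, map_zero] at h1
    simp only [map_smul, hcs, smul_ite, smul_zero] at h1
    rw [Finset.sum_ite_eq' t k, if_pos hk] at h1
    have h2 : g k * 1 = 0 :=
      congrFun (show (g k • (Pi.single 0 1 : Fin 1 → Γ(X, V))) = 0 from h1) 0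
    rwa [mul_one] at h2
  have : Nonempty V := ⟨⟨x, hxV⟩⟩
  have : Nontrivial Γ(X, V) := inferInstance
  have := hc.finite V hV
  exact hlin.finite

lemma exists_basis {M : X.Modules} (hM : M.IsLocallyFree) (hc : IsCoherent M) {r : ℕ}
    (hr : ∀ x, fiberDim M x = r) (x : X) :
    ∃ (W : X.Opens) (e : Fin r → Γ(M, W)), x ∈ W ∧ IsBasisOn M W e := by
  obtain ⟨q, hq⟩ := hM.exists_isLocallyFreeData
  obtain ⟨i, hi⟩ : ∃ i, x ∈ q.X i := by
    have := (Opens.coversTop_iff _ _).mp q.coversTop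
    exact TopologicalSpace.Opens.mem_iSup.mp (this ▸ trivial : x ∈ iSup q.X)
  have hiso := hq.isIso i
  have := finite_of_isIso_free hc hi (q.generators i).s
  obtain ⟨n, ⟨σ⟩⟩ := Finite.exists_equiv_fin (q.generators i).I
  have hb := isBasisOn_of_isIso σ (q.generators i).s
  have hn : n = r := (hb.fiberDim_eq hi).symm.trans (hr x)
  subst hn
  exact ⟨_, _, hi, hb⟩

end Converse


/-! ### Sections of quasi-coherent modules over basic opens -/

section Quasicoherent

variable {X : Scheme.{0}}

lemma fromSpec_appIso {W : X.Opens} (hW : IsAffineOpen W) (f : Γ(X, W))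
    (V : (Spec Γ(X, W)).Opens) (hV : hW.fromSpec ''ᵁ V ≤ W) :
    (hW.fromSpec.appIso V).inv ((Spec Γ(X, W)).presheaf.map V.leTop.op
      ((Scheme.ΓSpecIso Γ(X, W)).inv f)) = rr X hV f := by
  have h : (hW.fromSpec.appIso V).hom (rr X hV f) =
      (Spec Γ(X, W)).presheaf.map V.leTop.op ((Scheme.ΓSpecIso Γ(X, W)).inv f) := by
    rw [Scheme.Hom.appIso_hom']
    have h1 := hW.fromSpec.map_appLE (U := hW.fromSpec ''ᵁ V) (V := V)
      (by rw [Scheme.Hom.preimage_image_eq]) (homOfLE hV).op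
    have h2 := ConcreteCategory.congr_hom h1 f
    refine h2.trans ?_
    rw [Scheme.Hom.appLE, hW.fromSpec_app_self]
    simp only [← ConcreteCategory.comp_apply, Category.assoc, ← Functor.map_comp]
    rfl
  rw [← h, ← ConcreteCategory.comp_apply, Iso.hom_inv_id]
  rfl

lemma exists_pow_smul_eq_zero_Spec {R : CommRingCat.{0}} (N : (Spec R).Modules)
    (hN : N.IsQuasicoherent) (f : R) {D : (Spec R).Opens} (hD : D = PrimeSpectrum.basicOpen f)
    (s : Γ(N, ⊤)) (hs : rs N (le_top : D ≤ ⊤) s = 0) : ∃ n : ℕ, f ^ n • s = 0 := by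
  subst hD
  have hl := (isIso_fromTildeΓ_iff_isLocalizing _).mp
    ((isQuasicoherent_iff_isIso_fromTildeΓ N).mp hN) f
  obtain ⟨⟨_, n, rfl⟩, h1⟩ := hl.exists_of_eq (x₁ := s) (x₂ := 0) (hs.trans (map_zero _).symm)
  exact ⟨n, h1.trans (smul_zero _)⟩

lemma exists_rs_eq_pow_smul_Spec {R : CommRingCat.{0}} (N : (Spec R).Modules)
    (hN : N.IsQuasicoherent) (f : R) {D : (Spec R).Opens} (hD : D = PrimeSpectrum.basicOpen f)
    (t : Γ(N, D)) : ∃ (n : ℕ) (s : Γ(N, ⊤)), rs N (le_top : D ≤ ⊤) s = f ^ n • t := by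
  subst hD
  have hl := (isIso_fromTildeΓ_iff_isLocalizing _).mp
    ((isQuasicoherent_iff_isIso_fromTildeΓ N).mp hN) f
  obtain ⟨⟨s, ⟨_, n, rfl⟩⟩, h1⟩ := hl.surj t
  exact ⟨n, s, h1.symm⟩

lemma smul_restrict_fromSpec {M : X.Modules} {W : X.Opens}
    (hW : IsAffineOpen W) (f : Γ(X, W)) {V : (Spec Γ(X, W)).Opens} (hV : hW.fromSpec ''ᵁ V ≤ W)
    (s : Γ(M, hW.fromSpec ''ᵁ V)) :
    f • (toR hW.fromSpec M V s) = toR hW.fromSpec M V (rr X hV f • s) := by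
  rw [← fromSpec_appIso hW f V hV]
  rfl

/-- Transport to the spectrum of `Γ(X, W)`, where the sections over a basic open are a localization
of the global ones. -/
lemma exists_pow_smul_eq_zero {M : X.Modules} (hM : M.IsQuasicoherent) {W : X.Opens}
    (hW : IsAffineOpen W) (f : Γ(X, W)) (s : Γ(M, W)) (hs : rs M (X.basicOpen_le f) s = 0) :
    ∃ n : ℕ, f ^ n • s = 0 := by
  have e1 : hW.fromSpec ''ᵁ ⊤ = W := by simp
  obtain ⟨D, hD⟩ : ∃ D : (Spec Γ(X, W)).Opens, D = PrimeSpectrum.basicOpen f := ⟨_, rfl⟩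
  have e2 : hW.fromSpec ''ᵁ D = X.basicOpen f := hD ▸ hW.fromSpec_image_basicOpen f
  have h0 : rs (M.restrict hW.fromSpec) (le_top : D ≤ ⊤)
      (toR hW.fromSpec M ⊤ (rs M e1.le s)) = 0 := by
    rw [rs_toR, rs_rs, ← rs_rs M (X.basicOpen_le f) e2.le, hs, map_zero, map_zero]
  obtain ⟨n, h1⟩ := exists_pow_smul_eq_zero_Spec _ inferInstance f hD _ h0
  refine ⟨n, ?_⟩
  rw [smul_restrict_fromSpec hW _ e1.le, ← rs_smul] at h1
  have h3 : rs M e1.le (f ^ n • s) = 0 := h1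
  have h4 := congrArg (rs M e1.ge) h3
  rwa [rs_rs, rs_self, map_zero] at h4

lemma exists_rs_eq_pow_smul {M : X.Modules} (hM : M.IsQuasicoherent) {W : X.Opens}
    (hW : IsAffineOpen W) (f : Γ(X, W)) (t : Γ(M, X.basicOpen f)) :
    ∃ (n : ℕ) (s : Γ(M, W)), rs M (X.basicOpen_le f) s = rr X (X.basicOpen_le f) f ^ n • t := by
  have e1 : hW.fromSpec ''ᵁ ⊤ = W := by simp
  obtain ⟨D, hD⟩ : ∃ D : (Spec Γ(X, W)).Opens, D = PrimeSpectrum.basicOpen f := ⟨_, rfl⟩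
  have e2 : hW.fromSpec ''ᵁ D = X.basicOpen f := hD ▸ hW.fromSpec_image_basicOpen f
  obtain ⟨n, s', h2⟩ := exists_rs_eq_pow_smul_Spec (M.restrict hW.fromSpec) inferInstance f hD
    (toR hW.fromSpec M D (rs M e2.le t))
  obtain ⟨s, rfl⟩ : ∃ s, s' = toR hW.fromSpec M ⊤ (rs M e1.le s) :=
    ⟨rs M e1.ge ((toR hW.fromSpec M ⊤).symm s'), by simp [rs_rs, rs_self]⟩
  refine ⟨n, s, ?_⟩
  rw [rs_toR, rs_rs, smul_restrict_fromSpec hW _ (e2.le.trans (X.basicOpen_le f))] at h2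
  have h4 := congrArg (rs M e2.ge) ((toR hW.fromSpec M _).injective h2)
  rwa [rs_rs, rs_smul, rs_rs, rs_self, rr_rr, map_pow] at h4

end Quasicoherent


/-! ### Coherence of modules with local bases -/

section Coherent

variable {X : Scheme.{0}}

lemma exists_rr_eq_pow_mul {W : X.Opens} (hW : IsAffineOpen W) (f : Γ(X, W))
    (a : Γ(X, X.basicOpen f)) :
    ∃ (n : ℕ) (b : Γ(X, W)), rr X (X.basicOpen_le f) b = rr X (X.basicOpen_le f) f ^ n * a := by
  have := hW.isLocalization_basicOpen f
  obtain ⟨n, b, h⟩ := IsLocalization.Away.surj f a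
  refine ⟨n, b, ?_⟩
  rw [mul_comm]
  exact h.symm

/-- Finitely many basic opens `D(f)` carrying bases cover `W`. After multiplication by powers of
`f`, the basis elements extend to sections over `W`, and these extensions generate because
membership in a submodule may be tested up to powers of functions generating the unit ideal. -/
lemma finite_sections_of_bases {M : X.Modules} (hM : M.IsQuasicoherent)
    (h : ∀ x : X, ∃ (W : X.Opens) (n : ℕ) (e : Fin n → Γ(M, W)), x ∈ W ∧ IsBasisOn M W e)
    (W : X.Opens) (hW : IsAffineOpen W) : Module.Finite Γ(X, W) Γ(M, W) := by
  let S : Set Γ(X, W) := {f | ∃ (n : ℕ) (e : Fin n → Γ(M, X.basicOpen f)),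
    IsBasisOn M (X.basicOpen f) e}
  have hS : Ideal.span S = ⊤ := by
    rw [← IsAffineOpen.iSup_basicOpen_eq_self_iff hW]
    refine le_antisymm (iSup_le fun f => X.basicOpen_le f.1) fun x hx => ?_
    obtain ⟨V, n, e, hxV, he⟩ := h x
    obtain ⟨f, hf, hxf⟩ := hW.exists_basicOpen_le ⟨x, hxV⟩ hx
    exact TopologicalSpace.Opens.mem_iSup.mpr ⟨⟨f, n, _, he.res hf⟩, hxf⟩
  obtain ⟨T, hTS, hT⟩ := (Ideal.span_eq_top_iff_finite S).mp hS
  choose n e he using fun f : T => hTS f.2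
  choose N s hs using fun (f : T) (i : Fin (n f)) => exists_rs_eq_pow_smul hM hW f.1 (e f i)
  refine ⟨Submodule.fg_def.mpr ⟨Set.range (fun p : Σ f : T, Fin (n f) => s p.1 p.2),
    Set.finite_range _, eq_top_iff.mpr fun m _ => ?_⟩⟩
  refine Submodule.mem_of_span_eq_top_of_smul_pow_mem _ (T : Set Γ(X, W)) hT m fun f => ?_
  let f' : T := ⟨f.1, f.2⟩
  let ρ := X.basicOpen_le f.1
  have hu : IsUnit (rr X ρ f.1) := RingedSpace.isUnit_res_basicOpen _ f.1
  -- The section `s f' i` restricts to `f ^ N` times the basis element, so the coordinates are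
  -- divided by `f ^ N` before their own denominators are cleared.
  choose k b hb using fun i => exists_rr_eq_pow_mul hW f.1
    ((he f').coord le_rfl (rs M ρ m) i * ((hu.pow (N f' i)).unit⁻¹ : _))
  let K := Finset.univ.sup k
  have hk : ∀ i, k i ≤ K := fun i => Finset.le_sup (Finset.mem_univ i)
  have h1 : rs M ρ (f.1 ^ K • m) =
      rs M ρ (∑ i, (f.1 ^ (K - k i) * b i) • s f' i) := by
    rw [rs_smul, map_sum]
    conv_lhs => rw [← (he f').sum_coord le_rfl (rs M ρ m)]
    rw [Finset.smul_sum]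
    refine Finset.sum_congr rfl fun i _ => ?_
    have hs' : rs M ρ (s f' i) = rr X ρ f.1 ^ N f' i • e f' i := hs f' i
    rw [rs_smul, map_mul, hb, hs', rs_self, smul_smul, smul_smul, map_pow, map_pow]
    congr 1
    have h3 : ((hu.pow (N f' i)).unit⁻¹ : Γ(X, X.basicOpen f.1)ˣ).1 * rr X ρ f.1 ^ N f' i = 1 :=
      (hu.pow (N f' i)).val_inv_mul
    have h4 : rr X ρ f.1 ^ (K - k i) * rr X ρ f.1 ^ k i = rr X ρ f.1 ^ K := by
      rw [← pow_add, Nat.sub_add_cancel (hk i)]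
    linear_combination (rr X ρ f.1 ^ (K - k i) * rr X ρ f.1 ^ k i *
      (he f').coord le_rfl (rs M ρ m) i) * (-h3) - (he f').coord le_rfl (rs M ρ m) i * h4
  -- The equality holds over `D(f)`; over `W` it holds after multiplication by a further power of
  -- `f`.
  rw [← sub_eq_zero, ← map_sub] at h1
  obtain ⟨l, hl⟩ := exists_pow_smul_eq_zero hM hW f.1 _ h1
  refine ⟨l + K, ?_⟩
  rw [smul_sub, sub_eq_zero, smul_smul, ← pow_add] at hl
  rw [hl]
  exact Submodule.smul_mem _ _ (Submodule.sum_mem _ fun i _ => Submodule.smul_mem _ _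
    (Submodule.subset_span ⟨⟨f', i⟩, rfl⟩))

lemma isQuasicoherent_of_isLocallyFree {M : X.Modules} (h : M.IsLocallyFree) :
    M.IsQuasicoherent := by
  have := h.exists_isLocallyFreeData.choose_spec
  exact h.exists_isLocallyFreeData.choose.quasiCoherentData.isQuasicoherent

lemma isCoherent_of_bases {M : X.Modules}
    (h : ∀ x : X, ∃ (W : X.Opens) (n : ℕ) (e : Fin n → Γ(M, W)), x ∈ W ∧ IsBasisOn M W e) :
    IsCoherent M :=
  have hq := isQuasicoherent_of_isLocallyFree (isLocallyFree_of_bases h)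
  ⟨hq, finite_sections_of_bases hq h⟩

end Coherent


/-! ### Local rings étale over a principal ideal domain -/

section LocalAlgebra

/-- By Krull's intersection theorem a nonzero element lies in only finitely many powers of the
maximal ideal. The cofactor of the largest such power of `π` is a unit. -/
lemma exists_eq_pow_mul_unit {L : Type*} [CommRing L] [IsLocalRing L] [IsNoetherianRing L] {π : L}
    (hπ : IsLocalRing.maximalIdeal L = Ideal.span {π}) {a : L} (ha : a ≠ 0) :
    ∃ (n : ℕ) (u : Lˣ), a = π ^ n * u := by
  have h1 : ∃ n : ℕ, a ∉ Ideal.span {π ^ n} := by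
    by_contra! h
    have h2 : a ∈ ⨅ n : ℕ, IsLocalRing.maximalIdeal L ^ n := by
      rw [Ideal.mem_iInf]
      intro n
      rw [hπ, Ideal.span_singleton_pow]
      exact h n
    rw [Ideal.iInf_pow_eq_bot_of_isLocalRing _ (IsLocalRing.maximalIdeal.isMaximal L).ne_top] at h2
    exact ha h2
  classical
  have h0 : Nat.find h1 ≠ 0 := by
    intro h
    have := Nat.find_spec h1
    rw [h] at this
    simp at this
  obtain ⟨n, hn⟩ := Nat.exists_eq_succ_of_ne_zero h0
  have h3 : a ∈ Ideal.span {π ^ n} := not_not.mp (Nat.find_min h1 (by omega))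
  obtain ⟨b, rfl⟩ := Ideal.mem_span_singleton.mp h3
  have hb : IsUnit b := by
    by_contra hb
    have hb : b ∈ IsLocalRing.maximalIdeal L := hb
    rw [hπ] at hb
    obtain ⟨c, rfl⟩ := Ideal.mem_span_singleton.mp hb
    have := Nat.find_spec h1
    rw [hn] at this
    exact this (Ideal.mem_span_singleton.mpr ⟨c, by rw [pow_succ]; ring⟩)
  exact ⟨n, hb.unit, rfl⟩

lemma isDomain_of_maximalIdeal_eq_span {L : Type*} [CommRing L] [IsLocalRing L] [IsNoetherianRing L]
    {π : L} (hπ : IsLocalRing.maximalIdeal L = Ideal.span {π}) (h0 : π = 0 ∨ IsSMulRegular L π) :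
    IsDomain L := by
  rcases h0 with rfl | h0
  · have : IsField L := by
      rw [IsLocalRing.isField_iff_maximalIdeal_eq, hπ]
      simp
    exact this.isDomain
  · have : NoZeroDivisors L := by
      refine ⟨fun {a b} h => ?_⟩
      by_contra! hab
      obtain ⟨n, u, rfl⟩ := exists_eq_pow_mul_unit hπ hab.1
      obtain ⟨m, v, rfl⟩ := exists_eq_pow_mul_unit hπ hab.2
      have h1 : π ^ (n + m) • ((u * v : Lˣ) : L) = π ^ (n + m) • 0 := by
        rw [smul_zero, ← h, smul_eq_mul]
        push_cast
        ring
      exact (u * v).ne_zero (h0.pow (n + m) h1)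
    exact NoZeroDivisors.to_isDomain L

/-- A local ring of a curve that is étale over the affine line. -/
lemma exists_maximalIdeal_eq_span {R B : Type*} [CommRing R] [IsDomain R] [IsPrincipalIdealRing R]
    [CommRing B] [Algebra R B] [Algebra.Etale R B] (q : Ideal B) [q.IsPrime] :
    ∃ π : Localization.AtPrime q, IsLocalRing.maximalIdeal (Localization.AtPrime q) = Ideal.span {π} ∧
      ((π = 0 ∧ q.under R = ⊥) ∨ (π ≠ 0 ∧ IsSMulRegular (Localization.AtPrime q) π)) := by
  let p := q.under R
  let := Localization.AtPrime.algebraOfLiesOver p q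
  -- Unramifiedness: the prime `p` below `q` generates the maximal ideal of the localization at `q`,
  -- so the image of a generator of `p` does too.
  have h1 := ((Algebra.isUnramifiedAt_iff_map_eq R p q).mp inferInstance).2
  obtain ⟨t, ht⟩ := (IsPrincipalIdealRing.principal p).principal
  have ht' : p = Ideal.span {t} := ht
  refine ⟨algebraMap R _ t, by rw [← h1, ht', Ideal.map_span, Set.image_singleton], ?_⟩
  by_cases h0 : t = 0
  · left
    subst h0
    exact ⟨map_zero _, by rw [show q.under R = p from rfl, ht']; simp⟩
  · right
    -- Flatness keeps the nonzero element `t` of the domain `R` regular in the localization.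
    have : Module.Flat R (Localization.AtPrime q) := Module.Flat.trans R B _
    have h2 : IsSMulRegular (Localization.AtPrime q) (algebraMap R (Localization.AtPrime q) t) := by
      intro a b hab
      have h3 : IsSMulRegular (Localization.AtPrime q) t :=
        Module.Flat.isSMulRegular_of_nonZeroDivisors (mem_nonZeroDivisors_of_ne_zero h0)
      apply h3
      simpa [Algebra.smul_def] using hab
    refine ⟨fun h => ?_, h2⟩
    rw [h] at h2
    exact one_ne_zero (h2 (a₁ := 1) (a₂ := 0) (by simp))

/-- Nullstellensatz for Jacobson rings: `B ⧸ q` is finite over `R`, and maximal ideals contract to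
maximal ideals along integral extensions. -/
lemma under_isMaximal {R B : Type*} [CommRing R] [IsJacobsonRing R] [CommRing B] [Algebra R B]
    [Algebra.FiniteType R B] (q : Ideal B) [hq : q.IsMaximal] : (q.under R).IsMaximal := by
  let := Ideal.Quotient.field q
  have := finite_of_finite_type_of_isJacobsonRing R (B ⧸ q)
  have h := Ideal.isMaximal_comap_of_isIntegral_of_isMaximal (R := R) (S := B ⧸ q) ⊥
  have h2 : Ideal.comap (algebraMap R (B ⧸ q)) ⊥ = q.under R := by
    ext x
    rw [Ideal.mem_comap, Ideal.mem_bot, IsScalarTower.algebraMap_apply R B (B ⧸ q),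
      Ideal.Quotient.algebraMap_eq, Ideal.Quotient.eq_zero_iff_mem]
    rfl
  rwa [h2] at h

lemma isPrincipalIdealRing_mvPolynomial : IsPrincipalIdealRing (MvPolynomial (Fin 1) ℂ) :=
  IsPrincipalIdealRing.of_surjective (MvPolynomial.uniqueAlgEquiv ℂ (Fin 1)).symm.toRingHom
    (MvPolynomial.uniqueAlgEquiv ℂ (Fin 1)).symm.surjective

lemma not_isField_mvPolynomial : ¬ IsField (MvPolynomial (Fin 1) ℂ) := fun h =>
  Polynomial.not_isField ℂ
    ((MvPolynomial.uniqueAlgEquiv ℂ (Fin 1)).symm.toMulEquiv.isField h)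

end LocalAlgebra

/-- The preimage of the closed point under the open embedding `fromSpec` is a single closed point of
the spectrum. -/
lemma isMaximal_primeIdealOf {X : Scheme.{0}} {V : X.Opens} (hV : IsAffineOpen V) {x : X}
    (hx : x ∈ V) (hcl : IsClosed {x}) : (hV.primeIdealOf ⟨x, hx⟩).asIdeal.IsMaximal := by
  rw [← PrimeSpectrum.isClosed_singleton_iff_isMaximal]
  have h1 := hcl.preimage hV.fromSpec.continuous
  have h2 : ∀ y : Spec Γ(X, V), y ∈ hV.fromSpec ⁻¹' {x} ↔ y = hV.primeIdealOf ⟨x, hx⟩ := by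
    intro y
    rw [Set.mem_preimage, Set.mem_singleton_iff]
    have h3 : hV.fromSpec (hV.primeIdealOf ⟨x, hx⟩) = x := hV.fromSpec_primeIdealOf ⟨x, hx⟩
    conv_lhs => rw [← h3]
    exact hV.fromSpec.isOpenEmbedding.injective.eq_iff
  exact (show hV.fromSpec ⁻¹' {x} = {hV.primeIdealOf ⟨x, hx⟩} from Set.ext h2) ▸ h1

/-! ### Local rings of smooth curves -/

section SmoothCurve

variable {X : Scheme.{0}} (s : X ⟶ Spec (.of ℂ)) [SmoothOfRelativeDimension 1 s]

lemma exists_standardSmooth (x : X) : ∃ (V : X.Opens) (_ : IsAffineOpen V), x ∈ V ∧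
    (scalars s V).IsStandardSmoothOfRelativeDimension 1 := by
  obtain ⟨U, hU, V, hV, hx, e, h⟩ :=
    SmoothOfRelativeDimension.exists_isStandardSmoothOfRelativeDimension (n := 1) (f := s) x
  have hU : U = ⊤ := by
    rw [eq_top_iff]
    intro y _
    rw [Subsingleton.elim y (s x)]
    exact e hx
  subst hU
  refine ⟨V, hV, hx, ?_⟩
  exact h.comp (RingHom.IsStandardSmoothOfRelativeDimension.equiv
    (Scheme.ΓSpecIso (.of ℂ)).symm.commRingCatIsoToRingEquiv)

include s in
lemma isLocallyNoetherian_of_smooth : IsLocallyNoetherian X :=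
  have := SmoothOfRelativeDimension.smooth (n := 1) (f := s)
  LocallyOfFiniteType.isLocallyNoetherian s

-- Locally the curve is étale over the affine line, so each local ring has a principal maximal ideal
-- whose generator is 0 or regular. Being Noetherian, it is then a principal ideal domain.
include s in
lemma stalk_of_smooth (x : X) : IsDomain (X.presheaf.stalk x) ∧
    IsPrincipalIdealRing (X.presheaf.stalk x) ∧ (IsClosed {x} → ¬ IsField (X.presheaf.stalk x)) := by
  have := isLocallyNoetherian_of_smooth s
  obtain ⟨V, hV, hx, h⟩ := exists_standardSmooth s x
  obtain ⟨g, -, hg⟩ := h.exists_etale_mvPolynomial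
  algebraize [g]
  have := isPrincipalIdealRing_mvPolynomial
  let q := (hV.primeIdealOf ⟨x, hx⟩).asIdeal
  let := X.presheaf.algebra_section_stalk ⟨x, hx⟩
  have hloc : IsLocalization.AtPrime (X.presheaf.stalk x) q := hV.isLocalization_stalk ⟨x, hx⟩
  let e : Localization.AtPrime q ≃ₐ[Γ(X, V)] X.presheaf.stalk x :=
    IsLocalization.algEquiv q.primeCompl _ _
  have : IsNoetherianRing (Localization.AtPrime q) := isNoetherianRing_of_ringEquiv _ e.symm.toRingEquiv
  obtain ⟨π, hπ, h0⟩ := exists_maximalIdeal_eq_span (R := MvPolynomial (Fin 1) ℂ) q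
  have hdom : IsDomain (Localization.AtPrime q) :=
    isDomain_of_maximalIdeal_eq_span hπ (h0.imp And.left And.right)
  have hpir : IsPrincipalIdealRing (Localization.AtPrime q) :=
    ((tfae_of_isNoetherianRing_of_isLocalRing_of_isDomain (Localization.AtPrime q)).out 4 0).mp
      (show (IsLocalRing.maximalIdeal _).IsPrincipal from ⟨⟨π, hπ⟩⟩)
  refine ⟨e.symm.toMulEquiv.isDomain _, IsPrincipalIdealRing.of_surjective e.toRingHom e.surjective,
    fun hcl hf => ?_⟩
  have hq : q.IsMaximal := isMaximal_primeIdealOf hV hx hcl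
  have hp : (q.under (MvPolynomial (Fin 1) ℂ)).IsMaximal := under_isMaximal q
  -- At a closed point the contracted prime is maximal in `ℂ[x]`, hence nonzero since `ℂ[x]` is not
  -- a field.
  rcases h0 with ⟨-, h0⟩ | ⟨h0, -⟩
  · rw [h0] at hp
    exact not_isField_mvPolynomial (Ring.isField_iff_maximal_bot.mpr hp)
  · have h1 : IsField (Localization.AtPrime q) := e.toMulEquiv.isField hf
    rw [IsLocalRing.isField_iff_maximalIdeal_eq, hπ, Ideal.span_singleton_eq_bot] at h1
    exact h0 h1

end SmoothCurve


/-! ### Spreading out a basis of a stalk -/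

section ChangeOfBasis

variable {X : Scheme.{0}}

/-- A basis of the stalk extends to a local basis. -/
lemma IsBasisOn.exists_of_stalkBasis {n : ℕ} {M : X.Modules} {W : X.Opens} {e : Fin n → Γ(M, W)}
    (he : IsBasisOn M W e) {x : X} (hx : x ∈ W)
    (b : Module.Basis (Fin n) (X.presheaf.stalk x) (M.presheaf.stalk x)) :
    ∃ (V : X.Opens) (_ : V ≤ W) (hxV : x ∈ V) (e' : Fin n → Γ(M, V)),
      IsBasisOn M V e' ∧ ∀ i, gm M hxV (e' i) = b i := by
  classical
  let b₀ := he.stalkBasis hx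
  let C : Matrix (Fin n) (Fin n) (X.presheaf.stalk x) := (b₀.toMatrix b).transpose
  have hC : IsUnit C.det := by
    have := b₀.invertibleToMatrix b
    rw [Matrix.det_transpose, ← Matrix.isUnit_iff_isUnit_det]
    exact isUnit_of_invertible _
  -- All n² entries of the transition matrix are lifted at once to one neighbourhood, indexed
  -- through `Fin n × Fin n ≃ Fin (n * n)`.
  obtain ⟨V₀, hV₀, hxV₀, a, ha⟩ := exists_gr_family
    (fun k => C (finProdFinEquiv.symm k).1 (finProdFinEquiv.symm k).2) W hx
  let A : Matrix (Fin n) (Fin n) Γ(X, V₀) := fun i j => a (finProdFinEquiv (i, j))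
  have hA : A.map (gr X hxV₀) = C := by
    ext i j
    change gr X hxV₀ (a (finProdFinEquiv (i, j))) = C i j
    rw [ha, Equiv.symm_apply_apply]
  -- The new sections form a basis exactly where the lifted determinant is invertible.
  have hxV : x ∈ X.basicOpen A.det := by
    rw [Scheme.mem_basicOpen _ _ _ hxV₀]
    change IsUnit (gr X hxV₀ A.det)
    rw [RingHom.map_det, RingHom.mapMatrix_apply, hA]
    exact hC
  let ρ := X.basicOpen_le A.det
  let B : Matrix (Fin n) (Fin n) Γ(X, X.basicOpen A.det) := A.map (rr X ρ)
  have hB : IsUnit B := by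
    rw [Matrix.isUnit_iff_isUnit_det]
    have : B.det = rr X ρ A.det := by rw [RingHom.map_det]; rfl
    rw [this]
    exact RingedSpace.isUnit_res_basicOpen _ _
  refine ⟨X.basicOpen A.det, ρ.trans hV₀, hxV, fun i => ∑ j, B i j • rs M (ρ.trans hV₀) (e j),
    fun V hV => ?_, fun i => ?_⟩
  · let B' := B.map (rr X hV)
    have hB' : IsUnit B' := hB.map (rr X hV).mapMatrix
    have h1 : Function.Bijective (fun v => Matrix.vecMul v B') :=
      ⟨Matrix.vecMul_injective_of_isUnit hB', Matrix.vecMul_surjective_iff_isUnit.mpr hB'⟩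
    convert (he V (hV.trans (ρ.trans hV₀))).comp h1 using 1
    funext v
    simp only [Function.comp, rs_sum_smul, rs_rs, Matrix.vecMul, dotProduct, Finset.sum_smul,
      Finset.smul_sum, smul_smul]
    rw [Finset.sum_comm]
    rfl
  · rw [map_sum]
    conv_rhs => rw [← b₀.sum_repr (b i)]
    refine Finset.sum_congr rfl fun j _ => ?_
    rw [gm_smul, gm_rs, he.stalkBasis_apply hx]
    congr 1
    have : gr X hxV₀ (A i j) = C i j := congrFun (congrFun hA i) j
    rw [show B i j = rr X ρ (A i j) from rfl, gr_rr, this]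
    rfl

end ChangeOfBasis

/-! ### Generic stalks and saturated subsheaves -/

section Integral

variable {X : Scheme.{0}} [IsIntegral X]

lemma eta_mem {W : X.Opens} {x : X} (hx : x ∈ W) : genericPoint X ∈ W :=
  (genericPoint_specializes x).mem_open W.2 hx

lemma algebraMap_gr {W : X.Opens} {x : X} (hx : x ∈ W) (f : Γ(X, W)) :
    algebraMap (X.presheaf.stalk x) X.functionField (gr X hx f) = gr X (eta_mem hx) f := by
  have : Nonempty W := ⟨⟨x, hx⟩⟩
  exact X.algebraMap_germ_eq_germToFunctionField hx f

/-- The specialization map from the stalk at a point to the generic stalk. -/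
def spm (M : X.Modules) (x : X) : M.presheaf.stalk x →ₛₗ[algebraMap (X.presheaf.stalk x)
    X.functionField] M.presheaf.stalk (genericPoint X) where
  toFun := (M.presheaf.stalkSpecializes (genericPoint_specializes x)).hom
  map_add' := map_add _
  map_smul' r m := by
    obtain ⟨U, hU, r, rfl⟩ := exists_gr r
    obtain ⟨V, hV, m, rfl⟩ := exists_gm M m
    have hW : x ∈ U ⊓ V := ⟨hU, hV⟩
    have key : ∀ {W : X.Opens} (hx : x ∈ W) (t : Γ(M, W)),
      (M.presheaf.stalkSpecializes (genericPoint_specializes x)).hom (gm M hx t) =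
        gm M (eta_mem hx) t := fun {W} hx t =>
      ConcreteCategory.congr_hom (TopCat.Presheaf.germ_stalkSpecializes M.presheaf hx
        (genericPoint_specializes x)) t
    rw [← gr_rr (inf_le_left : U ⊓ V ≤ U) hW, ← gm_rs M (inf_le_right : U ⊓ V ≤ V) hW, ← gm_smul,
      key, key, gm_smul, algebraMap_gr]

lemma spm_gm (M : X.Modules) {x : X} {W : X.Opens} (hx : x ∈ W) (t : Γ(M, W)) :
    spm M x (gm M hx t) = gm M (eta_mem hx) t :=
  ConcreteCategory.congr_hom (TopCat.Presheaf.germ_stalkSpecializes M.presheaf hx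
    (genericPoint_specializes x)) t

/-- The subsheaf of sections whose generic germ lies in `L`. -/
def sat (M : X.Modules)
    (L : Submodule (X.presheaf.stalk (genericPoint X)) (M.presheaf.stalk (genericPoint X))) :
    LocalSub M where
  carrier W :=
    { carrier := {s | ∀ h : genericPoint X ∈ W, gm M h s ∈ L}
      add_mem' := fun ha hb h => by rw [map_add]; exact add_mem (ha h) (hb h)
      zero_mem' := fun h => by rw [map_zero]; exact zero_mem _
      smul_mem' := fun c s hs h => by rw [gm_smul]; exact Submodule.smul_mem _ _ (hs h) }
  res_mem h s hs h' := by rw [gm_rs]; exact hs (h h')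
  local_mem s hs h := by
    obtain ⟨V, hV, hxV, h1⟩ := hs _ h
    have := h1 hxV
    rwa [gm_rs] at this

lemma mem_sat {M : X.Modules}
    {L : Submodule (X.presheaf.stalk (genericPoint X)) (M.presheaf.stalk (genericPoint X))}
    {W : X.Opens} {s : Γ(M, W)} (h : genericPoint X ∈ W) :
    s ∈ (sat M L).carrier W ↔ gm M h s ∈ L := ⟨fun hs => hs h, fun hs _ => hs⟩

lemma eq_zero_of_gr_eta {W : X.Opens} (h : genericPoint X ∈ W) (f : Γ(X, W))
    (hf : gr X h f = 0) : f = 0 :=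
  germ_injective_of_isIntegral X _ h (hf.trans (map_zero (gr X h)).symm)

lemma subsingleton_of_eta_notMem {W : X.Opens} (h : genericPoint X ∉ W) : W = ⊥ := by
  rw [eq_bot_iff]
  intro x hx
  exact h (eta_mem hx)

/-- The preimage `N` of `L` in the stalk is saturated, so the quotient is finite and torsion free
over a principal ideal domain, hence free. A basis of `N` and lifts of a basis of the quotient
together give the adapted basis. -/
lemma exists_adapted_stalkBasis {M : X.Modules} {n : ℕ} {x : X}
    (hx : IsPrincipalIdealRing (X.presheaf.stalk x))
    (b₀ : Module.Basis (Fin n) (X.presheaf.stalk x) (M.presheaf.stalk x))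
    (L : Submodule (X.presheaf.stalk (genericPoint X)) (M.presheaf.stalk (genericPoint X))) :
    ∃ (d c : ℕ) (_ : d + c = n)
      (b : Module.Basis (Fin d ⊕ Fin c) (X.presheaf.stalk x) (M.presheaf.stalk x)),
      (∀ i, spm M x (b (.inl i)) ∈ L) ∧ ∀ v : Fin c → X.functionField,
        ∑ i, v i • spm M x (b (.inr i)) ∈ L → v = 0 := by
  let R := X.presheaf.stalk x
  let N : Submodule R (M.presheaf.stalk x) := L.comap (spm M x)
  have : Module.Free R (M.presheaf.stalk x) := .of_basis b₀
  have : Module.Finite R (M.presheaf.stalk x) := .of_basis b₀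
  -- `L` is a vector space over the function field, so nonzero scalars can be cancelled.
  have htf : Module.IsTorsionFree R (M.presheaf.stalk x ⧸ N) := by
    rw [Module.isTorsionFree_iff_smul_eq_zero]
    intro c q hq
    obtain ⟨m, rfl⟩ := N.mkQ_surjective q
    rw [← map_smul, Submodule.mkQ_apply, Submodule.Quotient.mk_eq_zero] at hq
    by_cases hc : c = 0
    · exact .inl hc
    · refine .inr ((Submodule.Quotient.mk_eq_zero N).mpr ?_)
      have h1 : spm M x (c • m) ∈ L := hq
      rw [map_smulₛₗ] at h1
      exact (L.smul_mem_iff (S := X.functionField) (fun h => hc ((IsFractionRing.injective R X.functionField) (h.trans (map_zero _).symm)))).mp h1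
  have : Module.Free R (M.presheaf.stalk x ⧸ N) := Module.free_of_finite_type_torsion_free'
  let bN := Module.finBasis R N
  let bQ := Module.finBasis R (M.presheaf.stalk x ⧸ N)
  let b := Module.Basis.sumQuot bN bQ
  refine ⟨_, _, ?_, b, fun i => ?_, fun v hv => ?_⟩
  · have h1 := Module.finrank_eq_card_basis b
    rw [Module.finrank_eq_card_basis b₀] at h1
    simpa using h1.symm
  · rw [Module.Basis.sumQuot_inl]
    exact (bN i).2
  · obtain ⟨t, ht⟩ := IsLocalization.exist_integer_multiples_of_finite (nonZeroDivisors R) v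
    choose w hw using ht
    have h1 : spm M x (∑ i, w i • b (.inr i)) ∈ L := by
      rw [map_sum]
      simp only [map_smulₛₗ]
      have h2 := L.smul_mem (algebraMap R X.functionField t) hv
      rw [Finset.smul_sum] at h2
      convert h2 using 2 with i
      rw [hw, smul_smul, Algebra.smul_def]
    have h2 : ∑ i, w i • bQ i = 0 := by
      have h3 : N.mkQ (∑ i, w i • b (.inr i)) = 0 := (Submodule.Quotient.mk_eq_zero N).mpr h1
      rw [map_sum] at h3
      rw [← h3]
      refine Finset.sum_congr rfl fun i _ => ?_
      rw [map_smul]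
      congr 1
      exact (Module.Basis.sumQuot_inr ..).symm
    have h3 := Fintype.linearIndependent_iff.mp bQ.linearIndependent w h2
    funext i
    have h4 := hw i
    rw [h3 i, map_zero, Algebra.smul_def, eq_comm, mul_eq_zero] at h4
    refine h4.resolve_left fun h5 => ?_
    exact nonZeroDivisors.ne_zero t.2 ((IsFractionRing.injective R X.functionField) (h5.trans (map_zero _).symm))

end Integral


/-! ### A local criterion for bases -/

section LocalBasis

variable {X : Scheme.{0}}

/-- Uniqueness of coefficients over every smaller open set makes locally found coefficients agree on
overlaps, so they glue. -/
lemma isBasisOn_of_locally {n : ℕ} {M : X.Modules} {W : X.Opens} {e : Fin n → Γ(M, W)}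
    (hinj : ∀ (V : X.Opens) (h : V ≤ W) (a : Fin n → Γ(X, V)), ∑ i, a i • rs M h (e i) = 0 → a = 0)
    (hsurj : ∀ (V : X.Opens) (h : V ≤ W) (t : Γ(M, V)) (x : X), x ∈ V →
      ∃ (V' : X.Opens) (h' : V' ≤ V) (a : Fin n → Γ(X, V')), x ∈ V' ∧
        ∑ i, a i • rs M (h'.trans h) (e i) = rs M h' t) :
    IsBasisOn M W e := by
  have hinj' : ∀ (V : X.Opens) (h : V ≤ W) (a b : Fin n → Γ(X, V)),
      ∑ i, a i • rs M h (e i) = ∑ i, b i • rs M h (e i) → a = b := fun V h a b hab => by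
    rw [← sub_eq_zero]
    refine hinj V h _ ?_
    simp only [Pi.sub_apply, sub_smul, Finset.sum_sub_distrib, hab, sub_self]
  refine fun V h => ⟨fun a b hab => hinj' V h a b hab, fun t => ?_⟩
  choose V' h' a hx ha using fun x : V => hsurj V h t x.1 x.2
  have hglue : ∀ i, ∃ b : Γ(X, V), ∀ x, rr X (h' x) b = a x i := fun i =>
    function_glue V' h' (fun x hxV => ⟨⟨x, hxV⟩, hx _⟩) (fun x => a x i) fun x y => by
      refine congrFun (hinj' _ (inf_le_left.trans ((h' x).trans h))
        (fun i => rr X (inf_le_left : V' x ⊓ V' y ≤ V' x) (a x i))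
        (fun i => rr X (inf_le_right : V' x ⊓ V' y ≤ V' y) (a y i)) ?_) i
      have h1 := congrArg (rs M (inf_le_left : V' x ⊓ V' y ≤ V' x)) (ha x)
      have h2 := congrArg (rs M (inf_le_right : V' x ⊓ V' y ≤ V' y)) (ha y)
      rw [rs_sum_smul] at h1 h2
      simp only [rs_rs] at h1 h2
      exact h1.trans h2.symm
  choose b hb using hglue
  refine ⟨b, section_ext _ _ _ fun x hxV => ⟨V' ⟨x, hxV⟩, h' _, hx _, ?_⟩⟩
  change rs M _ (∑ i, b i • rs M h (e i)) = _
  rw [rs_sum_smul, ← ha]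
  simp only [hb, rs_rs]

/-- Every point has a neighbourhood over which `M` has a finite basis. -/
def HasBases (M : X.Modules) : Prop :=
  ∀ x : X, ∃ (W : X.Opens) (n : ℕ) (e : Fin n → Γ(M, W)), x ∈ W ∧ IsBasisOn M W e

end LocalBasis

/-! ### Saturated subsheaves of bundles and their quotients -/

section Adapted

variable {X : Scheme.{0}} [IsIntegral X] {M : X.Modules}
  (L : Submodule (X.presheaf.stalk (genericPoint X)) (M.presheaf.stalk (genericPoint X)))

/-- A local basis of `M` whose first part is a basis of the subsheaf of sections with generic germ
in `L`. -/
structure IsAdaptedBasis {d c : ℕ} (V : X.Opens) (e₁ : Fin d → Γ(M, V)) (e₂ : Fin c → Γ(M, V)) :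
    Prop where
  isBasisOn : IsBasisOn M V (Fin.append e₁ e₂)
  mem_iff : ∀ (V' : X.Opens) (h : V' ≤ V) (a : Fin d → Γ(X, V')) (b : Fin c → Γ(X, V')),
    ∑ i, a i • rs M h (e₁ i) + ∑ i, b i • rs M h (e₂ i) ∈ (sat M L).carrier V' ↔ b = 0

/-- The adapted basis of the stalk spreads out to a neighbourhood. Membership in the saturated
subsheaf is tested on generic germs, and a function with zero generic germ is zero. -/
lemma exists_isAdaptedBasis {n : ℕ} {W : X.Opens} {e : Fin n → Γ(M, W)}
    (he : IsBasisOn M W e) {x : X} (hx : x ∈ W) (hpid : IsPrincipalIdealRing (X.presheaf.stalk x)) :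
    ∃ (d c : ℕ) (V : X.Opens) (e₁ : Fin d → Γ(M, V)) (e₂ : Fin c → Γ(M, V)),
      x ∈ V ∧ V ≤ W ∧ d + c = n ∧ IsAdaptedBasis L V e₁ e₂ := by
  obtain ⟨d, c, rfl, b, hb₁, hb₂⟩ := exists_adapted_stalkBasis hpid (he.stalkBasis hx) L
  obtain ⟨V, hV, hxV, e', he', hb⟩ := he.exists_of_stalkBasis hx (b.reindex finSumFinEquiv)
  have h1 : ∀ i, gm M (eta_mem hxV) (e' (Fin.castAdd c i)) = spm M x (b (.inl i)) := fun i => by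
    rw [← spm_gm M hxV, hb, Module.Basis.reindex_apply, finSumFinEquiv_symm_apply_castAdd]
  have h2 : ∀ i, gm M (eta_mem hxV) (e' (Fin.natAdd d i)) = spm M x (b (.inr i)) := fun i => by
    rw [← spm_gm M hxV, hb, Module.Basis.reindex_apply, finSumFinEquiv_symm_apply_natAdd]
  refine ⟨d, c, V, fun i => e' (Fin.castAdd c i), fun i => e' (Fin.natAdd d i), hxV, hV, rfl, ?_, ?_⟩
  · rwa [Fin.append_castAdd_natAdd]
  · intro V' h f g
    by_cases hη : genericPoint X ∈ V'
    · have hf : gm M hη (∑ i, f i • rs M h (e' (Fin.castAdd c i))) ∈ L := by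
        rw [map_sum]
        refine sum_mem fun i _ => ?_
        rw [gm_smul, gm_rs, h1]
        exact L.smul_mem _ (hb₁ i)
      rw [mem_sat hη, map_add, Submodule.add_mem_iff_right _ hf, map_sum]
      simp only [gm_smul, gm_rs, h2]
      refine ⟨fun h3 => ?_, fun h3 => ?_⟩
      · have h4 := hb₂ (fun i => gr X hη (g i)) h3
        funext i
        exact eq_zero_of_gr_eta hη _ (congrFun h4 i)
      · simp [h3]
    · obtain rfl := subsingleton_of_eta_notMem hη
      have : Subsingleton Γ(X, ⊥) := inferInstance
      refine ⟨fun _ => Subsingleton.elim _ _, fun _ h => (hη h).elim⟩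

variable {L} {d c : ℕ} {V : X.Opens} {e₁ : Fin d → Γ(M, V)} {e₂ : Fin c → Γ(M, V)}

lemma IsAdaptedBasis.exists_coord (h : IsAdaptedBasis L V e₁ e₂) {V' : X.Opens} (h' : V' ≤ V)
    (s : Γ(M, V')) : ∃ (a : Fin d → Γ(X, V')) (b : Fin c → Γ(X, V')),
      s = ∑ i, a i • rs M h' (e₁ i) + ∑ i, b i • rs M h' (e₂ i) := by
  refine ⟨fun i => h.isBasisOn.coord h' s (Fin.castAdd c i),
    fun i => h.isBasisOn.coord h' s (Fin.natAdd d i), ?_⟩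
  conv_lhs => rw [← h.isBasisOn.sum_coord h' s, Fin.sum_univ_add]
  simp only [Fin.append_left, Fin.append_right]

lemma IsAdaptedBasis.mem (h : IsAdaptedBasis L V e₁ e₂) (i : Fin d) :
    e₁ i ∈ (sat M L).carrier V := by
  have := (h.mem_iff V le_rfl (Pi.single i 1) 0).mpr rfl
  simpa [Pi.single_apply, ite_smul, rs_self] using this

/-- The basis of the saturated subsheaf. -/
def IsAdaptedBasis.satBasis (h : IsAdaptedBasis L V e₁ e₂) (i : Fin d) :
    Γ((sat M L).toModules, V) := ⟨e₁ i, h.mem i⟩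

lemma IsAdaptedBasis.ap_satBasis (h : IsAdaptedBasis L V e₁ e₂) (i : Fin d) :
    ap (sat M L).ι V (h.satBasis i) = e₁ i := rfl

lemma IsAdaptedBasis.isBasisOn_sat (h : IsAdaptedBasis L V e₁ e₂) :
    IsBasisOn (sat M L).toModules V h.satBasis := by
  have key : ∀ (V' : X.Opens) (h' : V' ≤ V) (a : Fin d → Γ(X, V')),
      ap (sat M L).ι V' (∑ i, a i • rs _ h' (h.satBasis i)) = ∑ i, a i • rs M h' (e₁ i) := by
    intro V' h' a
    rw [map_sum]
    simp only [map_smul, ap_rs, h.ap_satBasis]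
  refine isBasisOn_of_locally (fun V' h' a ha => ?_) (fun V' h' t x hx => ⟨V', le_rfl, ?_⟩)
  · have h1 := key V' h' a
    rw [ha, map_zero] at h1
    have h2 := (h.isBasisOn V' h').injective (a₁ := Fin.append a 0) (a₂ := 0) (by
      simp [Fin.sum_univ_add, ← h1])
    funext i
    simpa using congrFun h2 (Fin.castAdd c i)
  · obtain ⟨a, b, hab⟩ := h.exists_coord h' (ap (sat M L).ι V' t)
    have hb : b = 0 := (h.mem_iff V' h' a b).mp (hab ▸ t.2)
    refine ⟨a, hx, (sat M L).ap_ι_injective _ ?_⟩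
    rw [key, rs_self, hab, hb]
    simp

/-- Sections of the cokernel lift only locally, which suffices by `isBasisOn_of_locally`. The first
part of the adapted basis dies in the cokernel, and the complementary part admits no relation modulo
the subsheaf. -/
lemma IsAdaptedBasis.isBasisOn_cokernel (h : IsAdaptedBasis L V e₁ e₂) :
    IsBasisOn (cokernel (sat M L).ι) V (fun i => ap (cokernel.π (sat M L).ι) V (e₂ i)) := by
  have key : ∀ (V' : X.Opens) (h' : V' ≤ V) (b : Fin c → Γ(X, V')),
      ap (cokernel.π (sat M L).ι) V' (∑ i, b i • rs _ h' (e₂ i)) =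
        ∑ i, b i • rs _ h' (ap (cokernel.π (sat M L).ι) V (e₂ i)) := by
    intro V' h' b
    rw [map_sum]
    simp only [map_smul, ap_rs]
  refine isBasisOn_of_locally (fun V' h' b hb => ?_) (fun V' h' t x hx => ?_)
  · rw [← key, ap_cokernel_π_eq_zero_iff, LocalSub.range_ap_ι] at hb
    refine (h.mem_iff V' h' 0 b).mp ?_
    simpa using hb
  · obtain ⟨V'', h'', s, hx'', hs⟩ := locally_surjective_of_epi (cokernel.π (sat M L).ι) V' t x hx
    obtain ⟨a, b, rfl⟩ := h.exists_coord (h''.trans h') s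
    refine ⟨V'', h'', b, hx'', ?_⟩
    rw [← hs, map_add, key]
    have : ap (cokernel.π (sat M L).ι) V'' (∑ i, a i • rs M (h''.trans h') (e₁ i)) = 0 := by
      rw [ap_cokernel_π_eq_zero_iff, LocalSub.range_ap_ι]
      simpa using (h.mem_iff V'' (h''.trans h') a 0).mpr rfl
    rw [this, zero_add]

variable (L)

lemma hasBases_sat (hM : HasBases M) (hpid : ∀ x, IsPrincipalIdealRing (X.presheaf.stalk x)) :
    HasBases (sat M L).toModules := fun x => by
  obtain ⟨W, n, e, hx, he⟩ := hM x
  obtain ⟨d, c, V, e₁, e₂, hxV, -, -, h⟩ := exists_isAdaptedBasis L he hx (hpid x)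
  exact ⟨V, d, _, hxV, h.isBasisOn_sat⟩

lemma hasBases_cokernel (hM : HasBases M) (hpid : ∀ x, IsPrincipalIdealRing (X.presheaf.stalk x)) :
    HasBases (cokernel (sat M L).ι) := fun x => by
  obtain ⟨W, n, e, hx, he⟩ := hM x
  obtain ⟨d, c, V, e₁, e₂, hxV, -, -, h⟩ := exists_isAdaptedBasis L he hx (hpid x)
  exact ⟨V, c, _, hxV, h.isBasisOn_cokernel⟩

end Adapted

/-! ### Sections are determined by one germ -/

section TorsionFree

variable {X : Scheme.{0}} [IsIntegral X] {M : X.Modules}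

lemma HasBases.eq_zero_of_gm_eta (hM : HasBases M) {W : X.Opens} (s : Γ(M, W))
    (hη : genericPoint X ∈ W) (h : gm M hη s = 0) : s = 0 := by
  refine section_ext _ _ _ fun x hx => ?_
  obtain ⟨V, n, e, hxV, he⟩ := hM x
  have hx' : x ∈ W ⊓ V := ⟨hx, hxV⟩
  refine ⟨W ⊓ V, inf_le_left, hx', ?_⟩
  rw [map_zero]
  have h1 : gm M (eta_mem hx') (rs M inf_le_left s) = 0 := by rw [gm_rs, h]
  rw [← he.sum_coord inf_le_right (rs M (inf_le_left : W ⊓ V ≤ W) s)] at h1 ⊢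
  set a := he.coord inf_le_right (rs M (inf_le_left : W ⊓ V ≤ W) s) with ha
  rw [map_sum] at h1
  simp only [gm_smul, gm_rs] at h1
  have h2 := Fintype.linearIndependent_iff.mp (he.stalkBasis (eta_mem hxV)).linearIndependent
    (fun i => gr X (eta_mem hx') (a i)) (by simpa only [he.stalkBasis_apply] using h1)
  have h3 : a = 0 := funext fun i => eq_zero_of_gr_eta _ _ (h2 i)
  rw [h3]
  simp

lemma HasBases.eq_zero_of_gm (hM : HasBases M) {W : X.Opens} (s : Γ(M, W)) {x : X}
    (hx : x ∈ W) (h : gm M hx s = 0) : s = 0 := by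
  refine hM.eq_zero_of_gm_eta s (eta_mem hx) ?_
  rw [← spm_gm M hx, h, map_zero]

end TorsionFree


/-- Smooth curves: integral schemes, Noetherian and Jacobson as topological spaces, with principal
ideal domains as local rings, and without open closed points. -/
class IsSmoothCurve (X : Scheme.{0}) : Prop extends AlgebraicGeometry.IsIntegral X where
  pid : ∀ x : X, IsPrincipalIdealRing (X.presheaf.stalk x)
  not_isField : ∀ x : X, IsClosed {x} → ¬ IsField (X.presheaf.stalk x)
  jacobsonSpace : JacobsonSpace X
  noetherianSpace : TopologicalSpace.NoetherianSpace X

lemma isSmoothCurve_of_smooth {X : Scheme.{0}} (s : X ⟶ Spec (.of ℂ))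
    [SmoothOfRelativeDimension 1 s] [IrreducibleSpace X] [QuasiCompact s] : IsSmoothCurve X := by
  have h := fun x => stalk_of_smooth s x
  have : ∀ x : X, _root_.IsReduced (X.presheaf.stalk x) := fun x => by
    have := (h x).1
    infer_instance
  have : IsReduced X := isReduced_of_isReduced_stalk X
  have := isLocallyNoetherian_of_smooth s
  have := SmoothOfRelativeDimension.smooth (n := 1) (f := s)
  have : CompactSpace X := (quasiCompact_iff_compactSpace s).mp inferInstance
  have : IsNoetherian X := {}
  exact { toIsIntegral := isIntegral_of_irreducibleSpace_of_isReduced X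
          pid := fun x => (h x).2.1
          not_isField := fun x => (h x).2.2
          jacobsonSpace := LocallyOfFiniteType.jacobsonSpace s
          noetherianSpace := inferInstance }

/-! ### Topology of smooth curves and purity of bundles -/

section Topology

variable {X : Scheme.{0}} [IsSmoothCurve X]

lemma genericPoint_ne_of_isClosed {x : X} (h : IsClosed {x}) : x ≠ genericPoint X := by
  rintro rfl
  exact IsSmoothCurve.not_isField _ h (Field.toIsField X.functionField)

/-- A proper specialization of a non-generic point to `y` would give three distinct primes in the
local ring at `y`. A local principal ideal domain has at most two: zero and the maximal ideal. -/
lemma isClosed_of_ne_genericPoint {x : X} (h : x ≠ genericPoint X) : IsClosed {x} := by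
  rw [← closure_subset_iff_isClosed]
  intro y hy
  by_contra hne
  have hxy : x ⤳ y := specializes_iff_mem_closure.mpr hy
  have h1 : ∀ z, z ⤳ y → ∃ q, X.fromSpecStalk y q = z := fun z hz => by
    have : z ∈ Set.range (X.fromSpecStalk y) := by rw [Scheme.range_fromSpecStalk]; exact hz
    exact this
  obtain ⟨p, hp⟩ := h1 x hxy
  obtain ⟨q, hq⟩ := h1 _ (genericPoint_specializes y)
  obtain ⟨m, hm⟩ := h1 y specializes_rfl
  have : IsPrincipalIdealRing (X.presheaf.stalk y) := IsSmoothCurve.pid y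
  have hbot : ∀ z : PrimeSpectrum (X.presheaf.stalk y), z.asIdeal = ⊥ ∨
      z.asIdeal = IsLocalRing.maximalIdeal (X.presheaf.stalk y) := fun z => by
    rcases eq_or_ne z.asIdeal ⊥ with h | h
    · exact .inl h
    · exact .inr (IsLocalRing.eq_maximalIdeal (IsPrime.to_maximal_ideal (hpi := z.2) h))
  have hqp : q ≠ p := fun e => h (by rw [← hp, ← hq, e])
  have hqm : q ≠ m := fun e => by
    have e' : y = genericPoint X := by rw [← hm, ← hq, e]
    subst e'
    exact h (Specializes.antisymm hxy (genericPoint_specializes x)).eq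
  have hpm : p ≠ m := fun e => hne (hm.symm.trans ((congrArg _ e.symm).trans hp))
  rcases hbot q with a | a <;> rcases hbot p with b | b <;> rcases hbot m with c | c
  · exact hqp (PrimeSpectrum.ext (a.trans b.symm))
  · exact hqp (PrimeSpectrum.ext (a.trans b.symm))
  · exact hqm (PrimeSpectrum.ext (a.trans c.symm))
  · exact hpm (PrimeSpectrum.ext (b.trans c.symm))
  · exact hpm (PrimeSpectrum.ext (b.trans c.symm))
  · exact hqm (PrimeSpectrum.ext (a.trans c.symm))
  · exact hqp (PrimeSpectrum.ext (a.trans b.symm))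
  · exact hqp (PrimeSpectrum.ext (a.trans b.symm))

lemma exists_isClosed_mem {W : X.Opens} (hW : W ≠ ⊥) : ∃ x ∈ W, IsClosed {x} := by
  have := IsSmoothCurve.jacobsonSpace (X := X)
  obtain ⟨x, h1, h2⟩ := nonempty_inter_closedPoints (Z := (W : Set X))
    (W.ne_bot_iff_nonempty.mp hW) W.2.isLocallyClosed
  exact ⟨x, h1, h2⟩

/-- A closed set in a Noetherian space is a finite union of irreducible closed sets. Each one has a
generic point, which is not that of the curve and is therefore closed. -/
lemma finite_of_genericPoint_notMem {Z : Set X} (hZ : IsClosed Z) (h : genericPoint X ∉ Z) :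
    Z.Finite := by
  have := IsSmoothCurve.noetherianSpace (X := X)
  obtain ⟨S, hS, hc, hi, rfl⟩ :=
    TopologicalSpace.NoetherianSpace.exists_finite_set_isClosed_irreducible hZ
  refine hS.sUnion fun t ht => ?_
  obtain ⟨x, hx⟩ := QuasiSober.sober (hi t ht) (hc t ht)
  have hxt : x ∈ t := hx.mem
  have h1 := isClosed_of_ne_genericPoint (x := x) fun e => h ⟨t, ht, e ▸ hxt⟩
  have h2 : t = {x} := by rw [← hx.def, h1.closure_eq]
  rw [h2]
  exact Set.finite_singleton x

lemma topologicalKrullDim_le_one : topologicalKrullDim X ≤ 1 := by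
  rw [topologicalKrullDim, Order.krullDim_le_one_iff]
  intro Z
  obtain ⟨x, hx⟩ := QuasiSober.sober Z.2 Z.3
  by_cases h : x = genericPoint X
  · refine .inr fun Y _ y _ => ?_
    have h1 : y ∈ closure {genericPoint X} := specializes_iff_mem_closure.mp (genericPoint_specializes y)
    rw [← h, hx.def] at h1
    exact h1
  · refine .inl fun Y hY => ?_
    have h1 := isClosed_of_ne_genericPoint h
    have h2 : (Z : Set X) = {x} := by rw [← h1.closure_eq]; exact hx.def.symm
    obtain ⟨y, hy⟩ := Y.2.nonempty
    intro z hz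
    have h3 : (y : X) ∈ ({x} : Set X) := h2 ▸ hY hy
    have h4 : z ∈ ({x} : Set X) := h2 ▸ hz
    rw [Set.mem_singleton_iff] at h3 h4
    rw [h4, ← h3]
    exact hy

/-- A nonzero section of a subsheaf has no zero germ on its open set, since germs of a bundle
determine sections on an integral scheme. The support thus contains a nonempty open set, in
particular a closed point and the generic point. -/
lemma isTorsionFree_of_hasBases {M : X.Modules} (hM : HasBases M) : IsTorsionFree M where
  isCoherent := isCoherent_of_bases hM
  pure G g hg hG := by
    obtain ⟨W, s, hs⟩ : ∃ (W : X.Opens) (s : Γ(G, W)), s ≠ 0 := by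
      by_contra! h
      exact hG (isZero_of_section_eq_zero h)
    have hsupp : ∀ x ∈ W, x ∈ supp G := fun x hx => by
      refine ⟨gm G hx s, 0, fun h => hs ?_⟩
      refine ap_injective g W ?_
      rw [map_zero]
      refine hM.eq_zero_of_gm _ hx ?_
      rw [← stalkMap_gm, h, map_zero]
    have hW : W ≠ ⊥ := by
      rintro rfl
      exact hs (section_ext _ _ _ fun x hx => hx.elim)
    obtain ⟨x, hx, hcl⟩ := exists_isClosed_mem hW
    refine le_antisymm ((topologicalKrullDim_subspace_le X _).trans topologicalKrullDim_le_one) ?_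
    rw [topologicalKrullDim, Order.one_le_krullDim_iff]
    have hη : genericPoint X ∈ supp G := hsupp _ (eta_mem hx)
    -- A closed point below the closure of the generic point is a chain of length one in the
    -- support.
    let A : TopologicalSpace.IrreducibleCloseds (supp G) :=
      ⟨{⟨x, hsupp x hx⟩}, isIrreducible_singleton, by
        convert hcl.preimage (continuous_subtype_val (p := (· ∈ supp G)))
        ext y
        simp [Subtype.ext_iff]⟩
    let B : TopologicalSpace.IrreducibleCloseds (supp G) :=
      ⟨closure {⟨_, hη⟩}, isIrreducible_singleton.closure, isClosed_closure⟩
    have hAB : ∀ y : supp G, y ∈ (B : Set (supp G)) := fun y => by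
      change y ∈ closure _
      rw [closure_subtype, Set.image_singleton]
      exact specializes_iff_mem_closure.mp (genericPoint_specializes y.1)
    refine ⟨A, B, lt_of_le_of_ne (fun y _ => hAB y) fun e => ?_⟩
    have h1 : (⟨_, hη⟩ : supp G) ∈ (A : Set (supp G)) := e ▸ hAB _
    have h2 : (⟨_, hη⟩ : supp G) = ⟨x, hsupp x hx⟩ := h1
    exact genericPoint_ne_of_isClosed hcl (congrArg Subtype.val h2).symm

end Topology


/-! ### Finite-dimensional quotients of one-dimensional algebras -/

section FiniteQuotient

variable {A : Type*} [CommRing A] [Algebra ℂ A] [Algebra.FiniteType ℂ A]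
  [Ring.DimensionLEOne A]

/-- Primes containing `b ≠ 0` are nonzero, hence maximal, so the quotient has Krull dimension at
most 0. A finitely generated algebra of that kind is finite over the field. -/
lemma finite_quotient_span_singleton {b : A} (hb : b ≠ 0) : Module.Finite ℂ (A ⧸ Ideal.span {b}) := by
  rw [Module.finite_iff_krullDimLE_zero, Ring.krullDimLE_zero_iff]
  intro p hp
  have h1 : (p.comap (Ideal.Quotient.mk (Ideal.span {b}))).IsMaximal := by
    refine Ideal.IsPrime.isMaximal inferInstance fun h => hb ?_
    have : b ∈ p.comap (Ideal.Quotient.mk (Ideal.span {b})) := by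
      rw [Ideal.mem_comap, Ideal.Quotient.eq_zero_iff_mem.mpr (Ideal.mem_span_singleton_self b)]
      exact p.zero_mem
    rwa [h] at this
  rw [← Ideal.map_comap_of_surjective _ Ideal.Quotient.mk_surjective p]
  refine (Ideal.map_eq_top_or_isMaximal_of_surjective _ Ideal.Quotient.mk_surjective h1).resolve_left
    fun h => hp.ne_top ?_
  rwa [Ideal.map_comap_of_surjective _ Ideal.Quotient.mk_surjective p] at h

lemma finite_quotient_of_smul_mem {M : Type*} [AddCommGroup M] [Module A M] [Module ℂ M]
    [IsScalarTower ℂ A M] [Module.Finite A M] (N : Submodule A M) {b : A} (hb : b ≠ 0)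
    (h : ∀ m, b • m ∈ N) : Module.Finite ℂ (M ⧸ N) := by
  obtain ⟨k, m, hm⟩ := Module.Finite.exists_fin (R := A) (M := M ⧸ N)
  let φ : (Fin k → A ⧸ Ideal.span {b}) →ₗ[A] M ⧸ N :=
    ∑ i, (Submodule.liftQ (Ideal.span {b}) (LinearMap.toSpanSingleton A (M ⧸ N) (m i)) (by
      rw [Ideal.span, Submodule.span_le, Set.singleton_subset_iff]
      obtain ⟨x, hx⟩ := N.mkQ_surjective (m i)
      change b • m i = 0
      rw [← hx, ← map_smul, Submodule.mkQ_apply, Submodule.Quotient.mk_eq_zero]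
      exact h x)).comp (LinearMap.proj i)
  have hφ : Function.Surjective φ := by
    rw [← LinearMap.range_eq_top, eq_top_iff, ← hm, Submodule.span_le]
    rintro _ ⟨i, rfl⟩
    refine ⟨Pi.single i 1, ?_⟩
    simp only [φ, LinearMap.sum_apply, LinearMap.comp_apply, LinearMap.proj_apply]
    rw [Finset.sum_eq_single i]
    · rw [Pi.single_eq_same]
      exact one_smul A (m i)
    · intro j _ hj
      rw [Pi.single_eq_of_ne hj, map_zero]
    · simp
  have := finite_quotient_span_singleton hb
  exact Module.Finite.of_surjective (φ.restrictScalars ℂ) hφ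

-- Noether normalization needs at most one variable in dimension at most one. With two variables, a
-- prime lying over the principal ideal of the first would be nonzero, hence maximal. That ideal
-- would then be maximal as well, although it is properly contained in the ideal of the origin.
open MvPolynomial in
lemma exists_aeval_finite (A : Type*) [CommRing A] [IsDomain A] [Algebra ℂ A]
    [Algebra.FiniteType ℂ A] [Ring.DimensionLEOne A] :
    ∃ x : A, (Polynomial.aeval x : Polynomial ℂ →ₐ[ℂ] A).toRingHom.Finite := by
  obtain ⟨s, g, hg, hfin⟩ := exists_finite_inj_algHom_of_fg ℂ A
  have hs : s ≤ 1 := by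
    by_contra! hs
    algebraize [g.toRingHom]
    have hint : Algebra.IsIntegral (MvPolynomial (Fin s) ℂ) A := ⟨hfin.to_isIntegral⟩
    let i : Fin s := ⟨0, by omega⟩
    let j : Fin s := ⟨1, by omega⟩
    let P : Ideal (MvPolynomial (Fin s) ℂ) := Ideal.span {X i}
    have hP : P.IsPrime := (Ideal.span_singleton_prime (X_ne_zero i)).mpr X_prime
    obtain ⟨Q, hQP⟩ := Ideal.exists_ideal_over_prime_of_isIntegral_of_isDomain (S := A) P (by
      intro a ha
      have : g a = 0 := ha
      rw [(map_eq_zero_iff g hg).mp this]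
      exact P.zero_mem)
    have hQ' : Q.IsMaximal := Ideal.IsPrime.isMaximal hQP.1 fun h => by
      have h1 : (X i : MvPolynomial (Fin s) ℂ) ∈ Q.comap (algebraMap _ A) :=
        hQP.2 ▸ Ideal.mem_span_singleton_self _
      rw [h] at h1
      have h2 : g (X i) = 0 := h1
      exact X_ne_zero i ((map_eq_zero_iff g hg).mp h2)
    have hPm : P.IsMaximal := hQP.2 ▸ Ideal.isMaximal_comap_of_isIntegral_of_isMaximal Q
    have h3 : P ≤ RingHom.ker (constantCoeff (R := ℂ) (σ := Fin s)) := by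
      rw [Ideal.span_le, Set.singleton_subset_iff]
      exact constantCoeff_X (R := ℂ) i
    have h4 := hPm.eq_of_le (RingHom.ker_ne_top _) h3
    have h5 : (X j : MvPolynomial (Fin s) ℂ) ∈ P := h4 ▸ constantCoeff_X (R := ℂ) j
    rw [Ideal.mem_span_singleton, X_dvd_X] at h5
    have hij : i ≠ j := fun h => by simpa [i, j] using congrArg Fin.val h
    exact hij h5
  -- If there are no variables, `A` is finite over `ℂ` and any element serves; 0 is taken.
  obtain ⟨x, hx⟩ : ∃ x : A, ∀ i, g (X i) = x := by
    interval_cases s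
    · exact ⟨0, fun i => i.elim0⟩
    · exact ⟨g (X 0), fun i => by rw [Subsingleton.elim i 0]⟩
  refine ⟨x, RingHom.Finite.of_comp_finite
    (f := (aeval (fun _ => Polynomial.X) : MvPolynomial (Fin s) ℂ →ₐ[ℂ] Polynomial ℂ).toRingHom) ?_⟩
  convert hfin using 1
  have : (Polynomial.aeval x).comp (aeval (fun _ => Polynomial.X)) = g := by
    ext i
    simp [hx]
  rw [← this]
  rfl

end FiniteQuotient

/-! ### Bounded denominators up to finite dimension -/

section Lattices

variable {K E : Type*} [Field K] [Algebra ℂ K] [AddCommGroup E] [Module K E] [Module ℂ E]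

/-- The elements of `N` in the `K`-span of `s` form a finite `A`-module `N'`. A common denominator
of its generators carries `N'` into the `A`-span of `s`, so what is left of `N'` modulo that span is
finitely generated and killed by a nonzero element, hence finite-dimensional. -/
lemma finite_quotient_of_independent {A : Type*} [CommRing A] [IsDomain A] [Algebra ℂ A]
    [Algebra.FiniteType ℂ A] [Ring.DimensionLEOne A] [Algebra A K] [IsFractionRing A K]
    [IsScalarTower ℂ A K] [Module A E] [IsScalarTower A K E] [IsScalarTower ℂ A E]
    {N : Submodule A E} (hN : N.FG) {G : Submodule ℂ E} (hGN : ∀ g ∈ G, g ∈ N) {d : ℕ} (s : Fin d → E)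
    (hG : ∀ g ∈ G, g ∈ Submodule.span K (Set.range s)) :
    Module.Finite ℂ (G ⧸ ((Submodule.span A (Set.range s)).restrictScalars ℂ).comap G.subtype) := by
  have : IsNoetherianRing A := Algebra.FiniteType.isNoetherianRing ℂ A
  have : Module.Finite A N := .of_fg hN
  let N' : Submodule A N :=
    ((Submodule.span K (Set.range s)).restrictScalars A).comap N.subtype
  let T : Submodule A N' := ((Submodule.span A (Set.range s)).comap N.subtype).comap N'.subtype
  obtain ⟨k, m, hm⟩ := Module.Finite.exists_fin (R := A) (M := N')
  have h1 : ∀ i, ∃ b : A, b ≠ 0 ∧ b • m i ∈ T := fun i => by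
    obtain ⟨c, hc⟩ := Submodule.mem_span_range_iff_exists_fun K |>.mp (m i).2
    obtain ⟨t, ht⟩ := IsLocalization.exist_integer_multiples_of_finite (nonZeroDivisors A) c
    choose w hw using ht
    refine ⟨t, nonZeroDivisors.ne_zero t.2, ?_⟩
    change (t : A) • ((m i : N) : E) ∈ Submodule.span A (Set.range s)
    rw [show ((m i : N) : E) = ∑ j, c j • s j from hc.symm, Finset.smul_sum]
    refine sum_mem fun j _ => ?_
    rw [← smul_assoc, ← hw, algebraMap_smul]
    exact Submodule.smul_mem _ _ (Submodule.subset_span ⟨j, rfl⟩)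
  choose b hb hbm using h1
  have hfin : Module.Finite ℂ (N' ⧸ T) := by
    refine finite_quotient_of_smul_mem T (b := ∏ i, b i) (Finset.prod_ne_zero_iff.mpr fun i _ => hb i)
      fun x => ?_
    have hx : x ∈ Submodule.span A (Set.range m) := hm ▸ Submodule.mem_top
    induction hx using Submodule.span_induction with
    | mem x hx =>
      obtain ⟨i, rfl⟩ := hx
      rw [← Finset.prod_erase_mul _ _ (Finset.mem_univ i), mul_smul]
      exact T.smul_mem _ (hbm i)
    | zero => rw [smul_zero]; exact T.zero_mem
    | add x y _ _ hx hy => rw [smul_add]; exact T.add_mem hx hy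
    | smul a x _ hx => rw [smul_comm]; exact T.smul_mem _ hx
  let φ : G →ₗ[ℂ] N' :=
    { toFun := fun g => ⟨⟨g.1, hGN _ g.2⟩, hG _ g.2⟩
      map_add' := fun _ _ => rfl
      map_smul' := fun _ _ => rfl }
  let ψ : G →ₗ[ℂ] N' ⧸ T := (T.mkQ.restrictScalars ℂ).comp φ
  have hker : LinearMap.ker ψ =
      ((Submodule.span A (Set.range s)).restrictScalars ℂ).comap G.subtype := by
    ext g
    rw [LinearMap.mem_ker]
    change T.mkQ (φ g) = 0 ↔ _
    rw [Submodule.mkQ_apply, Submodule.Quotient.mk_eq_zero]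
    rfl
  rw [← hker]
  have : Module.Finite ℂ (LinearMap.range ψ) := inferInstance
  exact .equiv ψ.quotKerEquivRange.symm

/-- The quotient of `G` by `S ⊓ T` embeds into the product of the two finite-dimensional quotients.
-/
lemma finite_of_finite_quotients {G : Type*} [AddCommGroup G] [Module ℂ G] (S T : Submodule ℂ G)
    [Module.Finite ℂ (G ⧸ S)] [Module.Finite ℂ (G ⧸ T)] [Module.Finite ℂ (S ⊓ T : Submodule ℂ G)] :
    Module.Finite ℂ G := by
  let φ : G →ₗ[ℂ] (G ⧸ S) × (G ⧸ T) := S.mkQ.prod T.mkQ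
  have hker : LinearMap.ker φ = S ⊓ T := by
    rw [LinearMap.ker_prod, Submodule.ker_mkQ, Submodule.ker_mkQ]
  have h1 : Module.Finite ℂ (LinearMap.ker φ) := by rw [hker]; infer_instance
  have h2 : Module.Finite ℂ (G ⧸ LinearMap.ker φ) := .equiv φ.quotKerEquivRange.symm
  exact Module.Finite.of_submodule_quotient (LinearMap.ker φ)

end Lattices

/-! ### Splitting off poles by division with remainder -/

section Poles

variable {K E : Type*} [Field K] [Algebra ℂ K] [AddCommGroup E] [Module K E] [Module ℂ E]
  [IsScalarTower ℂ K E]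

-- A rational function of `x` whose numerator has degree at most that of the denominator is regular
-- at `x = ∞`. In terms of `y = 1/x` it is a power of `y` times a quotient of reversed polynomials,
-- and the reversed denominator has the leading coefficient of `q` as constant term.
open Polynomial in
lemma aeval_div_aeval_mem {x : K} (hx : x ≠ 0) {O : Subalgebra ℂ K} (hy : x⁻¹ ∈ O)
    (hO : ∀ q : ℂ[X], q.coeff 0 ≠ 0 → (aeval x⁻¹ q)⁻¹ ∈ O) {b q : ℂ[X]} (hq : q ≠ 0)
    (hbq : b.natDegree ≤ q.natDegree) : aeval x b / aeval x q ∈ O := by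
  have hrev : ∀ p : ℂ[X], aeval x⁻¹ p.reverse * x ^ p.natDegree = aeval x p := fun p => by
    let := invertibleOfNonzero hx
    have := eval₂_reverse_mul_pow (algebraMap ℂ K) x p
    rwa [invOf_eq_inv] at this
  have hmem : ∀ p : ℂ[X], aeval x⁻¹ p ∈ O := fun p =>
    aeval_subalgebra_coe p O ⟨_, hy⟩ ▸ (aeval (⟨_, hy⟩ : O) p).2
  have h1 : aeval x b / aeval x q =
      (x⁻¹) ^ (q.natDegree - b.natDegree) * aeval x⁻¹ b.reverse * (aeval x⁻¹ q.reverse)⁻¹ := by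
    rw [← hrev b, ← hrev q, inv_pow, ← pow_sub_mul_pow x hbq, div_eq_mul_inv, mul_inv, mul_inv]
    field_simp
  rw [h1]
  refine O.mul_mem (O.mul_mem (O.pow_mem hy _) (hmem _)) (hO _ ?_)
  rw [coeff_zero_reverse]
  exact leadingCoeff_ne_zero.mpr hq

-- Think of `P` as sections regular for finite `x` and of `Q` as germs regular at `x = ∞`. Division
-- of `x ^ M p` by `q` splits a coefficient into a Laurent polynomial and a proper fraction times
-- `x⁻¹ ^ M`. The fraction contributes to `Q`, nonnegative powers of `x` contribute to `P`, and the
-- powers from `x ^ (-M)` to `x ^ 0` span the finite-dimensional space `T` generating the rest.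
open Polynomial in
lemma finite_quotient_sup {x : K} (hx : x ≠ 0) {O : Subalgebra ℂ K} (hy : x⁻¹ ∈ O)
    (hO : ∀ q : ℂ[X], q.coeff 0 ≠ 0 → (aeval x⁻¹ q)⁻¹ ∈ O) (P Q : Submodule ℂ E)
    (hP : ∀ e ∈ P, x • e ∈ P) (hQ : ∀ a ∈ O, ∀ e ∈ Q, a • e ∈ Q) {m : ℕ} (e : Fin m → E)
    (heP : ∀ i, e i ∈ P) {M : ℕ} (heQ : ∀ i, (x⁻¹) ^ M • e i ∈ Q)
    (hspan : ∀ v : E, ∃ (p : Fin m → ℂ[X]) (q : ℂ[X]), q ≠ 0 ∧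
      v = ∑ i, (aeval x (p i) / aeval x q) • e i) :
    Module.Finite ℂ (E ⧸ (P ⊔ Q)) := by
  let T := Submodule.span ℂ (Set.range fun ij : Fin (M + 1) × Fin m => (x⁻¹) ^ (ij.1 : ℕ) • e ij.2)
  have hPow : ∀ (n : ℕ), ∀ v ∈ P, x ^ n • v ∈ P := fun n => by
    induction n with
    | zero => intro v hv; simpa using hv
    | succ n ih => intro v hv; rw [pow_succ, mul_smul]; exact ih _ (hP v hv)
  have key : ∀ (i : Fin m) (p q : ℂ[X]), q ≠ 0 →
      (aeval x p / aeval x q) • e i ∈ (P ⊔ Q) ⊔ T := fun i p q hq => by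
    by_cases hq' : aeval x q = 0
    · rw [hq', div_zero, zero_smul]; exact zero_mem _
    have h1 : aeval x p / aeval x q = x⁻¹ ^ M * aeval x (X ^ M * p / q) +
        (aeval x (X ^ M * p % q) / aeval x q) * x⁻¹ ^ M := by
      have h2 := congrArg (aeval x) (EuclideanDomain.div_add_mod (X ^ M * p) q)
      rw [map_add, map_mul, map_mul, map_pow, aeval_X] at h2
      rw [inv_pow]
      field_simp
      rw [mul_comm, ← h2]
    rw [h1, add_smul]
    refine add_mem ?_ ?_
    · rw [aeval_eq_sum_range, Finset.mul_sum, Finset.sum_smul]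
      refine sum_mem fun k _ => ?_
      rw [mul_smul_comm, smul_assoc]
      refine Submodule.smul_mem _ _ ?_
      rcases le_total M k with hk | hk
      · refine Submodule.mem_sup_left (Submodule.mem_sup_left ?_)
        rw [← pow_sub_mul_pow x hk, inv_pow, mul_comm, mul_assoc, mul_inv_cancel₀ (pow_ne_zero _ hx),
          mul_one]
        exact hPow _ _ (heP i)
      · refine Submodule.mem_sup_right (Submodule.subset_span ⟨(⟨M - k, by omega⟩, i), ?_⟩)
        change x⁻¹ ^ (M - k) • e i = _
        rw [← pow_sub_mul_pow (x⁻¹) hk, mul_assoc, ← mul_pow, inv_mul_cancel₀ hx, one_pow, mul_one]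
    · rw [mul_smul]
      refine Submodule.mem_sup_left (Submodule.mem_sup_right (hQ _ ?_ _ (heQ i)))
      refine aeval_div_aeval_mem hx hy hO hq ?_
      have := EuclideanDomain.mod_lt (X ^ M * p) hq
      exact natDegree_le_natDegree (le_of_lt this)
  have htop : (P ⊔ Q) ⊔ T = ⊤ := by
    rw [eq_top_iff]
    intro v _
    obtain ⟨p, q, hq, rfl⟩ := hspan v
    exact sum_mem fun i _ => key i _ _ hq
  have hT : Module.Finite ℂ T := Module.Finite.span_of_finite ℂ (Set.finite_range _)
  refine Module.Finite.of_surjective ((P ⊔ Q).mkQ.comp T.subtype) fun v => ?_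
  obtain ⟨v, rfl⟩ := (P ⊔ Q).mkQ_surjective v
  obtain ⟨a, ha, b, hb, rfl⟩ := Submodule.mem_sup.mp (htop ▸ Submodule.mem_top : v ∈ (P ⊔ Q) ⊔ T)
  refine ⟨⟨b, hb⟩, ?_⟩
  rw [map_add, LinearMap.comp_apply, Submodule.mkQ_apply _ a,
    (Submodule.Quotient.mk_eq_zero _).mpr ha, zero_add]
  rfl

end Poles


lemma exists_ringHom_of_range_le {R S K : Type*} [CommRing R] [CommRing S] [CommRing K]
    (f : R →+* K) (g : S →+* K) (hg : Function.Injective g) (h : ∀ r, f r ∈ g.range) :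
    ∃ φ : R →+* S, g.comp φ = f := by
  choose φ hφ using h
  refine ⟨{ toFun := φ
            map_one' := hg (by rw [hφ, map_one, map_one])
            map_mul' := fun a b => hg (by rw [hφ, map_mul, map_mul, hφ, hφ])
            map_zero' := hg (by rw [hφ, map_zero, map_zero])
            map_add' := fun a b => hg (by rw [hφ, map_add, map_add, hφ, hφ]) }, RingHom.ext hφ⟩

/-! ### Affine opens of a separated curve -/

section Affine

variable {X : Scheme.{0}}

lemma finiteType_scalars (s : X ⟶ Spec (.of ℂ)) [LocallyOfFiniteType s] {U : X.Opens}
    (hU : IsAffineOpen U) : (scalars s U).FiniteType :=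
  (s.finiteType_appLE (isAffineOpen_top _) hU le_top).comp
    (RingHom.FiniteType.of_surjective _
      (ConcreteCategory.bijective_of_isIso (Scheme.ΓSpecIso (.of ℂ)).inv).surjective)

/-- A nonzero prime is a non-generic point, hence a closed point, hence a maximal ideal. -/
lemma dimensionLEOne_of_isAffineOpen [IsSmoothCurve X] {U : X.Opens} (hU : IsAffineOpen U) :
    Ring.DimensionLEOne Γ(X, U) where
  maximalOfPrime {p} hp hpp := by
    let q : PrimeSpectrum Γ(X, U) := ⟨p, hpp⟩
    have : Nonempty U := by
      have hx : hU.fromSpec q ∈ U := by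
        have : hU.fromSpec q ∈ Set.range hU.fromSpec := ⟨q, rfl⟩
        rwa [hU.range_fromSpec] at this
      exact ⟨⟨_, hx⟩⟩
    have hx : hU.fromSpec q ∈ U := by
      have : hU.fromSpec q ∈ Set.range hU.fromSpec := ⟨q, rfl⟩
      rwa [hU.range_fromSpec] at this
    have hq : hU.primeIdealOf ⟨hU.fromSpec q, hx⟩ = q := by
      apply hU.fromSpec.isOpenEmbedding.injective
      rw [hU.fromSpec_primeIdealOf]
    have h1 := isMaximal_primeIdealOf hU hx (isClosed_of_ne_genericPoint fun h => hp ?_)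
    · rwa [hq] at h1
    · have h2 := genericPoint_eq_of_isOpenImmersion hU.fromSpec
      have h3 : q = genericPoint (Spec Γ(X, U)) :=
        hU.fromSpec.isOpenEmbedding.injective (h.trans h2.symm)
      rw [genericPoint_eq_bot_of_affine] at h3
      exact congrArg PrimeSpectrum.asIdeal h3

/-- If all functions on `U` are regular at `y`, they define a morphism from the spectrum of the
local ring at `y` into `U`. It agrees with the canonical morphism at the generic point, hence
everywhere by separatedness, so it sends the closed point to `y`. -/
lemma mem_of_forall_mem_range_algebraMap [AlgebraicGeometry.IsIntegral X]
    (s : X ⟶ Spec (.of ℂ)) [IsSeparated s] {U : X.Opens}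
    (hU : IsAffineOpen U) (hη : genericPoint X ∈ U) (y : X)
    (h : ∀ f : Γ(X, U), gr X hη f ∈ (algebraMap (X.presheaf.stalk y) X.functionField).range) :
    y ∈ U := by
  have hinj : Function.Injective (algebraMap (X.presheaf.stalk y) X.functionField) :=
    IsFractionRing.injective _ _
  obtain ⟨φ, hφ⟩ := exists_ringHom_of_range_le (gr X hη) _ hinj h
  let ψ : Γ(X, U) ⟶ X.presheaf.stalk y := CommRingCat.ofHom φ
  let σ : X.presheaf.stalk y ⟶ X.functionField := X.presheaf.stalkSpecializes (genericPoint_specializes y)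
  have hσ : σ.hom = algebraMap (X.presheaf.stalk y) X.functionField := rfl
  have hψσ : ψ ≫ σ = X.presheaf.germ U _ hη := by
    ext f
    exact congrArg (fun g : Γ(X, U) →+* X.functionField => g f) hφ
  have key : Spec.map σ ≫ (Spec.map ψ ≫ hU.fromSpec) = Spec.map σ ≫ X.fromSpecStalk y := by
    rw [← Spec.map_comp_assoc, hψσ, Scheme.SpecMap_stalkSpecializes_fromSpecStalk,
      ← hU.fromSpecStalk_eq_fromSpecStalk hη]
    rfl
  have hdom : IsDominant (Spec.map σ) := by
    refine ⟨?_⟩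
    exact (PrimeSpectrum.denseRange_comap_iff_ker_le_nilRadical σ.hom).mpr (by
      rw [hσ, (RingHom.injective_iff_ker_eq_bot _).mp hinj]
      exact bot_le)
  have hcomp : Spec.map σ ≫ ((Spec.map ψ ≫ hU.fromSpec) ≫ s) = Spec.map σ ≫ (X.fromSpecStalk y ≫ s) := by
    rw [← Category.assoc, key, Category.assoc]
  have hs : (Spec.map ψ ≫ hU.fromSpec) ≫ s = X.fromSpecStalk y ≫ s :=
    ext_of_isDominant (Spec.map σ) hcomp
  have := ext_of_isDominant_of_isSeparated s hs (Spec.map σ) key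
  rw [← Scheme.fromSpecStalk_closedPoint (X := X) (x := y), ← this]
  have h1 : hU.fromSpec (Spec.map ψ (IsLocalRing.closedPoint (X.presheaf.stalk y))) ∈
    Set.range hU.fromSpec := ⟨_, rfl⟩
  rwa [hU.range_fromSpec] at h1

end Affine

/-! ### Sections as subsets of the generic stalk -/

section Germs

variable {X : Scheme.{0}} [AlgebraicGeometry.IsIntegral X] {M : X.Modules}

lemma HasBases.gm_eta_injective (hM : HasBases M) {W : X.Opens} (hη : genericPoint X ∈ W) :
    Function.Injective (gm M hη) := by
  rw [injective_iff_map_eq_zero]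
  exact fun s hs => hM.eq_zero_of_gm_eta s hη hs

/-- A generic germ that comes from all stalks over `W` comes from a section over `W`. -/
lemma HasBases.exists_gm_eta_eq (hM : HasBases M) {W : X.Opens} (hη : genericPoint X ∈ W)
    (e : M.presheaf.stalk (genericPoint X)) (h : ∀ x ∈ W, ∃ m, spm M x m = e) :
    ∃ t : Γ(M, W), gm M hη t = e := by
  have h1 : ∀ x : W, ∃ (V : X.Opens) (hx : x.1 ∈ V) (_ : V ≤ W) (t : Γ(M, V)),
      gm M (eta_mem hx) t = e := fun x => by
    obtain ⟨m, rfl⟩ := h x.1 x.2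
    obtain ⟨V, hx, t, rfl⟩ := exists_gm M m
    refine ⟨V ⊓ W, ⟨hx, x.2⟩, inf_le_right, rs M inf_le_left t, ?_⟩
    rw [gm_rs, spm_gm]
  choose V hx hV t ht using h1
  obtain ⟨t', ht'⟩ := section_glue M V hV (fun x hxW => ⟨⟨x, hxW⟩, hx _⟩) t fun x y => by
    by_cases hη' : genericPoint X ∈ V x ⊓ V y
    · refine hM.gm_eta_injective hη' ?_
      rw [gm_rs, gm_rs, ht, ht]
    · refine section_ext _ _ _ fun z hz => (hη' (eta_mem hz)).elim
  refine ⟨t', ?_⟩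
  rw [← ht ⟨_, hη⟩, ← ht' ⟨_, hη⟩, gm_rs]

end Germs


/-! ### Gluing over two open sets -/

section GlueTwo

variable {X : Scheme.{0}} {U V W : X.Opens}

lemma section_glue_two (M : X.Modules) (hU : U ≤ W) (hV : V ≤ W) (hW : W ≤ U ⊔ V) (u : Γ(M, U))
    (v : Γ(M, V)) (h : rs M (inf_le_left : U ⊓ V ≤ U) u = rs M (inf_le_right : U ⊓ V ≤ V) v) :
    ∃ t : Γ(M, W), rs M hU t = u ∧ rs M hV t = v := by
  obtain ⟨t, ht⟩ := section_glue M (W := W) (I := Bool)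
    (fun j => if j then U else V) (fun j => by cases j <;> assumption) (fun x hx => by
      rcases hW hx with h | h
      · exact ⟨true, h⟩
      · exact ⟨false, h⟩)
    (fun j => match j with | true => u | false => v) (fun j j' => by
      match j, j' with
      | true, true => rfl
      | true, false => exact h
      | false, true =>
        have := congrArg (rs M ((inf_comm V U).le : V ⊓ U ≤ U ⊓ V)) h
        rw [rs_rs, rs_rs] at this
        exact this.symm
      | false, false => rfl)
  exact ⟨t, ht true, ht false⟩

lemma function_glue_two (hU : U ≤ W) (hV : V ≤ W) (hW : W ≤ U ⊔ V) (u : Γ(X, U))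
    (v : Γ(X, V)) (h : rr X (inf_le_left : U ⊓ V ≤ U) u = rr X (inf_le_right : U ⊓ V ≤ V) v) :
    ∃ t : Γ(X, W), rr X hU t = u ∧ rr X hV t = v := by
  obtain ⟨t, ht⟩ := function_glue (X := X) (W := W) (I := Bool)
    (fun j => if j then U else V) (fun j => by cases j <;> assumption) (fun x hx => by
      rcases hW hx with h | h
      · exact ⟨true, h⟩
      · exact ⟨false, h⟩)
    (fun j => match j with | true => u | false => v) (fun j j' => by
      match j, j' with
      | true, true => rfl
      | true, false => exact h
      | false, true =>
        have := congrArg (rr X ((inf_comm V U).le : V ⊓ U ≤ U ⊓ V)) h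
        rw [rr_rr, rr_rr] at this
        exact this.symm
      | false, false => rfl)
  exact ⟨t, ht true, ht false⟩

end GlueTwo

/-! ### Complex scalars on stalks and global functions -/

section Global

variable {X : Scheme.{0}} (s : X ⟶ Spec (.of ℂ))

lemma rr_scalars {V W : X.Opens} (h : V ≤ W) (z : ℂ) : rr X h (scalars s W z) = scalars s V z :=
  map_scalars s h z

/-- The structure map from `ℂ` to the local rings. -/
def stalkScalars (x : X) : ℂ →+* X.presheaf.stalk x :=
  (gr X (TopologicalSpace.Opens.mem_top x)).comp (scalars s ⊤)

lemma gr_scalars {W : X.Opens} {x : X} (hx : x ∈ W) (z : ℂ) :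
    gr X hx (scalars s W z) = stalkScalars s x z := by
  rw [← rr_scalars s (le_top : W ≤ ⊤), gr_rr]
  rfl

lemma smul_sections (M : X.Modules) (W : X.Opens) (z : ℂ) (t : Sections s M W) :
    z • t = (show Sections s M W from scalars s W z • (show Γ(M, W) from t)) := rfl

variable [AlgebraicGeometry.IsIntegral X]

lemma algebraMap_stalkScalars (x : X) (z : ℂ) :
    algebraMap (X.presheaf.stalk x) X.functionField (stalkScalars s x z) =
      stalkScalars s (genericPoint X) z := by
  rw [stalkScalars, RingHom.comp_apply, algebraMap_gr]
  rfl

/-- The function field as a `ℂ`-algebra. -/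
abbrev functionFieldAlgebra : Algebra ℂ X.functionField :=
  (stalkScalars s (genericPoint X)).toAlgebra

/-- The generic stalk as a complex vector space. -/
abbrev genericStalkModule (M : X.Modules) : Module ℂ (M.presheaf.stalk (genericPoint X)) :=
  Module.compHom _ (stalkScalars s (genericPoint X))

/-- The generic germ, as a linear map. -/
def germLinear (M : X.Modules) {W : X.Opens} (hη : genericPoint X ∈ W) :
    letI := genericStalkModule s M
    Sections s M W →ₗ[ℂ] M.presheaf.stalk (genericPoint X) :=
  let := genericStalkModule s M
  { toFun := fun t => gm M hη t
    map_add' := map_add (gm M hη)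
    map_smul' := fun z t => by
      rw [smul_sections]
      refine (gm_smul M hη _ _).trans ?_
      rw [gr_scalars]
      rfl }

lemma finite_scalars_top [UniversallyClosed s] [LocallyOfFiniteType s] : (scalars s ⊤).Finite := by
  have h1 : s.appTop.hom.Finite := finite_appTop_of_universallyClosed ℂ s
  have h2 : (Scheme.ΓSpecIso (.of ℂ)).inv.hom.Finite := RingHom.Finite.of_surjective _
    (ConcreteCategory.bijective_of_isIso (Scheme.ΓSpecIso (.of ℂ)).inv).surjective
  have h3 : s.appLE ⊤ ⊤ le_top = s.appTop := by
    rw [Scheme.Hom.appTop, Scheme.Hom.app_eq_appLE]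
    rfl
  rw [scalars, h3]
  exact h1.comp h2

end Global

/-! ### Finiteness of global sections -/

section Finiteness

variable {X : Scheme.{0}} (s : X ⟶ Spec (.of ℂ)) [IsSmoothCurve X]

/-- Apart from a finite-dimensional quotient, sections over `U` in the span of `b` have coefficients
regular on `U`. This is `finite_quotient_of_independent` for the coordinate ring of `U` acting on
the generic stalk. -/
lemma exists_finite_quotient_coefficients [LocallyOfFiniteType s] {M : X.Modules}
    (hM : HasBases M) {U : X.Opens} (hU : IsAffineOpen U) (hη : genericPoint X ∈ U) {d : ℕ}
    (b : Fin d → M.presheaf.stalk (genericPoint X)) :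
    letI := genericStalkModule s M
    ∀ (G : Submodule ℂ (M.presheaf.stalk (genericPoint X)))
      (_ : ∀ g ∈ G, ∃ t : Γ(M, U), gm M hη t = g)
      (_ : ∀ g ∈ G, g ∈ Submodule.span X.functionField (Set.range b)),
    ∃ S : Submodule ℂ G, Module.Finite ℂ (G ⧸ S) ∧ ∀ g ∈ S, ∃ a : Fin d → Γ(X, U),
      (g : M.presheaf.stalk (genericPoint X)) = ∑ i, gr X hη (a i) • b i := by
  let := genericStalkModule s M
  intro G hG hGb
  let := functionFieldAlgebra s
  let : Algebra ℂ Γ(X, U) := (scalars s U).toAlgebra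
  have : Algebra.FiniteType ℂ Γ(X, U) := finiteType_scalars s hU
  have := dimensionLEOne_of_isAffineOpen hU
  have : Nonempty U := ⟨⟨_, hη⟩⟩
  have := functionField_isFractionRing_of_isAffineOpen X U hU
  have halg : ∀ f : Γ(X, U), algebraMap Γ(X, U) X.functionField f = gr X hη f := fun f => rfl
  let : Module Γ(X, U) (M.presheaf.stalk (genericPoint X)) := Module.compHom _ (gr X hη)
  have : IsScalarTower ℂ Γ(X, U) X.functionField := .of_algebraMap_eq fun z => (gr_scalars s hη z).symm
  have : IsScalarTower Γ(X, U) X.functionField (M.presheaf.stalk (genericPoint X)) :=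
    ⟨fun f a m => by
      rw [Algebra.smul_def, mul_smul]
      rfl⟩
  have : IsScalarTower ℂ Γ(X, U) (M.presheaf.stalk (genericPoint X)) :=
    ⟨fun z f m => by
      rw [Algebra.smul_def]
      change gr X hη (scalars s U z * f) • m = stalkScalars s (genericPoint X) z • (gr X hη f • m)
      rw [map_mul, mul_smul, gr_scalars]⟩
  have : Module.Finite Γ(X, U) Γ(M, U) := (isCoherent_of_bases hM).finite U hU
  let γ : Γ(M, U) →ₗ[Γ(X, U)] M.presheaf.stalk (genericPoint X) :=
    { toFun := gm M hη
      map_add' := map_add _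
      map_smul' := fun f t => gm_smul M hη f t }
  have hfg : (LinearMap.range γ).FG := Module.Finite.iff_fg.mp inferInstance
  refine ⟨_, finite_quotient_of_independent (K := X.functionField) (A := Γ(X, U)) hfg
    (fun g hg => hG g hg) b hGb, fun g hg => ?_⟩
  obtain ⟨a, ha⟩ := (Submodule.mem_span_range_iff_exists_fun Γ(X, U)).mp hg
  exact ⟨a, ha.symm⟩

/-- Finiteness of the space of global sections of a vector bundle on a complete smooth curve. -/
lemma finite_sections_top [IsProper s] {M : X.Modules} (hM : HasBases M)
    {U V : X.Opens} (hU : IsAffineOpen U) (hV : IsAffineOpen V) (hUV : U ⊔ V = ⊤)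
    (hηU : genericPoint X ∈ U) (hηV : genericPoint X ∈ V) :
    Module.Finite ℂ (Sections s M ⊤) := by
  let := genericStalkModule s M
  let := functionFieldAlgebra s
  have : IsScalarTower ℂ X.functionField (M.presheaf.stalk (genericPoint X)) :=
    ⟨fun z f m => by
      rw [Algebra.smul_def, mul_smul]
      rfl⟩
  have hη : genericPoint X ∈ (⊤ : X.Opens) := trivial
  let γ := germLinear s M hη
  have hγ : Function.Injective γ := hM.gm_eta_injective hη
  let G := LinearMap.range γ
  suffices Module.Finite ℂ G from .equiv (LinearEquiv.ofInjective γ hγ).symm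
  -- A basis, over the function field, of the span of the global sections. Its independence makes
  -- the coefficients over `U` and over `V` comparable.
  obtain ⟨b, hbG, hbs, hb⟩ := exists_linearIndependent X.functionField
    (G : Set (M.presheaf.stalk (genericPoint X)))
  obtain ⟨W, n, e, hW, he⟩ := hM (genericPoint X)
  have : Module.Finite X.functionField (M.presheaf.stalk (genericPoint X)) :=
    .of_basis (he.stalkBasis hW)
  have hfin : Finite b := hb.finite
  obtain ⟨d, ⟨σ⟩⟩ := Finite.exists_equiv_fin b
  let v : Fin d → M.presheaf.stalk (genericPoint X) := fun i => (σ.symm i).1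
  have hv : LinearIndependent X.functionField v := hb.comp _ σ.symm.injective
  have hvs : ∀ g ∈ G, g ∈ Submodule.span X.functionField (Set.range v) := fun g hg => by
    have : Set.range v = b := by
      rw [show v = Subtype.val ∘ σ.symm from rfl, Set.range_comp, σ.symm.range_eq_univ, Set.image_univ,
        Subtype.range_coe]
    rw [this, hbs]
    exact Submodule.subset_span hg
  have hGU : ∀ (W : X.Opens) (hW : genericPoint X ∈ W), ∀ g ∈ G, ∃ t : Γ(M, W), gm M hW t = g := by
    rintro W hW _ ⟨t, rfl⟩
    exact ⟨rs M le_top t, gm_rs M _ _ _⟩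
  obtain ⟨S, hS, hS'⟩ := exists_finite_quotient_coefficients s hM hU hηU v G (hGU U hηU) hvs
  obtain ⟨T, hT, hT'⟩ := exists_finite_quotient_coefficients s hM hV hηV v G (hGU V hηV) hvs
  -- For a section in both `S` and `T` the coefficients are regular on `U` and on `V`, hence global
  -- functions, and these form a finite-dimensional space by properness.
  have hST : Module.Finite ℂ (S ⊓ T : Submodule ℂ G) := by
    let : Module ℂ Γ(X, ⊤) := Module.compHom _ (scalars s ⊤)
    have hfin : Module.Finite ℂ Γ(X, ⊤) := finite_scalars_top s
    let Φ : (Fin d → Γ(X, ⊤)) →ₗ[ℂ] M.presheaf.stalk (genericPoint X) :=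
      { toFun := fun a : Fin d → Γ(X, ⊤) => ∑ i, gr X hη (a i) • v i
        map_add' := fun a a' => by simp only [Pi.add_apply, map_add, add_smul, Finset.sum_add_distrib]
        map_smul' := fun z a => by
          rw [Finset.smul_sum]
          refine Finset.sum_congr rfl fun i _ => ?_
          change gr X hη (scalars s (⊤ : X.Opens) z * a i) • v i =
            stalkScalars s (genericPoint X) z • (gr X hη (a i) • v i)
          rw [map_mul, mul_smul]
          rfl }
    have hΦ : ∀ g ∈ S ⊓ T, (g : M.presheaf.stalk (genericPoint X)) ∈ LinearMap.range Φ := by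
      rintro g ⟨h1, h2⟩
      obtain ⟨a, ha⟩ := hS' g h1
      obtain ⟨a', ha'⟩ := hT' g h2
      have haa : ∀ i, gr X hηU (a i) = gr X hηV (a' i) := by
        have h3 := (Fintype.linearIndependent_iffₛ.mp hv) _ _ (ha.symm.trans ha')
        exact h3
      have hc : ∀ i, ∃ c : Γ(X, ⊤), gr X hη c = gr X hηU (a i) := fun i => by
        obtain ⟨c, hc, -⟩ := function_glue_two (W := ⊤) le_top le_top hUV.ge (a i) (a' i) (by
          rw [← sub_eq_zero]
          refine eq_zero_of_gr_eta (show genericPoint X ∈ U ⊓ V from ⟨hηU, hηV⟩) _ ?_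
          rw [map_sub, gr_rr, gr_rr, haa, sub_self])
        exact ⟨c, by rw [← hc, gr_rr]⟩
      choose c hc using hc
      refine ⟨c, ?_⟩
      rw [ha]
      change ∑ i, gr X hη (c i) • v i = _
      exact Finset.sum_congr rfl fun i _ => by rw [hc]
    exact Module.Finite.of_injective
      ((G.subtype.comp (S ⊓ T).subtype).codRestrict (LinearMap.range Φ) fun g => hΦ g.1 g.2)
      fun g g' h => by
        have h1 := congrArg Subtype.val h
        exact Subtype.ext (Subtype.ext h1)
  exact finite_of_finite_quotients S T

lemma finite_ker_cechDiff [IsProper s] {M : X.Modules} (hM : HasBases M)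
    {U V : X.Opens} (hU : IsAffineOpen U) (hV : IsAffineOpen V) (hUV : U ⊔ V = ⊤) :
    Module.Finite ℂ (LinearMap.ker (cechDiff s U V M)) := by
  have hfin : Module.Finite ℂ (Sections s M ⊤) := by
    -- An open set without the generic point is empty; the other one is then the whole curve and
    -- plays both roles.
    by_cases hηU : genericPoint X ∈ U
    · by_cases hηV : genericPoint X ∈ V
      · exact finite_sections_top s hM hU hV hUV hηU hηV
      · obtain rfl := subsingleton_of_eta_notMem hηV
        refine finite_sections_top s hM hU hU ?_ hηU hηU
        simpa using hUV
    · obtain rfl := subsingleton_of_eta_notMem hηU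
      have hV' : V = ⊤ := by simpa using hUV
      refine finite_sections_top s hM hV hV (by simpa using hUV) ?_ ?_ <;> rw [hV'] <;> trivial
  let φ : Sections s M ⊤ →ₗ[ℂ] LinearMap.ker (cechDiff s U V M) :=
    ((res s M le_top).prod (res s M le_top)).codRestrict _ fun t => by
      rw [LinearMap.mem_ker]
      change rs M _ (rs M _ _) - rs M _ (rs M _ _) = 0
      exact sub_eq_zero.mpr ((rs_rs M _ _ _).trans (rs_rs M _ _ _).symm)
  refine Module.Finite.of_surjective φ fun ⟨⟨u, v⟩, huv⟩ => ?_
  have huv' : rs M (inf_le_left : U ⊓ V ≤ U) u = rs M (inf_le_right : U ⊓ V ≤ V) v :=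
    sub_eq_zero.mp huv
  obtain ⟨t, htU, htV⟩ := section_glue_two M (W := ⊤) le_top le_top hUV.ge u v huv'
  exact ⟨t, Subtype.ext (Prod.ext htU htV)⟩

end Finiteness


/-! ### Powers and polynomials in an element of the maximal ideal -/

section Valuation

/-- The denominator of `c` is a unit times `π ^ n`, and it is absorbed by `t ^ m` for `m ≥ n`
because `π` divides `t`. -/
lemma eventually_pow_mul_mem_range {L K : Type*} [CommRing L] [IsDomain L] [IsLocalRing L]
    [IsPrincipalIdealRing L] [Field K] [Algebra L K] [IsFractionRing L K] {t : L} (ht : t ≠ 0)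
    (htm : t ∈ IsLocalRing.maximalIdeal L) (c : K) :
    ∀ᶠ n : ℕ in Filter.atTop, algebraMap L K t ^ n * c ∈ (algebraMap L K).range := by
  obtain ⟨a, b, hb, rfl⟩ := IsFractionRing.div_surjective (A := L) c
  have hb0 : b ≠ 0 := nonZeroDivisors.ne_zero hb
  obtain ⟨π, hπ⟩ := (IsPrincipalIdealRing.principal (IsLocalRing.maximalIdeal L)).principal
  obtain ⟨n, u, rfl⟩ := exists_eq_pow_mul_unit hπ hb0
  have hdvd : π ∣ t := by
    rw [hπ] at htm
    exact Ideal.mem_span_singleton.mp htm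
  obtain ⟨w, rfl⟩ := hdvd
  filter_upwards [Filter.eventually_ge_atTop n] with m hm
  refine ⟨(π * w) ^ (m - n) * w ^ n * ↑u⁻¹ * a, ?_⟩
  have hb' : algebraMap L K (π ^ n * u) ≠ 0 := fun h =>
    hb0 ((IsFractionRing.injective L K) (h.trans (map_zero _).symm))
  rw [mul_div_assoc', eq_div_iff hb', ← map_pow, ← map_mul, ← map_mul]
  congr 1
  rw [← pow_sub_mul_pow (π * w) hm]
  have hu : (↑u⁻¹ : L) * u = 1 := Units.inv_mul u
  calc (π * w) ^ (m - n) * w ^ n * ↑u⁻¹ * a * (π ^ n * ↑u)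
      = (π * w) ^ (m - n) * (w ^ n * π ^ n) * a * (↑u⁻¹ * u) := by ring
    _ = _ := by rw [hu, mul_one, mul_pow]; ring

-- Modulo the maximal ideal the value is the constant term, a nonzero complex number.
open Polynomial in
lemma isUnit_eval₂_of_mem_maximalIdeal {L : Type*} [CommRing L] [IsLocalRing L] (φ : ℂ →+* L) {t : L}
    (ht : t ∈ IsLocalRing.maximalIdeal L) {q : ℂ[X]} (hq : q.coeff 0 ≠ 0) :
    IsUnit (eval₂ φ t q) := by
  rw [← divX_mul_X_add q, eval₂_add, eval₂_mul, eval₂_X, eval₂_C]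
  have h1 : IsUnit (φ (q.coeff 0)) := (isUnit_iff_ne_zero.mpr hq).map φ
  by_contra h2
  have h3 : φ (q.coeff 0) ∈ IsLocalRing.maximalIdeal L := by
    have := (IsLocalRing.maximalIdeal L).sub_mem ((IsLocalRing.mem_maximalIdeal _).mpr h2)
      ((IsLocalRing.maximalIdeal L).mul_mem_left (eval₂ φ t q.divX) ht)
    rwa [add_sub_cancel_left] at this
  exact (IsLocalRing.mem_maximalIdeal _).mp h3 h1

end Valuation

/-! ### Finiteness of the first cohomology -/

section Poles

variable {X : Scheme.{0}} (s : X ⟶ Spec (.of ℂ)) [IsSmoothCurve X]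

/-- A function on an affine open `U` over which `Γ(X, U)` is finite has poles outside `U`. -/
lemma notMem_range_of_notMem [IsSeparated s] {U : X.Opens} (hU : IsAffineOpen U)
    (hη : genericPoint X ∈ U) (x : Γ(X, U))
    (hx : letI := (scalars s U).toAlgebra
      (Polynomial.aeval x : Polynomial ℂ →ₐ[ℂ] Γ(X, U)).toRingHom.Finite) {y : X} (hy : y ∉ U) :
    gr X hη x ∉ (algebraMap (X.presheaf.stalk y) X.functionField).range := by
  rintro ⟨x', hx'⟩
  have := IsSmoothCurve.pid y
  refine hy (mem_of_forall_mem_range_algebraMap s hU hη y fun f => ?_)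
  let := (scalars s U).toAlgebra
  obtain ⟨p, hp, hpf⟩ := hx.to_isIntegral f
  let φ : Polynomial ℂ →+* X.presheaf.stalk y := Polynomial.eval₂RingHom (stalkScalars s y) x'
  have hφ : (algebraMap (X.presheaf.stalk y) X.functionField).comp φ =
      (gr X hη).comp (Polynomial.aeval x : Polynomial ℂ →ₐ[ℂ] Γ(X, U)).toRingHom := by
    refine Polynomial.ringHom_ext (fun z => ?_) ?_
    · have h1 : (Polynomial.aeval x : Polynomial ℂ →ₐ[ℂ] Γ(X, U)) (Polynomial.C z) = scalars s U z :=
        Polynomial.aeval_C x z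
      have h2 : φ (Polynomial.C z) = stalkScalars s y z := Polynomial.eval₂_C _ _
      change algebraMap _ _ (φ (Polynomial.C z)) = gr X hη (Polynomial.aeval x (Polynomial.C z))
      rw [h1, h2, gr_scalars, algebraMap_stalkScalars]
    · have h1 : (Polynomial.aeval x : Polynomial ℂ →ₐ[ℂ] Γ(X, U)) Polynomial.X = x := Polynomial.aeval_X x
      have h2 : φ Polynomial.X = x' := Polynomial.eval₂_X _ _
      change algebraMap _ _ (φ Polynomial.X) = gr X hη (Polynomial.aeval x Polynomial.X)
      rw [h1, h2, hx']
  -- If `x` were regular at `y`, every function on `U`, being integral over `ℂ[x]`, would be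
  -- integral over the normal local ring at `y` and hence regular there. This would force `y ∈ U`.
  have hint : IsIntegral (X.presheaf.stalk y) (gr X hη f : X.functionField) := by
    refine ⟨p.map φ, hp.map φ, ?_⟩
    rw [Polynomial.eval₂_map, hφ]
    have := congrArg (gr X hη) hpf
    rw [map_zero, Polynomial.hom_eval₂] at this
    exact this
  exact (IsIntegrallyClosed.isIntegral_iff (R := X.presheaf.stalk y)).mp hint

/-- Finiteness of the first cohomology of a vector bundle on a complete smooth curve. -/
lemma finite_quotient_cechDiff [IsProper s] {M : X.Modules} (hM : HasBases M)
    {U V : X.Opens} (hU : IsAffineOpen U) :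
    Module.Finite ℂ (Sections s M (U ⊓ V) ⧸ LinearMap.range (cechDiff s U V M)) := by
  by_cases hηUV : genericPoint X ∉ U ⊓ V
  · have h1 : Subsingleton (Sections s M (U ⊓ V)) :=
      ⟨fun a b => section_ext M (W := U ⊓ V) a b fun x hx => (hηUV (eta_mem hx)).elim⟩
    infer_instance
  push Not at hηUV
  have hη := hηUV.1
  have hηV := hηUV.2
  -- If `V ≤ U`, then `U ⊓ V` is `V` and the differential is surjective. Otherwise a point of `V`
  -- outside `U` provides a pole.
  by_cases hVU : V ≤ U
  · have h1 : LinearMap.range (cechDiff s U V M) = ⊤ := by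
      rw [LinearMap.range_eq_top]
      intro f
      refine ⟨(0, -(show Γ(M, V) from rs M (le_inf hVU le_rfl) (show Γ(M, U ⊓ V) from f))), ?_⟩
      change rs M _ 0 - rs M _ (-(rs M _ _)) = _
      rw [map_zero, map_neg, rs_rs, rs_self, sub_neg_eq_add, zero_add]
    rw [h1]
    infer_instance
  obtain ⟨y₀, hy₀V, hy₀U⟩ := Set.not_subset.mp hVU
  let := genericStalkModule s M
  let := functionFieldAlgebra s
  have : IsScalarTower ℂ X.functionField (M.presheaf.stalk (genericPoint X)) :=
    ⟨fun z f m => by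
      rw [Algebra.smul_def, mul_smul]
      rfl⟩
  let : Algebra ℂ Γ(X, U) := (scalars s U).toAlgebra
  have : Algebra.FiniteType ℂ Γ(X, U) := finiteType_scalars s hU
  have := dimensionLEOne_of_isAffineOpen hU
  have : Nonempty U := ⟨⟨_, hη⟩⟩
  obtain ⟨x₀, hx₀⟩ := exists_aeval_finite Γ(X, U)
  let x : X.functionField := gr X hη x₀
  have hpole : ∀ y, y ∉ U → x ∉ (algebraMap (X.presheaf.stalk y) X.functionField).range :=
    fun y hy => notMem_range_of_notMem s hU hη x₀ hx₀ hy
  have hx : x ≠ 0 := fun h => hpole y₀ hy₀U (h ▸ zero_mem _)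
  have haeval : ∀ q : Polynomial ℂ, Polynomial.aeval x q = gr X hη (Polynomial.aeval x₀ q) := fun q => by
    have h1 : (algebraMap ℂ X.functionField) = (gr X hη).comp (algebraMap ℂ Γ(X, U)) :=
      RingHom.ext fun z => (gr_scalars s hη z).symm
    rw [Polynomial.aeval_def, h1, ← Polynomial.hom_eval₂]
    rfl
  -- `x` is transcendental: an algebraic element would be integral over `ℂ`, hence regular at `y₀`,
  -- where `x` has a pole.
  have htrans : ∀ q : Polynomial ℂ, q ≠ 0 → Polynomial.aeval x q ≠ 0 := fun q hq h => by
    have h1 : IsIntegral ℂ x := isAlgebraic_iff_isIntegral.mp ⟨q, hq, h⟩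
    obtain ⟨p, hp, hp0⟩ := h1
    have := IsSmoothCurve.pid y₀
    refine hpole y₀ hy₀U ((IsIntegrallyClosed.isIntegral_iff (R := X.presheaf.stalk y₀)).mp
      ⟨p.map (stalkScalars s y₀), hp.map _, ?_⟩)
    rw [Polynomial.eval₂_map]
    have h2 : (algebraMap (X.presheaf.stalk y₀) X.functionField).comp (stalkScalars s y₀) =
        algebraMap ℂ X.functionField := RingHom.ext fun z => algebraMap_stalkScalars s y₀ z
    rw [h2]
    exact hp0
  -- Local rings are valuation rings, so at a pole of `x` the inverse of `x` is regular and
  -- vanishes.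
  have hinv : ∀ y, y ∉ U → ∃ t : X.presheaf.stalk y, t ∈ IsLocalRing.maximalIdeal _ ∧
      algebraMap (X.presheaf.stalk y) X.functionField t = x⁻¹ := fun y hy => by
    have := IsSmoothCurve.pid y
    rcases ValuationRing.isInteger_or_isInteger (X.presheaf.stalk y) x with h | ⟨t, ht⟩
    · exact (hpole y hy h).elim
    · refine ⟨t, fun hu => hpole y hy ?_, ht⟩
      obtain ⟨u, rfl⟩ := hu
      refine ⟨↑u⁻¹, ?_⟩
      have h2 := map_units_inv (algebraMap (X.presheaf.stalk y) X.functionField) u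
      rw [h2, ht, inv_inv]
  -- `O` and `Q` consist of the rational functions and rational sections regular at the points of
  -- `V` outside `U`, and `P` of the sections over `U`. The obstruction to splitting a section over
  -- `U ⊓ V` lies in the generic stalk modulo `P ⊔ Q`.
  let O : Subalgebra ℂ X.functionField :=
    { carrier := {a | ∀ y ∈ V, y ∉ U → a ∈ (algebraMap (X.presheaf.stalk y) X.functionField).range}
      mul_mem' := fun ha hb y hy hy' => mul_mem (ha y hy hy') (hb y hy hy')
      add_mem' := fun ha hb y hy hy' => add_mem (ha y hy hy') (hb y hy hy')
      algebraMap_mem' := fun z y _ _ => ⟨stalkScalars s y z, algebraMap_stalkScalars s y z⟩ }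
  let P : Submodule ℂ (M.presheaf.stalk (genericPoint X)) := LinearMap.range (germLinear s M hη)
  let Q : Submodule ℂ (M.presheaf.stalk (genericPoint X)) :=
    { carrier := {e | ∀ y ∈ V, y ∉ U → ∃ m, spm M y m = e}
      add_mem' := fun {a b} ha hb y hy hy' => by
        obtain ⟨m, rfl⟩ := ha y hy hy'
        obtain ⟨m', rfl⟩ := hb y hy hy'
        exact ⟨m + m', map_add _ _ _⟩
      zero_mem' := fun y _ _ => ⟨0, map_zero _⟩
      smul_mem' := fun z a ha y hy hy' => by
        obtain ⟨m, rfl⟩ := ha y hy hy'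
        refine ⟨stalkScalars s y z • m, ?_⟩
        rw [map_smulₛₗ, algebraMap_stalkScalars]
        rfl }
  have : Module.Finite Γ(X, U) Γ(M, U) := (isCoherent_of_bases hM).finite U hU
  obtain ⟨m, g, hg⟩ : ∃ (m : ℕ) (g : Fin m → Γ(M, U)), ∀ t, ∃ p : Fin m → Polynomial ℂ,
      t = ∑ i, Polynomial.aeval x₀ (p i) • g i := by
    let : Algebra (Polynomial ℂ) Γ(X, U) :=
      (Polynomial.aeval x₀ : Polynomial ℂ →ₐ[ℂ] Γ(X, U)).toRingHom.toAlgebra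
    let : Module (Polynomial ℂ) Γ(M, U) :=
      Module.compHom _ (Polynomial.aeval x₀ : Polynomial ℂ →ₐ[ℂ] Γ(X, U)).toRingHom
    have : IsScalarTower (Polynomial ℂ) Γ(X, U) Γ(M, U) :=
      ⟨fun p f t => by
        rw [Algebra.smul_def, mul_smul]
        rfl⟩
    have : Module.Finite (Polynomial ℂ) Γ(X, U) := hx₀
    have : Module.Finite (Polynomial ℂ) Γ(M, U) := Module.Finite.trans Γ(X, U) Γ(M, U)
    obtain ⟨m, g, hg⟩ := Module.Finite.exists_fin (R := Polynomial ℂ) (M := Γ(M, U))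
    refine ⟨m, g, fun t => ?_⟩
    obtain ⟨p, hp⟩ := (Submodule.mem_span_range_iff_exists_fun _).mp (hg ▸ Submodule.mem_top : t ∈ _)
    exact ⟨p, hp.symm⟩
  have hfinS : {y : X | y ∉ U}.Finite :=
    finite_of_genericPoint_notMem (Z := {y : X | y ∉ U}) U.2.isClosed_compl fun h => h hη
  -- Only finitely many points lie outside `U` and there are finitely many generators `g i`, so one
  -- power of `x⁻¹` removes all their poles.
  have hM' : ∀ᶠ n : ℕ in Filter.atTop, ∀ y ∈ {y : X | y ∉ U}, ∀ i, ∃ m, spm M y m =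
      x⁻¹ ^ n • gm M hη (g i) := by
    rw [Filter.eventually_all_finite hfinS]
    intro y hy
    rw [Filter.eventually_all]
    intro i
    obtain ⟨t, htm, ht⟩ := hinv y hy
    have := IsSmoothCurve.pid y
    have ht0 : t ≠ 0 := by
      rintro rfl
      rw [map_zero] at ht
      exact inv_ne_zero hx ht.symm
    obtain ⟨W, n, e, hyW, he⟩ := hM y
    let c := (he.stalkBasis (eta_mem hyW)).repr (gm M hη (g i))
    have hc : gm M hη (g i) = ∑ k, c k • gm M (eta_mem hyW) (e k) := by
      conv_lhs => rw [← (he.stalkBasis (eta_mem hyW)).sum_repr (gm M hη (g i))]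
      simp only [he.stalkBasis_apply]
      rfl
    have h1 : ∀ᶠ N : ℕ in Filter.atTop, ∀ k, x⁻¹ ^ N * c k ∈
        (algebraMap (X.presheaf.stalk y) X.functionField).range := by
      rw [Filter.eventually_all]
      intro k
      have := eventually_pow_mul_mem_range (K := X.functionField) ht0 htm (c k)
      rwa [ht] at this
    filter_upwards [h1] with N hN
    choose w hw using hN
    refine ⟨∑ k, w k • gm M hyW (e k), ?_⟩
    rw [map_sum, hc, Finset.smul_sum]
    refine Finset.sum_congr rfl fun k _ => ?_
    rw [map_smulₛₗ, hw, spm_gm, mul_smul]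
  obtain ⟨N, hN⟩ := hM'.exists
  have hfinal : Module.Finite ℂ (M.presheaf.stalk (genericPoint X) ⧸ (P ⊔ Q)) := by
    refine finite_quotient_sup (K := X.functionField) hx (O := O) (fun y _ hy' => ?_)
      (fun q hq y hyV hy' => ?_) P Q ?_ ?_ (fun i => gm M hη (g i)) (fun i => ⟨g i, rfl⟩) (M := N)
      (fun i y _ hy' => hN y hy' i) (fun v => ?_)
    · obtain ⟨t, -, ht⟩ := hinv y hy'
      exact ⟨t, ht⟩
    · obtain ⟨t, htm, ht⟩ := hinv y hy'
      obtain ⟨u, hu⟩ := isUnit_eval₂_of_mem_maximalIdeal (stalkScalars s y) htm hq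
      refine ⟨↑u⁻¹, ?_⟩
      have h2 := map_units_inv (algebraMap (X.presheaf.stalk y) X.functionField) u
      rw [h2, hu, Polynomial.hom_eval₂, ht]
      congr 2
      exact RingHom.ext fun z => algebraMap_stalkScalars s y z
    · rintro _ ⟨t, rfl⟩
      exact ⟨show Sections s M U from x₀ • (show Γ(M, U) from t), gm_smul M hη x₀ t⟩
    · intro a ha e he y hy hy'
      obtain ⟨a', rfl⟩ := ha y hy hy'
      obtain ⟨m', rfl⟩ := he y hy hy'
      exact ⟨a' • m', map_smulₛₗ _ _ _⟩
    · obtain ⟨W, hW, t, rfl⟩ := exists_gm M v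
      obtain ⟨f, hfW, hηf⟩ := hU.exists_basicOpen_le ⟨genericPoint X, hW⟩ hη
      obtain ⟨n, u, hu⟩ := exists_rs_eq_pow_smul (isCoherent_of_bases hM).isQuasicoherent hU f
        (rs M hfW t)
      have hf0 : gr X hη f ≠ 0 := by
        have := (Scheme.mem_basicOpen _ _ _ hη).mp hηf
        exact this.ne_zero
      have hfn : f ^ n ∈ nonZeroDivisors Γ(X, U) := by
        refine mem_nonZeroDivisors_of_ne_zero (pow_ne_zero _ ?_)
        rintro rfl
        exact hf0 (map_zero _)
      let : Algebra (Polynomial ℂ) Γ(X, U) :=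
        (Polynomial.aeval x₀ : Polynomial ℂ →ₐ[ℂ] Γ(X, U)).toRingHom.toAlgebra
      -- The denominator `f ^ n` divides a nonzero polynomial in `x`, so every rational section is a
      -- combination of the generators with coefficients in `ℂ(x)`.
      have hint : IsIntegral (Polynomial ℂ) (f ^ n) := hx₀.to_isIntegral (f ^ n)
      obtain ⟨q, hq0, w, hw⟩ := hint.isAlgebraic.exists_nonzero_dvd hfn
      obtain ⟨p, hp⟩ := hg (w • u)
      have hq0' : q ≠ 0 := hq0
      refine ⟨p, q, hq0', ?_⟩
      have h1 : gm M hη u = gr X hη f ^ n • gm M hW t := by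
        have := congrArg (gm M hηf) hu
        rwa [gm_smul, map_pow, gm_rs, gm_rs, gr_rr] at this
      have h2 : Polynomial.aeval x q = gr X hη f ^ n * gr X hη w := by
        rw [haeval, ← map_pow, ← map_mul]
        exact congrArg _ hw
      have h3 : Polynomial.aeval x q • gm M hW t = ∑ i, Polynomial.aeval x (p i) • gm M hη (g i) := by
        rw [h2, mul_comm, mul_smul, ← h1, ← gm_smul, hp, map_sum]
        refine Finset.sum_congr rfl fun i _ => ?_
        rw [gm_smul, haeval]
      rw [← one_smul X.functionField (gm M hW t), ← inv_mul_cancel₀ (htrans q hq0'), mul_smul, h3,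
        Finset.smul_sum]
      refine Finset.sum_congr rfl fun i _ => ?_
      rw [smul_smul, div_eq_inv_mul]
  let ψ : Sections s M (U ⊓ V) →ₗ[ℂ] M.presheaf.stalk (genericPoint X) ⧸ (P ⊔ Q) :=
    (P ⊔ Q).mkQ.comp (germLinear s M hηUV)
  have hker : LinearMap.ker ψ ≤ LinearMap.range (cechDiff s U V M) := by
    intro f hf
    have hf' : germLinear s M hηUV f ∈ P ⊔ Q := (Submodule.Quotient.mk_eq_zero _).mp hf
    obtain ⟨_, ⟨u, rfl⟩, w, hw, huw⟩ := Submodule.mem_sup.mp hf'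
    -- The part `w` in `Q` is regular on all of `V`: outside `U` by definition of `Q`, and on `U ⊓
    -- V` as the difference of the given section and a section over `U`.
    obtain ⟨v, hv⟩ := hM.exists_gm_eta_eq hηV w fun y hy => by
      by_cases hyU : y ∈ U
      · have hw' : w = gm M hηUV (show Γ(M, U ⊓ V) from f) - gm M hη (show Γ(M, U) from u) :=
          eq_sub_of_add_eq' huw
        refine ⟨gm M (show y ∈ U ⊓ V from ⟨hyU, hy⟩) (show Γ(M, U ⊓ V) from f) -
          gm M hyU (show Γ(M, U) from u), ?_⟩
        rw [map_sub, spm_gm, spm_gm, hw']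
      · exact hw y hy hyU
    refine ⟨(u, -(show Sections s M V from v)), ?_⟩
    refine hM.gm_eta_injective hηUV ?_
    change gm M hηUV (rs M _ (show Γ(M, U) from u) - rs M _ (-v)) = _
    rw [map_sub, map_neg, map_neg, sub_neg_eq_add, gm_rs, gm_rs, hv]
    exact huw
  have h1 : Module.Finite ℂ (Sections s M (U ⊓ V) ⧸ LinearMap.ker ψ) :=
    .equiv ψ.quotKerEquivRange.symm
  exact Module.Finite.of_surjective (Submodule.factor hker) (Submodule.factor_surjective hker)

end Poles


lemma exists_comp_eq_of_surjective {R S Q : Type*} [CommRing R] [CommRing S] [CommRing Q]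
    (p : R →+* S) (hp : Function.Surjective p) (m : R →+* Q) (h : RingHom.ker p ≤ RingHom.ker m) :
    ∃ q : S →+* Q, q.comp p = m :=
  ⟨(p.liftOfRightInverse _ (Function.rightInverse_surjInv hp)) ⟨m, h⟩,
    p.liftOfRightInverse_comp _ _ ⟨m, h⟩⟩

lemma appLE_SpecMap_comp_fromSpec {X : Scheme.{0}} {W : X.Opens} (hW : IsAffineOpen W)
    {Q : CommRingCat.{0}} (q : Γ(X, W) ⟶ Q) (h : ⊤ ≤ (Spec.map q ≫ hW.fromSpec) ⁻¹ᵁ W) :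
    (Spec.map q ≫ hW.fromSpec).appLE W ⊤ h = q ≫ (Scheme.ΓSpecIso Q).inv := by
  refine (Scheme.Hom.comp_appLE _ _ _ _ _).trans ?_
  rw [hW.fromSpec_app_self, Category.assoc, Scheme.ΓSpecIso_inv_naturality, Scheme.Hom.appTop,
    Scheme.Hom.app_eq_appLE]
  exact congrArg _ (Scheme.Hom.map_appLE (Spec.map q) h (eqToHom hW.fromSpec_preimage_self).op)

/-! ### The node and functions on the nodal curve -/

namespace NodalCurve

variable (C : NodalCurve)

instance : IsReduced C.X₀ := C.isReduced
instance : IsProper C.str := C.isProper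
instance (j : Fin 2) : IsClosedImmersion (C.i j) := C.isClosedImmersion j
instance (j : Fin 2) : SmoothOfRelativeDimension 1 (C.compStr j) := C.smooth j
instance (j : Fin 2) : IsProper (C.compStr j) := inferInstanceAs (IsProper (C.i j ≫ C.str))
instance (j : Fin 2) : IsSmoothCurve (C.X j) := isSmoothCurve_of_smooth (C.compStr j)

/-- The node, as a complex point of the components. -/
def nodeMap : ∀ j, Spec (.of ℂ) ⟶ C.X j
  | 0 => haveI := C.node
      inv (pullback.fst (C.i 0) (C.i 1) ≫ C.i 0 ≫ C.str) ≫ pullback.fst (C.i 0) (C.i 1)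
  | 1 => haveI := C.node
      inv (pullback.fst (C.i 0) (C.i 1) ≫ C.i 0 ≫ C.str) ≫ pullback.snd (C.i 0) (C.i 1)

lemma nodeMap_comp : C.nodeMap 0 ≫ C.i 0 = C.nodeMap 1 ≫ C.i 1 := by
  simp only [nodeMap, Category.assoc, pullback.condition]

lemma nodeMap_compStr (j : Fin 2) : C.nodeMap j ≫ C.compStr j = 𝟙 _ := by
  have := C.node
  have h0 : C.nodeMap 0 ≫ C.compStr 0 = 𝟙 _ := by
    simp only [nodeMap, compStr, Category.assoc]
    exact IsIso.inv_hom_id _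
  match j with
  | 0 => exact h0
  | 1 => rw [← h0, compStr, compStr, ← Category.assoc, ← Category.assoc, nodeMap_comp]

/-- The point of the component lying over the node. -/
def z (j : Fin 2) : C.X j := C.nodeMap j (IsLocalRing.closedPoint ℂ)

/-- The node. -/
def x₀ : C.X₀ := C.i 0 (C.z 0)

lemma i_z (j : Fin 2) : C.i j (C.z j) = C.x₀ := by
  match j with
  | 0 => rfl
  | 1 =>
    have h := congrArg (fun f : Spec (.of ℂ) ⟶ C.X₀ => f (IsLocalRing.closedPoint ℂ)) C.nodeMap_comp
    exact h.symm

lemma subsingleton_spec (a b : Spec (.of ℂ)) : a = b :=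
  Subsingleton.elim (α := PrimeSpectrum ℂ) a b

/-- The fibre product of the two components is isomorphic to the spectrum of `ℂ`, so it has a single
point. -/
lemma eq_z_of_eq {a : C.X 0} {b : C.X 1} (h : C.i 0 a = C.i 1 b) : a = C.z 0 ∧ b = C.z 1 := by
  have := C.node
  let φ := pullback.fst (C.i 0) (C.i 1) ≫ C.i 0 ≫ C.str
  obtain ⟨p, rfl, rfl⟩ := Scheme.Pullback.exists_preimage_pullback a b h
  have hp : p = inv φ (IsLocalRing.closedPoint ℂ) := by
    have h1 : inv φ (φ p) = p := by
      rw [← Scheme.Hom.comp_apply, IsIso.hom_inv_id]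
      rfl
    rw [← h1]
    exact congrArg _ (subsingleton_spec _ _)
  rw [hp]
  exact ⟨rfl, rfl⟩

lemma eq_z {j j' : Fin 2} (hj : j' ≠ j) {a : C.X j} {b : C.X j'} (h : C.i j a = C.i j' b) :
    a = C.z j := by
  match j, j' with
  | 0, 0 => exact (hj rfl).elim
  | 0, 1 => exact (C.eq_z_of_eq h).1
  | 1, 0 => exact (C.eq_z_of_eq h.symm).2
  | 1, 1 => exact (hj rfl).elim

lemma i_injective (j : Fin 2) : Function.Injective (C.i j) :=
  (C.i j).isClosedEmbedding.injective

lemma eq_z_of_i_eq {j : Fin 2} {a : C.X j} (h : C.i j a = C.x₀) : a = C.z j :=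
  C.i_injective j (h.trans (C.i_z j).symm)

lemma isClosed_z (j : Fin 2) : IsClosed {C.z j} := by
  obtain ⟨j', hj'⟩ : ∃ j' : Fin 2, j' ≠ j := exists_ne j
  have h : {C.z j} = C.i j ⁻¹' Set.range (C.i j') := by
    ext a
    constructor
    · rintro rfl
      exact ⟨C.z j', (C.i_z j').trans (C.i_z j).symm⟩
    · rintro ⟨b, hb⟩
      exact C.eq_z hj' hb.symm
  rw [h]
  exact (C.i j').isClosedEmbedding.isClosed_range.preimage (C.i j).continuous

lemma isClosed_x₀ : IsClosed {C.x₀} := by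
  have h := (C.i 0).isClosedEmbedding.isClosedMap _ (C.isClosed_z 0)
  rwa [Set.image_singleton] at h

/-- The value at the node of a germ of functions on a component. -/
def ev (j : Fin 2) : (C.X j).presheaf.stalk (C.z j) →+* ℂ :=
  (Scheme.stalkClosedPointTo (C.nodeMap j)).hom

lemma top_le_preimage {j : Fin 2} {W : (C.X j).Opens} (hW : C.z j ∈ W) :
    ⊤ ≤ (C.nodeMap j) ⁻¹ᵁ W := fun a _ => by
  rw [subsingleton_spec a (IsLocalRing.closedPoint ℂ)]
  exact hW

lemma ev_gr (j : Fin 2) {W : (C.X j).Opens} (hW : C.z j ∈ W) (f : Γ(C.X j, W)) :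
    C.ev j (gr (C.X j) hW f) = (Scheme.ΓSpecIso (.of ℂ)).hom.hom
      (((C.nodeMap j).appLE W ⊤ (C.top_le_preimage hW)).hom f) := by
  have h := ConcreteCategory.congr_hom (Scheme.germ_stalkClosedPointTo (C.nodeMap j) W hW) f
  exact h

lemma ev_gr_eq_zero_iff (j : Fin 2) {W : (C.X j).Opens} (hW : C.z j ∈ W) (f : Γ(C.X j, W)) :
    C.ev j (gr (C.X j) hW f) = 0 ↔ ((C.nodeMap j).appLE W ⊤ (C.top_le_preimage hW)).hom f = 0 := by
  rw [ev_gr]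
  exact map_eq_zero_iff (Scheme.ΓSpecIso (.of ℂ)).hom.hom
    (ConcreteCategory.bijective_of_isIso (Scheme.ΓSpecIso (.of ℂ)).hom).injective

lemma ev_stalkScalars (j : Fin 2) (c : ℂ) : C.ev j (stalkScalars (C.compStr j) (C.z j) c) = c := by
  have h1 : (C.compStr j).appLE ⊤ ⊤ le_top ≫ (C.nodeMap j).appLE ⊤ ⊤ le_top = 𝟙 _ := by
    refine (Scheme.Hom.appLE_comp_appLE _ _ _ _ _ _ _).trans ?_
    have : ∀ g : Spec (.of ℂ) ⟶ Spec (.of ℂ), g = 𝟙 _ → ∀ h, g.appLE ⊤ ⊤ h = 𝟙 _ := by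
      rintro g rfl h
      exact (Scheme.Hom.appLE_eq_app _).trans (Scheme.Hom.id_app _)
    exact this _ (C.nodeMap_compStr j) _
  rw [stalkScalars, RingHom.comp_apply, ev_gr]
  have h2 := ConcreteCategory.congr_hom h1 ((Scheme.ΓSpecIso (.of ℂ)).inv.hom c)
  have h3 := ConcreteCategory.congr_hom (Scheme.ΓSpecIso (.of ℂ)).inv_hom_id c
  exact (congrArg (Scheme.ΓSpecIso (.of ℂ)).hom.hom h2).trans h3

lemma ev_pf {W : C.X₀.Opens} (h₀ : C.z 0 ∈ C.i 0 ⁻¹ᵁ W) (h₁ : C.z 1 ∈ C.i 1 ⁻¹ᵁ W)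
    (f : Γ(C.X₀, W)) :
    C.ev 0 (gr (C.X 0) h₀ (pf (C.i 0) W f)) = C.ev 1 (gr (C.X 1) h₁ (pf (C.i 1) W f)) := by
  rw [ev_gr, ev_gr]
  have h2 : (C.i 0).app W ≫ (C.nodeMap 0).appLE _ ⊤ (C.top_le_preimage h₀) =
      (C.i 1).app W ≫ (C.nodeMap 1).appLE _ ⊤ (C.top_le_preimage h₁) := by
    rw [Scheme.Hom.app_eq_appLE, Scheme.Hom.app_eq_appLE, Scheme.Hom.appLE_comp_appLE,
      Scheme.Hom.appLE_comp_appLE]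
    have : ∀ g g' : Spec (.of ℂ) ⟶ C.X₀, g = g' → ∀ h h', g.appLE W ⊤ h = g'.appLE W ⊤ h' := by
      rintro g _ rfl _ _
      rfl
    exact this _ _ C.nodeMap_comp _ _
  exact congrArg (Scheme.ΓSpecIso (.of ℂ)).hom.hom (ConcreteCategory.congr_hom h2 f)

lemma pf_scalars (j : Fin 2) (W : C.X₀.Opens) (c : ℂ) :
    pf (C.i j) W (scalars C.str W c) = scalars (C.compStr j) (C.i j ⁻¹ᵁ W) c := by
  have h : C.str.appLE ⊤ W le_top ≫ (C.i j).app W = (C.compStr j).appLE ⊤ (C.i j ⁻¹ᵁ W) le_top := by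
    rw [Scheme.Hom.app_eq_appLE]
    exact Scheme.Hom.appLE_comp_appLE _ _ _ _ _ _ _
  exact ConcreteCategory.congr_hom h _

/-- The basic open set of such a function meets neither component, hence is empty; on a reduced
scheme the function is then zero. -/
lemma pf_injective {W : C.X₀.Opens} (f : Γ(C.X₀, W)) (h : ∀ j, pf (C.i j) W f = 0) : f = 0 := by
  rw [← basicOpen_eq_bot_iff, eq_bot_iff]
  intro x hx
  obtain ⟨j, y, rfl⟩ := C.covers x
  have h1 : y ∈ C.i j ⁻¹ᵁ (C.X₀.basicOpen f) := hx
  rw [Scheme.preimage_basicOpen] at h1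
  have h2 : (C.i j).app W f = 0 := h j
  rw [h2, Scheme.basicOpen_zero] at h1
  exact h1

/-- The homomorphisms `q 0` and `q 1` define a morphism from the spectrum of `Q` to the intersection
of the components, which is a reduced point. So `q 0` factors through evaluation at the node. This
is where transversality of the branches enters. -/
lemma eq_zero_of_appLE_nodeMap_eq_zero {W : C.X₀.Opens} (hW : IsAffineOpen W)
    {Q : Type} [CommRing Q] (q : ∀ j, Γ(C.X j, C.i j ⁻¹ᵁ W) →+* Q)
    (hq : (q 0).comp (pf (C.i 0) W) = (q 1).comp (pf (C.i 1) W)) (f : Γ(C.X 0, C.i 0 ⁻¹ᵁ W))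
    (h : ∀ h : C.z 0 ∈ C.i 0 ⁻¹ᵁ W, C.ev 0 (gr (C.X 0) h f) = 0) : q 0 f = 0 := by
  have hWj : ∀ j, IsAffineOpen (C.i j ⁻¹ᵁ W) := fun j => hW.preimage (C.i j)
  let q' : ∀ j, Γ(C.X j, C.i j ⁻¹ᵁ W) ⟶ .of Q := fun j => CommRingCat.ofHom (q j)
  let τ : ∀ j, Spec (.of Q) ⟶ C.X j := fun j => Spec.map (q' j) ≫ (hWj j).fromSpec
  have hτ' : ∀ j, τ j ≫ C.i j = Spec.map ((C.i j).app W ≫ q' j) ≫ hW.fromSpec := fun j => by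
    have h1 := IsAffineOpen.SpecMap_appLE_fromSpec (C.i j) hW (hWj j) le_rfl
    rw [← Scheme.Hom.app_eq_appLE] at h1
    simp only [τ, Category.assoc]
    rw [← h1, Spec.map_comp, Category.assoc]
  have hq' : (C.i 0).app W ≫ q' 0 = (C.i 1).app W ≫ q' 1 := CommRingCat.hom_ext hq
  have hτ : τ 0 ≫ C.i 0 = τ 1 ≫ C.i 1 := by rw [hτ', hτ', hq']
  have := C.node
  let φ := pullback.fst (C.i 0) (C.i 1) ≫ C.i 0 ≫ C.str
  let γ := pullback.lift (τ 0) (τ 1) hτ ≫ φ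
  have hγ : τ 0 = γ ≫ C.nodeMap 0 := by
    change _ = (pullback.lift (τ 0) (τ 1) hτ ≫ φ) ≫ inv φ ≫ pullback.fst _ _
    rw [Category.assoc, IsIso.hom_inv_id_assoc, pullback.lift_fst]
  have hle : ⊤ ≤ τ 0 ⁻¹ᵁ (C.i 0 ⁻¹ᵁ W) := by
    change ⊤ ≤ Spec.map (q' 0) ⁻¹ᵁ ((hWj 0).fromSpec ⁻¹ᵁ (C.i 0 ⁻¹ᵁ W))
    rw [(hWj 0).fromSpec_preimage_self]
    exact le_rfl
  have h1 : (τ 0).appLE _ ⊤ hle = q' 0 ≫ (Scheme.ΓSpecIso (.of Q)).inv :=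
    appLE_SpecMap_comp_fromSpec (hWj 0) (q' 0) hle
  have h2 : (Scheme.ΓSpecIso (.of Q)).inv.hom (q 0 f) = ((τ 0).appLE _ ⊤ hle).hom f := by
    rw [h1]
    rfl
  refine (map_eq_zero_iff (Scheme.ΓSpecIso (.of Q)).inv.hom
    (ConcreteCategory.bijective_of_isIso (Scheme.ΓSpecIso (.of Q)).inv).injective).1 ?_
  rw [h2]
  by_cases hz : C.z 0 ∈ C.i 0 ⁻¹ᵁ W
  · have h3 := (C.ev_gr_eq_zero_iff 0 hz f).1 (h hz)
    have h4 : ∀ h, (γ ≫ C.nodeMap 0).appLE (C.i 0 ⁻¹ᵁ W) ⊤ h =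
        (C.nodeMap 0).appLE (C.i 0 ⁻¹ᵁ W) ⊤ (C.top_le_preimage hz) ≫ γ.appLE ⊤ ⊤ le_top := fun _ =>
      (Scheme.Hom.appLE_comp_appLE _ _ _ _ _ _ _).symm
    have h5 : ∀ g, g = γ ≫ C.nodeMap 0 → ∀ h, (g.appLE (C.i 0 ⁻¹ᵁ W) ⊤ h).hom f = 0 := by
      rintro g rfl h
      rw [h4]
      exact (congrArg (γ.appLE ⊤ ⊤ le_top).hom h3).trans (map_zero _)
    exact h5 _ hγ _
  -- Over an open set without the node, `Q` must be the zero ring.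
  · have hempty : IsEmpty (Spec (.of Q)) := ⟨fun a => hz (by
      have h6 : τ 0 a ∈ C.i 0 ⁻¹ᵁ W := hle (TopologicalSpace.Opens.mem_top a)
      have h7 : τ 0 a = C.z 0 := by
        rw [hγ]
        exact congrArg (C.nodeMap 0) (subsingleton_spec (γ a) _)
      rwa [h7] at h6)⟩
    have : Subsingleton Γ(Spec (.of Q), ⊤) := by
      have h8 : (⊤ : (Spec (.of Q)).Opens) = ⊥ := by
        ext a
        exact hempty.elim a
      rw [h8]
      infer_instance
    exact Subsingleton.elim _ _

lemma pf_surjective (j : Fin 2) {W : C.X₀.Opens} (hW : IsAffineOpen W) :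
    Function.Surjective (pf (C.i j) W) :=
  Scheme.Hom.app_surjective (C.i j) W hW

/-- Let `I j` be the ideal of the component `X j` in `W`. Lifts `a`, `b` of `f 0`, `f 1` have equal
images modulo `I 0 ⊔ I 1`, since that quotient only sees the value at the node. Writing `a - b = u +
v` with `u ∈ I 0` and `v ∈ I 1`, the function `a - u = b + v` restricts correctly to both
components. -/
lemma exists_pf_eq_of_isAffineOpen {W : C.X₀.Opens} (hW : IsAffineOpen W)
    (f : ∀ j, Γ(C.X j, C.i j ⁻¹ᵁ W))
    (h : ∀ h : ∀ j, C.z j ∈ C.i j ⁻¹ᵁ W, C.ev 0 (gr (C.X 0) (h 0) (f 0)) =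
      C.ev 1 (gr (C.X 1) (h 1) (f 1))) :
    ∃ a : Γ(C.X₀, W), ∀ j, pf (C.i j) W a = f j := by
  obtain ⟨a, ha⟩ := C.pf_surjective 0 hW (f 0)
  obtain ⟨b, hb⟩ := C.pf_surjective 1 hW (f 1)
  let I : Fin 2 → Ideal Γ(C.X₀, W) := fun j => RingHom.ker (pf (C.i j) W)
  have hq := fun j => exists_comp_eq_of_surjective (pf (C.i j) W) (C.pf_surjective j hW)
    (Ideal.Quotient.mk (I 0 ⊔ I 1)) (by
      rw [Ideal.mk_ker]
      match j with
      | 0 => exact le_sup_left (a := I 0)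
      | 1 => exact le_sup_right (b := I 1))
  choose q hq using hq
  have h1 : q 0 (pf (C.i 0) W (a - b)) = 0 := by
    refine C.eq_zero_of_appLE_nodeMap_eq_zero hW q ((hq 0).trans (hq 1).symm) _ fun h0 => ?_
    have h1 : C.z 1 ∈ C.i 1 ⁻¹ᵁ W := by
      change C.i 1 (C.z 1) ∈ W
      rwa [i_z, ← C.i_z 0]
    rw [map_sub, map_sub, map_sub, C.ev_pf h0 h1 b, ha, hb, sub_eq_zero]
    exact h (fun j => match j with | 0 => h0 | 1 => h1)
  have h2 : a - b ∈ I 0 ⊔ I 1 := Ideal.Quotient.eq_zero_iff_mem.1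
    ((RingHom.congr_fun (hq 0) (a - b)).symm.trans h1)
  obtain ⟨u, hu, v, hv, huv⟩ := Submodule.mem_sup.1 h2
  have hu : pf (C.i 0) W u = 0 := hu
  have hv : pf (C.i 1) W v = 0 := hv
  refine ⟨a - u, fun j => ?_⟩
  match j with
  | 0 => rw [map_sub, ha, hu, sub_zero]
  | 1 =>
    have : a - u = b + v := by rw [sub_eq_iff_eq_add, add_assoc, add_comm v u, huv]; abel
    rw [this, map_add, hb, hv, add_zero]

/-- Functions on the components that agree at the node are glued. -/
lemma exists_pf_eq {W : C.X₀.Opens} (f : ∀ j, Γ(C.X j, C.i j ⁻¹ᵁ W))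
    (h : ∀ h : ∀ j, C.z j ∈ C.i j ⁻¹ᵁ W, C.ev 0 (gr (C.X 0) (h 0) (f 0)) =
      C.ev 1 (gr (C.X 1) (h 1) (f 1))) :
    ∃ a : Γ(C.X₀, W), ∀ j, pf (C.i j) W a = f j := by
  have h1 : ∀ x : W, ∃ V : C.X₀.Opens, IsAffineOpen V ∧ x.1 ∈ V ∧ V ≤ W := fun x => by
    obtain ⟨V, hV, hx, hVW⟩ := TopologicalSpace.Opens.isBasis_iff_nbhd.mp
      C.X₀.isBasis_affineOpens x.2
    exact ⟨V, hV, hx, hVW⟩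
  choose V hV hxV hVW using h1
  have h2 := fun x => C.exists_pf_eq_of_isAffineOpen (hV x)
    (fun j => rr (C.X j) (pre_mono (C.i j) (hVW x)) (f j)) (fun h' => by
      rw [gr_rr, gr_rr]
      exact h fun j => pre_mono (C.i j) (hVW x) (h' j))
  choose a ha using h2
  obtain ⟨t, ht⟩ := function_glue V hVW (fun x hx => ⟨⟨x, hx⟩, hxV _⟩) a (fun x y => by
    rw [← sub_eq_zero]
    refine C.pf_injective _ fun j => ?_
    rw [map_sub, pf_rr, pf_rr, ha, ha, rr_rr, rr_rr, sub_self])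
  refine ⟨t, fun j => ?_⟩
  refine function_ext _ _ fun y hy => ⟨C.i j ⁻¹ᵁ V ⟨C.i j y, hy⟩, pre_mono _ (hVW _), hxV _, ?_⟩
  rw [← pf_rr (C.i j) (hVW ⟨C.i j y, hy⟩), ht, ha]

end NodalCurve


lemma subsingleton_sections {X : Scheme.{0}} (M : X.Modules) {W : X.Opens} (h : W = ⊥) :
    Subsingleton Γ(M, W) := by
  refine ⟨fun s t => section_ext M s t fun x hx => ?_⟩
  rw [h] at hx
  exact hx.elim

lemma subsingleton_functions {X : Scheme.{0}} {W : X.Opens} (h : W = ⊥) :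
    Subsingleton Γ(X, W) := by
  refine ⟨fun s t => function_ext s t fun x hx => ?_⟩
  rw [h] at hx
  exact hx.elim

lemma isBasisOn_of_eq_bot {X : Scheme.{0}} {M : X.Modules} {W : X.Opens} (h : W = ⊥) {n : ℕ}
    (e : Fin n → Γ(M, W)) : IsBasisOn M W e := by
  intro V hV
  have hV' : V = ⊥ := by rw [eq_bot_iff, ← h]; exact hV
  have := subsingleton_sections M hV'
  have := subsingleton_functions hV'
  exact ⟨fun _ _ _ => Subsingleton.elim _ _, fun _ => ⟨0, Subsingleton.elim _ _⟩⟩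

lemma IsBasisOn.map_of_bijective {X : Scheme.{0}} {M N : X.Modules} (f : M ⟶ N) [IsIso f] {n : ℕ}
    {W : X.Opens} {e : Fin n → Γ(M, W)} (he : IsBasisOn M W e) :
    IsBasisOn N W (fun k => ap f W (e k)) := by
  intro V h
  have h1 := (ap_bijective f V).comp (he V h)
  convert h1 using 1
  funext a
  simp only [Function.comp, map_sum, map_smul, ap_rs]

/-! ### Sections on the components with equal values at the node -/

namespace NodalCurve

variable (C : NodalCurve)

lemma z_mem {W : C.X₀.Opens} (hx : C.x₀ ∈ W) (j : Fin 2) : C.z j ∈ C.i j ⁻¹ᵁ W := by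
  change C.i j (C.z j) ∈ W
  rwa [i_z]

lemma x₀_mem {W : C.X₀.Opens} {j : Fin 2} (h : C.z j ∈ C.i j ⁻¹ᵁ W) : C.x₀ ∈ W := by
  rwa [← C.i_z j]

lemma exists_opens {j : Fin 2} (V : (C.X j).Opens) (hV : C.z j ∉ V) :
    ∃ W : C.X₀.Opens, C.i j ⁻¹ᵁ W = V ∧ ∀ j', j' ≠ j → C.i j' ⁻¹ᵁ W = ⊥ := by
  obtain ⟨j', hj⟩ := exists_ne j
  have h1 : IsClosed (C.i j '' (V : Set (C.X j))ᶜ ∪ Set.range (C.i j')) :=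
    ((C.i j).isClosedEmbedding.isClosedMap _ V.isOpen.isClosed_compl).union
      (C.i j').isClosedEmbedding.isClosed_range
  refine ⟨⟨_, h1.isOpen_compl⟩, ?_, fun k hk => ?_⟩
  · ext y
    constructor
    · intro hy
      by_contra hyV
      exact hy (Or.inl ⟨y, hyV, rfl⟩)
    · rintro hy (⟨y', hy', h⟩ | ⟨a, ha⟩)
      · exact hy' (C.i_injective j h ▸ hy)
      · exact hV (C.eq_z hj ha.symm ▸ hy)
  · obtain rfl : k = j' := by omega
    rw [eq_bot_iff]
    intro y hy
    exact hy (Or.inr ⟨y, rfl⟩)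

lemma exists_nhds_x₀ (V : ∀ j, (C.X j).Opens) (hV : ∀ j, C.z j ∈ V j) :
    ∃ W : C.X₀.Opens, C.x₀ ∈ W ∧ ∀ j, C.i j ⁻¹ᵁ W ≤ V j := by
  have h1 : IsClosed (⋃ j, C.i j '' (V j : Set (C.X j))ᶜ) :=
    isClosed_iUnion_of_finite fun j =>
      (C.i j).isClosedEmbedding.isClosedMap _ (V j).isOpen.isClosed_compl
  refine ⟨⟨_, h1.isOpen_compl⟩, fun hx => ?_, fun j y hy => ?_⟩
  · obtain ⟨j, y, hy, h⟩ := Set.mem_iUnion.1 hx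
    exact hy (C.eq_z_of_i_eq h ▸ hV j)
  · by_contra hyV
    exact hy (Set.mem_iUnion.2 ⟨j, y, hyV, rfl⟩)

/-- The complement of the node. -/
def nodeCompl : C.X₀.Opens := ⟨{C.x₀}ᶜ, C.isClosed_x₀.isOpen_compl⟩

section NodeValue

variable {C} {n : ℕ} {j : Fin 2} {N : (C.X j).Modules} {B : (C.X j).Opens} {b : Fin n → Γ(N, B)}

/-- The value at the node of a germ of sections, in terms of a local basis. -/
def nodeValue (hb : IsBasisOn N B b) (hB : C.z j ∈ B) :
    N.presheaf.stalk (C.z j) →+ (Fin n → ℂ) where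
  toFun m k := C.ev j ((hb.stalkBasis hB).repr m k)
  map_zero' := by ext k; simp
  map_add' a b := by ext k; simp

variable (hb : IsBasisOn N B b) (hB : C.z j ∈ B)

lemma nodeValue_smul (a : (C.X j).presheaf.stalk (C.z j)) (m : N.presheaf.stalk (C.z j)) :
    nodeValue hb hB (a • m) = C.ev j a • nodeValue hb hB m := by
  ext k
  simp [nodeValue]

lemma nodeValue_basis (k : Fin n) :
    nodeValue hb hB (gm N hB (b k)) = Pi.single k 1 := by
  ext l
  change C.ev j ((hb.stalkBasis hB).repr (gm N hB (b k)) l) = _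
  rw [← hb.stalkBasis_apply hB, Module.Basis.repr_self, Finsupp.single_apply, Pi.single_apply]
  split_ifs with h h' h'
  · exact map_one _
  · exact (h' h.symm).elim
  · exact (h h'.symm).elim
  · exact map_zero _

lemma nodeValue_sum {V : (C.X j).Opens} (hV : V ≤ B) (hz : C.z j ∈ V) (a : Fin n → Γ(C.X j, V)) :
    nodeValue hb hB (gm N hz (∑ k, a k • rs N hV (b k))) = fun k => C.ev j (gr (C.X j) hz (a k)) := by
  rw [map_sum, map_sum]
  simp only [gm_smul, nodeValue_smul, gm_rs, nodeValue_basis]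
  ext k
  simp [Pi.single_apply]

lemma nodeValue_surjective : Function.Surjective (nodeValue hb hB) := fun v => by
  refine ⟨∑ k, stalkScalars (C.compStr j) (C.z j) (v k) • gm N hB (b k), ?_⟩
  rw [map_sum]
  simp only [nodeValue_smul, nodeValue_basis, ev_stalkScalars]
  ext k
  simp [Pi.single_apply]

end NodeValue

section Compatible

variable {C} {n : ℕ} {N : ∀ j, (C.X j).Modules} {B : ∀ j, (C.X j).Opens}
  {b : ∀ j, Fin n → Γ(N j, B j)} (hb : ∀ j, IsBasisOn (N j) (B j) (b j)) (hB : ∀ j, C.z j ∈ B j)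

/-- Sections on the two components with the same value at the node. -/
def IsCompatible (W : C.X₀.Opens) (s : ∀ j, Γ(N j, C.i j ⁻¹ᵁ W)) : Prop :=
  ∀ hx : C.x₀ ∈ W, nodeValue (hb 0) (hB 0) (gm (N 0) (C.z_mem hx 0) (s 0)) =
    nodeValue (hb 1) (hB 1) (gm (N 1) (C.z_mem hx 1) (s 1))

lemma IsCompatible.res {V W : C.X₀.Opens} {s : ∀ j, Γ(N j, C.i j ⁻¹ᵁ W)}
    (hs : IsCompatible hb hB W s) (h : V ≤ W) :
    IsCompatible hb hB V (fun j => rs (N j) (pre_mono (C.i j) h) (s j)) := fun hx => by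
  rw [gm_rs, gm_rs]
  exact hs (h hx)

/-- The coordinates in the two bases take equal values at the node, hence glue to functions on the
nodal curve. -/
lemma IsCompatible.exists_coord {W : C.X₀.Opens} (hW : ∀ j, C.i j ⁻¹ᵁ W ≤ B j)
    {s : ∀ j, Γ(N j, C.i j ⁻¹ᵁ W)} (hs : IsCompatible hb hB W s) :
    ∃ a : Fin n → Γ(C.X₀, W), ∀ j, ∑ k, pf (C.i j) W (a k) • rs (N j) (hW j) (b j k) = s j := by
  have h1 := fun k => C.exists_pf_eq (W := W) (fun j => (hb j).coord (hW j) (s j) k) (fun h => by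
    have hx := C.x₀_mem (h 0)
    have h2 := hs hx
    rw [← (hb 0).sum_coord (hW 0) (s 0), ← (hb 1).sum_coord (hW 1) (s 1), nodeValue_sum,
      nodeValue_sum] at h2
    exact congrFun h2 k)
  choose a ha using h1
  refine ⟨a, fun j => ?_⟩
  simp only [ha]
  exact (hb j).sum_coord (hW j) (s j)

lemma isCompatible_sum {W : C.X₀.Opens} (hW : ∀ j, C.i j ⁻¹ᵁ W ≤ B j) (a : Fin n → Γ(C.X₀, W)) :
    IsCompatible hb hB W (fun j => ∑ k, pf (C.i j) W (a k) • rs (N j) (hW j) (b j k)) := fun hx => by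
  rw [nodeValue_sum, nodeValue_sum]
  ext k
  exact C.ev_pf _ _ _

end Compatible

lemma exists_coord_of_notMem {n : ℕ} {N : ∀ j, (C.X j).Modules} {W : C.X₀.Opens}
    (hx : C.x₀ ∉ W) {e : ∀ j, Fin n → Γ(N j, C.i j ⁻¹ᵁ W)}
    (he : ∀ j, IsBasisOn (N j) (C.i j ⁻¹ᵁ W) (e j)) (s : ∀ j, Γ(N j, C.i j ⁻¹ᵁ W)) :
    ∃ a : Fin n → Γ(C.X₀, W), ∀ j, ∑ k, pf (C.i j) W (a k) • e j k = s j := by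
  have h1 := fun k => C.exists_pf_eq (W := W) (fun j => (he j).coord le_rfl (s j) k)
    (fun h => (hx (C.x₀_mem (h 0))).elim)
  choose a ha using h1
  refine ⟨a, fun j => ?_⟩
  simp only [ha]
  have := (he j).sum_coord le_rfl (s j)
  simpa only [rs_self] using this

/-- A module on the nodal curve with local bases of rank `n`, together with its restrictions `N j`
to the components, given by the adjoint morphisms. -/
structure GluedModule (n : ℕ) (N : ∀ j, (C.X j).Modules) where
  E : C.X₀.Modules
  ψ : ∀ j, E ⟶ (Scheme.Modules.pushforward (C.i j)).obj (N j)
  exists_basis : ∀ x, ∃ (W : C.X₀.Opens) (e : Fin n → Γ(E, W)), x ∈ W ∧ IsBasisOn E W e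
  isBasisOn : ∀ {W : C.X₀.Opens} {e : Fin n → Γ(E, W)}, IsBasisOn E W e → ∀ j,
    IsBasisOn (N j) (C.i j ⁻¹ᵁ W) (fun k => pa (ψ j) W (e k))

namespace GluedModule

variable {C} {n : ℕ} {N : ∀ j, (C.X j).Modules}

lemma exists_basis_component (G : C.GluedModule n N) (j : Fin 2) (y : C.X j) :
    ∃ (W : (C.X j).Opens) (e : Fin n → Γ(N j, W)), y ∈ W ∧ IsBasisOn (N j) W e := by
  obtain ⟨W, e, hx, he⟩ := G.exists_basis (C.i j y)
  exact ⟨_, _, hx, G.isBasisOn he j⟩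

lemma hasBases (G : C.GluedModule n N) (j : Fin 2) : HasBases (N j) := fun y => by
  obtain ⟨W, e, hx, he⟩ := G.exists_basis_component j y
  exact ⟨W, n, e, hx, he⟩

variable (G : C.GluedModule n N)

/-- A neighbourhood of the node. -/
def nodeOpen : C.X₀.Opens := (G.exists_basis C.x₀).choose

/-- A basis near the node. -/
def nodeBasis : Fin n → Γ(G.E, G.nodeOpen) := (G.exists_basis C.x₀).choose_spec.choose

lemma x₀_mem : C.x₀ ∈ G.nodeOpen := (G.exists_basis C.x₀).choose_spec.choose_spec.1

lemma isBasisOn_nodeBasis : IsBasisOn G.E G.nodeOpen G.nodeBasis :=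
  (G.exists_basis C.x₀).choose_spec.choose_spec.2

lemma isBasisOn_node (j : Fin 2) :
    IsBasisOn (N j) (C.i j ⁻¹ᵁ G.nodeOpen) (fun k => pa (G.ψ j) G.nodeOpen (G.nodeBasis k)) :=
  G.isBasisOn G.isBasisOn_nodeBasis j

lemma z_mem (j : Fin 2) : C.z j ∈ C.i j ⁻¹ᵁ G.nodeOpen := C.z_mem G.x₀_mem j

/-- The value at the node. -/
def ν (j : Fin 2) : (N j).presheaf.stalk (C.z j) →+ (Fin n → ℂ) :=
  nodeValue (G.isBasisOn_node j) (G.z_mem j)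

lemma pa_sum (j : Fin 2) {W V : C.X₀.Opens} (h : V ≤ W) {m : ℕ} (e : Fin m → Γ(G.E, W))
    (a : Fin m → Γ(C.X₀, V)) : pa (G.ψ j) V (∑ k, a k • rs G.E h (e k)) =
      ∑ k, pf (C.i j) V (a k) • rs (N j) (pre_mono (C.i j) h) (pa (G.ψ j) W (e k)) := by
  rw [map_sum]
  simp only [pa_smul, pa_rs]

/-- Pairs of sections with the same value at the node. -/
def Compatible (W : C.X₀.Opens) (s : ∀ j, Γ(N j, C.i j ⁻¹ᵁ W)) : Prop :=
  ∀ hx : C.x₀ ∈ W, G.ν 0 (gm (N 0) (C.z_mem hx 0) (s 0)) = G.ν 1 (gm (N 1) (C.z_mem hx 1) (s 1))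

lemma compatible_pa {W : C.X₀.Opens} (s : Γ(G.E, W)) : G.Compatible W (fun j => pa (G.ψ j) W s) := by
  intro hx
  have hx' : C.x₀ ∈ W ⊓ G.nodeOpen := ⟨hx, G.x₀_mem⟩
  have h1 := isCompatible_sum (fun j => G.isBasisOn_node j) G.z_mem
    (W := W ⊓ G.nodeOpen) (fun j => pre_mono (C.i j) inf_le_right)
    (G.isBasisOn_nodeBasis.coord inf_le_right (rs G.E inf_le_left s))
  have h2 : (fun j => ∑ k, pf (C.i j) (W ⊓ G.nodeOpen) (G.isBasisOn_nodeBasis.coord inf_le_right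
      (rs G.E inf_le_left s) k) • rs (N j) (pre_mono (C.i j) inf_le_right)
        (pa (G.ψ j) G.nodeOpen (G.nodeBasis k))) =
      fun j => rs (N j) (pre_mono (C.i j) inf_le_left) (pa (G.ψ j) W s) := funext fun j => by
    rw [← G.pa_sum j (inf_le_right : W ⊓ G.nodeOpen ≤ G.nodeOpen), G.isBasisOn_nodeBasis.sum_coord,
      pa_rs]
  rw [h2] at h1
  have h3 := h1 hx'
  rw [gm_rs, gm_rs] at h3
  exact h3

/-- In a local basis, the coordinates of a section are functions determined by their restrictions to
the components. -/
lemma pa_injective {W : C.X₀.Opens} {s t : Γ(G.E, W)} (h : ∀ j, pa (G.ψ j) W s = pa (G.ψ j) W t) :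
    s = t := by
  refine section_ext _ _ _ fun x hx => ?_
  obtain ⟨V, e, hxV, he⟩ := G.exists_basis x
  refine ⟨W ⊓ V, inf_le_left, ⟨hx, hxV⟩, ?_⟩
  refine (he.coord inf_le_right).injective ?_
  ext k
  rw [← sub_eq_zero]
  refine C.pf_injective _ fun j => ?_
  rw [map_sub, sub_eq_zero]
  have h1 := congrArg (rs (N j) (pre_mono (C.i j) (inf_le_left : W ⊓ V ≤ W))) (h j)
  rw [← pa_rs, ← pa_rs] at h1
  rw [← he.sum_coord inf_le_right (rs G.E _ s), ← he.sum_coord inf_le_right (rs G.E _ t),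
    G.pa_sum, G.pa_sum] at h1
  exact congrFun ((G.isBasisOn he j _ _).1 h1) k

/-- With `compatible_pa` and `pa_injective` this identifies sections of `G.E` with compatible pairs.
Local lifts come from gluing coordinates, and they agree on overlaps by injectivity. -/
lemma exists_pa_eq {W : C.X₀.Opens} {s : ∀ j, Γ(N j, C.i j ⁻¹ᵁ W)} (hs : G.Compatible W s) :
    ∃ t : Γ(G.E, W), ∀ j, pa (G.ψ j) W t = s j := by
  have h1 : ∀ x : W, ∃ (V : C.X₀.Opens) (hV : V ≤ W) (t : Γ(G.E, V)), x.1 ∈ V ∧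
      ∀ j, pa (G.ψ j) V t = rs (N j) (pre_mono (C.i j) hV) (s j) := by
    rintro ⟨x, hx⟩
    by_cases hx₀ : x = C.x₀
    · subst hx₀
      obtain ⟨a, ha⟩ := (show IsCompatible (fun j => G.isBasisOn_node j) G.z_mem W s from
        hs).res _ _ (inf_le_left : W ⊓ G.nodeOpen ≤ W) |>.exists_coord _ _
          (fun j => pre_mono (C.i j) inf_le_right)
      refine ⟨W ⊓ G.nodeOpen, inf_le_left, ∑ k, a k • rs G.E inf_le_right (G.nodeBasis k),
        ⟨hx, G.x₀_mem⟩, fun j => ?_⟩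
      rw [G.pa_sum, ha]
    · obtain ⟨V, e, hxV, he⟩ := G.exists_basis x
      let V' := W ⊓ V ⊓ C.nodeCompl
      have hV' : V' ≤ V := inf_le_left.trans inf_le_right
      have hW : V' ≤ W := inf_le_left.trans inf_le_left
      obtain ⟨a, ha⟩ := C.exists_coord_of_notMem (W := V') (fun h => h.2 rfl)
        (fun j => (G.isBasisOn he j).res (pre_mono (C.i j) hV'))
        (fun j => rs (N j) (pre_mono (C.i j) hW) (s j))
      refine ⟨V', hW, ∑ k, a k • rs G.E hV' (e k), ⟨⟨hx, hxV⟩, hx₀⟩, fun j => ?_⟩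
      rw [G.pa_sum, ha]
  choose V hV t hxV ht using h1
  obtain ⟨u, hu⟩ := section_glue G.E V hV (fun x hx => ⟨⟨x, hx⟩, hxV _⟩) t (fun x y => by
    refine G.pa_injective fun j => ?_
    rw [pa_rs, pa_rs, ht, ht, rs_rs, rs_rs])
  refine ⟨u, fun j => section_ext _ _ _ fun y hy => ?_⟩
  refine ⟨C.i j ⁻¹ᵁ V ⟨C.i j y, hy⟩, pre_mono _ (hV _), hxV ⟨C.i j y, hy⟩, ?_⟩
  rw [← pa_rs (G.ψ j) (hV ⟨C.i j y, hy⟩), hu, ht]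

end GluedModule

end NodalCurve


lemma section_eq_zero_of_isZero {X : Scheme.{0}} {M : X.Modules} (h : IsZero M) (W : X.Opens)
    (s : Γ(M, W)) : s = 0 := by
  rw [← ap_id W s, (IsZero.iff_id_eq_zero M).1 h, ap_zero]

/-! ### Subsheaves with torsion free quotient are glued from the components -/

namespace NodalCurve

variable (C : NodalCurve)

lemma eta_ne_z (j : Fin 2) : genericPoint (C.X j) ≠ C.z j :=
  (genericPoint_ne_of_isClosed (C.isClosed_z j)).symm

/-- An open subset meeting no component other than `X j`. -/
def OnlyIn (j : Fin 2) (W : C.X₀.Opens) : Prop := ∀ j', j' ≠ j → C.i j' ⁻¹ᵁ W = ⊥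

variable {C} {j : Fin 2} {V W : C.X₀.Opens}

lemma OnlyIn.mono (h : C.OnlyIn j W) (hV : V ≤ W) : C.OnlyIn j V := fun j' hj => by
  rw [eq_bot_iff, ← h j' hj]
  exact pre_mono _ hV

lemma OnlyIn.x₀_notMem (h : C.OnlyIn j W) : C.x₀ ∉ W := fun hx => by
  obtain ⟨j', hj⟩ := exists_ne j
  have h1 := C.z_mem hx j'
  rw [h j' hj] at h1
  exact h1

lemma OnlyIn.exists_pf_eq (h : C.OnlyIn j W) (a : Γ(C.X j, C.i j ⁻¹ᵁ W)) :
    ∃ b : Γ(C.X₀, W), pf (C.i j) W b = a := by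
  obtain ⟨b, hb⟩ := C.exists_pf_eq (W := W) (Function.update (fun _ => 0) j a)
    (fun h' => (h.x₀_notMem (C.x₀_mem (h' 0))).elim)
  exact ⟨b, (hb j).trans (Function.update_self ..)⟩

lemma OnlyIn.pf_injective (h : C.OnlyIn j W) : Function.Injective (pf (C.i j) W) := by
  rw [injective_iff_map_eq_zero]
  intro a ha
  refine C.pf_injective a fun j' => ?_
  by_cases hj : j' = j
  · subst hj
    exact ha
  · have := subsingleton_functions (h j' hj)
    exact Subsingleton.elim _ _

lemma exists_onlyIn {j : Fin 2} (U : (C.X j).Opens) {y : C.X j} (hy : y ≠ C.z j) (hU : y ∈ U) :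
    ∃ W : C.X₀.Opens, C.i j y ∈ W ∧ C.i j ⁻¹ᵁ W ≤ U ∧ C.OnlyIn j W := by
  let Z : (C.X j).Opens := ⟨{C.z j}ᶜ, (C.isClosed_z j).isOpen_compl⟩
  obtain ⟨W, hW, h⟩ := C.exists_opens (U ⊓ Z) (fun h => h.2 rfl)
  refine ⟨W, ?_, hW.le.trans inf_le_left, h⟩
  change y ∈ C.i j ⁻¹ᵁ W
  rw [hW]
  exact ⟨hU, hy⟩

namespace GluedModule

variable {n : ℕ} {N : ∀ j, (C.X j).Modules} (G : C.GluedModule n N)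

lemma exists_pa_eq_of_onlyIn (h : C.OnlyIn j W) (s : Γ(N j, C.i j ⁻¹ᵁ W)) :
    ∃ t : Γ(G.E, W), pa (G.ψ j) W t = s := by
  obtain ⟨t, ht⟩ := G.exists_pa_eq (W := W) (s := Function.update (fun _ => 0) j s)
    (fun hx => (h.x₀_notMem hx).elim)
  exact ⟨t, (ht j).trans (Function.update_self ..)⟩

lemma eq_of_onlyIn (h : C.OnlyIn j W) {s t : Γ(G.E, W)} (hst : pa (G.ψ j) W s = pa (G.ψ j) W t) :
    s = t := by
  refine G.pa_injective fun j' => ?_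
  by_cases hj : j' = j
  · subst hj
    exact hst
  · have := subsingleton_sections (N j') (h j' hj)
    exact Subsingleton.elim _ _

variable {F : C.X₀.Modules} (f : F ⟶ G.E)

/-- The generic stalk on `X j` of the image of a subsheaf. -/
def genSub (j : Fin 2) : Submodule ((C.X j).presheaf.stalk (genericPoint (C.X j)))
    ((N j).presheaf.stalk (genericPoint (C.X j))) where
  carrier := {m | ∃ (W : C.X₀.Opens) (h : genericPoint (C.X j) ∈ C.i j ⁻¹ᵁ W) (t : Γ(F, W)),
    gm (N j) h (pa (G.ψ j) W (ap f W t)) = m}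
  add_mem' := by
    rintro _ _ ⟨W, h, t, rfl⟩ ⟨W', h', t', rfl⟩
    refine ⟨W ⊓ W', ⟨h, h'⟩, rs F inf_le_left t + rs F inf_le_right t', ?_⟩
    rw [map_add, map_add, map_add, ap_rs, ap_rs, pa_rs, pa_rs]
    exact congrArg₂ _ (gm_rs _ _ _ _) (gm_rs _ _ _ _)
  zero_mem' := ⟨⊤, TopologicalSpace.Opens.mem_top _, 0, by
    rw [map_zero, map_zero]
    exact map_zero _⟩
  smul_mem' := by
    rintro c _ ⟨W, h, t, rfl⟩
    obtain ⟨U, hU, a, rfl⟩ := exists_gr c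
    -- Near the generic point, away from the other component, functions on `X j` lift to functions
    -- on `X₀`, so a scalar of the generic local ring acts through sections of `F`.
    obtain ⟨V, hyV, hVU, hV⟩ := exists_onlyIn U (C.eta_ne_z j) hU
    obtain ⟨b, hb⟩ := (hV.mono (inf_le_left : V ⊓ W ≤ V)).exists_pf_eq
      (rr (C.X j) ((pre_mono _ inf_le_left).trans hVU) a)
    have h' : genericPoint (C.X j) ∈ C.i j ⁻¹ᵁ (V ⊓ W) := ⟨hyV, h⟩
    refine ⟨V ⊓ W, h', b • rs F inf_le_right t, ?_⟩
    rw [map_smul, pa_smul, gm_smul, hb, gr_rr, ap_rs, pa_rs, gm_rs]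

/-- The subsheaf generated by `F` on the component `X j`. -/
def satSub (j : Fin 2) : LocalSub (N j) := sat (N j) (G.genSub f j)

lemma pa_mem_satSub (t : Γ(F, W)) (j : Fin 2) :
    pa (G.ψ j) W (ap f W t) ∈ (G.satSub f j).carrier (C.i j ⁻¹ᵁ W) :=
  fun h => ⟨W, h, t, rfl⟩

/-- `F ⊆ E` consists of the sections whose restrictions to the components lie in the subsheaves
`g j`. -/
def IsGlued {K : ∀ j, (C.X j).Modules} (g : ∀ j, K j ⟶ N j) : Prop :=
  ∀ (W : C.X₀.Opens) (s : Γ(G.E, W)), (∃ t, ap f W t = s) ↔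
    ∀ j, ∃ u, ap (g j) (C.i j ⁻¹ᵁ W) u = pa (G.ψ j) W s

/-- Near the generic point of `X j` the restriction to `X j` loses nothing, so a section with the
generic germ of a section of `F` coincides with it there. -/
lemma exists_rs_cokernel_eq_zero [Mono f] {s : Γ(G.E, W)}
    (hs : pa (G.ψ j) W s ∈ (G.satSub f j).carrier (C.i j ⁻¹ᵁ W)) :
    ∃ (V : C.X₀.Opens) (hV : V ≤ W), (C.gen j ∈ W → C.gen j ∈ V) ∧
      rs _ hV (ap (cokernel.π f) W s) = 0 := by
  by_cases h : C.gen j ∈ W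
  · obtain ⟨V, hV, t, ht⟩ := hs h
    obtain ⟨V', hyV', -, hV'⟩ := exists_onlyIn ⊤ (C.eta_ne_z j) (TopologicalSpace.Opens.mem_top _)
    have hη : genericPoint (C.X j) ∈ C.i j ⁻¹ᵁ (V' ⊓ (V ⊓ W)) := ⟨hyV', hV, h⟩
    refine ⟨V' ⊓ (V ⊓ W), inf_le_right.trans inf_le_right, fun _ => hη, ?_⟩
    rw [← ap_rs, ap_cokernel_π_eq_zero_iff]
    refine ⟨rs F (inf_le_right.trans inf_le_left) t, ?_⟩
    refine G.eq_of_onlyIn (hV'.mono inf_le_left) ?_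
    rw [← sub_eq_zero]
    refine (G.hasBases j).eq_zero_of_gm_eta _ hη ?_
    rw [map_sub, sub_eq_zero, ap_rs, pa_rs, pa_rs, gm_rs, gm_rs]
    exact ht
  · refine ⟨⊥, bot_le, fun h' => (h h').elim, ?_⟩
    have := subsingleton_sections (cokernel f) (W := ⊥) rfl
    exact Subsingleton.elim _ _

lemma exists_finite_support [Mono f] {s : Γ(G.E, W)}
    (hs : ∀ j, pa (G.ψ j) W s ∈ (G.satSub f j).carrier (C.i j ⁻¹ᵁ W)) :
    ∃ T : Set C.X₀, T.Finite ∧ (∀ x ∈ T, IsClosed {x}) ∧ ∀ (x : C.X₀) (hx : x ∈ W), x ∉ T →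
      gm _ hx (ap (cokernel.π f) W s) = 0 := by
  choose V hV hη h using fun j => G.exists_rs_cokernel_eq_zero f (hs j)
  -- If `W` misses the generic point of `X j`, it misses the whole component and no point is to be
  -- removed; the first condition makes `Z j` empty then.
  let Z : ∀ j, Set (C.X j) := fun j => {a | C.gen j ∈ W ∧ a ∉ C.i j ⁻¹ᵁ V j}
  have hZη : ∀ j, genericPoint (C.X j) ∉ Z j := fun j h' => h'.2 (hη j h'.1)
  have hZ : ∀ j, IsClosed (Z j) := fun j => by
    by_cases h' : C.gen j ∈ W
    · have : Z j = ((C.i j ⁻¹ᵁ V j : (C.X j).Opens) : Set (C.X j))ᶜ := by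
        ext a
        simp [Z, h']
      rw [this]
      exact (C.i j ⁻¹ᵁ V j).isOpen.isClosed_compl
    · have : Z j = ∅ := by
        ext a
        simp [Z, h']
      rw [this]
      exact isClosed_empty
  refine ⟨⋃ j, C.i j '' Z j, Set.finite_iUnion fun j =>
    (finite_of_genericPoint_notMem (hZ j) (hZη j)).image _, fun x hx => ?_, fun x hx hxT => ?_⟩
  · obtain ⟨j, a, ha, rfl⟩ := Set.mem_iUnion.1 hx
    have h1 : IsClosed {a} := isClosed_of_ne_genericPoint fun e => hZη j (e ▸ ha)
    have h2 := (C.i j).isClosedEmbedding.isClosedMap _ h1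
    rwa [Set.image_singleton] at h2
  · obtain ⟨j, a, rfl⟩ := C.covers x
    have hη' : genericPoint (C.X j) ∈ C.i j ⁻¹ᵁ W := eta_mem (x := a) hx
    have ha : C.i j a ∈ V j := by
      by_contra ha
      exact hxT (Set.mem_iUnion.2 ⟨j, a, ⟨hη', ha⟩, rfl⟩)
    rw [← gm_rs _ (hV j) ha, h, map_zero]

/-- Around a point `y` with nonzero germ the other points of `T` can be removed. The section then
lies in the subsheaf of sections supported at `y`, whose support is a point, of dimension 0,
contrary to purity. -/
lemma eq_zero_of_support {X : Scheme.{0}} {M : X.Modules} (hM : IsTorsionFree M) {W : X.Opens}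
    {s : Γ(M, W)} {T : Set X} (hT : T.Finite) (hc : ∀ x ∈ T, IsClosed {x})
    (h : ∀ (x : X) (hx : x ∈ W), x ∉ T → gm M hx s = 0) : s = 0 := by
  classical
  by_contra hs
  obtain ⟨y, hy, hys⟩ : ∃ (y : X) (hy : y ∈ W), gm M hy s ≠ 0 := by
    by_contra! h'
    exact hs (section_eq_zero_of_gm M s h')
  have hclosed : IsClosed (T \ {y}) := by
    rw [← Set.biUnion_of_singleton (T \ {y})]
    exact (hT.subset Set.sdiff_subset).isClosed_biUnion fun x hx => hc x hx.1
  let W' : X.Opens := W ⊓ ⟨(T \ {y})ᶜ, hclosed.isOpen_compl⟩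
  have hW' : W' ≤ W := inf_le_left
  have hyW' : y ∈ W' := ⟨hy, fun h' => h'.2 rfl⟩
  let P : LocalSub M := stalkwise M fun x => if x = y then ⊤ else ⊥
  have hP : rs M hW' s ∈ P.carrier W' := fun x hx => by
    by_cases hxy : x = y
    · change _ ∈ ite _ _ _
      rw [if_pos hxy]
      trivial
    · change _ ∈ ite _ _ _
      rw [if_neg hxy, Submodule.mem_bot, gm_rs]
      exact h x hx.1 fun hxT => hx.2 ⟨hxT, hxy⟩
  have h0 : ¬ IsZero P.toModules := fun h0 => by
    have h1 : (⟨rs M hW' s, hP⟩ : P.carrier W') = 0 := section_eq_zero_of_isZero h0 W' _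
    refine hys ?_
    rw [← gm_rs M hW' hyW', show rs M hW' s = 0 from congrArg Subtype.val h1, map_zero]
  have hsupp : (supp P.toModules).Subsingleton := by
    have : ∀ x ∈ supp P.toModules, x = y := fun x hx => by
      by_contra hxy
      have hx' : Nontrivial (P.toModules.presheaf.stalk x) := hx
      obtain ⟨m, hm⟩ := exists_ne (0 : P.toModules.presheaf.stalk x)
      obtain ⟨U, hU, t, rfl⟩ := exists_gm _ m
      refine hm (stalkMap_injective P.ι x ?_)
      rw [stalkMap_gm, map_zero]
      have : gm M hU t.1 ∈ ite _ _ _ := t.2 x hU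
      rw [if_neg hxy, Submodule.mem_bot] at this
      exact this
    intro a ha b hb
    rw [this a ha, this b hb]
  have h1 := hM.pure P.toModules P.ι inferInstance h0
  have : Subsingleton (supp P.toModules) := (Set.subsingleton_coe _).2 hsupp
  have h2 : topologicalKrullDim (supp P.toModules) ≤ 0 :=
    topologicalKrullDim_zero_of_discreteTopology _
  rw [h1] at h2
  exact absurd h2 (by norm_num)

/-- The image in the cokernel of a section whose restrictions lie in both saturations has finite
support in closed points, so it vanishes by purity, and the section comes from `F`. -/
lemma isGlued_satSub [Mono f] (hf : IsTorsionFree (cokernel f)) :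
    G.IsGlued f (fun j => (G.satSub f j).ι) := by
  intro W s
  simp only [LocalSub.range_ap_ι]
  constructor
  · rintro ⟨t, rfl⟩ j
    exact G.pa_mem_satSub f t j
  · intro h
    rw [← ap_cokernel_π_eq_zero_iff]
    obtain ⟨T, hT, hc, h'⟩ := G.exists_finite_support f h
    exact eq_zero_of_support hf hT hc h'

lemma isGlued_id : G.IsGlued (𝟙 G.E) (fun j => 𝟙 (N j)) := fun _ s =>
  ⟨fun _ _ => ⟨_, rfl⟩, fun _ => ⟨s, rfl⟩⟩

end GluedModule

end NodalCurve


/-- Additivity of the index of linear maps in a short exact sequence of two-term complexes. -/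
lemma index_of_exact {k A₀ A₁ B₀ B₁ C₀ C₁ : Type*} [Field k]
    [AddCommGroup A₀] [Module k A₀] [AddCommGroup A₁] [Module k A₁]
    [AddCommGroup B₀] [Module k B₀] [AddCommGroup B₁] [Module k B₁]
    [AddCommGroup C₀] [Module k C₀] [AddCommGroup C₁] [Module k C₁]
    (a : A₀ →ₗ[k] A₁) (b : B₀ →ₗ[k] B₁) (c : C₀ →ₗ[k] C₁)
    (i₀ : A₀ →ₗ[k] B₀) (i₁ : A₁ →ₗ[k] B₁) (p₀ : B₀ →ₗ[k] C₀) (p₁ : B₁ →ₗ[k] C₁)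
    (hi₀ : Function.Injective i₀) (hi₁ : Function.Injective i₁) (hp₀ : Function.Surjective p₀)
    (h₀ : Function.Exact i₀ p₀) (h₁ : Function.Exact i₁ p₁)
    (hab : i₁.comp a = b.comp i₀) (hbc : p₁.comp b = c.comp p₀) (hc : Function.Surjective c)
    [Module.Finite k (LinearMap.ker b)] [Module.Finite k (B₁ ⧸ LinearMap.range b)]
    [Module.Finite k C₀] [Module.Finite k C₁] :
    (Module.finrank k (LinearMap.ker a) : ℤ) - Module.finrank k (A₁ ⧸ LinearMap.range a) =
      Module.finrank k (LinearMap.ker b) - Module.finrank k (B₁ ⧸ LinearMap.range b) -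
        (Module.finrank k C₀ - Module.finrank k C₁) := by
  have hab' := fun x => LinearMap.congr_fun hab x
  have hbc' := fun x => LinearMap.congr_fun hbc x
  simp only [LinearMap.comp_apply] at hab' hbc'
  let K : LinearMap.ker a →ₗ[k] LinearMap.ker b := i₀.restrict fun x hx => by
    rw [LinearMap.mem_ker] at hx ⊢
    rw [← hab', hx, map_zero]
  let F : LinearMap.ker b →ₗ[k] LinearMap.ker c := p₀.restrict fun x hx => by
    rw [LinearMap.mem_ker] at hx ⊢
    rw [← hbc', hx, map_zero]
  let G : (A₁ ⧸ LinearMap.range a) →ₗ[k] (B₁ ⧸ LinearMap.range b) :=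
    Submodule.mapQ _ _ i₁ (by
      rintro _ ⟨x, rfl⟩
      exact ⟨i₀ x, (hab' x).symm⟩)
  -- Since `c` is surjective, the snake sequence is 0 → ker a → ker b → ker c → coker a → coker b →
  -- 0. Finiteness of the terms for `a` follows from that of the terms for `b` and `c`.
  let δ := SnakeLemma.δ' a b c i₀ p₀ h₀ i₁ p₁ h₁ hab hbc (LinearMap.ker c).subtype
    (LinearMap.exact_subtype_ker_map c) (LinearMap.range a).mkQ (LinearMap.exact_map_mkQ_range a)
    hp₀ hi₁
  have e1 : Function.Exact F δ := SnakeLemma.exact_δ'_right a b c i₀ p₀ h₀ i₁ p₁ h₁ hab hbc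
    (LinearMap.ker b).subtype (LinearMap.exact_subtype_ker_map b) (LinearMap.ker c).subtype
    (LinearMap.exact_subtype_ker_map c) (LinearMap.range a).mkQ (LinearMap.exact_map_mkQ_range a)
    hp₀ hi₁ F rfl (Submodule.injective_subtype _)
  have e2 : Function.Exact δ G := SnakeLemma.exact_δ'_left a b c i₀ p₀ h₀ i₁ p₁ h₁ hab hbc
    (LinearMap.ker c).subtype (LinearMap.exact_subtype_ker_map c) (LinearMap.range a).mkQ
    (LinearMap.exact_map_mkQ_range a) (LinearMap.range b).mkQ (LinearMap.exact_map_mkQ_range b)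
    hp₀ hi₁ G rfl (Submodule.mkQ_surjective _)
  have hK : Function.Injective K := fun x y h => Subtype.ext (hi₀ (congrArg Subtype.val h))
  have e0 : LinearMap.range K = LinearMap.ker F := by
    ext x
    constructor
    · rintro ⟨y, rfl⟩
      exact Subtype.ext ((h₀ _).2 ⟨y.1, rfl⟩)
    · intro hx
      obtain ⟨y, hy⟩ := (h₀ x.1).1 (congrArg Subtype.val hx)
      refine ⟨⟨y, hi₁ ?_⟩, Subtype.ext hy⟩
      rw [hab', hy, map_zero]
      exact x.2
  have hG : Function.Surjective G := by
    intro y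
    obtain ⟨y, rfl⟩ := Submodule.mkQ_surjective _ y
    obtain ⟨u, hu⟩ := hc (p₁ y)
    obtain ⟨v, rfl⟩ := hp₀ u
    obtain ⟨w, hw⟩ := (h₁ (y - b v)).1 (by rw [map_sub, hbc', hu, sub_self])
    refine ⟨(LinearMap.range a).mkQ w, ?_⟩
    change (LinearMap.range b).mkQ (i₁ w) = _
    rw [hw, map_sub, sub_eq_self]
    exact (LinearMap.exact_map_mkQ_range b).apply_apply_eq_zero v
  have : Module.Finite k (A₁ ⧸ LinearMap.range a) := Module.Finite.of_exact e2 hG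
  have r1 := LinearMap.finrank_range_add_finrank_ker F
  have r2 := LinearMap.finrank_range_add_finrank_ker δ
  have r3 := LinearMap.finrank_range_add_finrank_ker G
  have r4 := LinearMap.finrank_range_add_finrank_ker c
  rw [← e0, LinearMap.finrank_range_of_inj hK] at r1
  rw [e1.linearMap_ker_eq] at r2
  rw [e2.linearMap_ker_eq, LinearMap.range_eq_top.2 hG, finrank_top] at r3
  rw [LinearMap.range_eq_top.2 hc, finrank_top] at r4
  omega


/-! ### Kernels and cokernels of product maps -/

section Prod

variable {k A B A' B' : Type*} [Field k] [AddCommGroup A] [Module k A] [AddCommGroup B] [Module k B]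
  [AddCommGroup A'] [Module k A'] [AddCommGroup B'] [Module k B'] (f : A →ₗ[k] B) (g : A' →ₗ[k] B')

/-- The kernel of a product of linear maps. -/
def kerProdMapEquiv : LinearMap.ker (f.prodMap g) ≃ₗ[k] LinearMap.ker f × LinearMap.ker g where
  toFun x := (⟨x.1.1, congrArg Prod.fst x.2⟩, ⟨x.1.2, congrArg Prod.snd x.2⟩)
  invFun x := ⟨(x.1.1, x.2.1), Prod.ext x.1.2 x.2.2⟩
  map_add' _ _ := rfl
  map_smul' _ _ := rfl

/-- The cokernel of a product of linear maps. -/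
def cokerProdMapEquiv : ((B × B') ⧸ LinearMap.range (f.prodMap g)) ≃ₗ[k]
    (B ⧸ LinearMap.range f) × (B' ⧸ LinearMap.range g) :=
  (Submodule.quotEquivOfEq _ (LinearMap.ker ((LinearMap.range f).mkQ.prodMap (LinearMap.range g).mkQ))
    (by rw [LinearMap.ker_prodMap, Submodule.ker_mkQ, Submodule.ker_mkQ, LinearMap.range_prodMap])).trans
  (LinearMap.quotKerEquivOfSurjective _
    ((Submodule.mkQ_surjective _).prodMap (Submodule.mkQ_surjective _)))

end Prod

/-! ### Values of sections over affine opens -/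

section ComplexSections

variable {X : Scheme.{0}} (s : X ⟶ Spec (.of ℂ))

/-- The action of a morphism on sections, as a `ℂ`-linear map. -/
def apLinear {M N : X.Modules} (f : M ⟶ N) (W : X.Opens) : Sections s M W →ₗ[ℂ] Sections s N W where
  toFun t := ap f W t
  map_add' := map_add (ap f W)
  map_smul' z t := (ap f W).map_smul (scalars s W z) t

/-- A surjective evaluation of sections at a point. -/
lemma exists_section_value {M : X.Modules} (hM : HasBases M) {W : X.Opens} (hW : IsAffineOpen W)
    {x : X} (hx : x ∈ W) (ev : X.presheaf.stalk x →+* ℂ) (hloc : ∀ a, IsUnit a → ev a ≠ 0)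
    (m : M.presheaf.stalk x) :
    ∃ (z : ℂ) (t : Γ(M, W)) (a : X.presheaf.stalk x), z * ev a = 1 ∧ gm M hx t = a • m := by
  obtain ⟨V, hV, t, rfl⟩ := exists_gm M m
  obtain ⟨g, hg, hxg⟩ := hW.exists_basicOpen_le (V := V) ⟨x, hV⟩ hx
  obtain ⟨k, u, hu⟩ := exists_rs_eq_pow_smul
    (isQuasicoherent_of_isLocallyFree (isLocallyFree_of_bases hM)) hW g (rs M hg t)
  refine ⟨(ev (gr X hx g ^ k))⁻¹, u, gr X hx g ^ k, inv_mul_cancel₀ (hloc _ ?_), ?_⟩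
  · exact ((Scheme.mem_basicOpen _ _ _ hx).1 hxg).pow k
  · rw [← gm_rs M (X.basicOpen_le g) hxg, hu, gm_smul, gm_rs, map_pow, gr_rr]

end ComplexSections

/-! ### The Euler characteristic of a glued subsheaf -/

namespace NodalCurve

variable {C : NodalCurve}

lemma ev_ne_zero (j : Fin 2) (a : (C.X j).presheaf.stalk (C.z j)) (h : IsUnit a) : C.ev j a ≠ 0 :=
  (h.map (C.ev j)).ne_zero

namespace GluedModule

variable {n : ℕ} {N : ∀ j, (C.X j).Modules} (G : C.GluedModule n N)

lemma ν_smul (j : Fin 2) (a : (C.X j).presheaf.stalk (C.z j)) (m : (N j).presheaf.stalk (C.z j)) :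
    G.ν j (a • m) = C.ev j a • G.ν j m := nodeValue_smul _ _ a m

/-- The values at the node of a subsheaf on a component. -/
def nodeImage {j : Fin 2} {K : (C.X j).Modules} (g : K ⟶ N j) : Submodule ℂ (Fin n → ℂ) where
  carrier := {v | ∃ m, G.ν j (stalkMap g (C.z j) m) = v}
  add_mem' := by
    rintro _ _ ⟨m, rfl⟩ ⟨m', rfl⟩
    exact ⟨m + m', by rw [map_add, map_add]⟩
  zero_mem' := ⟨0, by rw [map_zero, map_zero]⟩
  smul_mem' := by
    rintro c _ ⟨m, rfl⟩
    exact ⟨stalkScalars (C.compStr j) (C.z j) c • m, by rw [map_smul, ν_smul, ev_stalkScalars]⟩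

/-- Over an affine open set a germ extends to a section after multiplication by a function not
vanishing at the node; division by the value of that function restores the prescribed value. -/
lemma exists_section_of_mem_nodeImage {j : Fin 2} {K : (C.X j).Modules} (hK : HasBases K)
    (g : K ⟶ N j) {W : (C.X j).Opens} (hW : IsAffineOpen W) (hz : C.z j ∈ W) {v : Fin n → ℂ}
    (hv : v ∈ G.nodeImage g) : ∃ t : Γ(K, W), G.ν j (gm (N j) hz (ap g W t)) = v := by
  obtain ⟨m, rfl⟩ := hv
  obtain ⟨c, t, a, hc, ht⟩ := exists_section_value hK hW hz (C.ev j) (ev_ne_zero j) m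
  refine ⟨scalars (C.compStr j) W c • t, ?_⟩
  rw [map_smul, gm_smul, gr_scalars, ν_smul, ev_stalkScalars, ← stalkMap_gm, ht, map_smul, ν_smul,
    smul_smul, hc, one_smul]

/-- Restriction of sections to a component. -/
def paLinear (j : Fin 2) (W : C.X₀.Opens) :
    Sections C.str G.E W →ₗ[ℂ] Sections (C.compStr j) (N j) (C.i j ⁻¹ᵁ W) where
  toFun t := pa (G.ψ j) W t
  map_add' := map_add (pa (G.ψ j) W)
  map_smul' c t := by
    refine (pa_smul (G.ψ j) W (scalars C.str W c) t).trans ?_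
    rw [pf_scalars]
    rfl

variable {F : C.X₀.Modules} {f : F ⟶ G.E} {K : ∀ j, (C.X j).Modules} {g : ∀ j, K j ⟶ N j}

variable {G} in
/-- The components of the sections of a glued subsheaf. -/
def IsGlued.part (h : G.IsGlued f g) [∀ j, Mono (g j)] (j : Fin 2) (W : C.X₀.Opens) :
    Sections C.str F W →ₗ[ℂ] Sections (C.compStr j) (K j) (C.i j ⁻¹ᵁ W) :=
  (LinearEquiv.ofInjective (apLinear (C.compStr j) (g j) (C.i j ⁻¹ᵁ W))
    (ap_injective (g j) _)).symm.toLinearMap.comp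
    (((G.paLinear j W).comp (apLinear C.str f W)).codRestrict _ fun t =>
      (h W (ap f W t)).1 ⟨t, rfl⟩ j)

lemma IsGlued.ap_part (h : G.IsGlued f g) [∀ j, Mono (g j)] (j : Fin 2) (W : C.X₀.Opens)
    (t : Γ(F, W)) : ap (g j) _ (h.part j W t) = pa (G.ψ j) W (ap f W t) :=
  congrArg Subtype.val (LinearEquiv.apply_symm_apply (LinearEquiv.ofInjective
    (apLinear (C.compStr j) (g j) (C.i j ⁻¹ᵁ W)) (ap_injective (g j) _)) _)

lemma IsGlued.part_rs (h : G.IsGlued f g) [∀ j, Mono (g j)] (j : Fin 2) {V W : C.X₀.Opens}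
    (hV : V ≤ W) (t : Γ(F, W)) : h.part j V (rs F hV t) =
      rs (K j) (pre_mono (C.i j) hV) (h.part j W t) := by
  refine ap_injective (g j) _ ?_
  refine (h.ap_part G j V _).trans ?_
  rw [ap_rs f, pa_rs]
  exact ((ap_rs (g j) _ _).trans (congrArg _ (h.ap_part G j W t))).symm

open Classical in
/-- The difference of the values at the node. -/
def nodeDiff (g : ∀ j, K j ⟶ N j) (W : C.X₀.Opens) :
    (Sections (C.compStr 0) (K 0) (C.i 0 ⁻¹ᵁ W) × Sections (C.compStr 1) (K 1) (C.i 1 ⁻¹ᵁ W)) →ₗ[ℂ]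
      (Fin n → ℂ) where
  toFun u := if hx : C.x₀ ∈ W then G.ν 0 (gm (N 0) (C.z_mem hx 0) (ap (g 0) _ u.1)) -
    G.ν 1 (gm (N 1) (C.z_mem hx 1) (ap (g 1) _ u.2)) else 0
  map_add' u v := by
    split_ifs with hx
    · have h0 := map_add (ap (g 0) (C.i 0 ⁻¹ᵁ W)) u.1 v.1
      have h1 := map_add (ap (g 1) (C.i 1 ⁻¹ᵁ W)) u.2 v.2
      have h0' := (congrArg (fun t => G.ν 0 (gm (N 0) (C.z_mem hx 0) t)) h0).trans
        ((congrArg _ (map_add _ _ _)).trans (map_add _ _ _))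
      have h1' := (congrArg (fun t => G.ν 1 (gm (N 1) (C.z_mem hx 1) t)) h1).trans
        ((congrArg _ (map_add _ _ _)).trans (map_add _ _ _))
      exact (congrArg₂ _ h0' h1').trans (add_sub_add_comm _ _ _ _)
    · simp
  map_smul' c u := by
    split_ifs with hx
    · have key : ∀ (j : Fin 2) (t : Γ(K j, C.i j ⁻¹ᵁ W)), G.ν j (gm (N j) (C.z_mem hx j)
          (ap (g j) _ (scalars (C.compStr j) _ c • t))) =
          c • G.ν j (gm (N j) (C.z_mem hx j) (ap (g j) _ t)) := fun j t => by
        rw [map_smul, gm_smul, gr_scalars, ν_smul, ev_stalkScalars]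
      exact (congrArg₂ _ (key 0 u.1) (key 1 u.2)).trans (smul_sub _ _ _).symm
    · simp

lemma nodeDiff_of_mem {W : C.X₀.Opens} (hx : C.x₀ ∈ W) (u₀ : Γ(K 0, C.i 0 ⁻¹ᵁ W))
    (u₁ : Γ(K 1, C.i 1 ⁻¹ᵁ W)) : G.nodeDiff g W (u₀, u₁) =
      G.ν 0 (gm (N 0) (C.z_mem hx 0) (ap (g 0) _ u₀)) -
        G.ν 1 (gm (N 1) (C.z_mem hx 1) (ap (g 1) _ u₁)) := dif_pos hx

lemma nodeDiff_of_notMem {W : C.X₀.Opens} (hx : C.x₀ ∉ W) (u) : G.nodeDiff g W u = 0 :=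
  dif_neg hx

lemma nodeDiff_rs {V W : C.X₀.Opens} (hx : C.x₀ ∈ V) (h : V ≤ W) (u₀ : Γ(K 0, C.i 0 ⁻¹ᵁ W))
    (u₁ : Γ(K 1, C.i 1 ⁻¹ᵁ W)) :
    G.nodeDiff g V (rs (K 0) (pre_mono (C.i 0) h) u₀, rs (K 1) (pre_mono (C.i 1) h) u₁) =
      G.nodeDiff g W (u₀, u₁) := by
  rw [G.nodeDiff_of_mem hx, G.nodeDiff_of_mem (h hx), ap_rs, ap_rs, gm_rs, gm_rs]

/-- A pair with equal values at the node is a section of `G.E`, and it lies in `F` because its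
components lie in the subsheaves `g j`. -/
lemma IsGlued.nodeDiff_eq_zero_iff (h : G.IsGlued f g) [∀ j, Mono (g j)] {W : C.X₀.Opens}
    (u₀ : Γ(K 0, C.i 0 ⁻¹ᵁ W)) (u₁ : Γ(K 1, C.i 1 ⁻¹ᵁ W)) :
    G.nodeDiff g W (u₀, u₁) = 0 ↔ ∃ t : Γ(F, W), h.part 0 W t = u₀ ∧ h.part 1 W t = u₁ := by
  let u : ∀ j, Γ(K j, C.i j ⁻¹ᵁ W) := Fin.cons u₀ (Fin.cons u₁ finZeroElim)
  constructor
  · intro h0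
    obtain ⟨s, hs⟩ := G.exists_pa_eq (W := W) (s := fun j => ap (g j) _ (u j)) (fun hx => by
      rw [G.nodeDiff_of_mem hx, sub_eq_zero] at h0
      exact h0)
    obtain ⟨t, rfl⟩ := (h W s).2 fun j => ⟨u j, (hs j).symm⟩
    exact ⟨t, ap_injective (g 0) _ ((h.ap_part G 0 W t).trans (hs 0)),
      ap_injective (g 1) _ ((h.ap_part G 1 W t).trans (hs 1))⟩
  · rintro ⟨t, rfl, rfl⟩
    by_cases hx : C.x₀ ∈ W
    · refine (G.nodeDiff_of_mem hx _ _).trans (sub_eq_zero.2 ?_)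
      refine ((congrArg _ (congrArg _ (h.ap_part G 0 W t))).trans
        (G.compatible_pa (ap f W t) hx)).trans ?_
      exact congrArg _ (congrArg _ (h.ap_part G 1 W t).symm)
    · exact G.nodeDiff_of_notMem hx _

lemma IsGlued.part_injective (h : G.IsGlued f g) [∀ j, Mono (g j)] [Mono f] {W : C.X₀.Opens}
    {t t' : Γ(F, W)} (h0 : h.part 0 W t = h.part 0 W t') (h1 : h.part 1 W t = h.part 1 W t') :
    t = t' := by
  refine ap_injective f W (G.pa_injective fun j => ?_)
  rw [← h.ap_part, ← h.ap_part]
  match j with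
  | 0 => exact congrArg _ h0
  | 1 => exact congrArg _ h1

open Classical in
/-- The values at the node, over an open subset. -/
def nodeSpace (g : ∀ j, K j ⟶ N j) (W : C.X₀.Opens) : Submodule ℂ (Fin n → ℂ) :=
  if C.x₀ ∈ W then G.nodeImage (g 0) ⊔ G.nodeImage (g 1) else ⊥

lemma nodeSpace_of_mem {W : C.X₀.Opens} (hx : C.x₀ ∈ W) :
    G.nodeSpace g W = G.nodeImage (g 0) ⊔ G.nodeImage (g 1) := if_pos hx

lemma nodeSpace_of_notMem {W : C.X₀.Opens} (hx : C.x₀ ∉ W) : G.nodeSpace g W = ⊥ := if_neg hx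

lemma nodeDiff_mem (W : C.X₀.Opens) (u) : G.nodeDiff g W u ∈ G.nodeSpace g W := by
  by_cases hx : C.x₀ ∈ W
  · rw [G.nodeSpace_of_mem hx]
    obtain ⟨u₀, u₁⟩ := u
    refine (congrArg (· ∈ _) (G.nodeDiff_of_mem hx u₀ u₁)).mpr (sub_mem ?_ ?_)
    · exact Submodule.mem_sup_left ⟨gm (K 0) (C.z_mem hx 0) u₀,
        congrArg _ (stalkMap_gm (g 0) _ _)⟩
    · exact Submodule.mem_sup_right ⟨gm (K 1) (C.z_mem hx 1) u₁,
        congrArg _ (stalkMap_gm (g 1) _ _)⟩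
  · rw [G.nodeDiff_of_notMem hx]
    exact zero_mem _

lemma exists_nodeDiff_eq (hK : ∀ j, HasBases (K j)) {W : C.X₀.Opens} (hW : IsAffineOpen W)
    {v : Fin n → ℂ} (hv : v ∈ G.nodeSpace g W) : ∃ u, G.nodeDiff g W u = v := by
  by_cases hx : C.x₀ ∈ W
  · rw [G.nodeSpace_of_mem hx] at hv
    obtain ⟨v₀, h₀, v₁, h₁, rfl⟩ := Submodule.mem_sup.1 hv
    obtain ⟨u₀, rfl⟩ := G.exists_section_of_mem_nodeImage (hK 0) (g 0) (hW.preimage (C.i 0))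
      (C.z_mem hx 0) h₀
    obtain ⟨u₁, rfl⟩ := G.exists_section_of_mem_nodeImage (hK 1) (g 1) (hW.preimage (C.i 1))
      (C.z_mem hx 1) h₁
    refine ⟨((show Γ(K 0, C.i 0 ⁻¹ᵁ W) from u₀), (show Γ(K 1, C.i 1 ⁻¹ᵁ W) from -u₁)), ?_⟩
    refine (G.nodeDiff_of_mem hx u₀ (-u₁)).trans ?_
    rw [map_neg, map_neg, map_neg, sub_neg_eq_add]
  · rw [G.nodeSpace_of_notMem hx, Submodule.mem_bot] at hv
    exact ⟨0, by rw [map_zero, hv]⟩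

open Classical in
/-- The differential on values at the node. -/
def nodeCech (g : ∀ j, K j ⟶ N j) (U V : C.X₀.Opens) :
    (G.nodeSpace g U × G.nodeSpace g V) →ₗ[ℂ] G.nodeSpace g (U ⊓ V) :=
  -- If the node is not in `U ⊓ V`, the target is zero while a factor of the source may not be, so
  -- the difference has to be replaced by 0.
  LinearMap.codRestrict _ ((if C.x₀ ∈ U ⊓ V then (1 : ℂ) else 0) •
    ((G.nodeSpace g U).subtype.comp (LinearMap.fst ℂ _ _) -
      (G.nodeSpace g V).subtype.comp (LinearMap.snd ℂ _ _))) (by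
    rintro ⟨⟨u, hu⟩, ⟨v, hv⟩⟩
    by_cases hx : C.x₀ ∈ U ⊓ V
    · rw [G.nodeSpace_of_mem (W := U) hx.1] at hu
      rw [G.nodeSpace_of_mem (W := V) hx.2] at hv
      rw [G.nodeSpace_of_mem hx, if_pos hx, one_smul]
      exact sub_mem hu hv
    · rw [if_neg hx, zero_smul]
      exact zero_mem _)

open Classical in
lemma coe_nodeCech_of_mem {U V : C.X₀.Opens} (hx : C.x₀ ∈ U ⊓ V) (u) :
    (G.nodeCech g U V u : Fin n → ℂ) = u.1 - u.2 := by
  change ((if C.x₀ ∈ U ⊓ V then (1 : ℂ) else 0) • ((u.1 : Fin n → ℂ) - u.2)) = _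
  rw [if_pos hx, one_smul]

lemma nodeCech_surjective (U V : C.X₀.Opens) : Function.Surjective (G.nodeCech g U V) := by
  rintro ⟨v, hv⟩
  by_cases hx : C.x₀ ∈ U ⊓ V
  · have hv' : v ∈ G.nodeSpace g U := by
      rw [G.nodeSpace_of_mem hx] at hv
      rwa [G.nodeSpace_of_mem (W := U) hx.1]
    refine ⟨(⟨v, hv'⟩, 0), Subtype.ext ?_⟩
    rw [G.coe_nodeCech_of_mem hx]
    exact sub_zero v
  · refine ⟨0, Subtype.ext ?_⟩
    rw [G.nodeSpace_of_notMem hx, Submodule.mem_bot] at hv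
    rw [map_zero]
    exact hv.symm

/-- The skyscraper at the node has Euler characteristic equal to its dimension, whichever members of
the cover contain the node. -/
lemma finrank_nodeSpace {U V : C.X₀.Opens} (hUV : U ⊔ V = ⊤) :
    (Module.finrank ℂ (G.nodeSpace g U × G.nodeSpace g V) : ℤ) -
      Module.finrank ℂ (G.nodeSpace g (U ⊓ V)) =
        Module.finrank ℂ ↥(G.nodeImage (g 0) ⊔ G.nodeImage (g 1)) := by
  rw [Module.finrank_prod]
  have h1 : C.x₀ ∈ U ⊔ V := hUV ▸ TopologicalSpace.Opens.mem_top _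
  have h2 : ∀ W : C.X₀.Opens, C.x₀ ∈ W →
      G.nodeSpace g W = G.nodeImage (g 0) ⊔ G.nodeImage (g 1) := fun W h => G.nodeSpace_of_mem h
  have h3 : ∀ W : C.X₀.Opens, C.x₀ ∉ W → G.nodeSpace g W = ⊥ := fun W h => G.nodeSpace_of_notMem h
  by_cases hU : C.x₀ ∈ U
  · by_cases hV : C.x₀ ∈ V
    · rw [h2 U hU, h2 V hV, h2 (U ⊓ V) ⟨hU, hV⟩]
      push_cast
      ring
    · rw [h2 U hU, h3 V hV, h3 (U ⊓ V) fun h => hV h.2]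
      simp
  · have hV : C.x₀ ∈ V := h1.resolve_left hU
    rw [h3 U hU, h2 V hV, h3 (U ⊓ V) fun h => hU h.1]
    simp

set_option maxHeartbeats 1000000 in
/-- The Euler characteristic of a glued subsheaf. -/
lemma IsGlued.eulerChar_eq (h : G.IsGlued f g) [∀ j, Mono (g j)] [Mono f]
    (hK : ∀ j, HasBases (K j)) {U V : C.X₀.Opens} (hU : IsAffineOpen U) (hV : IsAffineOpen V)
    (hUV : U ⊔ V = ⊤) :
    eulerChar C.str U V F =
      eulerChar (C.compStr 0) (C.i 0 ⁻¹ᵁ U) (C.i 0 ⁻¹ᵁ V) (K 0) +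
        eulerChar (C.compStr 1) (C.i 1 ⁻¹ᵁ U) (C.i 1 ⁻¹ᵁ V) (K 1) -
        Module.finrank ℂ ↥(G.nodeImage (g 0) ⊔ G.nodeImage (g 1)) := by
  let d : ∀ j, _ := fun j => cechDiff (C.compStr j) (C.i j ⁻¹ᵁ U) (C.i j ⁻¹ᵁ V) (K j)
  have hcov : ∀ j, C.i j ⁻¹ᵁ U ⊔ C.i j ⁻¹ᵁ V = ⊤ := fun j => by
    change C.i j ⁻¹ᵁ (U ⊔ V) = ⊤
    rw [hUV]
    rfl
  have : ∀ j, Module.Finite ℂ (LinearMap.ker (d j)) := fun j =>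
    finite_ker_cechDiff _ (hK j) (hU.preimage _) (hV.preimage _) (hcov j)
  have : ∀ j, Module.Finite ℂ (_ ⧸ LinearMap.range (d j)) := fun j =>
    finite_quotient_cechDiff _ (hK j) (hU.preimage _)
  let b := (d 0).prodMap (d 1)
  have : Module.Finite ℂ (LinearMap.ker b) := Module.Finite.equiv (kerProdMapEquiv _ _).symm
  have : Module.Finite ℂ (_ ⧸ LinearMap.range b) := Module.Finite.equiv (cokerProdMapEquiv _ _).symm
  have hb1 : Module.finrank ℂ (LinearMap.ker b) = Module.finrank ℂ (LinearMap.ker (d 0)) +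
      Module.finrank ℂ (LinearMap.ker (d 1)) := by
    rw [(kerProdMapEquiv (d 0) (d 1)).finrank_eq, Module.finrank_prod]
  have hb2 : Module.finrank ℂ (_ ⧸ LinearMap.range b) = Module.finrank ℂ (_ ⧸ LinearMap.range (d 0)) +
      Module.finrank ℂ (_ ⧸ LinearMap.range (d 1)) := by
    rw [(cokerProdMapEquiv (d 0) (d 1)).finrank_eq, Module.finrank_prod]
  let θ : ∀ W, _ →ₗ[ℂ] G.nodeSpace g W := fun W => (G.nodeDiff g W).codRestrict _ (G.nodeDiff_mem W)
  let i₀ : (Sections C.str F U × Sections C.str F V) →ₗ[ℂ] _ :=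
    ((h.part 0 U).prodMap (h.part 0 V)).prod ((h.part 1 U).prodMap (h.part 1 V))
  let i₁ : Sections C.str F (U ⊓ V) →ₗ[ℂ]
      (Sections (C.compStr 0) (K 0) (C.i 0 ⁻¹ᵁ U ⊓ C.i 0 ⁻¹ᵁ V) ×
        Sections (C.compStr 1) (K 1) (C.i 1 ⁻¹ᵁ U ⊓ C.i 1 ⁻¹ᵁ V)) :=
    (h.part 0 (U ⊓ V)).prod (h.part 1 (U ⊓ V))
  let p₀ : ((Sections (C.compStr 0) (K 0) (C.i 0 ⁻¹ᵁ U) ×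
      Sections (C.compStr 0) (K 0) (C.i 0 ⁻¹ᵁ V)) × (Sections (C.compStr 1) (K 1) (C.i 1 ⁻¹ᵁ U) ×
      Sections (C.compStr 1) (K 1) (C.i 1 ⁻¹ᵁ V))) →ₗ[ℂ] (G.nodeSpace g U × G.nodeSpace g V) :=
    ((θ U).comp ((LinearMap.fst ℂ _ _).prodMap (LinearMap.fst ℂ _ _))).prod
      ((θ V).comp ((LinearMap.snd ℂ _ _).prodMap (LinearMap.snd ℂ _ _)))
  let p₁ : (Sections (C.compStr 0) (K 0) (C.i 0 ⁻¹ᵁ U ⊓ C.i 0 ⁻¹ᵁ V) ×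
        Sections (C.compStr 1) (K 1) (C.i 1 ⁻¹ᵁ U ⊓ C.i 1 ⁻¹ᵁ V)) →ₗ[ℂ] G.nodeSpace g (U ⊓ V) :=
    θ (U ⊓ V)
  -- The Čech complexes of `F`, of the two component subsheaves together, and of the skyscraper of
  -- values at the node form a short exact sequence; surjectivity in degree zero uses that `U` and
  -- `V` are affine.
  have key := index_of_exact (cechDiff C.str U V F) b (G.nodeCech g U V) i₀ i₁ p₀ p₁
    (fun x y hxy => Prod.ext
      (h.part_injective G (congrArg (fun q => q.1.1) hxy) (congrArg (fun q => q.2.1) hxy))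
      (h.part_injective G (congrArg (fun q => q.1.2) hxy) (congrArg (fun q => q.2.2) hxy)))
    (fun x y hxy => h.part_injective G (congrArg Prod.fst hxy) (congrArg Prod.snd hxy))
    (by
      rintro ⟨⟨u, hu⟩, ⟨v, hv⟩⟩
      obtain ⟨u', rfl⟩ := G.exists_nodeDiff_eq hK hU hu
      obtain ⟨v', rfl⟩ := G.exists_nodeDiff_eq hK hV hv
      exact ⟨((u'.1, v'.1), (u'.2, v'.2)), rfl⟩)
    (by
      rintro ⟨⟨u₀, v₀⟩, ⟨u₁, v₁⟩⟩
      constructor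
      · intro h0
        obtain ⟨t, ht0, ht1⟩ := (h.nodeDiff_eq_zero_iff G u₀ u₁).1
          (congrArg (fun q => (q.1 : Fin n → ℂ)) h0)
        obtain ⟨t', ht0', ht1'⟩ := (h.nodeDiff_eq_zero_iff G v₀ v₁).1
          (congrArg (fun q => (q.2 : Fin n → ℂ)) h0)
        exact ⟨(t, t'), Prod.ext (Prod.ext ht0 ht0') (Prod.ext ht1 ht1')⟩
      · rintro ⟨⟨t, t'⟩, ht⟩
        exact Prod.ext (Subtype.ext ((h.nodeDiff_eq_zero_iff G u₀ u₁).2 ⟨t,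
            congrArg (fun q => q.1.1) ht, congrArg (fun q => q.2.1) ht⟩))
          (Subtype.ext ((h.nodeDiff_eq_zero_iff G v₀ v₁).2 ⟨t',
            congrArg (fun q => q.1.2) ht, congrArg (fun q => q.2.2) ht⟩)))
    (by
      rintro ⟨u₀, u₁⟩
      constructor
      · intro h0
        obtain ⟨t, ht0, ht1⟩ := (h.nodeDiff_eq_zero_iff G (W := U ⊓ V) u₀ u₁).1
          (congrArg (fun q : G.nodeSpace g (U ⊓ V) => (q : Fin n → ℂ)) h0)
        exact ⟨t, Prod.ext ht0 ht1⟩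
      · rintro ⟨t, ht⟩
        exact Subtype.ext ((h.nodeDiff_eq_zero_iff G (W := U ⊓ V) u₀ u₁).2
          ⟨t, congrArg Prod.fst ht, congrArg Prod.snd ht⟩))
    (LinearMap.ext fun ⟨t, t'⟩ => by
      have key : ∀ j, h.part j (U ⊓ V) (cechDiff C.str U V F (t, t')) =
          (show Sections (C.compStr j) (K j) (C.i j ⁻¹ᵁ U ⊓ C.i j ⁻¹ᵁ V) from
            d j (h.part j U t, h.part j V t')) := fun j =>
        (map_sub (h.part j (U ⊓ V)) _ _).trans (congrArg₂ _ (h.part_rs G j inf_le_left t)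
          (h.part_rs G j inf_le_right t'))
      exact Prod.ext (key 0) (key 1))
    (LinearMap.ext fun ⟨⟨u₀, v₀⟩, ⟨u₁, v₁⟩⟩ => Subtype.ext (by
      by_cases hx : C.x₀ ∈ U ⊓ V
      · refine Eq.trans ?_ (G.coe_nodeCech_of_mem hx _).symm
        refine (map_sub (G.nodeDiff g (U ⊓ V))
          ((show Γ(K 0, C.i 0 ⁻¹ᵁ (U ⊓ V)) from rs (K 0) (pre_mono (C.i 0) inf_le_left) u₀),
            (show Γ(K 1, C.i 1 ⁻¹ᵁ (U ⊓ V)) from rs (K 1) (pre_mono (C.i 1) inf_le_left) u₁))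
          ((show Γ(K 0, C.i 0 ⁻¹ᵁ (U ⊓ V)) from rs (K 0) (pre_mono (C.i 0) inf_le_right) v₀),
            (show Γ(K 1, C.i 1 ⁻¹ᵁ (U ⊓ V)) from rs (K 1) (pre_mono (C.i 1) inf_le_right) v₁))).trans ?_
        exact congrArg₂ _ (G.nodeDiff_rs hx inf_le_left u₀ u₁) (G.nodeDiff_rs hx inf_le_right v₀ v₁)
      · have h0 : ∀ w : G.nodeSpace g (U ⊓ V), (w : Fin n → ℂ) = 0 := fun w => by
          have h1 : ∀ v ∈ G.nodeSpace g (U ⊓ V), v = 0 := fun v hv => by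
            rwa [G.nodeSpace_of_notMem hx, Submodule.mem_bot] at hv
          exact h1 _ w.2
        exact (h0 _).trans (h0 _).symm))
    (G.nodeCech_surjective U V)
  have hT := G.finrank_nodeSpace (g := g) hUV
  unfold eulerChar
  rw [key, hT, hb1, hb2]
  push_cast
  ring

end GluedModule

end NodalCurve


/-! ### Values of sections in fibres -/

section Values

variable {X : Scheme.{0}} {M N : X.Modules}

lemma value_rs {V W : X.Opens} (h : V ≤ W) {x : X} (hx : x ∈ V) (t : Γ(M, W)) :
    value M V x hx (rs M h t) = value M W x (h hx) t :=
  congrArg (fun m => (1 : X.residueField x) ⊗ₜ[X.presheaf.stalk x] m) (gm_rs M h hx t)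

lemma value_add {W : X.Opens} {x : X} (hx : x ∈ W) (t t' : Γ(M, W)) :
    value M W x hx (t + t') = value M W x hx t + value M W x hx t' := by
  change (1 : X.residueField x) ⊗ₜ[X.presheaf.stalk x] (gm M hx (t + t')) = _
  rw [map_add, TensorProduct.tmul_add]
  rfl

lemma value_smul {W : X.Opens} {x : X} (hx : x ∈ W) (a : Γ(X, W)) (t : Γ(M, W)) :
    value M W x hx (a • t) = (X.residue x).hom (gr X hx a) • value M W x hx t := by
  change (1 : X.residueField x) ⊗ₜ[X.presheaf.stalk x] (gm M hx (a • t)) = _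
  rw [gm_smul, TensorProduct.tmul_smul, TensorProduct.smul_tmul']
  change _ = (X.residue x).hom (gr X hx a) • (1 : X.residueField x) ⊗ₜ[X.presheaf.stalk x] (gm M hx t)
  rw [TensorProduct.smul_tmul', Algebra.smul_def]
  rfl

lemma value_sum {W : X.Opens} {x : X} (hx : x ∈ W) {n : ℕ} (t : Fin n → Γ(M, W)) :
    value M W x hx (∑ k, t k) = ∑ k, value M W x hx (t k) :=
  map_sum (⟨⟨value M W x hx, by simpa using value_smul hx (0 : Γ(X, W)) (0 : Γ(M, W))⟩,
    value_add hx⟩ : Γ(M, W) →+ Fiber M x) t Finset.univ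

lemma exists_value_eq {x : X} (v : Fiber M x) :
    ∃ (W : X.Opens) (hx : x ∈ W) (t : Γ(M, W)), value M W x hx t = v := by
  obtain ⟨m, rfl⟩ : ∃ m, (1 : X.residueField x) ⊗ₜ[X.presheaf.stalk x] m = v := by
    induction v using TensorProduct.induction_on with
    | zero => exact ⟨0, TensorProduct.tmul_zero _ _⟩
    | tmul r m =>
      obtain ⟨a, rfl⟩ := Ideal.Quotient.mk_surjective r
      refine ⟨a • m, ?_⟩
      rw [TensorProduct.tmul_smul, TensorProduct.smul_tmul', Algebra.smul_def, mul_one]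
      rfl
    | add u v hu hv =>
      obtain ⟨m, rfl⟩ := hu
      obtain ⟨m', rfl⟩ := hv
      exact ⟨m + m', TensorProduct.tmul_add _ _ _⟩
  obtain ⟨W, hx, t, rfl⟩ := exists_gm M m
  exact ⟨W, hx, t, rfl⟩

lemma fiberMap_value (f : M ⟶ N) {W : X.Opens} {x : X} (hx : x ∈ W) (t : Γ(M, W)) :
    fiberMap f x (value M W x hx t) = value N W x hx (ap f W t) :=
  (LinearMap.baseChange_tmul _ _ _).trans
    (congrArg (fun m => (1 : X.residueField x) ⊗ₜ[X.presheaf.stalk x] m) (stalkMap_gm f hx t))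

end Values

/-! ### Fibres of a module and of its restriction to a closed subscheme -/

section FiberComparison

variable {X Y : Scheme.{0}} (i : Y ⟶ X)

/-- The map of residue fields. -/
def residueMap (y : Y) : X.residueField (i y) →+* Y.residueField y := (i.residueFieldMap y).hom

lemma residueMap_gr {W : X.Opens} {y : Y} (hx : i y ∈ W) (a : Γ(X, W)) :
    residueMap i y ((X.residue (i y)).hom (gr X hx a)) =
      (Y.residue y).hom (gr Y (W := i ⁻¹ᵁ W) hx (pf i W a)) := by
  have h1 := ConcreteCategory.congr_hom (Scheme.residue_residueFieldMap i y) (gr X hx a)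
  have h2 := ConcreteCategory.congr_hom (i.germ_stalkMap W y hx) a
  exact h1.trans (congrArg (Y.residue y).hom h2)

lemma residueMap_bijective [IsClosedImmersion i] (y : Y) : Function.Bijective (residueMap i y) := by
  refine ⟨(residueMap i y).injective, fun r => ?_⟩
  obtain ⟨a, rfl⟩ := Ideal.Quotient.mk_surjective r
  obtain ⟨b, rfl⟩ := i.stalkMap_surjective y a
  exact ⟨(X.residue (i y)).hom b, ConcreteCategory.congr_hom (Scheme.residue_residueFieldMap i y) b⟩

variable {i} {E : X.Modules} {N : Y.Modules} {ψ : E ⟶ (Scheme.Modules.pushforward i).obj N} {n : ℕ}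
  {W : X.Opens} {e : Fin n → Γ(E, W)} (he : IsBasisOn E W e)
  (he' : IsBasisOn N (i ⁻¹ᵁ W) (fun k => pa ψ W (e k))) {y : Y} (hx : i y ∈ W)

/-- The comparison of the fibre of a module with that of its restriction. -/
def fiberComparison : Fiber E (i y) →+ Fiber N y where
  toFun v := ∑ k, residueMap i y ((he.fiberBasis hx).repr v k) • he'.fiberBasis (x := y) hx k
  map_zero' := by simp
  map_add' a b := by simp [add_smul, Finset.sum_add_distrib]

lemma fiberComparison_smul (c : X.residueField (i y)) (v : Fiber E (i y)) :
    fiberComparison he he' hx (c • v) = residueMap i y c • fiberComparison he he' hx v := by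
  simp [fiberComparison, Finset.smul_sum, mul_smul]

lemma fiberComparison_value {W' : X.Opens} (hx' : i y ∈ W') (t : Γ(E, W')) :
    fiberComparison he he' hx (value E W' (i y) hx' t) =
      value N (i ⁻¹ᵁ W') y hx' (pa ψ W' t) := by
  have h1 : i y ∈ W' ⊓ W := ⟨hx', hx⟩
  have h2 := he.sum_coord inf_le_right (rs E (inf_le_left : W' ⊓ W ≤ W') t)
  set a := he.coord inf_le_right (rs E (inf_le_left : W' ⊓ W ≤ W') t)
  have h3 : value E W' (i y) hx' t = ∑ k, (X.residue (i y)).hom (gr X h1 (a k)) •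
      he.fiberBasis hx k := by
    rw [← value_rs (inf_le_left : W' ⊓ W ≤ W') h1, ← h2, value_sum]
    simp only [value_smul, value_rs, he.fiberBasis_apply]
  have h1' : y ∈ i ⁻¹ᵁ (W' ⊓ W) := h1
  have h4 : value N (i ⁻¹ᵁ W') y hx' (pa ψ W' t) = ∑ k, (Y.residue y).hom
      (gr Y h1' (pf i _ (a k))) • he'.fiberBasis (x := y) hx k := by
    rw [← value_rs (pre_mono i (inf_le_left : W' ⊓ W ≤ W')) h1',
      ← pa_rs ψ (inf_le_left : W' ⊓ W ≤ W'), ← h2, map_sum, value_sum]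
    simp only [pa_smul, pa_rs, value_smul, value_rs]
    exact Finset.sum_congr rfl fun k _ => congrArg _ (he'.fiberBasis_apply hx k).symm
  have h5 : ∀ k, (he.fiberBasis hx).repr (value E W' (i y) hx' t) k =
      (X.residue (i y)).hom (gr X h1 (a k)) := fun k => by
    rw [h3, Module.Basis.repr_sum_self]
  change ∑ k, residueMap i y ((he.fiberBasis hx).repr _ k) • _ = _
  simp only [h5, h4, residueMap_gr]

lemma fiberComparison_bijective [IsClosedImmersion i] :
    Function.Bijective (fiberComparison he he' hx) := by
  constructor
  · rw [injective_iff_map_eq_zero]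
    intro v hv
    have h1 := Fintype.linearIndependent_iff.1 (he'.fiberBasis (x := y) hx).linearIndependent _ hv
    refine (he.fiberBasis hx).ext_elem fun k => (residueMap_bijective i y).1 ?_
    rw [h1 k, map_zero, Finsupp.zero_apply, map_zero]
  · intro w
    choose c hc using fun k => (residueMap_bijective i y).2 ((he'.fiberBasis (x := y) hx).repr w k)
    refine ⟨∑ k, c k • he.fiberBasis hx k, ?_⟩
    change ∑ k, residueMap i y ((he.fiberBasis hx).repr _ k) • _ = _
    simp only [Module.Basis.repr_sum_self, hc]
    exact (he'.fiberBasis (x := y) hx).sum_repr w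

/-- The comparison of fibres is bijective and semilinear over an isomorphism of residue fields, so
it preserves dimensions. -/
lemma finrank_eq_of_fiberComparison [IsClosedImmersion i]
    (A : Submodule (X.residueField (i y)) (Fiber E (i y)))
    (B : Submodule (Y.residueField y) (Fiber N y))
    (h : ∀ v, v ∈ A ↔ fiberComparison he he' hx v ∈ B) :
    Module.finrank (X.residueField (i y)) A = Module.finrank (Y.residueField y) B := by
  let J := fiberComparison he he' hx
  have hJ := fiberComparison_bijective he he' hx
  let φ : A ≃+ B := AddEquiv.ofBijective
    ({ toFun := fun v => ⟨J v.1, (h v.1).1 v.2⟩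
       map_zero' := Subtype.ext (map_zero J)
       map_add' := fun a b => Subtype.ext (map_add J a.1 b.1) } : A →+ B)
    ⟨fun a b hab => Subtype.ext (hJ.1 (congrArg Subtype.val hab)), fun b => by
      obtain ⟨v, hv⟩ := hJ.2 b
      exact ⟨⟨v, (h v).2 (by rw [hv]; exact b.2)⟩, Subtype.ext hv⟩⟩
  have h1 := rank_eq_of_equiv_equiv (residueMap i y) φ (residueMap_bijective i y)
    (fun r m => Subtype.ext (fiberComparison_smul he he' hx r m.1))
  exact congrArg Cardinal.toNat h1

end FiberComparison

lemma HasBases.fiberDim_eq_zero {X : Scheme.{0}} [IsIntegral X] {M : X.Modules} (hM : IsZero M) :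
    fiberDim M (genericPoint X) = 0 := by
  have : Subsingleton (Fiber M (genericPoint X)) := ⟨fun v w => by
    obtain ⟨W, hW, t, rfl⟩ := exists_value_eq v
    obtain ⟨W', hW', t', rfl⟩ := exists_value_eq w
    rw [section_eq_zero_of_isZero hM W t, section_eq_zero_of_isZero hM W' t', value, value]
    exact congrArg _ ((map_zero (gm M hW)).trans (map_zero (gm M hW')).symm)⟩
  exact Module.finrank_zero_of_subsingleton

lemma HasBases.section_eq_zero {X : Scheme.{0}} [IsIntegral X] {M : X.Modules} (hM : HasBases M)
    (h : fiberDim M (genericPoint X) = 0) {W : X.Opens} (t : Γ(M, W)) : t = 0 := by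
  refine section_ext _ _ _ fun x hx => ?_
  obtain ⟨V, m, e, hxV, he⟩ := hM x
  obtain rfl : m = 0 := (he.fiberDim_eq (eta_mem hxV)).symm.trans h
  refine ⟨W ⊓ V, inf_le_left, ⟨hx, hxV⟩, ?_⟩
  rw [map_zero, ← he.sum_coord inf_le_right (rs M inf_le_left t)]
  exact Finset.sum_empty

lemma fiberDim_eq_of_isIso {X : Scheme.{0}} [IsIntegral X] {M N : X.Modules} (hM : HasBases M)
    (f : M ⟶ N) [IsIso f] :
    fiberDim M (genericPoint X) = fiberDim N (genericPoint X) := by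
  obtain ⟨V, m, e, hxV, he⟩ := hM (genericPoint X)
  rw [he.fiberDim_eq hxV, (he.map_of_bijective f).fiberDim_eq hxV]

/-- Equal ranks leave no complementary vectors in an adapted basis, so the saturated subsheaf is
everything. -/
lemma sat_carrier_eq_top {X : Scheme.{0}} [IsSmoothCurve X] {M : X.Modules} (hM : HasBases M)
    (L : Submodule (X.presheaf.stalk (genericPoint X)) (M.presheaf.stalk (genericPoint X)))
    (h : fiberDim (sat M L).toModules (genericPoint X) = fiberDim M (genericPoint X))
    {W : X.Opens} (t : Γ(M, W)) : t ∈ (sat M L).carrier W := by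
  refine (sat M L).local_mem t fun x hx => ?_
  obtain ⟨V, n, e, hxV, he⟩ := hM x
  obtain ⟨d, c, V', e₁, e₂, hxV', -, hdc, ha⟩ :=
    exists_isAdaptedBasis L he hxV (IsSmoothCurve.pid x)
  rw [ha.isBasisOn_sat.fiberDim_eq (eta_mem hxV'), he.fiberDim_eq (eta_mem hxV)] at h
  obtain rfl : c = 0 := by omega
  refine ⟨W ⊓ V', inf_le_left, ⟨hx, hxV'⟩, ?_⟩
  obtain ⟨a, b, hab⟩ := ha.exists_coord inf_le_right (rs M (inf_le_left : W ⊓ V' ≤ W) t)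
  rw [hab, ha.mem_iff]
  exact Subsingleton.elim _ _

/-! ### Ranks and fibres of glued subsheaves -/

namespace NodalCurve

variable {C : NodalCurve}

namespace GluedModule

variable {n : ℕ} {N : ∀ j, (C.X j).Modules} {G : C.GluedModule n N}
  {F : C.X₀.Modules} {f : F ⟶ G.E} {K : ∀ j, (C.X j).Modules} {g : ∀ j, K j ⟶ N j}

lemma fiberDim_component (G : C.GluedModule n N) (j : Fin 2) (y : C.X j) : fiberDim (N j) y = n := by
  obtain ⟨W, e, hy, he⟩ := G.exists_basis_component j y
  exact he.fiberDim_eq hy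

lemma IsGlued.exists_part_eq (h : G.IsGlued f g) [∀ j, Mono (g j)] {j : Fin 2} {W : C.X₀.Opens}
    (hW : C.OnlyIn j W) (u : Γ(K j, C.i j ⁻¹ᵁ W)) : ∃ t : Γ(F, W), h.part j W t = u := by
  obtain ⟨s, hs⟩ := G.exists_pa_eq_of_onlyIn hW (ap (g j) _ u)
  obtain ⟨t, rfl⟩ := (h W s).2 fun j' => by
    by_cases hj : j' = j
    · subst hj
      exact ⟨u, hs.symm⟩
    · have := subsingleton_sections (N j') (hW j' hj)
      exact ⟨0, Subsingleton.elim _ _⟩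
  exact ⟨t, ap_injective (g j) _ ((h.ap_part G j W t).trans hs)⟩

lemma IsGlued.part_injective_of_onlyIn (h : G.IsGlued f g) [∀ j, Mono (g j)] [Mono f] {j : Fin 2}
    {W : C.X₀.Opens} (hW : C.OnlyIn j W) : Function.Injective (h.part j W) := fun t t' ht =>
  ap_injective f W (G.eq_of_onlyIn hW ((h.ap_part G j W t).symm.trans
    ((congrArg _ ht).trans (h.ap_part G j W t'))))

lemma IsGlued.part_smul (h : G.IsGlued f g) [∀ j, Mono (g j)] (j : Fin 2) {W : C.X₀.Opens}
    (a : Γ(C.X₀, W)) (t : Γ(F, W)) : h.part j W (show Γ(F, W) from a • t) =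
      pf (C.i j) W a • (show Γ(K j, C.i j ⁻¹ᵁ W) from h.part j W t) := by
  refine ap_injective (g j) _ ((h.ap_part G j W _).trans ?_)
  rw [map_smul, pa_smul, map_smul]
  exact congrArg _ (h.ap_part G j W t).symm

lemma IsGlued.exists_isBasisOn (h : G.IsGlued f g) [∀ j, Mono (g j)] [Mono f] {j : Fin 2}
    {W : C.X₀.Opens} (hW : C.OnlyIn j W) {m : ℕ} {e : Fin m → Γ(K j, C.i j ⁻¹ᵁ W)}
    (he : IsBasisOn (K j) (C.i j ⁻¹ᵁ W) e) : ∃ e' : Fin m → Γ(F, W), IsBasisOn F W e' := by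
  choose e' he' using fun k => h.exists_part_eq hW (e k)
  refine ⟨e', fun V hV => ?_⟩
  have hV' := hW.mono hV
  let P : Γ(F, V) →+ Γ(K j, C.i j ⁻¹ᵁ V) := (h.part j V).toAddMonoidHom
  have hP : Function.Bijective P := ⟨h.part_injective_of_onlyIn hV', h.exists_part_eq hV'⟩
  rw [← hP.of_comp_iff']
  have hpf : Function.Bijective (fun a : Fin m → Γ(C.X₀, V) => fun k => pf (C.i j) V (a k)) :=
    ⟨fun a b hab => funext fun k => hV'.pf_injective (congrFun hab k), fun b => by
      choose a ha using fun k => hV'.exists_pf_eq (b k)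
      exact ⟨a, funext ha⟩⟩
  convert (he _ (pre_mono (C.i j) hV)).comp hpf using 1
  funext a
  simp only [Function.comp, map_sum]
  refine Finset.sum_congr rfl fun k _ => ?_
  refine (h.part_smul j (a k) (rs F hV (e' k))).trans (congrArg _ ?_)
  refine (h.part_rs G j hV (e' k)).trans (congrArg _ (he' k))

/-- The rank of a glued subsheaf on a component. -/
lemma IsGlued.fiberDim_gen (h : G.IsGlued f g) [∀ j, Mono (g j)] [Mono f] (hK : ∀ j, HasBases (K j))
    (j : Fin 2) : fiberDim F (C.gen j) = fiberDim (K j) (genericPoint (C.X j)) := by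
  obtain ⟨U, m, e, hη, he⟩ := hK j (genericPoint (C.X j))
  obtain ⟨W, hηW, hWU, hW⟩ := exists_onlyIn U (C.eta_ne_z j) hη
  obtain ⟨e', he'⟩ := h.exists_isBasisOn hW (he.res hWU)
  exact (he'.fiberDim_eq hηW).trans (he.fiberDim_eq hη).symm

lemma IsGlued.isZero (h : G.IsGlued f g) [∀ j, Mono (g j)] [Mono f] (hK : ∀ j, HasBases (K j))
    (h0 : ∀ j, fiberDim (K j) (genericPoint (C.X j)) = 0) : IsZero F :=
  isZero_of_section_eq_zero fun _ _ => h.part_injective G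
    ((hK 0).section_eq_zero (h0 0) _ |>.trans ((hK 0).section_eq_zero (h0 0) _).symm)
    ((hK 1).section_eq_zero (h0 1) _ |>.trans ((hK 1).section_eq_zero (h0 1) _).symm)

lemma hasBases_satSub (f : F ⟶ G.E) (j : Fin 2) : HasBases (G.satSub f j).toModules :=
  hasBases_sat _ (G.hasBases j) IsSmoothCurve.pid

lemma isIso_of_fiberDim [Mono f] (hf : IsTorsionFree (cokernel f))
    (h : ∀ j, fiberDim (G.satSub f j).toModules (genericPoint (C.X j)) = n) : IsIso f := by
  refine isIso_of_ap_bijective f fun W => ⟨ap_injective f W, fun s => ?_⟩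
  refine (G.isGlued_satSub f hf W s).2 fun j => ?_
  rw [LocalSub.range_ap_ι]
  exact sat_carrier_eq_top (G.hasBases j) _ ((h j).trans (G.fiberDim_component j _).symm) _

/-! ### Values at the node -/

lemma linearIndependent_ν (G : C.GluedModule n N) (j : Fin 2) {m : ℕ} {V : (C.X j).Opens}
    {e : Fin m → Γ(N j, V)} (he : IsBasisOn (N j) V e) (hz : C.z j ∈ V) :
    LinearIndependent ℂ (fun k => G.ν j (gm (N j) hz (e k))) := by
  refine linearIndependent_of_top_le_span_of_card_eq_finrank ?_ ?_
  · rintro v -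
    obtain ⟨w, rfl⟩ := nodeValue_surjective (G.isBasisOn_node j) (G.z_mem j) v
    change G.ν j w ∈ _
    rw [← (he.stalkBasis hz).sum_repr w, map_sum]
    refine Submodule.sum_mem _ fun k _ => ?_
    rw [ν_smul, he.stalkBasis_apply]
    exact Submodule.smul_mem _ _ (Submodule.subset_span ⟨k, rfl⟩)
  · rw [Fintype.card_fin, Module.finrank_fin_fun, ← he.fiberDim_eq hz, G.fiberDim_component]

/-- A basis of the saturated subsheaf at the node is part of a basis of `N j`, so its values in ℂ^n
stay independent. Without saturation they could vanish. -/
lemma fiberDim_le_finrank_nodeImage (f : F ⟶ G.E) (j : Fin 2) :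
    fiberDim (G.satSub f j).toModules (genericPoint (C.X j)) ≤
      Module.finrank ℂ (G.nodeImage (G.satSub f j).ι) := by
  obtain ⟨V, e, hz, he⟩ := G.exists_basis_component j (C.z j)
  obtain ⟨d, c, V', e₁, e₂, hz', -, -, ha⟩ :=
    exists_isAdaptedBasis (G.genSub f j) he hz (IsSmoothCurve.pid _)
  rw [show fiberDim (G.satSub f j).toModules (genericPoint (C.X j)) = d from
    ha.isBasisOn_sat.fiberDim_eq (eta_mem hz')]
  have h1 := (G.linearIndependent_ν j ha.isBasisOn hz').comp (Fin.castAdd c)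
    (Fin.castAdd_injective d c)
  let w : Fin d → G.nodeImage (G.satSub f j).ι := fun k => ⟨G.ν j (gm (N j) hz' (e₁ k)),
    gm _ hz' (ha.satBasis k), congrArg _ (stalkMap_gm (sat (N j) (G.genSub f j)).ι hz' _)⟩
  have h2 : LinearIndependent ℂ w := by
    refine LinearIndependent.of_comp (Submodule.subtype _) ?_
    convert h1 using 1
    funext k
    simp [w]
  have h3 := h2.fintype_card_le_finrank
  rwa [Fintype.card_fin] at h3

lemma nodeImage_id (G : C.GluedModule n N) (j : Fin 2) : G.nodeImage (𝟙 (N j)) = ⊤ := by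
  rw [eq_top_iff]
  rintro v -
  obtain ⟨m, rfl⟩ := nodeValue_surjective (G.isBasisOn_node j) (G.z_mem j) v
  refine ⟨m, ?_⟩
  obtain ⟨W, hx, t, rfl⟩ := exists_gm _ m
  rw [stalkMap_gm]
  rfl

/-! ### Induced parabolic structures -/

/-- Away from the node, small open sets meet only one component, where sections of `F` and of `K j`
correspond. The images of their fibres therefore match under the comparison of fibres. -/
lemma IsGlued.finrank_inf (h : G.IsGlued f g) [∀ j, Mono (g j)] [Mono f] {j : Fin 2} {y : C.X j}
    (hy : y ≠ C.z j) (A : Submodule (C.X₀.residueField (C.i j y)) (Fiber G.E (C.i j y)))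
    (B : Submodule ((C.X j).residueField y) (Fiber (N j) y))
    (hAB : ∀ (W : C.X₀.Opens) (hx : C.i j y ∈ W) (t : Γ(G.E, W)),
      value G.E W (C.i j y) hx t ∈ A ↔ value (N j) (C.i j ⁻¹ᵁ W) y hx (pa (G.ψ j) W t) ∈ B) :
    Module.finrank (C.X₀.residueField (C.i j y))
        ↥(LinearMap.range (fiberMap f (C.i j y)) ⊓ A) =
      Module.finrank ((C.X j).residueField y) ↥(LinearMap.range (fiberMap (g j) y) ⊓ B) := by
  obtain ⟨W₀, e, hx₀, he⟩ := G.exists_basis (C.i j y)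
  have he' := G.isBasisOn he j
  refine finrank_eq_of_fiberComparison he he' hx₀ _ _ fun v => and_congr ⟨?_, fun hv => ?_⟩ ?_
  · rintro ⟨w, rfl⟩
    obtain ⟨W, hx, t, rfl⟩ := exists_value_eq w
    refine ⟨value (K j) (C.i j ⁻¹ᵁ W) y hx (h.part j W t), ?_⟩
    rw [fiberMap_value, fiberComparison_value]
    exact (fiberMap_value (g j) _ _).trans (congrArg _ (h.ap_part G j W t))
  · obtain ⟨w, hw⟩ := hv
    obtain ⟨U, hyU, u, rfl⟩ := exists_value_eq w
    obtain ⟨W, hyW, hWU, hW⟩ := exists_onlyIn U hy hyU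
    have hyW' : y ∈ C.i j ⁻¹ᵁ W := hyW
    obtain ⟨t, ht⟩ := h.exists_part_eq hW (rs (K j) hWU u)
    refine ⟨value F W _ hyW t, (fiberComparison_bijective he he' hx₀).1 ?_⟩
    rw [← hw, fiberMap_value, fiberComparison_value, fiberMap_value, ← value_rs hWU hyW', ← ap_rs]
    exact congrArg _ ((h.ap_part G j W t).symm.trans (congrArg _ ht))
  · obtain ⟨W, hx, t, rfl⟩ := exists_value_eq v
    refine (hAB W hx t).trans ?_
    rw [← fiberComparison_value he he' hx₀]
    rfl

/-- The parabolic structures of a module on the nodal curve and of its restrictions correspond. -/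
def FlagsCorrespond {ι : Fin 2 → Type} {D : ParabolicData (Σ j, ι j)} {p : ∀ j, ι j → C.X j}
    (P : Flags D (C.points p) G.E) (P' : ∀ j, Flags (D.comap (Sigma.mk j)) (p j) (N j)) : Prop :=
  ∀ (j : Fin 2) (x : ι j) (i : Fin (D.len ⟨j, x⟩ + 2)) (W : C.X₀.Opens) (hx : C.i j (p j x) ∈ W)
    (t : Γ(G.E, W)), value G.E W (C.i j (p j x)) hx t ∈ P.flag ⟨j, x⟩ i ↔
      value (N j) (C.i j ⁻¹ᵁ W) (p j x) hx (pa (G.ψ j) W t) ∈ (P' j).flag x i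

variable {ι : Fin 2 → Type} {D : ParabolicData (Σ j, ι j)} {p : ∀ j, ι j → C.X j}

lemma _root_.ParabolicGluing.NodalCurve.IsMarking.ne_z (hp : C.IsMarking p) (j : Fin 2) (x : ι j) :
    p j x ≠ C.z j := fun h => by
  obtain ⟨j', hj⟩ := exists_ne j
  exact hp.ne_node j j' x hj ⟨C.z j', (C.i_z j').trans ((C.i_z j).symm.trans (congrArg _ h.symm))⟩

lemma IsGlued.inducedDim_eq (h : G.IsGlued f g) [∀ j, Mono (g j)] [Mono f] (hp : C.IsMarking p)
    {P : Flags D (C.points p) G.E} {P' : ∀ j, Flags (D.comap (Sigma.mk j)) (p j) (N j)}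
    (hP : FlagsCorrespond P P') (j : Fin 2) (x : ι j) (i : Fin (D.len ⟨j, x⟩ + 1)) :
    P.inducedDim f ⟨j, x⟩ i = (P' j).inducedDim (g j) x i := by
  have h1 := fun i' => h.finrank_inf (hp.ne_z j x) (P.flag ⟨j, x⟩ i') ((P' j).flag x i')
    (fun W hx t => hP j x i' W hx t)
  exact congrArg₂ (fun a b : ℕ => (a : ℤ) - b) (h1 i.castSucc) (h1 i.succ)

/-- The parabolic Euler characteristic of a glued subsheaf. -/
lemma IsGlued.parChi_eq [∀ j, Fintype (ι j)] (h : G.IsGlued f g) [∀ j, Mono (g j)] [Mono f]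
    (hK : ∀ j, HasBases (K j)) {U V : C.X₀.Opens} (hU : IsAffineOpen U) (hV : IsAffineOpen V)
    (hUV : U ⊔ V = ⊤) (hp : C.IsMarking p)
    {P : Flags D (C.points p) G.E} {P' : ∀ j, Flags (D.comap (Sigma.mk j)) (p j) (N j)}
    (hP : FlagsCorrespond P P') :
    P.parChi C.str U V f =
      (P' 0).parChi (C.compStr 0) (C.i 0 ⁻¹ᵁ U) (C.i 0 ⁻¹ᵁ V) (g 0) +
        (P' 1).parChi (C.compStr 1) (C.i 1 ⁻¹ᵁ U) (C.i 1 ⁻¹ᵁ V) (g 1) -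
        Module.finrank ℂ ↥(G.nodeImage (g 0) ⊔ G.nodeImage (g 1)) := by
  have h1 : ∑ x, ∑ i, (P.inducedDim f x i : ℚ) * D.a x i =
      ∑ j, ∑ x, ∑ i, ((P' j).inducedDim (g j) x i : ℚ) * (D.comap (Sigma.mk j)).a x i := by
    rw [Fintype.sum_sigma]
    refine Finset.sum_congr rfl fun j _ => Finset.sum_congr rfl fun x _ =>
      Finset.sum_congr rfl fun i _ => ?_
    rw [h.inducedDim_eq hp hP]
    rfl
  rw [Flags.parChi, h1, h.eulerChar_eq G hK hU hV hUV, Fin.sum_univ_two]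
  simp only [Flags.parChi]
  have hk : ∀ j, ((D.comap (Sigma.mk j : ι j → _)).k : ℚ) = D.k := fun _ => rfl
  rw [hk 0, hk 1]
  push_cast
  ring

end GluedModule

end NodalCurve


/-! ### Numerical identities -/

/-- Summation by parts, carried out by splitting off the last index. -/
lemma sum_smul_d {l : ℕ} (a : Fin (l + 1) → ℤ) (n : Fin (l + 1) → ℕ) :
    ∑ i : Fin l, (a i.succ - a i.castSucc) * ((∑ j ∈ Finset.Iic i.castSucc, n j : ℕ) : ℤ) =
      a (Fin.last l) * ((∑ i, n i : ℕ) : ℤ) - ∑ i, (n i : ℤ) * a i := by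
  induction l with
  | zero =>
    simp only [Finset.univ_eq_empty, Finset.sum_empty, Fin.sum_univ_one, Nat.reduceAdd, Fin.last_zero]
    ring
  | succ l ih =>
    have h1 := ih (fun i => a i.castSucc) (fun i => n i.castSucc)
    rw [Fin.sum_univ_castSucc, Fin.sum_univ_castSucc (fun i => n i),
      Fin.sum_univ_castSucc (fun i => (n i : ℤ) * a i)]
    have h2 : ∀ i : Fin (l + 1), ∑ j ∈ Finset.Iic (Fin.castSucc i), n j =
        ∑ j ∈ Finset.Iic i, n j.castSucc := fun i => by
      rw [← Fin.map_castSuccEmb_Iic, Finset.sum_map]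
      rfl
    have h3 : ∑ j ∈ Finset.Iic (Fin.castSucc (Fin.last l)), n j = ∑ j : Fin (l + 1), n j.castSucc := by
      rw [h2]
      refine Finset.sum_congr ?_ fun _ _ => rfl
      ext j
      simp [Fin.le_last]
    rw [h3]
    simp only [h2]
    have h4 : ∀ i : Fin l, (i.castSucc.succ : Fin (l + 2)) = i.succ.castSucc := fun _ => rfl
    simp only [h4]
    rw [h1, Fin.succ_last]
    push_cast
    ring

/-- Here `δ_j` is the excess of `χ_j` over `n_j`, `A_j` the sum of the top weights and the `α_x`,
and `δ_j + r / k * (A_j + ℓ_j)` the parabolic Euler characteristic of the bundle on `X j`. The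
correction terms of `parχ_m` cancel the `A_j`. -/
lemma slope_identity {r k c₀ c₁ ℓ₀ ℓ₁ δ₀ δ₁ A₀ A₁ r₀ r₁ ρ T : ℚ} (hr : r ≠ 0) (hk : k ≠ 0)
    (hc : c₀ + c₁ ≠ 0) (h₀ : ℓ₀ = c₀ / (c₀ + c₁) * (ℓ₀ + ℓ₁)) (h₁ : ℓ₁ = c₁ / (c₀ + c₁) * (ℓ₀ + ℓ₁))
    (hδ : δ₀ + δ₁ = r) (hρ : ρ = (c₀ * r₀ + c₁ * r₁) / (c₀ + c₁)) :
    (δ₀ + r / k * (A₀ + ℓ₀) + (δ₁ + r / k * (A₁ + ℓ₁)) - r) / r * ρ =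
      (δ₀ + r / k * (A₀ + ℓ₀)) / r * r₀ + (δ₁ + r / k * (A₁ + ℓ₁)) / r * r₁ - T +
        ((ρ - r₀) / k * A₀ + (ρ - r₁) / k * A₁) + (δ₀ / r * (T - r₀) + δ₁ / r * (T - r₁)) := by
  -- The only use of the polarization: as `ℓ_j` is proportional to `c_j`, the weighted rank `ρ`
  -- absorbs the terms in `ℓ_j`.
  have e : r₀ * ℓ₀ + r₁ * ℓ₁ = ρ * (ℓ₀ + ℓ₁) := by
    set L := ℓ₀ + ℓ₁
    rw [h₀, h₁, hρ]
    field_simp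
  obtain rfl : δ₁ = r - δ₀ := by linarith
  field_simp
  linear_combination (-r) * e

namespace Flags

variable {X : Scheme.{0}} {ι : Type} {D : ParabolicData ι} {pt : ι → X} {E : X.Modules}

lemma fiberMap_id (x : X) : fiberMap (𝟙 E) x = LinearMap.id := by
  refine LinearMap.ext fun v => ?_
  obtain ⟨W, hx, t, rfl⟩ := exists_value_eq v
  exact fiberMap_value (𝟙 E) hx t

lemma inducedDim_id (P : Flags D pt E) (x : ι) (i : Fin (D.len x + 1)) :
    P.inducedDim (𝟙 E) x i = D.n x i := by
  rw [inducedDim, fiberMap_id, LinearMap.range_id, top_inf_eq, top_inf_eq, P.finrank_flag]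
  push_cast
  ring

lemma sum_n (P : Flags D pt E) (x : ι) : ∑ i, D.n x i = fiberDim E (pt x) := by
  have key : ∀ (m : ℕ) (φ : Fin (m + 2) → ℕ) (n : Fin (m + 1) → ℕ),
      (∀ i : Fin (m + 1), φ i.castSucc = φ i.succ + n i) → φ 0 = φ (Fin.last _) + ∑ i, n i := by
    intro m φ n h
    have h2 : ∀ i : Fin (m + 1), (n i : ℤ) = φ i.castSucc - φ i.succ := fun i => by
      rw [h i]
      push_cast
      ring
    have h3 : (∑ i, (n i : ℤ)) = φ 0 - φ (Fin.last _) := by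
      simp only [h2, Finset.sum_sub_distrib]
      have e1 := Fin.sum_univ_castSucc (fun i : Fin (m + 2) => (φ i : ℤ))
      have e2 := Fin.sum_univ_succ (fun i : Fin (m + 2) => (φ i : ℤ))
      linarith
    have : (φ 0 : ℤ) = φ (Fin.last _) + ((∑ i, n i : ℕ) : ℤ) := by
      push_cast
      linarith
    exact_mod_cast this
  have h := key (D.len x) (fun i => Module.finrank (X.residueField (pt x)) (P.flag x i)) (D.n x)
    (P.finrank_flag x)
  beta_reduce at h
  rw [P.flag_zero, P.flag_last, finrank_top, finrank_bot, zero_add] at h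
  exact h.symm

variable [Fintype ι]

lemma total_eq (P : Flags D pt E) {r : ℕ} (hr : ∀ x, fiberDim E x = r) :
    D.total r = r * D.topWeight - ∑ x, ∑ i, (D.n x i : ℤ) * D.a x i := by
  have h1 : ∀ x, ∑ i, D.d x i * (D.r x i : ℤ) =
      D.a x (Fin.last _) * r - ∑ i, (D.n x i : ℤ) * D.a x i := fun x => by
    have h2 := sum_smul_d (D.a x) (D.n x)
    rw [P.sum_n, hr] at h2
    exact h2
  rw [ParabolicData.total, ParabolicData.topWeight]
  simp only [h1, Finset.sum_sub_distrib, Finset.sum_add_distrib, ← Finset.sum_mul]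
  ring

lemma parChi_id (P : Flags D pt E) {r : ℕ} (hr : ∀ x, fiberDim E x = r)
    (s : X ⟶ Spec (.of ℂ)) (U V : X.Opens) :
    P.parChi s U V (𝟙 E) = eulerChar s U V E + (1 / (D.k : ℚ)) * (r * D.topWeight - D.total r) := by
  rw [parChi, P.total_eq hr]
  simp only [inducedDim_id]
  push_cast
  ring

end Flags

namespace ParabolicData

lemma total_sigma {ι : Fin 2 → Type} [∀ j, Fintype (ι j)] (D : ParabolicData (Σ j, ι j)) (r : ℕ) :
    D.total r = (D.comap (Sigma.mk 0)).total r + (D.comap (Sigma.mk 1)).total r := by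
  simp only [total, Fintype.sum_sigma, Fin.sum_univ_two]
  have e : ∀ j : Fin 2, (D.comap (Sigma.mk j : ι j → _)).total r =
    ∑ x : ι j, ∑ i, D.d ⟨j, x⟩ i * D.r ⟨j, x⟩ i + r * ∑ x : ι j, D.α ⟨j, x⟩ := fun _ => rfl
  have e0 := e 0
  have e1 := e 1
  simp only [total] at e0 e1
  rw [e0, e1]
  ring

end ParabolicData


namespace NodalCurve

variable {C : NodalCurve} {ι : Fin 2 → Type} {p : ∀ j, ι j → C.X j} {rk : ℕ}
  {D : ParabolicData (Σ j, ι j)} {E : ParabolicBundle D (C.points p) rk}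
  {E' : ∀ j, ParabolicBundle (D.comap (Sigma.mk j)) (p j) rk}

/-! ### Gluings of parabolic bundles -/

/-- The module underlying a gluing, with its adjoint restriction maps. -/
def IsGluing.glued (h : C.IsGluing E E') : C.GluedModule rk (fun j => (E' j).sheaf) where
  E := E.sheaf
  ψ j := (Scheme.Modules.pullbackPushforwardAdjunction (C.i j)).homEquiv E.sheaf (E' j).sheaf
    (h j).choose.hom
  exists_basis x := exists_basis E.isLocallyFree E.isCoherent E.rank_eq x
  isBasisOn he j := by
    have h1 := (he.pullback (C.i j)).map_of_bijective (h j).choose.hom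
    convert h1 using 1
    funext k
    exact pa_homEquiv (C.i j) _ _ _ _ _

lemma IsGluing.flagsCorrespond (h : C.IsGluing E E') :
    GluedModule.FlagsCorrespond (G := h.glued) E.flags (fun j => (E' j).flags) :=
  fun j x i W hx t => (h j).choose_spec x i W hx t

namespace GluedModule

variable {n : ℕ} {N : ∀ j, (C.X j).Modules} (G : C.GluedModule n N) {F : C.X₀.Modules} (f : F ⟶ G.E)

lemma isTorsionFree_cokernel_satSub (j : Fin 2) : IsTorsionFree (cokernel (G.satSub f j).ι) :=
  isTorsionFree_of_hasBases (hasBases_cokernel _ (G.hasBases j) IsSmoothCurve.pid)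

lemma isCoherent_satSub (j : Fin 2) : IsCoherent (G.satSub f j).toModules :=
  isCoherent_of_bases (hasBases_satSub f j)

lemma le_finrank_sup (j : Fin 2) :
    fiberDim (G.satSub f j).toModules (genericPoint (C.X j)) ≤
      Module.finrank ℂ ↥(G.nodeImage (G.satSub f 0).ι ⊔ G.nodeImage (G.satSub f 1).ι) := by
  refine (fiberDim_le_finrank_nodeImage f j).trans ?_
  fin_cases j
  · exact Submodule.finrank_mono le_sup_left
  · exact Submodule.finrank_mono le_sup_right

/-- The case of the whole module, whose values at the node fill ℂ^n. -/
lemma eulerChar_eq {U V : C.X₀.Opens} (hU : IsAffineOpen U) (hV : IsAffineOpen V)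
    (hUV : U ⊔ V = ⊤) :
    eulerChar C.str U V G.E =
      eulerChar (C.compStr 0) (C.i 0 ⁻¹ᵁ U) (C.i 0 ⁻¹ᵁ V) (N 0) +
        eulerChar (C.compStr 1) (C.i 1 ⁻¹ᵁ U) (C.i 1 ⁻¹ᵁ V) (N 1) - n := by
  rw [G.isGlued_id.eulerChar_eq G (fun j => G.hasBases j) hU hV hUV, G.nodeImage_id, top_sup_eq,
    finrank_top, Module.finrank_fin_fun]

end GluedModule

lemma rank_of_fiberDim {c : Fin 2 → ℕ} (hc : ∀ j, 0 < c j) {M : C.X₀.Modules} {n : ℕ}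
    (h : ∀ j, fiberDim M (C.gen j) = n) : C.rank c M = n := by
  have h0 : (0 : ℚ) < c 0 := by exact_mod_cast hc 0
  have h1 : (0 : ℚ) < c 1 := by exact_mod_cast hc 1
  rw [rank, Fin.sum_univ_two, Fin.sum_univ_two, h 0, h 1]
  field_simp

lemma rank_eq (c : Fin 2 → ℕ) (M : C.X₀.Modules) : C.rank c M =
    (c 0 * fiberDim M (C.gen 0) + c 1 * fiberDim M (C.gen 1)) / (c 0 + c 1) := by
  rw [rank, Fin.sum_univ_two, Fin.sum_univ_two]

variable [∀ j, Fintype (ι j)]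

lemma correction_of_fiberDim {c : Fin 2 → ℕ} (hc : ∀ j, 0 < c j) {M : C.X₀.Modules} {n : ℕ}
    (h : ∀ j, fiberDim M (C.gen j) = n) : C.correction D c M = 0 := by
  rw [correction, rank_of_fiberDim hc h]
  simp [h]

/-- The excess `χ_j - n_j` of an Euler characteristic over the bound `n_j`. -/
def excess (D : ParabolicData (Σ j, ι j)) (rk : ℕ) (ℓ χ' : Fin 2 → ℤ) (j : Fin 2) : ℚ :=
  χ' j - bound D rk ℓ j

lemma excess_add {rk : ℕ} {ℓ χ' : Fin 2 → ℤ} {χ : ℤ}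
    (hstar : D.total rk + rk * (ℓ 0 + ℓ 1) = D.k * χ) (hχ : χ' 0 + χ' 1 = χ + rk) :
    excess D rk ℓ χ' 0 + excess D rk ℓ χ' 1 = rk := by
  have hk : (D.k : ℚ) ≠ 0 := by exact_mod_cast D.k_pos.ne'
  rw [D.total_sigma] at hstar
  have h1 : (((D.comap (Sigma.mk 0 : ι 0 → _)).total rk : ℚ) +
    (D.comap (Sigma.mk 1 : ι 1 → _)).total rk + rk * (ℓ 0 + ℓ 1)) = D.k * χ := by exact_mod_cast hstar
  have h2 : (χ' 0 + χ' 1 : ℚ) = χ + rk := by exact_mod_cast hχ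
  simp only [excess, bound]
  field_simp
  linear_combination (D.k : ℚ) * h2 - h1

namespace IsGluing

lemma parChi_component {U V : C.X₀.Opens} {ℓ χ' : Fin 2 → ℤ}
    (hE'χ : ∀ j, eulerChar (C.compStr j) (C.i j ⁻¹ᵁ U) (C.i j ⁻¹ᵁ V) (E' j).sheaf = χ' j) (j : Fin 2) :
    (E' j).flags.parChi (C.compStr j) (C.i j ⁻¹ᵁ U) (C.i j ⁻¹ᵁ V) (𝟙 (E' j).sheaf) =
      excess D rk ℓ χ' j + rk / D.k * ((D.comap (Sigma.mk j)).topWeight + ℓ j) := by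
  rw [Flags.parChi_id _ (E' j).rank_eq, hE'χ, excess, bound]
  have : ((D.comap (Sigma.mk j : ι j → _)).k : ℚ) = D.k := rfl
  rw [this]
  ring

variable {c : Fin 2 → ℕ} {χ : ℤ} {ℓ χ' : Fin 2 → ℤ} {U V : C.X₀.Opens}

/-- The slope inequality defining semistability of a gluing differs from the sum of those of its
components by two terms that are nonnegative if `0 ≤ χ_j - n_j`. -/
lemma slope_sub_parChiM (h : C.IsGluing E E') (hU : IsAffineOpen U) (hV : IsAffineOpen V)
    (hUV : U ⊔ V = ⊤) (hp : C.IsMarking p) (hr : 0 < rk) (hc : ∀ j, 0 < c j)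
    (hℓ : ∀ j, (ℓ j : ℚ) = c j / (c 0 + c 1) * (ℓ 0 + ℓ 1))
    (hstar : D.total rk + rk * (ℓ 0 + ℓ 1) = D.k * χ) (hχ : χ' 0 + χ' 1 = χ + rk)
    (hE'χ : ∀ j, eulerChar (C.compStr j) (C.i j ⁻¹ᵁ U) (C.i j ⁻¹ᵁ V) (E' j).sheaf = χ' j)
    {F : C.X₀.Modules} (f : F ⟶ E.sheaf) [Mono f] (hf : IsTorsionFree (cokernel f)) :
    let r : Fin 2 → ℚ := fun j => fiberDim (h.glued.satSub f j).toModules (genericPoint (C.X j))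
    let T : ℚ := Module.finrank ℂ
      ↥(h.glued.nodeImage (h.glued.satSub f 0).ι ⊔ h.glued.nodeImage (h.glued.satSub f 1).ι)
    let μ : Fin 2 → ℚ := fun j =>
      (E' j).flags.parChi (C.compStr j) (C.i j ⁻¹ᵁ U) (C.i j ⁻¹ᵁ V) (𝟙 (E' j).sheaf) /
        fiberDim (E' j).sheaf (genericPoint (C.X j)) * r j -
      (E' j).flags.parChi (C.compStr j) (C.i j ⁻¹ᵁ U) (C.i j ⁻¹ᵁ V) (h.glued.satSub f j).ι
    C.parChiM E.flags c U V (𝟙 E.sheaf) / C.rank c E.sheaf * C.rank c F -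
      C.parChiM E.flags c U V f = μ 0 + μ 1 +
        (excess D rk ℓ χ' 0 / rk * (T - r 0) + excess D rk ℓ χ' 1 / rk * (T - r 1)) := by
  intro r T μ
  have : Mono (C := C.X₀.Modules) (Y := h.glued.E) f := ‹_›
  have hK := GluedModule.hasBases_satSub (G := h.glued) f
  have hG := h.glued.isGlued_satSub f hf
  have hid : C.parChiM E.flags c U V (𝟙 E.sheaf) =
      excess D rk ℓ χ' 0 + rk / D.k * ((D.comap (Sigma.mk 0)).topWeight + ℓ 0) +
        (excess D rk ℓ χ' 1 + rk / D.k * ((D.comap (Sigma.mk 1)).topWeight + ℓ 1)) - rk := by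
    have hE : E.flags.parChi C.str U V (𝟙 E.sheaf) = _ :=
      h.glued.isGlued_id.parChi_eq (fun j => h.glued.hasBases j) hU hV hUV hp h.flagsCorrespond
    rw [parChiM, correction_of_fiberDim hc fun j => E.rank_eq _, hE, parChi_component hE'χ, parChi_component hE'χ, h.glued.nodeImage_id, top_sup_eq, finrank_top,
      Module.finrank_fin_fun, add_zero]
  have hF : C.parChiM E.flags c U V f = _ := congrArg (· + C.correction D c F)
    (hG.parChi_eq hK hU hV hUV hp h.flagsCorrespond)
  have hr0 : fiberDim F (C.gen 0) = r 0 := congrArg _ (hG.fiberDim_gen hK 0)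
  have hr1 : fiberDim F (C.gen 1) = r 1 := congrArg _ (hG.fiberDim_gen hK 1)
  have hρ := rank_eq c F
  have h0 : (0 : ℚ) < c 0 := by exact_mod_cast hc 0
  have h1 : (0 : ℚ) < c 1 := by exact_mod_cast hc 1
  have key := slope_identity (r := rk) (k := D.k) (A₀ := (D.comap (Sigma.mk 0)).topWeight)
    (A₁ := (D.comap (Sigma.mk 1)).topWeight) (T := T) (by exact_mod_cast hr.ne')
    (by exact_mod_cast D.k_pos.ne') (by positivity) (hℓ 0) (hℓ 1) (excess_add hstar hχ) hρ
  have hrE : C.rank c E.sheaf = rk := rank_of_fiberDim hc fun j => E.rank_eq _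
  rw [hid, hrE, key, hF, correction, Fin.sum_univ_two, hr0, hr1]
  simp only [μ, parChi_component (ℓ := ℓ) hE'χ, (E' _).rank_eq]
  ring

/-- Every term on the right of `slope_sub_parChiM` is nonnegative. The saturated subsheaves qualify
for the semistability of the components because their cokernels have local bases. -/
theorem isSemistable (h : C.IsGluing E E') (hU : IsAffineOpen U) (hV : IsAffineOpen V)
    (hUV : U ⊔ V = ⊤) (hp : C.IsMarking p) (hr : 0 < rk) (hc : ∀ j, 0 < c j)
    (hℓ : ∀ j, (ℓ j : ℚ) = c j / (c 0 + c 1) * (ℓ 0 + ℓ 1))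
    (hstar : D.total rk + rk * (ℓ 0 + ℓ 1) = D.k * χ) (hχ : χ' 0 + χ' 1 = χ + rk)
    (hE'χ : ∀ j, eulerChar (C.compStr j) (C.i j ⁻¹ᵁ U) (C.i j ⁻¹ᵁ V) (E' j).sheaf = χ' j)
    (hbound : ∀ j, bound D rk ℓ j ≤ χ' j)
    (hE' : ∀ j, (E' j).IsSemistable (C.compStr j) (C.i j ⁻¹ᵁ U) (C.i j ⁻¹ᵁ V)) :
    C.IsSemistable E c U V := by
  intro F f hmono _ hf
  have key := h.slope_sub_parChiM hU hV hUV hp hr hc hℓ hstar hχ hE'χ f hf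
  have hδ : ∀ j, 0 ≤ excess D rk ℓ χ' j := fun j => sub_nonneg.mpr (hbound j)
  have hT : ∀ j, (0 : ℚ) ≤ _ - _ := fun j =>
    sub_nonneg.mpr (Nat.cast_le.mpr (h.glued.le_finrank_sup f j))
  have hμ := fun j => hE' j _ (h.glued.satSub f j).ι inferInstance (h.glued.isCoherent_satSub f j)
    (h.glued.isTorsionFree_cokernel_satSub f j)
  have h2 := fun j => mul_nonneg (div_nonneg (hδ j) (Nat.cast_nonneg (α := ℚ) rk)) (hT j)
  dsimp only at key
  linarith [hμ 0, hμ 1, h2 0, h2 1]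

/-- Either some `T - r_j` is positive and its coefficient makes the difference positive, or all
ranks equal `T` and the stable component supplies the strict inequality. -/
theorem isStable (h : C.IsGluing E E') (hU : IsAffineOpen U) (hV : IsAffineOpen V)
    (hUV : U ⊔ V = ⊤) (hp : C.IsMarking p) (hr : 0 < rk) (hc : ∀ j, 0 < c j)
    (hℓ : ∀ j, (ℓ j : ℚ) = c j / (c 0 + c 1) * (ℓ 0 + ℓ 1))
    (hstar : D.total rk + rk * (ℓ 0 + ℓ 1) = D.k * χ) (hχ : χ' 0 + χ' 1 = χ + rk)
    (hE'χ : ∀ j, eulerChar (C.compStr j) (C.i j ⁻¹ᵁ U) (C.i j ⁻¹ᵁ V) (E' j).sheaf = χ' j)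
    (hbound : ∀ j, χ' j < bound D rk ℓ j + rk)
    (hE' : ∀ j, (E' j).IsSemistable (C.compStr j) (C.i j ⁻¹ᵁ U) (C.i j ⁻¹ᵁ V)) {j₀ : Fin 2}
    (hj₀ : (E' j₀).IsStable (C.compStr j₀) (C.i j₀ ⁻¹ᵁ U) (C.i j₀ ⁻¹ᵁ V)) :
    C.IsStable E c U V := by
  intro F f hmono _ hf hF0 hFiso
  have : Mono (C := C.X₀.Modules) (Y := h.glued.E) f := hmono
  have key := h.slope_sub_parChiM hU hV hUV hp hr hc hℓ hstar hχ hE'χ f hf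
  have hadd := excess_add hstar hχ
  -- The excesses add up to the rank, so each is positive because the other is smaller than the
  -- rank.
  have hδ : ∀ j, 0 < excess D rk ℓ χ' j := fun j => by
    have hlt : ∀ j, excess D rk ℓ χ' j < rk := fun j => by
      rw [excess]
      linarith [hbound j]
    have h01 : j = 0 ∨ j = 1 := by
      fin_cases j <;> simp
    obtain rfl | rfl := h01
    · linarith [hlt 1]
    · linarith [hlt 0]
  have hrk : (0 : ℚ) < rk := by exact_mod_cast hr
  have hT := h.glued.le_finrank_sup f
  have hμ := fun j => hE' j _ (h.glued.satSub f j).ι inferInstance (h.glued.isCoherent_satSub f j)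
    (h.glued.isTorsionFree_cokernel_satSub f j)
  have hT' : ∀ j, (0 : ℚ) ≤ _ - _ := fun j => sub_nonneg.mpr (Nat.cast_le.mpr (hT j))
  have h2 := fun j => mul_nonneg (div_nonneg (hδ j).le hrk.le) (hT' j)
  dsimp only at key
  by_cases hs : ∃ j, fiberDim (h.glued.satSub f j).toModules (genericPoint (C.X j)) <
      Module.finrank ℂ ↥(h.glued.nodeImage (h.glued.satSub f 0).ι ⊔
        h.glued.nodeImage (h.glued.satSub f 1).ι)
  · obtain ⟨j, hj⟩ := hs
    have h3 := mul_pos (div_pos (hδ j) hrk) (sub_pos.mpr (Nat.cast_lt (α := ℚ).mpr hj))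
    revert h3
    fin_cases j
    · intro h3
      dsimp only [Fin.zero_eta] at h3
      linarith [hμ 0, hμ 1, h2 1]
    · intro h3
      dsimp only [Fin.mk_one] at h3
      linarith [hμ 0, hμ 1, h2 0]
  · push Not at hs
    -- Both ranks now equal `T`. If the subsheaf on the stable component is zero or everything, then
    -- the rank on the other component is 0 or full as well, so `F` is zero or all of `E`.
    have heq := fun j => le_antisymm (hT j) (hs j)
    have hK := GluedModule.hasBases_satSub (G := h.glued) f
    have hG := h.glued.isGlued_satSub f hf
    have hμ' := hj₀ _ (h.glued.satSub f j₀).ι inferInstance (h.glued.isCoherent_satSub f j₀)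
      (h.glued.isTorsionFree_cokernel_satSub f j₀) (fun h0 => hF0 (hG.isZero hK fun j => by
        rw [heq j, ← heq j₀]
        exact HasBases.fiberDim_eq_zero h0))
      (fun hi => hFiso (GluedModule.isIso_of_fiberDim (G := h.glued) (f := f) hf fun j => by
        rw [heq j, ← heq j₀, fiberDim_eq_of_isIso (hK j₀) (h.glued.satSub f j₀).ι]
        exact h.glued.fiberDim_component j₀ _))
    clear hj₀
    revert hμ'
    fin_cases j₀
    · intro hμ'
      dsimp only [Fin.zero_eta] at hμ'
      linarith [hμ 1, h2 0, h2 1]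
    · intro hμ'
      dsimp only [Fin.mk_one] at hμ'
      linarith [hμ 0, h2 0, h2 1]

end IsGluing

end NodalCurve


/-! ### Recognizing pullbacks by local bases -/

section LocalIso

variable {X Y : Scheme.{0}}

lemma isIso_of_locally_bijective {M N : X.Modules} (f : M ⟶ N)
    (h : ∀ x : X, ∃ W : X.Opens, x ∈ W ∧ ∀ V ≤ W, Function.Bijective (ap f V)) : IsIso f := by
  have hinj : ∀ V, Function.Injective (ap f V) := fun V => by
    rw [injective_iff_map_eq_zero]
    intro s hs
    refine section_ext _ _ _ fun x hx => ?_
    obtain ⟨W, hxW, hW⟩ := h x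
    refine ⟨V ⊓ W, inf_le_left, ⟨hx, hxW⟩, (hW _ inf_le_right).1 ?_⟩
    rw [ap_rs, ap_rs, hs, map_zero, map_zero, map_zero]
  refine isIso_of_ap_bijective f fun V => ⟨hinj V, fun s => ?_⟩
  choose W hxW hW using h
  choose t ht using fun x : X => (hW x (V ⊓ W x) inf_le_right).2 (rs N inf_le_left s)
  obtain ⟨u, hu⟩ := section_glue M (fun x => V ⊓ W x) (fun _ => inf_le_left)
    (fun x hx => ⟨x, hx, hxW x⟩) t (fun x y => hinj _ (by rw [ap_rs, ap_rs, ht, ht, rs_rs, rs_rs]))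
  refine ⟨u, section_ext _ _ _ fun x hx => ⟨V ⊓ W x, inf_le_left, ⟨hx, hxW x⟩, ?_⟩⟩
  rw [← ap_rs, hu, ht]

lemma IsBasisOn.ap_bijective_of_isBasisOn {M N : X.Modules} (f : M ⟶ N) {n : ℕ} {W : X.Opens}
    {e : Fin n → Γ(M, W)} (he : IsBasisOn M W e) (he' : IsBasisOn N W (fun k => ap f W (e k)))
    {V : X.Opens} (hV : V ≤ W) : Function.Bijective (ap f V) := by
  refine (Function.Bijective.of_comp_iff _ (he V hV)).1 ?_
  convert he' V hV using 1
  funext a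
  simp only [Function.comp, map_sum, map_smul, ap_rs]

/-- A morphism to a direct image that sends local bases to local bases exhibits a pullback. -/
lemma isIso_homEquiv_symm (f : Y ⟶ X) {M : X.Modules} {N : Y.Modules}
    (ψ : M ⟶ (Scheme.Modules.pushforward f).obj N)
    (h : ∀ x, ∃ (W : X.Opens) (n : ℕ) (e : Fin n → Γ(M, W)), x ∈ W ∧ IsBasisOn M W e ∧
      IsBasisOn N (f ⁻¹ᵁ W) (fun k => pa ψ W (e k))) :
    IsIso (((Scheme.Modules.pullbackPushforwardAdjunction f).homEquiv M N).symm ψ) := by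
  refine isIso_of_locally_bijective _ fun y => ?_
  obtain ⟨W, n, e, hx, he, he'⟩ := h (f y)
  refine ⟨f ⁻¹ᵁ W, hx, fun V hV => (he.pullback f).ap_bijective_of_isBasisOn _ ?_ hV⟩
  convert he' using 1
  funext k
  rw [← pa_homEquiv, Equiv.apply_symm_apply]

end LocalIso

/-! ### Finite products of modules -/

section PiModule

variable {X : Scheme.{0}} {J : Type} (M : J → X.Modules)

/-- The product of a family of modules. -/
def piModule : X.Modules where
  val :=
    { obj := fun W => ModuleCat.of Γ(X, W.unop) (∀ j, Γ(M j, W.unop))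
      map := fun {V W} f => ModuleCat.semilinearMapAddEquiv _ _ _
        ({ toFun := fun a j => rs (M j) f.unop.le (a j)
           map_add' := fun a b => by ext i; simp
           map_smul' := fun c a => by
            ext i
            exact rs_smul (M i) f.unop.le c (a i) } :
          (∀ j, Γ(M j, V.unop)) →ₛₗ[rr X f.unop.le] (∀ j, Γ(M j, W.unop)))
      map_id := fun W => by
        ext a
        funext i
        exact rs_self _ le_rfl _
      map_comp := fun f g => by
        ext a
        funext i
        exact (rs_rs _ _ _ _).symm }
  isSheaf := by
    refine (TopCat.Presheaf.isSheaf_iff_isSheaf_comp (CategoryTheory.forget AddCommGrpCat) _).2 ?_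
    refine TopCat.Presheaf.isSheaf_of_isSheafUniqueGluing_types _ ?_
    intro I V sf hsf
    let s' : ∀ (k : J) i, Γ(M k, V i) := fun k i => (show ∀ k, Γ(M k, V i) from sf i) k
    have hs' : ∀ k i j, rs (M k) (inf_le_left : V i ⊓ V j ≤ V i) (s' k i) =
        rs (M k) (inf_le_right : V i ⊓ V j ≤ V j) (s' k j) := fun k i j =>
      congrFun (show (_ : ∀ k, Γ(M k, V i ⊓ V j)) = _ from hsf i j) k
    have := fun k => TopCat.Sheaf.existsUnique_gluing' ⟨(M k).presheaf, (M k).isSheaf⟩ V (iSup V)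
      (fun i => homOfLE (le_iSup V i)) le_rfl (s' k) (fun i j => hs' k i j)
    choose t ht hu using this
    refine ⟨t, fun i => funext fun k => ht k i, fun y hy => funext fun k => hu k _ fun i => ?_⟩
    exact congrFun (show (_ : ∀ k, Γ(M k, V i)) = _ from hy i) k

/-- The projections of a product. -/
def piModule.proj (j : J) : piModule M ⟶ M j :=
  homMk (fun W =>
    ({ toFun := fun s => s j
       map_add' := fun _ _ => rfl
       map_smul' := fun _ _ => rfl } : (∀ j, Γ(M j, W)) →ₗ[Γ(X, W)] Γ(M j, W)))
    (fun _ _ _ _ => rfl)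

end PiModule

namespace NodalCurve

variable {C : NodalCurve} {n : ℕ} {N : ∀ j, (C.X j).Modules} {B : ∀ j, (C.X j).Opens}
  {b : ∀ j, Fin n → Γ(N j, B j)} (hb : ∀ j, IsBasisOn (N j) (B j) (b j)) (hB : ∀ j, C.z j ∈ B j)

/-! ### Gluing two modules along the node -/

section

variable {W : C.X₀.Opens} {s t : ∀ j, Γ(N j, C.i j ⁻¹ᵁ W)}

lemma IsCompatible.add (hs : IsCompatible hb hB W s) (ht : IsCompatible hb hB W t) :
    IsCompatible hb hB W (fun j => s j + t j) := fun hx => by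
  simp only [map_add]
  rw [hs hx, ht hx]

lemma IsCompatible.zero : IsCompatible hb hB W (fun _ => 0) := fun hx => by
  simp only [map_zero]

lemma IsCompatible.smul (hs : IsCompatible hb hB W s) (a : Γ(C.X₀, W)) :
    IsCompatible hb hB W (fun j => pf (C.i j) W a • s j) := fun hx => by
  rw [gm_smul, gm_smul, nodeValue_smul, nodeValue_smul, hs hx,
    C.ev_pf (C.z_mem hx 0) (C.z_mem hx 1)]

end

/-- The condition that two sections have the same value at the node. -/
def compatibleSub : LocalSub (piModule fun j => (Scheme.Modules.pushforward (C.i j)).obj (N j)) where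
  carrier W := ({
    carrier := {s | IsCompatible hb hB W s}
    add_mem' := IsCompatible.add hb hB
    zero_mem' := IsCompatible.zero hb hB
    smul_mem' := fun a _ hs => hs.smul hb hB a } :
    Submodule Γ(C.X₀, W) (∀ j, Γ((Scheme.Modules.pushforward (C.i j)).obj (N j), W)))
  res_mem h _ hs := hs.res hb hB h
  local_mem s h hx := by
    obtain ⟨V, hV, hxV, hs⟩ := h _ hx
    have h1 := hs hxV
    refine ((congrArg _ (gm_rs (N 0) (pre_mono (C.i 0) hV) (C.z_mem hxV 0) _)).symm.trans h1).trans
      (congrArg _ (gm_rs (N 1) (pre_mono (C.i 1) hV) (C.z_mem hxV 1) _))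

/-- The gluing of two modules along the node. -/
def glueModule : C.X₀.Modules := (compatibleSub hb hB).toModules

/-- The restriction maps of the gluing to the components. -/
def glueProj (j : Fin 2) : glueModule hb hB ⟶ (Scheme.Modules.pushforward (C.i j)).obj (N j) :=
  (compatibleSub hb hB).ι ≫ piModule.proj _ j

lemma exists_glueProj_eq {W : C.X₀.Opens} {s : ∀ j, Γ(N j, C.i j ⁻¹ᵁ W)}
    (hs : IsCompatible hb hB W s) :
    ∃ t : Γ(glueModule hb hB, W), ∀ j, pa (glueProj hb hB j) W t = s j :=
  ⟨⟨s, hs⟩, fun _ => rfl⟩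

lemma glueModule_ext {W : C.X₀.Opens} {s t : Γ(glueModule hb hB, W)}
    (h : ∀ j, pa (glueProj hb hB j) W s = pa (glueProj hb hB j) W t) : s = t :=
  Subtype.ext (funext h)

lemma isCompatible_glueProj {W : C.X₀.Opens} (s : Γ(glueModule hb hB, W)) :
    IsCompatible hb hB W (fun j => pa (glueProj hb hB j) W s) := s.2

lemma pa_glueProj_sum (j : Fin 2) {W V : C.X₀.Opens} (h : V ≤ W) {m : ℕ}
    (e : Fin m → Γ(glueModule hb hB, W)) (a : Fin m → Γ(C.X₀, V)) :
    pa (glueProj hb hB j) V (∑ k, a k • rs (glueModule hb hB) h (e k)) =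
      ∑ k, pf (C.i j) V (a k) • rs (N j) (pre_mono (C.i j) h) (pa (glueProj hb hB j) W (e k)) := by
  rw [map_sum]
  simp only [pa_smul, pa_rs]

lemma isBasisOn_glueModule {W : C.X₀.Opens} {e : Fin n → Γ(glueModule hb hB, W)}
    (he : ∀ j, IsBasisOn (N j) (C.i j ⁻¹ᵁ W) (fun k => pa (glueProj hb hB j) W (e k)))
    (h : ∀ (V : C.X₀.Opens) (hV : V ≤ W) (s : Γ(glueModule hb hB, V)),
      ∃ a : Fin n → Γ(C.X₀, V), ∀ j, ∑ k, pf (C.i j) V (a k) •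
        rs (N j) (pre_mono (C.i j) hV) (pa (glueProj hb hB j) W (e k)) =
          pa (glueProj hb hB j) V s) :
    IsBasisOn (glueModule hb hB) W e := by
  intro V hV
  constructor
  · intro a a' haa
    ext k
    rw [← sub_eq_zero]
    refine C.pf_injective _ fun j => ?_
    rw [map_sub, sub_eq_zero]
    have h1 := congrArg (pa (glueProj hb hB j) V) haa
    rw [pa_glueProj_sum, pa_glueProj_sum] at h1
    exact congrFun ((he j _ (pre_mono (C.i j) hV)).1 h1) k
  · intro s
    obtain ⟨a, ha⟩ := h V hV s
    refine ⟨a, glueModule_ext hb hB fun j => ?_⟩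
    rw [pa_glueProj_sum, ha]

/-- At the node, the pairs of corresponding basis vectors form a basis, because coordinates of
compatible pairs glue. Elsewhere a neighbourhood meets a single component and its basis is used. -/
lemma exists_isBasisOn_glueModule
    (hN : ∀ j y, ∃ (W : (C.X j).Opens) (e : Fin n → Γ(N j, W)), y ∈ W ∧ IsBasisOn (N j) W e)
    (x : C.X₀) : ∃ (W : C.X₀.Opens) (e : Fin n → Γ(glueModule hb hB, W)), x ∈ W ∧
      IsBasisOn (glueModule hb hB) W e ∧
      ∀ j, IsBasisOn (N j) (C.i j ⁻¹ᵁ W) (fun k => pa (glueProj hb hB j) W (e k)) := by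
  by_cases hx : x = C.x₀
  · subst hx
    obtain ⟨W, hxW, hW⟩ := C.exists_nhds_x₀ B hB
    -- The basis vectors of index `k` on the two components both have the `k`-th unit vector as
    -- value at the node.
    have h1 := fun k => isCompatible_sum hb hB hW (Pi.single k 1)
    have h2 : ∀ k j, ∑ l, pf (C.i j) W ((Pi.single k 1 : Fin n → Γ(C.X₀, W)) l) •
        rs (N j) (hW j) (b j l) = rs (N j) (hW j) (b j k) := fun k j => by
      rw [Finset.sum_eq_single k (fun l _ hl => by rw [Pi.single_eq_of_ne hl, map_zero, zero_smul])
        (fun h => (h (Finset.mem_univ k)).elim), Pi.single_eq_same, map_one, one_smul]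
    simp only [h2] at h1
    choose e he using fun k => exists_glueProj_eq hb hB (h1 k)
    have he' : ∀ j, IsBasisOn (N j) (C.i j ⁻¹ᵁ W) (fun k => pa (glueProj hb hB j) W (e k)) :=
      fun j => by
        simp only [he]
        exact (hb j).res (hW j)
    refine ⟨W, e, hxW, isBasisOn_glueModule hb hB he' fun V hV s => ?_, he'⟩
    obtain ⟨a, ha⟩ := (isCompatible_glueProj hb hB s).exists_coord hb hB
      (fun j => (pre_mono (C.i j) hV).trans (hW j))
    refine ⟨a, fun j => ?_⟩
    simp only [he, rs_rs]
    exact ha j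
  · obtain ⟨j, y, rfl⟩ := C.covers x
    have hy : y ≠ C.z j := fun h => hx (by rw [h, C.i_z])
    obtain ⟨U, c, hyU, hc⟩ := hN j y
    obtain ⟨W, hyW, hWU, hW⟩ := exists_onlyIn U hy hyU
    have hxW := hW.x₀_notMem
    have h1 : ∃ s : ∀ j', Fin n → Γ(N j', C.i j' ⁻¹ᵁ W),
        ∀ j', IsBasisOn (N j') (C.i j' ⁻¹ᵁ W) (s j') := by
      have h2 : ∀ j', ∃ s : Fin n → Γ(N j', C.i j' ⁻¹ᵁ W),
          IsBasisOn (N j') (C.i j' ⁻¹ᵁ W) s := fun j' => by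
        by_cases hj : j' = j
        · subst hj
          exact ⟨_, hc.res hWU⟩
        -- On the other component the open set is empty, and any family of sections is a basis
        -- there.
        · exact ⟨0, isBasisOn_of_eq_bot (hW j' hj) _⟩
      choose s hs using h2
      exact ⟨s, hs⟩
    obtain ⟨s, hs⟩ := h1
    choose e he using fun k => exists_glueProj_eq hb hB (W := W) (s := fun j' => s j' k)
      (fun h => (hxW h).elim)
    have he' : ∀ j, IsBasisOn (N j) (C.i j ⁻¹ᵁ W) (fun k => pa (glueProj hb hB j) W (e k)) :=
      fun j => by
        simp only [he]
        exact hs j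
    refine ⟨W, e, hyW, isBasisOn_glueModule hb hB he' fun V hV t => ?_, he'⟩
    exact C.exists_coord_of_notMem (fun h => hxW (hV h))
      (fun j => (he' j).res (pre_mono (C.i j) hV)) _

end NodalCurve


/-! ### Transport of flags and existence of the gluing -/

section FiberComparison

variable {X Y : Scheme.{0}} {i : Y ⟶ X} {E : X.Modules} {N : Y.Modules}
  {ψ : E ⟶ (Scheme.Modules.pushforward i).obj N} {n : ℕ}
  {W : X.Opens} {e : Fin n → Γ(E, W)} (he : IsBasisOn E W e)
  (he' : IsBasisOn N (i ⁻¹ᵁ W) (fun k => pa ψ W (e k))) {y : Y} (hx : i y ∈ W)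

/-- The preimage of a subspace of the fibre of the restriction of a module. -/
def fiberComap (B : Submodule (Y.residueField y) (Fiber N y)) :
    Submodule (X.residueField (i y)) (Fiber E (i y)) where
  carrier := {v | fiberComparison he he' hx v ∈ B}
  add_mem' := fun {v w} hv hw => by
    change fiberComparison he he' hx (v + w) ∈ B
    rw [map_add]
    exact B.add_mem hv hw
  zero_mem' := by
    change fiberComparison he he' hx 0 ∈ B
    rw [map_zero]
    exact B.zero_mem
  smul_mem' := fun c v hv => by
    change fiberComparison he he' hx (c • v) ∈ B
    rw [fiberComparison_smul]
    exact B.smul_mem _ hv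

lemma fiberComap_top : fiberComap he he' hx ⊤ = ⊤ := rfl

lemma fiberComap_mono : Monotone (fiberComap he he' hx) := fun _ _ h _ hv => h hv

variable [IsClosedImmersion i]

lemma fiberComap_bot : fiberComap he he' hx ⊥ = ⊥ := by
  rw [eq_bot_iff]
  intro v hv
  have h1 : fiberComparison he he' hx v = 0 := hv
  exact (fiberComparison_bijective he he' hx).1 (h1.trans (map_zero _).symm)

lemma finrank_fiberComap (B : Submodule (Y.residueField y) (Fiber N y)) :
    Module.finrank (X.residueField (i y)) (fiberComap he he' hx B) =
      Module.finrank (Y.residueField y) B :=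
  finrank_eq_of_fiberComparison he he' hx _ B fun _ => Iff.rfl

end FiberComparison

namespace NodalCurve

variable {C : NodalCurve} {ι : Fin 2 → Type} {p : ∀ j, ι j → C.X j} {rk : ℕ}
  {D : ParabolicData (Σ j, ι j)}

/-- Two parabolic bundles on the components can be glued at the node. -/
theorem exists_isGluing (E' : ∀ j, ParabolicBundle (D.comap (Sigma.mk j)) (p j) rk) :
    ∃ E : ParabolicBundle D (C.points p) rk, C.IsGluing E E' := by
  have hN := fun j => exists_basis (E' j).isLocallyFree (E' j).isCoherent (E' j).rank_eq
  choose B b hB hb using fun j => hN j (C.z j)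
  choose W e hxW he he' using exists_isBasisOn_glueModule hb hB hN
  -- The flags are preimages under the comparison of fibres, which is bijective, so that inclusions
  -- and dimensions carry over.
  let P : Flags D (C.points p) (glueModule hb hB) :=
    { flag := fun x i => fiberComap (y := p x.1 x.2) (he (C.points p x)) (he' (C.points p x) x.1)
        (hxW _) ((E' x.1).flags.flag x.2 i)
      antitone := fun x _ _ h => fiberComap_mono _ _ _ ((E' x.1).flags.antitone x.2 h)
      flag_zero := fun x => (congrArg _ ((E' x.1).flags.flag_zero x.2)).trans
        (fiberComap_top _ _ _)
      flag_last := fun x => (congrArg _ ((E' x.1).flags.flag_last x.2)).trans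
        (fiberComap_bot _ _ _)
      finrank_flag := fun x i => (finrank_fiberComap _ _ _ _).trans
        (((E' x.1).flags.finrank_flag x.2 i).trans
          (congrArg (· + D.n x i) (finrank_fiberComap _ _ _ _).symm)) }
  have hbases : HasBases (glueModule hb hB) := fun x => ⟨W x, rk, e x, hxW x, he x⟩
  refine ⟨⟨glueModule hb hB, isCoherent_of_bases hbases, isLocallyFree_of_bases hbases,
    fun x => (he x).fiberDim_eq (hxW x), P⟩, fun j => ?_⟩
  have := isIso_homEquiv_symm (C.i j) (glueProj hb hB j)
    fun x => ⟨W x, rk, e x, hxW x, he x, he' x j⟩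
  refine ⟨asIso (((Scheme.Modules.pullbackPushforwardAdjunction (C.i j)).homEquiv _ _).symm
    (glueProj hb hB j)), fun x k V hx t => ?_⟩
  rw [asIso_hom, Equiv.apply_symm_apply]
  exact iff_of_eq (congrArg (· ∈ (E' j).flags.flag x k) (fiberComparison_value (y := p j x)
    (he (C.points p ⟨j, x⟩)) (he' (C.points p ⟨j, x⟩) j) (hxW _) hx t))

end NodalCurve

end ParabolicGluing

end

theorem proposition1p4 (C : ParabolicGluing.NodalCurve)
    -- a cover by two affine opens, used to compute Euler characteristics
    (U V : C.X₀.Opens) (hU : IsAffineOpen U) (hV : IsAffineOpen V) (hUV : U ⊔ V = ⊤)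
    -- marked points and numerical data
    {ι : Fin 2 → Type} [∀ j, Fintype (ι j)] (p : ∀ j, ι j → C.X j) (hp : C.IsMarking p)
    (D : ParabolicGluing.ParabolicData (Σ j, ι j)) (r : ℕ) (hr : 0 < r)
    (c : Fin 2 → ℕ) (hc : ∀ j, 0 < c j) (χ : ℤ) (ℓ : Fin 2 → ℤ)
    (hℓ : ∀ j, (ℓ j : ℚ) = c j / (c 0 + c 1) * (ℓ 0 + ℓ 1))
    (hstar : D.total r + r * (ℓ 0 + ℓ 1) = D.k * χ)
    (χ' : Fin 2 → ℤ) (hχ : χ' 0 + χ' 1 = χ + r)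
    (hbound : ∀ j, ParabolicGluing.NodalCurve.bound D r ℓ j ≤ χ' j ∧
      χ' j ≤ ParabolicGluing.NodalCurve.bound D r ℓ j + r)
    -- semistable parabolic bundles of Euler characteristic `χ' j` on the components
    (E' : ∀ j, ParabolicGluing.ParabolicBundle (D.comap (Sigma.mk j)) (p j) r)
    (hE'χ : ∀ j, ParabolicGluing.eulerChar (C.compStr j) (C.i j ⁻¹ᵁ U) (C.i j ⁻¹ᵁ V)
      (E' j).sheaf = χ' j)
    (hE' : ∀ j, (E' j).IsSemistable (C.compStr j) (C.i j ⁻¹ᵁ U) (C.i j ⁻¹ᵁ V)) :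
    (∃ E : ParabolicGluing.ParabolicBundle D (C.points p) r, C.IsGluing E E') ∧
    ∀ E : ParabolicGluing.ParabolicBundle D (C.points p) r, C.IsGluing E E' →
      ParabolicGluing.eulerChar C.str U V E.sheaf = χ ∧
      C.IsSemistable E c U V ∧
      ((∀ j, ParabolicGluing.NodalCurve.bound D r ℓ j ≤ χ' j ∧
          χ' j < ParabolicGluing.NodalCurve.bound D r ℓ j + r) →
        (∃ j, (E' j).IsStable (C.compStr j) (C.i j ⁻¹ᵁ U) (C.i j ⁻¹ᵁ V)) →
        C.IsStable E c U V) := by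
  refine ⟨ParabolicGluing.NodalCurve.exists_isGluing E', fun E h => ⟨?_, ?_, ?_⟩⟩
  · have h1 := h.glued.eulerChar_eq hU hV hUV
    rw [hE'χ, hE'χ, hχ, add_sub_cancel_right] at h1
    exact h1
  · exact h.isSemistable hU hV hUV hp hr hc hℓ hstar hχ hE'χ (fun j => (hbound j).1) hE'
  · rintro hlt ⟨j₀, hj₀⟩
    exact h.isStable hU hV hUV hp hr hc hℓ hstar hχ hE'χ (fun j => (hlt j).2) hE' hj₀
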